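/- **Conventions.** Manifolds are smooth and pure dimensional, $X$ is Hausdorff and second countable, and submanifolds are embedded. Let $G$ be a compact connected Lie group with Lie algebra $\mathfrak g$, and let $(X,\omega)$ be a symplectic manifold with a Hamiltonian $G$-action: $G$ acts smoothly on $X$ preserving $\omega$, with a smooth coadjoint-equivariant moment map $\mu:X\to\mathfrak g^*$ such that $\omega(\chi(a),u)=\langle d\mu(u),a\rangle$, where $\chi(a)_x=\frac{d}{dt}\big|_{t=0}\exp(-ta)\cdot x$. Assume that $G$ acts freely on $\mu^{-1}(0)$. Then $X/\!\!/G:=\mu^{-1}(0)/G$ is a manifold, with the symplectic form $\omega_{\mathrm{red}}$ whose pullback to $\mu^{-1}(0)$ is $\omega|_{\mu^{-1}(0)}$. **A-branes.** A *transverse holomorphic symplectic form* on a manifold $C$ is a closed complex valued $2$-form $\Omega$ such that $(TC)^{\perp\Omega}=\{u:\Omega(u,\cdot)=0\}$ is a vector subbundle of $TC$ and such that, for the form $\widetilde\Omega$ induced on $T_{\mathrm{quo}}C=TC/(TC)^{\perp\Omega}$, there is an endomorphism $I$ of $T_{\mathrm{quo}}C$ with $\operatorname{Re}\widetilde\Omega(u,v)=\operatorname{Im}\widetilde\Omega(Iu,v)$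 and $I^2=-1$ (it is then unique). Let $(E,\nabla)$ be a Hermitian vector bundle of rank $r\ge 1$ with unitary connection over $C$; write its curvature as $F^\nabla=F_0-\sqrt{-1}\,F_{\mathrm{tr}}\operatorname{Id}_E$ with $F_{\mathrm{tr}}=\frac{\sqrt{-1}}{r}\operatorname{Tr}F^\nabla$. A *coisotropic A-brane* on $(X,\omega)$ is a triple $(C,E,\nabla)$ where $C$ is a coisotropic submanifold of $X$ and $(E,\nabla)$ is such a bundle over $C$, such that $\Omega:=F_{\mathrm{tr}}+\sqrt{-1}\,\omega|_C$ is a transverse holomorphic symplectic form on $C$ and the traceless curvature $F_0$ is of transverse type $(1,1)$, i.e. $F_0$ descends to $T_{\mathrm{quo}}C$ and satisfies $F_0(Iu,Iv)=F_0(u,v)$ there. **Invariance, moment section, neatness.** The brane $\mathcal B=(C,E,\nabla)$ is *$G$-invariant* if $C$ is $G$-invariant and $E$ is a $G$-equivariant bundle over $C$ whose metric and connection are $G$-invariant. Let $(L_as)(x)=\frac{d}{dt}\big|_{t=0}\exp(ta)\cdot s(\exp(-ta)\cdot x)$ be the infinitesimal action on sections. The *moment section* is $\langle\mu_{\mathcal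 B},a\rangle=L_a-\nabla_{\chi(a)}+\langle\mu|_C,a\rangle\operatorname{Id}_E\in\Gamma(\operatorname{End}E)$, and the *moment trace* is $\nu=\frac{\sqrt{-1}}{r}\operatorname{Tr}\mu_{\mathcal B}:C\to\mathfrak g^*\otimes\mathbb C$. Its imaginary part is $\mu|_C$. The moment section is *neat* if (1) $0$ is a clean value of $\nu$, i.e. $\nu^{-1}(0)$ is a submanifold of $C$ with $T_x\nu^{-1}(0)=\ker d\nu_x$ for all $x\in\nu^{-1}(0)$, and (2) $\nabla_{\chi(a)}=L_a$ at all points of $\nu^{-1}(0)$, for all $a\in\mathfrak g$. **Theorem 4.11 (= Theorem 1.2).** Let $\mathcal B=(C,E,\nabla)$ be a $G$-invariant coisotropic A-brane on $(X,\omega)$ whose moment section is neat. Then the symplectic reduction $(X/\!\!/G,\omega_{\mathrm{red}})$ exists; $C_{\mathrm{red}}:=\nu^{-1}(0)/G$ is a manifold for which $\nu^{-1}(0)\to C_{\mathrm{red}}$ is a submersion; $(E,\nabla)|_{\nu^{-1}(0)}$ descends to a Hermitian bundle with unitary connection $(E_{\mathrm{red}},\nabla_{\mathrm{red}})$ over $C_{\mathrm{red}}$,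 that is, it is isomorphic to the pullback of $(E_{\mathrm{red}},\nabla_{\mathrm{red}})$, equivariantly and compatibly with metrics and connections; and for the map $C_{\mathrm{red}}\to X/\!\!/G$ induced by the inclusion $\nu^{-1}(0)\subset\mu^{-1}(0)$, and any such $(E_{\mathrm{red}},\nabla_{\mathrm{red}})$, the brane reduction $\mathcal B_{\mathrm{red}}=(C_{\mathrm{red}},E_{\mathrm{red}},\nabla_{\mathrm{red}})$ is a coisotropic A-brane on $(X/\!\!/G,\omega_{\mathrm{red}})$: the induced map is an embedding onto a coisotropic submanifold, the form $F_{\mathrm{tr}}+\sqrt{-1}\,\omega_{\mathrm{red}}|_{C_{\mathrm{red}}}$ is transverse holomorphic symplectic, and the traceless curvature of $\nabla_{\mathrm{red}}$ is of transverse type $(1,1)$. -/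

import Mathlib

open scoped Manifold ContDiff

set_option linter.unusedSectionVars false

noncomputable section

namespace ABrane

section Forms

variable {m : ℕ} {M : Type*} [TopologicalSpace M] [ChartedSpace (EuclideanSpace ℝ (Fin m)) M]
  [IsManifold (𝓡 m) ∞ M]

/-- The vector field `V` is smooth at the point `x`. -/
def SmoothFieldAt (V : Π x : M, TangentSpace (𝓡 m) x) (x : M) : Prop :=
  ContMDiffAt (𝓡 m) (𝓡 m).tangent ∞ (fun y ↦ (⟨y, V y⟩ : TangentBundle (𝓡 m) M)) x

variable (m M) in
/-- Pointwise `ℝ`-bilinear forms on the tangent spaces of `M` with values in `W`; smoothness,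
antisymmetry and closedness are imposed separately, by `IsClosedForm`. -/
abbrev TwoForm (W : Type*) [NormedAddCommGroup W] [NormedSpace ℝ W] :=
  Π x : M, TangentSpace (𝓡 m) x →ₗ[ℝ] TangentSpace (𝓡 m) x →ₗ[ℝ] W

/-- `Ω` is a smooth closed `2`-form. Closedness is the vanishing of `dΩ`, written by the invariant
formula
`dΩ(U,V,T) = U Ω(V,T) - V Ω(U,T) + T Ω(U,V) - Ω([U,V],T) + Ω([U,T],V) - Ω([V,T],U)`. -/
structure IsClosedForm {W : Type*} [NormedAddCommGroup W] [NormedSpace ℝ W]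
    (Ω : TwoForm m M W) : Prop where
  alternating : ∀ (x : M) (v : TangentSpace (𝓡 m) x), Ω x v v = 0
  smooth : ∀ (x : M) (U V : Π y : M, TangentSpace (𝓡 m) y), SmoothFieldAt U x →
    SmoothFieldAt V x → ContMDiffAt (𝓡 m) 𝓘(ℝ, W) ∞ (fun y ↦ Ω y (U y) (V y)) x
  closed : ∀ (x : M) (U V T : Π y : M, TangentSpace (𝓡 m) y),
    SmoothFieldAt U x → SmoothFieldAt V x → SmoothFieldAt T x →
      mvfderiv (𝓡 m) (fun y ↦ Ω y (V y) (T y)) x (U x)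
        - mvfderiv (𝓡 m) (fun y ↦ Ω y (U y) (T y)) x (V x)
        + mvfderiv (𝓡 m) (fun y ↦ Ω y (U y) (V y)) x (T x)
        - Ω x (VectorField.mlieBracket (𝓡 m) U V x) (T x)
        + Ω x (VectorField.mlieBracket (𝓡 m) U T x) (V x)
        - Ω x (VectorField.mlieBracket (𝓡 m) V T x) (U x) = 0

/-- Symplectic forms: closed and nondegenerate `2`-forms. -/
structure IsSymplectic (ωM : TwoForm m M ℝ) : Prop extends IsClosedForm ωM where
  nondegenerate : ∀ (x : M) (u : TangentSpace (𝓡 m) x), (∀ v, ωM x u v = 0) → u = 0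

/-- The family of subspaces `D` is a smooth subbundle of the tangent bundle: near every point it is
spanned by a frame of smooth vector fields. -/
def IsSubbundle (D : Π x : M, Submodule ℝ (TangentSpace (𝓡 m) x)) : Prop :=
  ∀ x : M, ∃ (d : ℕ) (e : Fin d → Π y : M, TangentSpace (𝓡 m) y) (O : Set M),
    IsOpen O ∧ x ∈ O ∧ ∀ y ∈ O, (∀ i, SmoothFieldAt (e i) y) ∧
      LinearIndependent ℝ (fun i ↦ e i y) ∧ Submodule.span ℝ (Set.range fun i ↦ e i y) = D y

/-- `(T_x M)^{⊥Ω}`: the vectors `u` with `Ω(u, v) = 0` for all `v`. -/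
def radical (Ω : TwoForm m M ℂ) (x : M) : Submodule ℝ (TangentSpace (𝓡 m) x) :=
  LinearMap.ker (Ω x)

/-- The fibre at `x` of the quotient bundle `TM / (TM)^{⊥Ω}`. -/
abbrev TQuo (Ω : TwoForm m M ℂ) (x : M) := TangentSpace (𝓡 m) x ⧸ radical Ω x

/-- `I` is the endomorphism of `TM / (TM)^{⊥Ω}` at `x` given by `Re Ω(u, v) = Im Ω(I u, v)` for the
form induced by `Ω` on the quotient (here `w` is any representative of `I [u]`), and `I² = -1`.
The first condition determines `I` whenever some `I` satisfies both. -/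
structure IsTransverseComplexStructure (Ω : TwoForm m M ℂ) (x : M)
    (I : TQuo Ω x →ₗ[ℝ] TQuo Ω x) : Prop where
  sq : ∀ u, I (I u) = -u
  compat : ∀ u v w : TangentSpace (𝓡 m) x, (radical Ω x).mkQ w = I ((radical Ω x).mkQ u) →
    (Ω x u v).re = (Ω x w v).im

/-- Transverse holomorphic symplectic forms: closed complex valued `2`-forms `Ω` such that
`(TM)^{⊥Ω}` is a subbundle of `TM` and the endomorphism `I` of the quotient bundle with
`Re Ω(u, v) = Im Ω(I u, v)` exists and satisfies `I² = -1`. -/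
structure IsTransverseHolomorphicSymplectic (Ω : TwoForm m M ℂ) : Prop extends
    IsClosedForm Ω where
  subbundle : IsSubbundle (radical Ω)
  complexStructure : ∀ x, ∃ I, IsTransverseComplexStructure Ω x I

end Forms

section Bundles

universe u v w

/-- A smooth complex vector bundle on `M` with typical fibre `F`, a smooth Hermitian metric and a
smooth unitary connection `conn`. For a section `s` and `v ∈ T_x M`, `conn s x v` is `(∇_v s)(x)`.
Mathlib's `CovariantDerivative` is `ℝ`-linear and satisfies the Leibniz rule for real functions;
`conn_smul` adds complex linearity. -/
structure HermitianBundle (m : ℕ) (F : Type u) [NormedAddCommGroup F] [NormedSpace ℂ F]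
    (M : Type v) [TopologicalSpace M] [ChartedSpace (EuclideanSpace ℝ (Fin m)) M]
    [IsManifold (𝓡 m) ∞ M] where
  Fib : M → Type w
  [fibGroup : ∀ x, NormedAddCommGroup (Fib x)]
  [fibInner : ∀ x, InnerProductSpace ℂ (Fib x)]
  [totalTop : TopologicalSpace (Bundle.TotalSpace F Fib)]
  [fiberBundle : FiberBundle F Fib]
  [vectorBundle : VectorBundle ℂ F Fib]
  [realVectorBundle : VectorBundle ℝ F Fib]
  [smoothBundle : ContMDiffVectorBundle ∞ F Fib (𝓡 m)]
  smooth_inner : ∀ (x : M) (s t : Π y, Fib y),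
    ContMDiffAt (𝓡 m) ((𝓡 m).prod 𝓘(ℝ, F)) ∞ (fun y ↦ Bundle.TotalSpace.mk' F y (s y)) x →
    ContMDiffAt (𝓡 m) ((𝓡 m).prod 𝓘(ℝ, F)) ∞ (fun y ↦ Bundle.TotalSpace.mk' F y (t y)) x →
    ContMDiffAt (𝓡 m) 𝓘(ℝ, ℂ) ∞ (fun y ↦ inner ℂ (s y) (t y)) x
  conn : CovariantDerivative (𝓡 m) F Fib
  conn_smooth : ∀ (x : M) (s : Π y, Fib y) (V : Π y : M, TangentSpace (𝓡 m) y),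
    ContMDiffAt (𝓡 m) ((𝓡 m).prod 𝓘(ℝ, F)) ∞ (fun y ↦ Bundle.TotalSpace.mk' F y (s y)) x →
    SmoothFieldAt V x →
    ContMDiffAt (𝓡 m) ((𝓡 m).prod 𝓘(ℝ, F)) ∞
      (fun y ↦ Bundle.TotalSpace.mk' F y (conn s y (V y))) x
  conn_smul : ∀ (x : M) (c : ℂ) (s : Π y, Fib y) (v : TangentSpace (𝓡 m) x),
    MDifferentiableAt (𝓡 m) ((𝓡 m).prod 𝓘(ℝ, F)) (fun y ↦ Bundle.TotalSpace.mk' F y (s y)) x →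
    conn (c • s) x v = c • conn s x v
  conn_unitary : ∀ (x : M) (s t : Π y, Fib y) (v : TangentSpace (𝓡 m) x),
    MDifferentiableAt (𝓡 m) ((𝓡 m).prod 𝓘(ℝ, F)) (fun y ↦ Bundle.TotalSpace.mk' F y (s y)) x →
    MDifferentiableAt (𝓡 m) ((𝓡 m).prod 𝓘(ℝ, F)) (fun y ↦ Bundle.TotalSpace.mk' F y (t y)) x →
    mvfderiv (𝓡 m) (fun y ↦ inner ℂ (s y) (t y)) x v =
      inner ℂ (conn s x v) (t x) + inner ℂ (s x) (conn t x v)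

attribute [instance] HermitianBundle.fibGroup HermitianBundle.fibInner HermitianBundle.totalTop
  HermitianBundle.fiberBundle HermitianBundle.vectorBundle HermitianBundle.realVectorBundle
  HermitianBundle.smoothBundle

variable {m : ℕ} {F : Type u} [NormedAddCommGroup F] [NormedSpace ℂ F]
  {M : Type v} [TopologicalSpace M] [ChartedSpace (EuclideanSpace ℝ (Fin m)) M]
  [IsManifold (𝓡 m) ∞ M]

namespace HermitianBundle

variable (E : HermitianBundle.{u, v, w} m F M)

/-- The section `s` is smooth at `x`. -/
def SmoothAt (s : Π y, E.Fib y) (x : M) : Prop :=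
  ContMDiffAt (𝓡 m) ((𝓡 m).prod 𝓘(ℝ, F)) ∞ (fun y ↦ Bundle.TotalSpace.mk' F y (s y)) x

/-- `∇_U ∇_V s - ∇_V ∇_U s - ∇_{[U,V]} s` at the point `x`. -/
def curvAux (s : Π y, E.Fib y) (U V : Π y : M, TangentSpace (𝓡 m) y) (x : M) : E.Fib x :=
  E.conn (fun y ↦ E.conn s y (V y)) x (U x) - E.conn (fun y ↦ E.conn s y (U y)) x (V x)
    - E.conn s x (VectorField.mlieBracket (𝓡 m) U V x)

end HermitianBundle

/-- The extension of `v ∈ V x` to a section that is constant in the preferred trivialization at `x`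
(and zero outside the domain of that trivialization). -/
def localExt (𝕜 : Type*) [NontriviallyNormedField 𝕜] {B : Type*} [TopologicalSpace B]
    (F' : Type*) [NormedAddCommGroup F'] [NormedSpace 𝕜 F']
    {V : B → Type*} [TopologicalSpace (Bundle.TotalSpace F' V)]
    [∀ x, AddCommGroup (V x)] [∀ x, TopologicalSpace (V x)] [∀ x, Module 𝕜 (V x)]
    [FiberBundle F' V] [VectorBundle 𝕜 F' V] {x : B} (v : V x) (y : B) : V y :=
  (trivializationAt F' V x).symmₗ 𝕜 y ((trivializationAt F' V x).linearMapAt 𝕜 x v)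

section localExt

variable {𝕜 : Type*} [NontriviallyNormedField 𝕜] {B : Type*} [TopologicalSpace B]
  {F' : Type*} [NormedAddCommGroup F'] [NormedSpace 𝕜 F']
  {V : B → Type*} [TopologicalSpace (Bundle.TotalSpace F' V)]
  [∀ x, AddCommGroup (V x)] [∀ x, TopologicalSpace (V x)] [∀ x, Module 𝕜 (V x)]
  [FiberBundle F' V] [VectorBundle 𝕜 F' V]

lemma localExt_add {x : B} (v w : V x) :
    localExt 𝕜 F' (v + w) = localExt 𝕜 F' v + localExt 𝕜 F' w := by
  funext y; simp [localExt]

lemma localExt_smul {x : B} (c : 𝕜) (v : V x) :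
    localExt 𝕜 F' (c • v) = c • localExt 𝕜 F' v := by
  funext y; simp [localExt]

lemma localExt_self {x : B} (v : V x) : localExt 𝕜 F' v x = v := by
  have hx := FiberBundle.mem_baseSet_trivializationAt' (F := F') (E := V) x
  simp [localExt, Bundle.Trivialization.symmₗ_linearMapAt _ hx]

lemma localExt_eventuallyEq {x : B} (v : V x) :
    ∀ᶠ y in nhds x, localExt 𝕜 F' v y = FiberBundle.extend F' v y := by
  have hx := FiberBundle.mem_baseSet_trivializationAt' (F := F') (E := V) x
  filter_upwards [(trivializationAt F' V x).open_baseSet.mem_nhds hx] with y hy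
  simp only [FiberBundle.extend, localExt]
  rw [Bundle.Trivialization.linearMapAt_apply, if_pos hx, Bundle.Trivialization.symmₗ_apply _ hy]

end localExt

lemma smoothFieldAt_localExt {x : M} (e : TangentSpace (𝓡 m) x) :
    SmoothFieldAt (localExt ℝ (EuclideanSpace ℝ (Fin m)) e : Π y : M, TangentSpace (𝓡 m) y) x := by
  refine ContMDiffAt.congr_of_eventuallyEq (FiberBundle.contMDiffAt_extend (𝓡 m) _ e) ?_
  filter_upwards [localExt_eventuallyEq (𝕜 := ℝ) (F' := EuclideanSpace ℝ (Fin m))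
    (V := fun y : M ↦ TangentSpace (𝓡 m) y) e] with y hy
  rw [hy]

namespace HermitianBundle

variable {E : HermitianBundle.{u, v, w} m F M}

lemma SmoothAt.mdiff {s : Π y, E.Fib y} {x : M} (hs : E.SmoothAt s x) :
    MDifferentiableAt (𝓡 m) ((𝓡 m).prod 𝓘(ℝ, F)) (fun y ↦ Bundle.TotalSpace.mk' F y (s y)) x :=
  ContMDiffAt.mdifferentiableAt hs (by simp)

lemma SmoothAt.eventually_mdiff {s : Π y, E.Fib y} {x : M} (hs : E.SmoothAt s x) :
    ∀ᶠ y in nhds x, MDifferentiableAt (𝓡 m) ((𝓡 m).prod 𝓘(ℝ, F))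
      (fun y ↦ Bundle.TotalSpace.mk' F y (s y)) y := by
  have h1 : ContMDiffAt (𝓡 m) ((𝓡 m).prod 𝓘(ℝ, F)) 1
    (fun y ↦ Bundle.TotalSpace.mk' F y (s y)) x := ContMDiffAt.of_le hs (by simp)
  filter_upwards [(contMDiffAt_iff_contMDiffAt_nhds (by simp)).1 h1] with y hy
  exact ContMDiffAt.mdifferentiableAt hy (by simp)

lemma SmoothAt.add {s t : Π y, E.Fib y} {x : M} (hs : E.SmoothAt s x) (ht : E.SmoothAt t x) :
    E.SmoothAt (s + t) x :=
  ContMDiffAt.add_section hs ht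

lemma SmoothAt.smul {s : Π y, E.Fib y} {x : M} (c : ℂ) (hs : E.SmoothAt s x) :
    E.SmoothAt (c • s) x := by
  unfold SmoothAt at hs ⊢
  rw [Bundle.contMDiffAt_section] at hs ⊢
  have hx := FiberBundle.mem_baseSet_trivializationAt' (F := F) (E := E.Fib) x
  have h := ((c • ContinuousLinearMap.id ℝ F).contMDiff.contMDiffAt
    (n := ∞) (x := (trivializationAt F E.Fib x ⟨x, s x⟩).2)).comp x hs
  refine h.congr_of_eventuallyEq ?_
  filter_upwards [(trivializationAt F E.Fib x).open_baseSet.mem_nhds hx] with y hy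
  simpa using (Bundle.Trivialization.linear ℂ (trivializationAt F E.Fib x) hy).map_smul c (s y)

lemma smoothAt_localExt {x : M} (e : E.Fib x) : E.SmoothAt (localExt ℂ F e) x := by
  refine ContMDiffAt.congr_of_eventuallyEq (FiberBundle.contMDiffAt_extend (𝓡 m) F e) ?_
  filter_upwards [localExt_eventuallyEq (𝕜 := ℂ) (F' := F) e] with y hy
  rw [hy]

lemma curvAux_add_left (s : Π y, E.Fib y) {U U' V : Π y : M, TangentSpace (𝓡 m) y} {x : M}
    (hs : E.SmoothAt s x) (hU : SmoothFieldAt U x) (hU' : SmoothFieldAt U' x) :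
    E.curvAux s (U + U') V x = E.curvAux s U V x + E.curvAux s U' V x := by
  have h1 := VectorField.mlieBracket_add_left (I := 𝓡 m) (W := V)
    (ContMDiffAt.mdifferentiableAt hU (by simp)) (ContMDiffAt.mdifferentiableAt hU' (by simp))
  have h2 := E.conn.isCovariantDerivativeOn.add (s := Set.univ)
    (SmoothAt.mdiff (E.conn_smooth x s U hs hU)) (SmoothAt.mdiff (E.conn_smooth x s U' hs hU'))
  have h3 : (fun y ↦ E.conn s y ((U + U') y)) =
    (fun y ↦ E.conn s y (U y)) + (fun y ↦ E.conn s y (U' y)) := by funext y; simp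
  simp only [curvAux, h1, h3, h2]
  simp
  abel

lemma curvAux_smul_left (c : ℝ) (s : Π y, E.Fib y) {U V : Π y : M, TangentSpace (𝓡 m) y} {x : M}
    (hs : E.SmoothAt s x) (hU : SmoothFieldAt U x) :
    E.curvAux s (c • U) V x = c • E.curvAux s U V x := by
  have h1 := VectorField.mlieBracket_const_smul_left (I := 𝓡 m) (W := V) (c := c)
    (ContMDiffAt.mdifferentiableAt hU (by simp))
  have h2 := E.conn.isCovariantDerivativeOn.smul_const (s := Set.univ) c
    (SmoothAt.mdiff (E.conn_smooth x s U hs hU))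
  have h3 : (fun y ↦ E.conn s y ((c • U) y)) = c • (fun y ↦ E.conn s y (U y)) := by
    funext y; simp
  simp only [curvAux, h1, h3, h2]
  simp [smul_sub]

lemma curvAux_swap (s : Π y, E.Fib y) (U V : Π y : M, TangentSpace (𝓡 m) y) (x : M) :
    E.curvAux s U V x = - E.curvAux s V U x := by
  have h1 := VectorField.mlieBracket_swap_apply (I := 𝓡 m) (V := U) (W := V) (x := x)
  simp only [curvAux, h1, map_neg]
  abel

lemma curvAux_add {s t : Π y, E.Fib y} {U V : Π y : M, TangentSpace (𝓡 m) y} {x : M}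
    (hs : E.SmoothAt s x) (ht : E.SmoothAt t x) (hU : SmoothFieldAt U x) (hV : SmoothFieldAt V x) :
    E.curvAux (s + t) U V x = E.curvAux s U V x + E.curvAux t U V x := by
  have key : ∀ {V : Π y : M, TangentSpace (𝓡 m) y}, SmoothFieldAt V x →
      E.conn (fun y ↦ E.conn (s + t) y (V y)) x =
        E.conn (fun y ↦ E.conn s y (V y)) x + E.conn (fun y ↦ E.conn t y (V y)) x := by
    intro V hV
    have a := E.conn_smooth x s V hs hV
    have b := E.conn_smooth x t V ht hV
    rw [← E.conn.isCovariantDerivativeOn.add (s := Set.univ) (SmoothAt.mdiff a) (SmoothAt.mdiff b)]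
    refine E.conn.isCovariantDerivativeOn.congr_of_eventuallyEq (s := Set.univ)
      (SmoothAt.mdiff (E.conn_smooth x _ V (hs.add ht) hV)) (SmoothAt.mdiff (SmoothAt.add a b))
      Filter.univ_mem ?_
    filter_upwards [hs.eventually_mdiff, ht.eventually_mdiff] with y h1 h2
    rw [E.conn.isCovariantDerivativeOn.add (s := Set.univ) h1 h2]
    rfl
  simp only [curvAux, key hU, key hV,
    E.conn.isCovariantDerivativeOn.add (s := Set.univ) hs.mdiff ht.mdiff]
  simp
  abel

lemma curvAux_smul (c : ℂ) {s : Π y, E.Fib y} {U V : Π y : M, TangentSpace (𝓡 m) y} {x : M}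
    (hs : E.SmoothAt s x) (hU : SmoothFieldAt U x) (hV : SmoothFieldAt V x) :
    E.curvAux (c • s) U V x = c • E.curvAux s U V x := by
  have key : ∀ {V : Π y : M, TangentSpace (𝓡 m) y}, SmoothFieldAt V x → ∀ u,
      E.conn (fun y ↦ E.conn (c • s) y (V y)) x u =
        c • E.conn (fun y ↦ E.conn s y (V y)) x u := by
    intro V hV u
    have a := E.conn_smooth x s V hs hV
    rw [← E.conn_smul _ _ _ _ (SmoothAt.mdiff a)]
    congr 1
    refine E.conn.isCovariantDerivativeOn.congr_of_eventuallyEq (s := Set.univ)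
      (SmoothAt.mdiff (E.conn_smooth x _ V (hs.smul c) hV)) (SmoothAt.mdiff (SmoothAt.smul c a))
      Filter.univ_mem ?_
    filter_upwards [hs.eventually_mdiff] with y h1
    rw [E.conn_smul _ _ _ _ h1]
    rfl
  simp only [curvAux, key hU, key hV, E.conn_smul _ _ _ _ hs.mdiff]
  simp [smul_sub]

variable (E)

/-- The curvature `F^∇(u, v) ∈ End(E_x)`. Being a tensor, it is computed from arbitrary smooth local
extensions of `u`, `v` and `e`; here the ones that are constant in the preferred
trivializations at `x` are used. -/
def curvature (x : M) :
    TangentSpace (𝓡 m) x →ₗ[ℝ] TangentSpace (𝓡 m) x →ₗ[ℝ] (E.Fib x →ₗ[ℂ] E.Fib x) :=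
  LinearMap.mk₂ ℝ
    (fun u v ↦
      { toFun := fun e ↦ E.curvAux (localExt ℂ F e) (localExt ℝ (EuclideanSpace ℝ (Fin m)) u)
          (localExt ℝ (EuclideanSpace ℝ (Fin m)) v) x
        map_add' := fun e e' ↦ by
          rw [localExt_add, curvAux_add (smoothAt_localExt e) (smoothAt_localExt e')
            (smoothFieldAt_localExt u) (smoothFieldAt_localExt v)]
        map_smul' := fun c e ↦ by
          rw [localExt_smul, curvAux_smul c (smoothAt_localExt e)
            (smoothFieldAt_localExt u) (smoothFieldAt_localExt v)]
          rfl })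
    (fun u u' v ↦ by
      ext e
      simp only [LinearMap.coe_mk, AddHom.coe_mk, LinearMap.add_apply]
      rw [localExt_add, curvAux_add_left _ (smoothAt_localExt e) (smoothFieldAt_localExt u)
        (smoothFieldAt_localExt u')])
    (fun c u v ↦ by
      ext e
      simp only [LinearMap.coe_mk, AddHom.coe_mk, LinearMap.smul_apply]
      rw [localExt_smul, curvAux_smul_left _ _ (smoothAt_localExt e) (smoothFieldAt_localExt u)])
    (fun u v v' ↦ by
      ext e
      simp only [LinearMap.coe_mk, AddHom.coe_mk, LinearMap.add_apply]
      rw [localExt_add, curvAux_swap, curvAux_add_left _ (smoothAt_localExt e)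
        (smoothFieldAt_localExt v) (smoothFieldAt_localExt v'), neg_add, ← curvAux_swap,
        ← curvAux_swap])
    (fun c u v ↦ by
      ext e
      simp only [LinearMap.coe_mk, AddHom.coe_mk, LinearMap.smul_apply]
      rw [localExt_smul, curvAux_swap, curvAux_smul_left _ _ (smoothAt_localExt e)
        (smoothFieldAt_localExt v), ← smul_neg, ← curvAux_swap])

end HermitianBundle

section Action

variable {k : ℕ} (G : Type*) [Group G] [TopologicalSpace G]
  [ChartedSpace (EuclideanSpace ℝ (Fin k)) G] [LieGroup (𝓡 k) ∞ G]
  [MulAction G M] [ContMDiffSMul (𝓡 k) (𝓡 m) ∞ G M]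

variable {G} in
/-- The adjoint action of `g` on the Lie algebra `T_1 G`. -/
def adjoint (g : G) : GroupLieAlgebra (𝓡 k) G →L[ℝ] GroupLieAlgebra (𝓡 k) G :=
  mfderiv (𝓡 k) (𝓡 k) (fun h : G ↦ g * h * g⁻¹) 1

/-- The infinitesimal action: `a` is sent to the velocity at `t = 0` of `t ↦ exp(-ta) • x`, that is,
to the derivative at `1` in the direction `a` of `g ↦ g⁻¹ • x` (with `1⁻¹ • x` read as `x`).
With this sign, `𝔤 → {vector fields}` is a homomorphism of Lie algebras. -/
def infAct (x : M) : GroupLieAlgebra (𝓡 k) G →L[ℝ] TangentSpace (𝓡 m) x :=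
  mfderiv (𝓡 k) (𝓡 m) (fun g : G ↦ g⁻¹ • x) 1

/-- The action of `G` preserves `ωM`, and `μ : M → 𝔤*` is a moment map: it is smooth and
equivariant for the coadjoint action, `⟨μ(g x), Ad_g a⟩ = ⟨μ(x), a⟩`, and
`ωM(χ(a), u) = ⟨dμ(u), a⟩`, where `χ(a)` is the infinitesimal action of `a`. -/
structure IsHamiltonian (ωM : TwoForm m M ℝ)
    (μ : M → Module.Dual ℝ (GroupLieAlgebra (𝓡 k) G)) : Prop where
  invariant : ∀ (g : G) (x : M) (u v : TangentSpace (𝓡 m) x),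
    ωM (g • x) (mfderiv (𝓡 m) (𝓡 m) (fun y : M ↦ g • y) x u)
      (mfderiv (𝓡 m) (𝓡 m) (fun y : M ↦ g • y) x v) = ωM x u v
  smooth : ∀ a, ContMDiff (𝓡 m) 𝓘(ℝ, ℝ) ∞ (fun x ↦ μ x a)
  equivariant : ∀ (g : G) (x : M) (a), μ (g • x) (adjoint g a) = μ x a
  moment : ∀ (x : M) (a) (u : TangentSpace (𝓡 m) x),
    ωM x (infAct G x a) u = mvfderiv (𝓡 m) (fun y ↦ μ y a) x u

variable (k) in
/-- A lift of the action of `G` on `M` to `E` by fibrewise linear maps which is smooth as a map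
`G × E → E` and preserves the metric and the connection. `act g` maps `E_x` to `E_y` when
`g x = y`; invariance of the connection reads `∇_{g u} (g s) = g (∇_u s)` with
`(g s)(y) = g (s (g⁻¹ y))`. -/
structure EquivariantStructure (E : HermitianBundle.{u, v, w} m F M) where
  act : ∀ (g : G) {x y : M}, g • x = y → (E.Fib x ≃ₗᵢ[ℂ] E.Fib y)
  act_one : ∀ (x : M) (h : (1 : G) • x = x) (e : E.Fib x), act 1 h e = e
  act_mul : ∀ (g g' : G) {x y z : M} (h' : g' • x = y) (h : g • y = z) (hh : (g * g') • x = z)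
    (e : E.Fib x), act (g * g') hh e = act g h (act g' h' e)
  smooth : ContMDiff ((𝓡 k).prod ((𝓡 m).prod 𝓘(ℝ, F))) ((𝓡 m).prod 𝓘(ℝ, F)) ∞
    (fun p : G × Bundle.TotalSpace F E.Fib ↦
      Bundle.TotalSpace.mk' F (p.1 • p.2.proj) (act p.1 rfl p.2.snd))
  conn_invariant : ∀ (g : G) (x : M) (s : Π y, E.Fib y) (u : TangentSpace (𝓡 m) x),
    E.SmoothAt s x →
    E.conn (fun y ↦ act g (smul_inv_smul g y) (s (g⁻¹ • y))) (g • x)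
      (mfderiv (𝓡 m) (𝓡 m) (fun y : M ↦ g • y) x u) = act g rfl (E.conn s x u)

namespace EquivariantStructure

variable {G} {E : HermitianBundle.{u, v, w} m F M} (A : EquivariantStructure k G E)

/-- `g ↦ g (s (g⁻¹ x))`, a function on `G` with values in the vector space `E_x`. -/
def orbitSection (s : Π y, E.Fib y) (x : M) (g : G) : E.Fib x :=
  A.act g (smul_inv_smul g x) (s (g⁻¹ • x))

/-- The infinitesimal action on sections, `(L_a s)(x) = d/dt exp(ta) (s (exp(-ta) x))` at `t = 0`. -/
def lieDeriv (a : GroupLieAlgebra (𝓡 k) G) (s : Π y, E.Fib y) (x : M) : E.Fib x :=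
  mvfderiv (𝓡 k) (A.orbitSection s x) 1 a

lemma mk_act (g : G) {x y : M} (h : g • x = y) (e : E.Fib x) :
    Bundle.TotalSpace.mk' F y (A.act g h e) = Bundle.TotalSpace.mk' F (g • x) (A.act g rfl e) := by
  subst h; rfl

lemma mdiff_orbitSection {s : Π y, E.Fib y} {x : M} (hs : E.SmoothAt s x) :
    MDifferentiableAt (𝓡 k) 𝓘(ℝ, E.Fib x) (A.orbitSection s x) (1 : G) := by
  have h1 : ContMDiffAt (𝓡 k) (𝓡 m) ∞ (fun g : G ↦ g⁻¹ • x) 1 :=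
    ((contMDiff_inv (𝓡 k) ∞).smul contMDiff_const).contMDiffAt
  have h2 : ContMDiffAt (𝓡 k) ((𝓡 m).prod 𝓘(ℝ, F)) ∞
      (fun g : G ↦ Bundle.TotalSpace.mk' F (g⁻¹ • x) (s (g⁻¹ • x))) 1 := by
    have : E.SmoothAt s ((1 : G)⁻¹ • x) := by simpa using hs
    unfold HermitianBundle.SmoothAt at this
    exact ContMDiffAt.comp (1 : G) this h1
  have h3 := ContMDiffAt.comp (1 : G) A.smooth.contMDiffAt (contMDiffAt_id.prodMk h2)
  have h4 : ContMDiffAt (𝓡 k) ((𝓡 m).prod 𝓘(ℝ, F)) ∞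
      (fun g : G ↦ Bundle.TotalSpace.mk' F x (A.orbitSection s x g)) 1 := by
    refine h3.congr_of_eventuallyEq (Filter.Eventually.of_forall fun g ↦ ?_)
    exact A.mk_act g _ _
  have h5 := (Bundle.contMDiffAt_totalSpace.1 h4).2
  have hx := FiberBundle.mem_baseSet_trivializationAt' (F := F) (E := E.Fib) x
  have h6 := (((trivializationAt F E.Fib x).symmL ℝ x).contMDiff.contMDiffAt (n := ∞)).comp
    (1 : G) h5
  refine ContMDiffAt.mdifferentiableAt (n := ∞) ?_ (by simp)
  refine h6.congr_of_eventuallyEq (Filter.Eventually.of_forall fun g ↦ ?_)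
  have := Bundle.Trivialization.symmL_continuousLinearMapAt (R := ℝ)
    (trivializationAt F E.Fib x) hx (A.orbitSection s x g)
  rw [Bundle.Trivialization.continuousLinearMapAt_apply_of_mem _ _ hx] at this
  exact this.symm

lemma lieDeriv_add (a : GroupLieAlgebra (𝓡 k) G) {s t : Π y, E.Fib y} {x : M}
    (hs : E.SmoothAt s x) (ht : E.SmoothAt t x) :
    A.lieDeriv a (s + t) x = A.lieDeriv a s x + A.lieDeriv a t x := by
  have h : A.orbitSection (s + t) x = A.orbitSection s x + A.orbitSection t x := by
    funext g; simp [orbitSection]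
  simp only [lieDeriv, h]
  rw [mvfderiv_add (A.mdiff_orbitSection hs) (A.mdiff_orbitSection ht)]
  rfl

lemma lieDeriv_smul (a : GroupLieAlgebra (𝓡 k) G) (c : ℂ) {s : Π y, E.Fib y} {x : M}
    (hs : E.SmoothAt s x) :
    A.lieDeriv a (c • s) x = c • A.lieDeriv a s x := by
  have h : A.orbitSection (c • s) x =
      (c • ContinuousLinearMap.id ℝ (E.Fib x)) ∘ A.orbitSection s x := by
    funext g; simp [orbitSection]
  simp only [lieDeriv, h]
  have := mfderiv_comp_apply (1 : G) (c • ContinuousLinearMap.id ℝ (E.Fib x)).mdifferentiableAt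
    (A.mdiff_orbitSection hs) a
  rw [ContinuousLinearMap.mfderiv_eq] at this
  exact this

/-- The moment section `⟨μ_B, a⟩ = L_a - ∇_{χ(a)} + ⟨μ, a⟩ Id`, an endomorphism of `E`. It is a
tensor in the section it is applied to, so that it can be computed on the extension of `e ∈ E_x` by
a section that is constant in the preferred trivialization at `x`. -/
def momentSection (μ : M → Module.Dual ℝ (GroupLieAlgebra (𝓡 k) G)) (x : M)
    (a : GroupLieAlgebra (𝓡 k) G) : E.Fib x →ₗ[ℂ] E.Fib x where
  toFun e := A.lieDeriv a (localExt ℂ F e) x - E.conn (localExt ℂ F e) x (infAct G x a)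
    + (μ x a : ℂ) • e
  map_add' e e' := by
    rw [localExt_add, A.lieDeriv_add a (HermitianBundle.smoothAt_localExt e)
      (HermitianBundle.smoothAt_localExt e'),
      E.conn.isCovariantDerivativeOn.add (s := Set.univ)
        (HermitianBundle.smoothAt_localExt e).mdiff (HermitianBundle.smoothAt_localExt e').mdiff]
    simp
    abel
  map_smul' c e := by
    rw [localExt_smul, A.lieDeriv_smul a c (HermitianBundle.smoothAt_localExt e),
      E.conn_smul _ _ _ _ (HermitianBundle.smoothAt_localExt e).mdiff]
    simp [smul_sub, smul_comm c]

/-- The moment trace `⟨ν, a⟩ = (i / r) Tr ⟨μ_B, a⟩`, where `r` is the rank of the bundle. -/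
def momentTrace (μ : M → Module.Dual ℝ (GroupLieAlgebra (𝓡 k) G)) (x : M)
    (a : GroupLieAlgebra (𝓡 k) G) : ℂ :=
  Complex.I / (Module.finrank ℂ F : ℂ) * LinearMap.trace ℂ (E.Fib x) (A.momentSection μ x a)

end EquivariantStructure
end Action

section Branes

namespace HermitianBundle

variable (E : HermitianBundle.{u, v, w} m F M)

/-- The (real) form `F_tr = (i / r) Tr F^∇`, regarded as a complex valued `2`-form. -/
def traceCurvature : TwoForm m M ℂ := fun x ↦
  LinearMap.mk₂ ℝ (fun u v ↦ Complex.I / (Module.finrank ℂ F : ℂ) *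
      LinearMap.trace ℂ (E.Fib x) (E.curvature x u v))
    (fun u u' v ↦ by simp [mul_add]) (fun c u v ↦ by simp; ring)
    (fun u v v' ↦ by simp [mul_add]) (fun c u v ↦ by simp; ring)

/-- The traceless curvature `F_0`, defined by `F^∇ = F_0 - i F_tr Id`. -/
def tracelessCurvature (x : M) (u v : TangentSpace (𝓡 m) x) : E.Fib x →ₗ[ℂ] E.Fib x :=
  E.curvature x u v + (Complex.I * E.traceCurvature x u v) • LinearMap.id

/-- The complex valued form `Ω = F_tr + i ω|_C` on `C`, where `ω|_C` is the pull back of the form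
`ωY` along `ι : C → Y`. -/
def braneForm {n : ℕ} {Y : Type*} [TopologicalSpace Y] [ChartedSpace (EuclideanSpace ℝ (Fin n)) Y]
    (ωY : TwoForm n Y ℝ) (ι : M → Y) : TwoForm m M ℂ := fun x ↦
  LinearMap.mk₂ ℝ (fun u v ↦ E.traceCurvature x u v + Complex.I *
      (ωY (ι x) (mfderiv (𝓡 m) (𝓡 n) ι x u) (mfderiv (𝓡 m) (𝓡 n) ι x v) : ℂ))
    (fun u u' v ↦ by simp; ring) (fun c u v ↦ by simp; ring)
    (fun u v v' ↦ by simp; ring) (fun c u v ↦ by simp; ring)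

/-- Transverse type `(1,1)` of the traceless curvature with respect to `Ω`: it descends to
`TM / (TM)^{⊥Ω}`, and there `F_0(I u, I v) = F_0(u, v)` for the transverse complex structure `I`
of `Ω` (here `u'`, `v'` represent `I [u]`, `I [v]`). -/
structure IsTransverseOneOne (Ω : TwoForm m M ℂ) : Prop where
  descends : ∀ (x : M) (u v : TangentSpace (𝓡 m) x), u ∈ radical Ω x →
    E.tracelessCurvature x u v = 0 ∧ E.tracelessCurvature x v u = 0
  invariant : ∀ (x : M) (I : TQuo Ω x →ₗ[ℝ] TQuo Ω x), IsTransverseComplexStructure Ω x I →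
    ∀ u v u' v' : TangentSpace (𝓡 m) x,
      (radical Ω x).mkQ u' = I ((radical Ω x).mkQ u) →
      (radical Ω x).mkQ v' = I ((radical Ω x).mkQ v) →
      E.tracelessCurvature x u' v' = E.tracelessCurvature x u v

end HermitianBundle

/-- `(C, E, ∇)` is a coisotropic A-brane on `(Y, ωY)`, where `C` is embedded into `Y` by `ι` and
`E` is a Hermitian bundle with unitary connection on `C`. -/
structure IsCoisotropicABrane {n : ℕ} {Y : Type*} [TopologicalSpace Y]
    [ChartedSpace (EuclideanSpace ℝ (Fin n)) Y] (ωY : TwoForm n Y ℝ) (ι : M → Y)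
    (E : HermitianBundle.{u, v, w} m F M) : Prop where
  /-- `C` is a submanifold of `Y` -/
  embedding : Manifold.IsSmoothEmbedding (𝓡 m) (𝓡 n) ∞ ι
  /-- `C` is coisotropic: the `ωY`-orthogonal of `TC` is contained in `TC` -/
  coisotropic : ∀ (x : M) (y : TangentSpace (𝓡 n) (ι x)),
    (∀ u : TangentSpace (𝓡 m) x, ωY (ι x) y (mfderiv (𝓡 m) (𝓡 n) ι x u) = 0) →
      ∃ u : TangentSpace (𝓡 m) x, mfderiv (𝓡 m) (𝓡 n) ι x u = y
  /-- `F_tr + i ω|_C` is a transverse holomorphic symplectic form -/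
  holomorphicSymplectic : IsTransverseHolomorphicSymplectic (E.braneForm ωY ι)
  /-- the traceless curvature is of transverse type `(1,1)` -/
  oneOne : E.IsTransverseOneOne (E.braneForm ωY ι)

end Branes

section Levels

variable (m) in
/-- `0` is a clean value of the family of functions `f x a` of `x` (equivalently, of the map
`x ↦ f x`): the zero level is a submanifold `S`, and `T_x S` consists of the tangent vectors `u` to
`M` at `x` such that `df(u) = 0`. The data are a smooth structure on the level; it is unique. -/
structure CleanLevel {A V : Type*} [NormedAddCommGroup V] [NormedSpace ℝ V] (f : M → A → V) where
  dim : ℕ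
  [charted : ChartedSpace (EuclideanSpace ℝ (Fin dim)) {x : M // ∀ a, f x a = 0}]
  [isManifold : IsManifold (𝓡 dim) ∞ {x : M // ∀ a, f x a = 0}]
  embedding : Manifold.IsSmoothEmbedding (𝓡 dim) (𝓡 m) ∞
    (Subtype.val : {x : M // ∀ a, f x a = 0} → M)
  tangent : ∀ (x : {x : M // ∀ a, f x a = 0}) (u : TangentSpace (𝓡 m) x.1),
    (∃ z : TangentSpace (𝓡 dim) x,
      mfderiv (𝓡 dim) (𝓡 m) (Subtype.val : {x : M // ∀ a, f x a = 0} → M) x z = u) ↔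
      ∀ a, mvfderiv (𝓡 m) (fun y ↦ f y a) x.1 u = 0

namespace CleanLevel

variable {A V : Type*} [NormedAddCommGroup V] [NormedSpace ℝ V] {f : M → A → V}

/-- The level set, with the smooth structure given by `L`. -/
def Space (_L : CleanLevel m f) : Type _ := {x : M // ∀ a, f x a = 0}

instance (L : CleanLevel m f) : TopologicalSpace L.Space :=
  inferInstanceAs (TopologicalSpace {x : M // ∀ a, f x a = 0})

instance (L : CleanLevel m f) : ChartedSpace (EuclideanSpace ℝ (Fin L.dim)) L.Space := L.charted

instance (L : CleanLevel m f) : IsManifold (𝓡 L.dim) ∞ L.Space := L.isManifold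

/-- The inclusion of the level set. -/
def incl (L : CleanLevel m f) : L.Space → M := Subtype.val

/-- Two points of the level set are equivalent if they are in the same `G`-orbit. -/
def orbitSetoid (G : Type*) [Group G] [MulAction G M] (L : CleanLevel m f) : Setoid L.Space :=
  (MulAction.orbitRel G M).comap L.incl

end CleanLevel

/-- A structure of (Hausdorff, second countable) smooth manifold on the topological quotient of the
level set by `G` for which the projection is a submersion; it is unique. -/
structure LevelQuotient (G : Type*) [Group G] [MulAction G M]
    {A V : Type*} [NormedAddCommGroup V] [NormedSpace ℝ V] {f : M → A → V}
    (L : CleanLevel m f) where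
  dim : ℕ
  [charted : ChartedSpace (EuclideanSpace ℝ (Fin dim)) (Quotient (L.orbitSetoid G))]
  [isManifold : IsManifold (𝓡 dim) ∞ (Quotient (L.orbitSetoid G))]
  [t2 : T2Space (Quotient (L.orbitSetoid G))]
  [secondCountable : SecondCountableTopology (Quotient (L.orbitSetoid G))]
  submersion : Manifold.IsSubmersion (𝓡 L.dim) (𝓡 dim) ∞ (Quotient.mk (L.orbitSetoid G))

namespace LevelQuotient

variable {G : Type*} [Group G] [MulAction G M]
  {A V : Type*} [NormedAddCommGroup V] [NormedSpace ℝ V] {f : M → A → V} {L : CleanLevel m f}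

/-- The quotient of the level set by `G`, with the smooth structure given by `Q`. -/
def Space (_Q : LevelQuotient G L) : Type _ := Quotient (L.orbitSetoid G)

instance (Q : LevelQuotient G L) : TopologicalSpace Q.Space :=
  inferInstanceAs (TopologicalSpace (Quotient (L.orbitSetoid G)))

instance (Q : LevelQuotient G L) : ChartedSpace (EuclideanSpace ℝ (Fin Q.dim)) Q.Space := Q.charted

instance (Q : LevelQuotient G L) : IsManifold (𝓡 Q.dim) ∞ Q.Space := Q.isManifold

/-- The projection of the level set to the quotient. -/
def proj (Q : LevelQuotient G L) : L.Space → Q.Space := Quotient.mk (L.orbitSetoid G)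

end LevelQuotient

end Levels

section Reduction

variable {k : ℕ} (G : Type*) [Group G] [TopologicalSpace G]
  [ChartedSpace (EuclideanSpace ℝ (Fin k)) G] [LieGroup (𝓡 k) ∞ G]
  [MulAction G M] [ContMDiffSMul (𝓡 k) (𝓡 m) ∞ G M]

/-- The symplectic reduction of `M` by `G`: the manifold `μ⁻¹(0) / G` with the symplectic form whose
pull back to `μ⁻¹(0)` is the restriction of `ωM`. -/
structure SymplecticReduction (ωM : TwoForm m M ℝ)
    (μ : M → Module.Dual ℝ (GroupLieAlgebra (𝓡 k) G)) where
  level : CleanLevel m (fun (x : M) (a : GroupLieAlgebra (𝓡 k) G) ↦ μ x a)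
  quot : LevelQuotient G level
  form : TwoForm quot.dim quot.Space ℝ
  isSymplectic : IsSymplectic form
  pullback : ∀ (z : level.Space) (u v : TangentSpace (𝓡 level.dim) z),
    form (quot.proj z) (mfderiv (𝓡 level.dim) (𝓡 quot.dim) quot.proj z u)
        (mfderiv (𝓡 level.dim) (𝓡 quot.dim) quot.proj z v) =
      ωM (level.incl z) (mfderiv (𝓡 level.dim) (𝓡 m) level.incl z u)
        (mfderiv (𝓡 level.dim) (𝓡 m) level.incl z v)

/-- The pull back of the connection of `E` along `f : N → M`: for a section `σ` of `f^* E` and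
`u ∈ T_z N`, the covariant derivative of `σ` in the direction `u`. In the preferred trivialization
of `E` at `f z`, it is the sum of the derivative of the components of `σ` and of the covariant
derivative along `df(u)` of the section with constant components extending `σ z`. -/
def HermitianBundle.pullbackConn (E : HermitianBundle.{u, v, w} m F M) {d : ℕ} {N : Type*}
    [TopologicalSpace N] [ChartedSpace (EuclideanSpace ℝ (Fin d)) N] (f : N → M)
    (σ : Π z, E.Fib (f z)) (z : N) (u : TangentSpace (𝓡 d) z) : E.Fib (f z) :=
  E.conn (localExt ℂ F (σ z)) (f z) (mfderiv (𝓡 d) (𝓡 m) f z u) +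
    (trivializationAt F E.Fib (f z)).symmₗ ℂ (f z)
      (mvfderiv (𝓡 d) (fun y ↦ (trivializationAt F E.Fib (f z) ⟨f y, σ y⟩).2) z u)

variable {G} {E : HermitianBundle.{u, v, w} m F M}

/-- The moment section is neat: `0` is a clean value of the moment trace `ν`, and on `ν⁻¹(0)` the
derivatives `∇_{χ(a)}` coincide with the infinitesimal action of `𝔤` on `E`. -/
structure IsNeat (A : EquivariantStructure k G E)
    (μ : M → Module.Dual ℝ (GroupLieAlgebra (𝓡 k) G)) : Prop where
  clean : Nonempty (CleanLevel m (A.momentTrace μ))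
  infinitesimal : ∀ x : M, (∀ a, A.momentTrace μ x a = 0) →
    ∀ (a : GroupLieAlgebra (𝓡 k) G) (s : Π y, E.Fib y), E.SmoothAt s x →
      E.conn s x (infAct G x a) = A.lieDeriv a s x

/-- The brane reduction: the manifold `ν⁻¹(0) / G`, and on it a Hermitian bundle with unitary
connection to which the restriction of `(E, ∇)` to `ν⁻¹(0)` descends: there is an isomorphism `iso`
of Hermitian bundles with connection from that restriction to the pull back of `bundle` along the
projection, constant along the orbits of `G`. -/
structure BraneReduction (A : EquivariantStructure k G E)
    (μ : M → Module.Dual ℝ (GroupLieAlgebra (𝓡 k) G)) where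
  level : CleanLevel m (A.momentTrace μ)
  quot : LevelQuotient G level
  bundle : HermitianBundle.{u, v, w} quot.dim F quot.Space
  iso : ∀ z : level.Space, E.Fib (level.incl z) ≃ₗᵢ[ℂ] bundle.Fib (quot.proj z)
  equivariant : ∀ (g : G) (z z' : level.Space) (h : g • level.incl z = level.incl z')
    (e : E.Fib (level.incl z)),
    Bundle.TotalSpace.mk' F (quot.proj z') (iso z' (A.act g h e)) =
      Bundle.TotalSpace.mk' F (quot.proj z) (iso z e)
  smooth : ∀ (z : level.Space) (s : Π y, bundle.Fib y), bundle.SmoothAt s (quot.proj z) →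
    ContMDiffAt (𝓡 level.dim) ((𝓡 m).prod 𝓘(ℝ, F)) ∞
      (fun z' ↦ Bundle.TotalSpace.mk' F (level.incl z') ((iso z').symm (s (quot.proj z')))) z
  conn : ∀ (z : level.Space) (s : Π y, bundle.Fib y), bundle.SmoothAt s (quot.proj z) →
    ∀ u : TangentSpace (𝓡 level.dim) z,
      E.pullbackConn level.incl (fun z' ↦ (iso z').symm (s (quot.proj z'))) z u =
        (iso z).symm
          (bundle.conn s (quot.proj z) (mfderiv (𝓡 level.dim) (𝓡 quot.dim) quot.proj z u))

end Reduction

end Bundles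

end ABrane

end

noncomputable section

namespace ABrane

open Set Filter Topology Manifold

universe u v w

section

section InverseFunction

variable {V W : Type*} [NormedAddCommGroup V] [NormedSpace ℝ V] [CompleteSpace V]
  [NormedAddCommGroup W] [NormedSpace ℝ W] [CompleteSpace W]

/-- The inverse function theorem, with a smooth inverse on an open set. -/
theorem exists_openPartialHomeomorph_of_hasFDerivAt {f : V → W} {s : Set V} (hs : IsOpen s)
    (hf : ContDiffOn ℝ ∞ f s) {p : V} (hp : p ∈ s) {f' : V ≃L[ℝ] W}
    (hf' : HasFDerivAt f (f' : V →L[ℝ] W) p) :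
    ∃ e : OpenPartialHomeomorph V W, p ∈ e.source ∧ e.source ⊆ s ∧ (∀ x, e x = f x) ∧
      ContDiffOn ℝ ∞ e.symm e.target := by
  have hfp : ContDiffAt ℝ ∞ f p := hf.contDiffAt (hs.mem_nhds hp)
  let e₀ := hfp.toOpenPartialHomeomorph f hf' (by simp)
  have hpe : p ∈ e₀.source := hfp.mem_toOpenPartialHomeomorph_source hf' (by simp)
  have hcont : ContinuousOn (fderiv ℝ f) s := hf.continuousOn_fderiv_of_isOpen hs (by simp)
  let t : Set V := s ∩ fderiv ℝ f ⁻¹' (range ((↑) : (V ≃L[ℝ] W) → V →L[ℝ] W))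
  have ht : IsOpen t := hcont.isOpen_inter_preimage hs ContinuousLinearEquiv.isOpen
  have hpt : p ∈ t := ⟨hp, ⟨f', hf'.fderiv.symm⟩⟩
  refine ⟨e₀.restrOpen t ht, ⟨hpe, hpt⟩, fun x hx ↦ hx.2.1, fun x ↦ rfl, ?_⟩
  intro y hy
  have hy' : (e₀.restrOpen t ht).symm y ∈ (e₀.restrOpen t ht).source :=
    (e₀.restrOpen t ht).map_target hy
  obtain ⟨g', hg'⟩ := hy'.2.2
  have hfy : ContDiffAt ℝ ∞ f ((e₀.restrOpen t ht).symm y) :=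
    hf.contDiffAt (hs.mem_nhds hy'.2.1)
  refine ((e₀.restrOpen t ht).contDiffAt_symm hy (f₀' := g') ?_ hfy).contDiffWithinAt
  rw [hg']
  exact (hfy.differentiableAt (by simp)).hasFDerivAt

end InverseFunction

section NormalForms

variable {m n : ℕ} {M N : Type*}
  [TopologicalSpace M] [ChartedSpace (EuclideanSpace ℝ (Fin m)) M] [IsManifold (𝓡 m) ∞ M]
  [TopologicalSpace N] [ChartedSpace (EuclideanSpace ℝ (Fin n)) N] [IsManifold (𝓡 n) ∞ N]

lemma hasFDerivAt_writtenInExtChartAt {f : M → N} {x : M}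
    (hf : MDifferentiableAt (𝓡 m) (𝓡 n) f x) :
    HasFDerivAt (writtenInExtChartAt (𝓡 m) (𝓡 n) x f)
      (mfderiv (𝓡 m) (𝓡 n) f x : EuclideanSpace ℝ (Fin m) →L[ℝ] EuclideanSpace ℝ (Fin n))
      (extChartAt (𝓡 m) x x) := by
  have := hf.hasMFDerivAt.2
  rw [ModelWithCorners.range_eq_univ] at this
  exact hasFDerivWithinAt_univ.1 this

lemma contDiffOn_writtenInExtChartAt {f : M → N} (x : M) {O : Set M} (hO : IsOpen O)
    (hf : ContMDiffOn (𝓡 m) (𝓡 n) ∞ f O) :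
    IsOpen ((extChartAt (𝓡 m) x).target ∩
        (extChartAt (𝓡 m) x).symm ⁻¹' (O ∩ f ⁻¹' (extChartAt (𝓡 n) (f x)).source)) ∧
      ContDiffOn ℝ ∞ (writtenInExtChartAt (𝓡 m) (𝓡 n) x f)
        ((extChartAt (𝓡 m) x).target ∩
          (extChartAt (𝓡 m) x).symm ⁻¹' (O ∩ f ⁻¹' (extChartAt (𝓡 n) (f x)).source)) := by
  constructor
  · exact (continuousOn_extChartAt_symm x).isOpen_inter_preimage (isOpen_extChartAt_target x)
      (hf.continuousOn.isOpen_inter_preimage hO (isOpen_extChartAt_source (f x)))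
  · rw [← contMDiffOn_iff_contDiffOn]
    refine (contMDiffOn_extChartAt (I := 𝓡 n) (x := f x) (n := ∞)).comp
      (t := (chartAt (EuclideanSpace ℝ (Fin n)) (f x)).source)
      (hf.comp ((contMDiffOn_extChartAt_symm x).mono inter_subset_left) fun y hy ↦ hy.2.1)
      fun y hy ↦ ?_
    simpa using hy.2.2

lemma trans_mem_maximalAtlas {φ : OpenPartialHomeomorph M (EuclideanSpace ℝ (Fin m))}
    (hφ : φ ∈ IsManifold.maximalAtlas (𝓡 m) ∞ M)
    {e : OpenPartialHomeomorph (EuclideanSpace ℝ (Fin m)) (EuclideanSpace ℝ (Fin m))}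
    (he : ContDiffOn ℝ ∞ e e.source) (he' : ContDiffOn ℝ ∞ e.symm e.target) :
    φ.trans e ∈ IsManifold.maximalAtlas (𝓡 m) ∞ M := by
  refine OpenPartialHomeomorph.mem_maximalAtlas_of_contMDiffOn _ ?_ ?_
  · refine he.contMDiffOn.comp ((contMDiffOn_of_mem_maximalAtlas hφ).mono ?_) ?_ <;>
      intro y hy
    exacts [hy.1, hy.2]
  · refine (contMDiffOn_symm_of_mem_maximalAtlas hφ).comp (he'.contMDiffOn.mono ?_) ?_ <;>
      intro y hy
    exacts [hy.1, hy.2]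

/-- A smooth map with injective differential at `x` is an immersion at `x`. -/
theorem isImmersionAtOfComplement_of_injective {f : M → N} {x : M} {O : Set M} (hO : IsOpen O)
    (hx : x ∈ O) (hf : ContMDiffOn (𝓡 m) (𝓡 n) ∞ f O)
    (hinj : Function.Injective (mfderiv (𝓡 m) (𝓡 n) f x)) :
    IsImmersionAtOfComplement (EuclideanSpace ℝ (Fin (n - m))) (𝓡 m) (𝓡 n) ∞ f x := by
  have hfx : ContMDiffAt (𝓡 m) (𝓡 n) ∞ f x := hf.contMDiffAt (hO.mem_nhds hx)
  let T : EuclideanSpace ℝ (Fin m) →L[ℝ] EuclideanSpace ℝ (Fin n) := mfderiv (𝓡 m) (𝓡 n) f x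
  have hT : Function.Injective T := hinj
  have hmn : m ≤ n := by simpa using LinearMap.finrank_le_finrank_of_injective (f := T.toLinearMap) hT
  obtain ⟨S, hS⟩ := (LinearMap.range T.toLinearMap).exists_isCompl
  have hrT : Module.finrank ℝ (LinearMap.range T.toLinearMap) = m := by
    simpa using LinearMap.finrank_range_of_inj hT
  have hSd : Module.finrank ℝ S = n - m := by
    have := Submodule.finrank_add_eq_of_isCompl hS
    simp only [hrT, finrank_euclideanSpace, Fintype.card_fin] at this
    omega
  let c : EuclideanSpace ℝ (Fin (n - m)) ≃ₗ[ℝ] S := LinearEquiv.ofFinrankEq _ _ (by simp [hSd])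
  let L : (EuclideanSpace ℝ (Fin m) × EuclideanSpace ℝ (Fin (n - m))) ≃L[ℝ]
      EuclideanSpace ℝ (Fin n) :=
    (((LinearEquiv.ofInjective T.toLinearMap hT).prodCongr c).trans
      (Submodule.prodEquivOfIsCompl _ _ hS)).toContinuousLinearEquiv
  have hL : ∀ u w, L (u, w) = T u + L (0, w) := fun u w ↦ by
    simp [L, Submodule.coe_prodEquivOfIsCompl']
  let φ := extChartAt (𝓡 m) x
  let ψ := extChartAt (𝓡 n) (f x)
  let fl := writtenInExtChartAt (𝓡 m) (𝓡 n) x f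
  obtain ⟨hDo, hfl⟩ := contDiffOn_writtenInExtChartAt x hO hf
  set D := φ.target ∩ φ.symm ⁻¹' (O ∩ f ⁻¹' ψ.source)
  have hpD : φ x ∈ D := by
    refine ⟨mem_extChartAt_target x, ?_⟩
    simp [φ, ψ, hx]
  let h : EuclideanSpace ℝ (Fin m) × EuclideanSpace ℝ (Fin (n - m)) → EuclideanSpace ℝ (Fin n) :=
    fun q ↦ fl q.1 + L (0, q.2)
  have hh : ContDiffOn ℝ ∞ h (D ×ˢ univ) := by
    refine (hfl.comp contDiffOn_fst fun q hq ↦ hq.1).add ?_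
    exact (L.contDiff.comp (contDiff_const.prodMk contDiff_snd)).contDiffOn
  have hh' : HasFDerivAt h (L : _ →L[ℝ] _) (φ x, 0) := by
    have h0 : HasFDerivAt fl T (φ x) :=
      hasFDerivAt_writtenInExtChartAt (hfx.mdifferentiableAt (by simp))
    have h1 := HasFDerivAt.comp (φ x, (0 : EuclideanSpace ℝ (Fin (n - m)))) (f := Prod.fst) h0
      hasFDerivAt_fst
    have h2 := (L.toContinuousLinearMap.comp ((ContinuousLinearMap.inr ℝ
      (EuclideanSpace ℝ (Fin m)) (EuclideanSpace ℝ (Fin (n - m)))).comp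
      (ContinuousLinearMap.snd ℝ _ _))).hasFDerivAt (x := (φ x, 0))
    refine (h1.add h2).congr_fderiv (ContinuousLinearMap.ext fun q ↦ ?_)
    exact (hL q.1 q.2).symm
  obtain ⟨e, hpe, heD, heq, hes⟩ := exists_openPartialHomeomorph_of_hasFDerivAt
    (hDo.prod isOpen_univ) hh (p := (φ x, 0)) ⟨hpD, mem_univ _⟩ hh'
  let cN := chartAt (EuclideanSpace ℝ (Fin n)) (f x)
  let cM := chartAt (EuclideanSpace ℝ (Fin m)) x
  let e' : OpenPartialHomeomorph (EuclideanSpace ℝ (Fin n)) (EuclideanSpace ℝ (Fin n)) :=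
    e.symm.trans L.toHomeomorph.toOpenPartialHomeomorph
  have he1 : ContDiffOn ℝ ∞ e' e'.source :=
    L.contDiff.comp_contDiffOn (hes.mono fun y hy ↦ hy.1)
  have he2 : ContDiffOn ℝ ∞ e'.symm e'.target := by
    refine ContDiffOn.congr (f := h ∘ L.symm) ?_ fun y hy ↦ heq _
    exact (hh.mono heD).comp L.symm.contDiff.contDiffOn fun y hy ↦ hy.2
  let codC : OpenPartialHomeomorph N (EuclideanSpace ℝ (Fin n)) := cN.trans e'
  have hcod : codC ∈ IsManifold.maximalAtlas (𝓡 n) ∞ N :=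
    trans_mem_maximalAtlas (IsManifold.chart_mem_maximalAtlas _) he1 he2
  have hcont := hfx.continuousAt
  let B : Set M := {y | y ∈ cM.source ∧ (cM y, (0 : EuclideanSpace ℝ (Fin (n - m)))) ∈ e.source}
  have hB : IsOpen B :=
    (cM.continuousOn.prodMk continuousOn_const).isOpen_inter_preimage cM.open_source e.open_source
  have hxB : x ∈ B := ⟨mem_chart_source _ x, hpe⟩
  refine IsImmersionAtOfComplement.mk_of_continuousAt hcont L (cM.restrOpen B hB) codC
    ⟨mem_chart_source _ x, hxB⟩ ?_ ?_ hcod ?_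
  · have h0 : e (φ x, 0) = cN (f x) := by
      rw [heq]
      have h3 : L (0, 0) = 0 := L.map_zero
      have h4 : fl (φ x) = cN (f x) := by
        simp [fl, φ, writtenInExtChartAt, cN]
      simp only [h, h3, h4, add_zero]
    have h5 : cN (f x) ∈ e.target := h0 ▸ e.map_source hpe
    exact ⟨mem_chart_source (EuclideanSpace ℝ (Fin n)) (f x), ⟨h5, mem_univ (e.symm (cN (f x)))⟩⟩
  · exact OpenPartialHomeomorph.mem_maximalAtlas_of_contMDiffOn _
      ((contMDiffOn_chart (I := 𝓡 m) (x := x)).mono fun y hy ↦ hy.1)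
      ((contMDiffOn_chart_symm (I := 𝓡 m) (x := x)).mono fun y hy ↦ hy.1)
  · intro w hw
    have hw1 : w ∈ (cM.restrOpen B hB).target := hw.2
    have hw' : w ∈ cM.target ∧ cM.symm w ∈ B := ⟨hw1.1, ((cM.restrOpen B hB).map_target hw1).2⟩
    have hw2 : (w, (0 : EuclideanSpace ℝ (Fin (n - m)))) ∈ e.source := by
      have := hw'.2.2
      rwa [cM.right_inv hw'.1] at this
    have h6 : cN (f (cM.symm w)) = e (w, 0) := by
      rw [heq]
      have h3 : L (0, 0) = 0 := L.map_zero
      simp only [h, h3, add_zero]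
      simp [fl, writtenInExtChartAt, cN, cM]
    have h7 : e.symm (cN (f (cM.symm w))) = (w, 0) := by rw [h6, e.left_inv hw2]
    exact congrArg L h7

/-- A smooth map with injective differential is an immersion. -/
theorem isImmersion_of_injective {f : M → N} (hf : ContMDiff (𝓡 m) (𝓡 n) ∞ f)
    (hinj : ∀ x, Function.Injective (mfderiv (𝓡 m) (𝓡 n) f x)) :
    IsImmersion (𝓡 m) (𝓡 n) ∞ f :=
  IsImmersionOfComplement.isImmersion fun x ↦
    isImmersionAtOfComplement_of_injective isOpen_univ (mem_univ x) hf.contMDiffOn (hinj x)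

/-- Near a point where the differential of `f : M → N` is surjective, there are a chart of `M`
and a linear isomorphism `L` such that the first component of `L` in the chart is `f` in the
preferred chart of `N`. -/
theorem exists_chart_of_surjective {f : M → N} {x : M} {O : Set M} (hO : IsOpen O)
    (hx : x ∈ O) (hf : ContMDiffOn (𝓡 m) (𝓡 n) ∞ f O)
    (hsurj : Function.Surjective (mfderiv (𝓡 m) (𝓡 n) f x)) :
    ∃ φ ∈ IsManifold.maximalAtlas (𝓡 m) ∞ M, ∃ L : EuclideanSpace ℝ (Fin m) ≃L[ℝ]
      (EuclideanSpace ℝ (Fin n) × EuclideanSpace ℝ (Fin (m - n))),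
      x ∈ φ.source ∧ φ.source ⊆ O ∧ (∀ y ∈ φ.source,
        f y ∈ (chartAt (EuclideanSpace ℝ (Fin n)) (f x)).source ∧
        (L (φ y)).1 = chartAt (EuclideanSpace ℝ (Fin n)) (f x) (f y)) := by
  have hfx : ContMDiffAt (𝓡 m) (𝓡 n) ∞ f x := hf.contMDiffAt (hO.mem_nhds hx)
  let T : EuclideanSpace ℝ (Fin m) →L[ℝ] EuclideanSpace ℝ (Fin n) := mfderiv (𝓡 m) (𝓡 n) f x
  have hT : Function.Surjective T := hsurj
  obtain ⟨S, hS⟩ := (LinearMap.ker T.toLinearMap).exists_isCompl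
  have hKd : Module.finrank ℝ (LinearMap.ker T.toLinearMap) = m - n := by
    have := LinearMap.finrank_range_add_finrank_ker T.toLinearMap
    rw [LinearMap.range_eq_top.2 hT] at this
    simp at this
    omega
  let c : LinearMap.ker T.toLinearMap ≃ₗ[ℝ] EuclideanSpace ℝ (Fin (m - n)) :=
    LinearEquiv.ofFinrankEq _ _ (by simp [hKd])
  let P : EuclideanSpace ℝ (Fin m) →L[ℝ] EuclideanSpace ℝ (Fin (m - n)) :=
    (c.toLinearMap ∘ₗ Submodule.projectionOnto _ _ hS).toContinuousLinearMap
  have hn : n ≤ m := by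
    simpa using LinearMap.finrank_le_finrank_of_surjective (f := T.toLinearMap) hT
  let L₀ : EuclideanSpace ℝ (Fin m) →ₗ[ℝ]
      (EuclideanSpace ℝ (Fin n) × EuclideanSpace ℝ (Fin (m - n))) :=
    (T.prod P).toLinearMap
  have hL₀ : Function.Injective L₀ := by
    rw [injective_iff_map_eq_zero]
    intro u hu
    have h1 : T u = 0 := congrArg Prod.fst hu
    have h2 : P u = 0 := congrArg Prod.snd hu
    have h3 : Submodule.projectionOnto (LinearMap.ker T.toLinearMap) S hS u = ⟨u, h1⟩ :=
      Submodule.projectionOnto_apply_left hS ⟨u, h1⟩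
    have h4 : c ⟨u, h1⟩ = 0 := by rw [← h3]; exact h2
    exact congrArg Subtype.val (c.map_eq_zero_iff.1 h4)
  let L : EuclideanSpace ℝ (Fin m) ≃L[ℝ]
      (EuclideanSpace ℝ (Fin n) × EuclideanSpace ℝ (Fin (m - n))) :=
    (LinearEquiv.ofInjectiveOfFinrankEq L₀ hL₀ (by simp; omega)).toContinuousLinearEquiv
  have hL : ∀ u, L u = (T u, P u) := fun u ↦ rfl
  let φ := extChartAt (𝓡 m) x
  let ψ := extChartAt (𝓡 n) (f x)
  let fl := writtenInExtChartAt (𝓡 m) (𝓡 n) x f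
  obtain ⟨hDo, hfl⟩ := contDiffOn_writtenInExtChartAt x hO hf
  set D := φ.target ∩ φ.symm ⁻¹' (O ∩ f ⁻¹' ψ.source)
  have hpD : φ x ∈ D := by
    refine ⟨mem_extChartAt_target x, ?_⟩
    simp [φ, ψ, hx]
  let h : EuclideanSpace ℝ (Fin m) → EuclideanSpace ℝ (Fin m) :=
    fun q ↦ L.symm (fl q, P q)
  have hh : ContDiffOn ℝ ∞ h D :=
    L.symm.contDiff.comp_contDiffOn (hfl.prodMk P.contDiff.contDiffOn)
  have hh' : HasFDerivAt h ((ContinuousLinearEquiv.refl ℝ (EuclideanSpace ℝ (Fin m)) :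
      EuclideanSpace ℝ (Fin m) ≃L[ℝ] EuclideanSpace ℝ (Fin m)) : _ →L[ℝ] _) (φ x) := by
    have h1 : HasFDerivAt fl T (φ x) :=
      hasFDerivAt_writtenInExtChartAt (hfx.mdifferentiableAt (by simp))
    have h2 := (L.symm.toContinuousLinearMap.hasFDerivAt).comp (φ x)
      (h1.prodMk P.hasFDerivAt)
    refine h2.congr_fderiv ?_
    ext1 q
    exact L.symm_apply_apply q
  obtain ⟨e, hpe, heD, heq, hes⟩ := exists_openPartialHomeomorph_of_hasFDerivAt hDo hh hpD hh'
  let cN := chartAt (EuclideanSpace ℝ (Fin n)) (f x)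
  let cM := chartAt (EuclideanSpace ℝ (Fin m)) x
  have hmem : ∀ y ∈ (cM.trans e).source, y ∈ cM.source ∧ cM y ∈ e.source := by
    intro y hy; simpa using hy
  refine ⟨cM.trans e, ?_, L, ?_, ?_, ?_⟩
  · exact trans_mem_maximalAtlas (IsManifold.chart_mem_maximalAtlas _)
      ((hh.mono heD).congr fun y hy ↦ heq y) hes
  · simp only [OpenPartialHomeomorph.trans_source]
    exact ⟨mem_chart_source _ x, hpe⟩
  · intro y hy
    have := (heD (hmem y hy).2).2.1
    simpa [φ, cM, cM.left_inv (hmem y hy).1] using this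
  · intro y hy
    have h0 := heD (hmem y hy).2
    have h1 : f y ∈ ψ.source := by
      have := h0.2.2
      simpa [φ, cM, cM.left_inv (hmem y hy).1] using this
    refine ⟨by simpa [ψ] using h1, ?_⟩
    have h2 : (cM.trans e) y = L.symm (fl (cM y), P (cM y)) := heq _
    rw [h2, L.apply_symm_apply]
    simp [fl, writtenInExtChartAt, cM, cM.left_inv (hmem y hy).1]

/-- A smooth map with surjective differential is a submersion. -/
theorem isSubmersion_of_surjective {f : M → N} (hf : ContMDiff (𝓡 m) (𝓡 n) ∞ f)
    (hsurj : ∀ x, Function.Surjective (mfderiv (𝓡 m) (𝓡 n) f x)) :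
    IsSubmersion (𝓡 m) (𝓡 n) ∞ f := by
  refine IsSubmersionOfComplement.isSubmersion (F := EuclideanSpace ℝ (Fin (m - n))) fun x ↦ ?_
  obtain ⟨φ, hφ, L, hx, -, hL⟩ := exists_chart_of_surjective isOpen_univ (mem_univ x)
    hf.contMDiffOn (hsurj x)
  refine IsSubmersionAtOfComplement.mk_of_charts L φ
    (chartAt (EuclideanSpace ℝ (Fin n)) (f x)) hx (mem_chart_source _ _) hφ
    (IsManifold.chart_mem_maximalAtlas _) (fun y hy ↦ (hL y hy).1) ?_
  intro w hw
  have hw' : w ∈ φ.target := by simpa using hw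
  have := (hL _ (φ.map_target hw')).2
  rw [φ.right_inv hw'] at this
  simp [this]

end NormalForms

end

section

section Chain

variable {E E' H H' W : Type*} [NormedAddCommGroup E] [NormedSpace ℝ E] [NormedAddCommGroup E']
  [NormedSpace ℝ E'] [TopologicalSpace H] [TopologicalSpace H'] [NormedAddCommGroup W]
  [NormedSpace ℝ W] {I : ModelWithCorners ℝ E H} {I' : ModelWithCorners ℝ E' H'}
  {M N : Type*} [TopologicalSpace M] [ChartedSpace H M] [TopologicalSpace N] [ChartedSpace H' N]

lemma mvfderiv_comp_vec {g : N → W} {f : M → N} {x : M}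
    (hg : MDifferentiableAt I' 𝓘(ℝ, W) g (f x)) (hf : MDifferentiableAt I I' f x)
    (u : TangentSpace I x) :
    mvfderiv I (fun y ↦ g (f y)) x u = mvfderiv I' g (f x) (mfderiv I I' f x u) :=
  mfderiv_comp_apply x hg hf u

lemma mvfderiv_congr_of_eventuallyEq {g g' : M → W} {x : M} (h : g =ᶠ[𝓝 x] g')
    (u : TangentSpace I x) : mvfderiv I g x u = mvfderiv I g' x u := by
  have h1 := h.mfderiv_eq (I := I) (I' := 𝓘(ℝ, W))
  exact congrArg (fun T : TangentSpace I x →L[ℝ] W ↦ T u) h1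

lemma mvfderiv_eq_fderiv {g : E → W} (x : E) (u : E) :
    mvfderiv 𝓘(ℝ, E) g x u = fderiv ℝ g x u := by
  have h1 : mfderiv 𝓘(ℝ, E) 𝓘(ℝ, W) g x = fderiv ℝ g x := mfderiv_eq_fderiv
  exact congrArg (fun T : E →L[ℝ] W ↦ T u) h1

/-- The derivative of a linear function of a vector valued function. -/
lemma mvfderiv_clm_comp {W' : Type*} [NormedAddCommGroup W'] [NormedSpace ℝ W'] (T : W →L[ℝ] W')
    {g : M → W} {x : M} (hg : MDifferentiableAt I 𝓘(ℝ, W) g x) (u : TangentSpace I x) :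
    mvfderiv I (fun y ↦ T (g y)) x u = T (mvfderiv I g x u) := by
  rw [mvfderiv_comp_vec T.mdifferentiableAt hg]
  have h1 : mfderiv 𝓘(ℝ, W) 𝓘(ℝ, W') T (g x) = T := by
    rw [mfderiv_eq_fderiv]; exact T.fderiv
  exact congrArg (fun S : W →L[ℝ] W' ↦ S (mvfderiv I g x u)) h1

end Chain

section Sections

variable {m n : ℕ} {M N : Type*}
  [TopologicalSpace M] [ChartedSpace (EuclideanSpace ℝ (Fin m)) M] [IsManifold (𝓡 m) ∞ M]
  [TopologicalSpace N] [ChartedSpace (EuclideanSpace ℝ (Fin n)) N] [IsManifold (𝓡 n) ∞ N]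

/-- A submersion has smooth local sections through every point. -/
theorem exists_local_section {f : M → N} (hf : IsSubmersion (𝓡 m) (𝓡 n) ∞ f) (x : M) :
    ∃ (σ : N → M) (O : Set N), IsOpen O ∧ f x ∈ O ∧ σ (f x) = x ∧
      ContMDiffOn (𝓡 n) (𝓡 m) ∞ σ O ∧ ∀ q ∈ O, f (σ q) = q := by
  have hx := hf.isSubmersionAt x
  set φ := hx.domChart
  set ψ := hx.codChart
  let L := hx.equiv
  have hφ := hx.domChart_mem_maximalAtlas
  have hψ := hx.codChart_mem_maximalAtlas
  let s : EuclideanSpace ℝ (Fin n) → EuclideanSpace ℝ (Fin m) := fun w ↦ L.symm (w, (L (φ x)).2)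
  have hs : ContDiff ℝ ∞ s := L.symm.contDiff.comp (contDiff_id.prodMk contDiff_const)
  have hform : ∀ w ∈ φ.target, ψ (f (φ.symm w)) = (L w).1 := by
    intro w hw
    have hw' : w ∈ (hx.domChart.extend (𝓡 m)).target := by simpa [φ] using hw
    simpa [φ, ψ] using hx.writtenInCharts hw'
  have hfx : ψ (f x) = (L (φ x)).1 := by
    rw [← hform _ (φ.map_source hx.mem_domChart_source), φ.left_inv hx.mem_domChart_source]
  have hsx : s (ψ (f x)) = φ x := by simp [s, hfx]
  have hO : IsOpen (ψ.source ∩ ψ ⁻¹' (s ⁻¹' φ.target)) :=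
    ψ.continuousOn.isOpen_inter_preimage ψ.open_source
      (φ.open_target.preimage hs.continuous)
  refine ⟨φ.symm ∘ s ∘ ψ, ψ.source ∩ ψ ⁻¹' (s ⁻¹' φ.target), hO,
    ⟨hx.mem_codChart_source, ?_⟩, ?_, ?_, ?_⟩
  · change s (ψ (f x)) ∈ φ.target
    rw [hsx]; exact φ.map_source hx.mem_domChart_source
  · change φ.symm (s (ψ (f x))) = x
    rw [hsx]
    exact φ.left_inv hx.mem_domChart_source
  · exact (contMDiffOn_symm_of_mem_maximalAtlas hφ).comp (hs.contMDiff.comp_contMDiffOn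
      ((contMDiffOn_of_mem_maximalAtlas hψ).mono inter_subset_left)) fun y hy ↦ hy.2
  · intro q hq
    refine ψ.injOn (hx.source_subset_preimage_source (φ.map_target hq.2)) hq.1 ?_
    rw [hform _ hq.2]
    simp [s]

/-- An immersion has smooth local left inverses. -/
theorem exists_local_retraction {f : M → N} (hf : IsImmersion (𝓡 m) (𝓡 n) ∞ f) (x : M) :
    ∃ (ρ : N → M) (O : Set N), IsOpen O ∧ f x ∈ O ∧
      ContMDiffOn (𝓡 n) (𝓡 m) ∞ ρ O ∧ ∀ᶠ y in 𝓝 x, ρ (f y) = y := by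
  have hx := hf.isImmersionAt x
  set φ := hx.domChart
  set ψ := hx.codChart
  let L := hx.equiv
  have hφ := hx.domChart_mem_maximalAtlas
  have hψ := hx.codChart_mem_maximalAtlas
  let s : EuclideanSpace ℝ (Fin n) → EuclideanSpace ℝ (Fin m) := fun w ↦ (L.symm w).1
  have hs : ContDiff ℝ ∞ s := contDiff_fst.comp L.symm.contDiff
  have hform : ∀ w ∈ φ.target, ψ (f (φ.symm w)) = L (w, 0) := by
    intro w hw
    have hw' : w ∈ (hx.domChart.extend (𝓡 m)).target := by simpa [φ] using hw
    simpa [φ, ψ] using hx.writtenInCharts hw'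
  have hform' : ∀ y ∈ φ.source, s (ψ (f y)) = φ y := by
    intro y hy
    have := hform _ (φ.map_source hy)
    rw [φ.left_inv hy] at this
    simp [s, this]
  have hO : IsOpen (ψ.source ∩ ψ ⁻¹' (s ⁻¹' φ.target)) :=
    ψ.continuousOn.isOpen_inter_preimage ψ.open_source
      (φ.open_target.preimage hs.continuous)
  refine ⟨φ.symm ∘ s ∘ ψ, ψ.source ∩ ψ ⁻¹' (s ⁻¹' φ.target), hO,
    ⟨hx.mem_codChart_source, ?_⟩, ?_, ?_⟩
  · change s (ψ (f x)) ∈ φ.target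
    rw [hform' _ hx.mem_domChart_source]; exact φ.map_source hx.mem_domChart_source
  · exact (contMDiffOn_symm_of_mem_maximalAtlas hφ).comp (hs.contMDiff.comp_contMDiffOn
      ((contMDiffOn_of_mem_maximalAtlas hψ).mono inter_subset_left)) fun y hy ↦ hy.2
  · filter_upwards [φ.open_source.mem_nhds hx.mem_domChart_source] with y hy
    simp only [Function.comp_apply, hform' y hy]
    exact φ.left_inv hy

lemma mfderiv_comp_eq_of_eventually_id {f : M → N} {g : N → M} {x : M}
    (hf : MDifferentiableAt (𝓡 m) (𝓡 n) f x) (hg : MDifferentiableAt (𝓡 n) (𝓡 m) g (f x))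
    (h : ∀ᶠ y in 𝓝 x, g (f y) = y) (u : TangentSpace (𝓡 m) x) :
    (mfderiv (𝓡 n) (𝓡 m) g (f x) (mfderiv (𝓡 m) (𝓡 n) f x u) : EuclideanSpace ℝ (Fin m)) = u := by
  have h1 := mfderiv_comp_apply x hg hf u
  have h2 : mfderiv (𝓡 m) (𝓡 m) (g ∘ f) x = mfderiv (𝓡 m) (𝓡 m) id x :=
    Filter.EventuallyEq.mfderiv_eq h
  have h3 : (mfderiv (𝓡 m) (𝓡 m) (g ∘ f) x u : EuclideanSpace ℝ (Fin m)) = u := by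
    have h4 : (mfderiv (𝓡 m) (𝓡 m) (g ∘ f) x u : EuclideanSpace ℝ (Fin m))
      = mfderiv (𝓡 m) (𝓡 m) (@id M) x u := congrArg (fun T ↦ T u) h2
    rw [h4, mfderiv_id]; rfl
  exact h1.symm.trans h3

theorem injective_mfderiv_of_isImmersion {f : M → N} (hf : IsImmersion (𝓡 m) (𝓡 n) ∞ f) (x : M) :
    Function.Injective (mfderiv (𝓡 m) (𝓡 n) f x) := by
  obtain ⟨ρ, O, hO, hxO, hρ, h⟩ := exists_local_retraction hf x
  have h1 := mfderiv_comp_eq_of_eventually_id (hf.contMDiff.contMDiffAt.mdifferentiableAt (by simp))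
    ((hρ.contMDiffAt (hO.mem_nhds hxO)).mdifferentiableAt (by simp)) h
  intro u v huv
  rw [← h1 u, ← h1 v]
  exact congrArg (mfderiv (𝓡 n) (𝓡 m) ρ (f x)) huv

/-- If `σ` is a section of `f` near `f x` with `σ (f x) = x`, then `df (dσ v) = v`. -/
lemma mfderiv_section {f : M → N} {σ : N → M} {x : M} {O : Set N}
    (hf : MDifferentiableAt (𝓡 m) (𝓡 n) f x) (hO : IsOpen O) (hxO : f x ∈ O) (hσx : σ (f x) = x)
    (hσ : ContMDiffOn (𝓡 n) (𝓡 m) ∞ σ O) (h : ∀ q ∈ O, f (σ q) = q)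
    (v : TangentSpace (𝓡 n) (f x)) :
    mfderiv (𝓡 m) (𝓡 n) f x (mfderiv (𝓡 n) (𝓡 m) σ (f x) v) = v := by
  have hf' : MDifferentiableAt (𝓡 m) (𝓡 n) f (σ (f x)) := by rwa [hσx]
  have := mfderiv_comp_eq_of_eventually_id
    ((hσ.contMDiffAt (hO.mem_nhds hxO)).mdifferentiableAt (by simp)) hf'
    (Filter.eventually_of_mem (hO.mem_nhds hxO) h) v
  rw [hσx] at this
  exact this

theorem surjective_mfderiv_of_isSubmersion {f : M → N} (hf : IsSubmersion (𝓡 m) (𝓡 n) ∞ f)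
    (x : M) : Function.Surjective (mfderiv (𝓡 m) (𝓡 n) f x) := by
  obtain ⟨σ, O, hO, hxO, hσx, hσ, h⟩ := exists_local_section hf x
  exact fun v ↦ ⟨_, mfderiv_section (hf.contMDiff.contMDiffAt.mdifferentiableAt (by simp))
    hO hxO hσx hσ h v⟩

end Sections

section RegularLevel

variable {m k : ℕ} {M : Type*}
  [TopologicalSpace M] [ChartedSpace (EuclideanSpace ℝ (Fin m)) M] [IsManifold (𝓡 m) ∞ M]

/-- The chart of the zero level `Z` of `Φ` obtained from a chart `φ` of `M` in which the first
component of `L` is `Φ`. -/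
def levelChart {Z : Set M} {Φ : M → EuclideanSpace ℝ (Fin k)} (hZ : ∀ x, x ∈ Z ↔ Φ x = 0) (z₀ : Z)
    (φ : OpenPartialHomeomorph M (EuclideanSpace ℝ (Fin m)))
    (L : EuclideanSpace ℝ (Fin m) ≃L[ℝ]
      (EuclideanSpace ℝ (Fin k) × EuclideanSpace ℝ (Fin (m - k))))
    (hL : ∀ y ∈ φ.source, (L (φ y)).1 = Φ y) :
    OpenPartialHomeomorph Z (EuclideanSpace ℝ (Fin (m - k))) :=
  have hmem : ∀ w, L.symm (0, w) ∈ φ.target → φ.symm (L.symm (0, w)) ∈ Z := fun w hw ↦ by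
    rw [hZ, ← hL _ (φ.map_target hw), φ.right_inv hw, L.apply_symm_apply]
  have hL' : ∀ z : Z, z.1 ∈ φ.source → L.symm (0, (L (φ z.1)).2) = φ z.1 := fun z hz ↦ by
    rw [L.symm_apply_eq]
    exact Prod.ext ((hL _ hz).trans ((hZ z.1).1 z.2)).symm rfl
  { toFun := fun z ↦ (L (φ z.1)).2
    invFun := fun w ↦ open scoped Classical in
      if h : φ.symm (L.symm (0, w)) ∈ Z then ⟨φ.symm (L.symm (0, w)), h⟩ else z₀
    source := {z | z.1 ∈ φ.source}
    target := {w | L.symm (0, w) ∈ φ.target}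
    map_source' := fun z hz ↦ by
      simp only [mem_ofPred_eq] at hz ⊢
      rw [hL' z hz]
      exact φ.map_source hz
    map_target' := fun w hw ↦ by
      simp only [mem_ofPred_eq] at hw ⊢
      rw [dif_pos (hmem w hw)]
      exact φ.map_target hw
    left_inv' := fun z hz ↦ by
      simp only [mem_ofPred_eq] at hz
      have h1 : φ.symm (L.symm (0, (L (φ z.1)).2)) = z.1 := by rw [hL' z hz, φ.left_inv hz]
      rw [dif_pos (by rw [h1]; exact z.2)]
      exact Subtype.ext h1
    right_inv' := fun w hw ↦ by
      simp only [mem_ofPred_eq] at hw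
      rw [dif_pos (hmem w hw)]
      simp only [φ.right_inv hw, L.apply_symm_apply]
    open_source := φ.open_source.preimage continuous_subtype_val
    open_target := φ.open_target.preimage
      (L.symm.continuous.comp (continuous_const.prodMk continuous_id))
    continuousOn_toFun := (continuous_snd.comp L.continuous).comp_continuousOn
      (φ.continuousOn.comp continuous_subtype_val.continuousOn fun z hz ↦ hz)
    continuousOn_invFun := by
      rw [IsInducing.subtypeVal.continuousOn_iff]
      refine (φ.continuousOn_symm.comp (L.symm.continuous.comp
        (continuous_const.prodMk continuous_id)).continuousOn fun w hw ↦ hw).congr fun w hw ↦ ?_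
      simp only [Function.comp_apply]
      rw [dif_pos (hmem w hw)]
      rfl }

section

variable {Z : Set M} {Φ : M → EuclideanSpace ℝ (Fin k)} (hZ : ∀ x, x ∈ Z ↔ Φ x = 0) (z₀ : Z)
    {φ : OpenPartialHomeomorph M (EuclideanSpace ℝ (Fin m))}
    {L : EuclideanSpace ℝ (Fin m) ≃L[ℝ]
      (EuclideanSpace ℝ (Fin k) × EuclideanSpace ℝ (Fin (m - k)))}
    (hL : ∀ y ∈ φ.source, (L (φ y)).1 = Φ y)

lemma coe_levelChart_symm {w : EuclideanSpace ℝ (Fin (m - k))}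
    (hw : w ∈ (levelChart hZ z₀ φ L hL).target) :
    ((levelChart hZ z₀ φ L hL).symm w).1 = φ.symm (L.symm (0, w)) := by
  have : φ.symm (L.symm (0, w)) ∈ Z := by
    have hw' : L.symm (0, w) ∈ φ.target := hw
    rw [hZ, ← hL _ (φ.map_target hw'), φ.right_inv hw', L.apply_symm_apply]
  exact congrArg Subtype.val (dif_pos this)

end

/-- The regular level set theorem. -/
theorem nonempty_cleanLevel_of_regular {A V : Type*} [NormedAddCommGroup V] [NormedSpace ℝ V]
    {f : M → A → V} {Φ : M → EuclideanSpace ℝ (Fin k)}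
    (hΦ : ContMDiff (𝓡 m) 𝓘(ℝ, EuclideanSpace ℝ (Fin k)) ∞ Φ)
    (hzero : ∀ x, (∀ a, f x a = 0) ↔ Φ x = 0)
    (hsurj : ∀ x, Φ x = 0 → Function.Surjective (mvfderiv (𝓡 m) Φ x))
    (hker : ∀ x, Φ x = 0 → ∀ u : TangentSpace (𝓡 m) x,
      (∀ a, mvfderiv (𝓡 m) (fun y ↦ f y a) x u = 0) ↔ mvfderiv (𝓡 m) Φ x u = 0) :
    Nonempty (CleanLevel m f) := by
  let Z : Set M := {x | ∀ a, f x a = 0}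
  have hZ : ∀ x, x ∈ Z ↔ Φ x = 0 := hzero
  have hΦ0 : ∀ z : Z, Φ z.1 = 0 := fun z ↦ (hZ z.1).1 z.2
  have key : ∀ z : Z, ∃ φ ∈ IsManifold.maximalAtlas (𝓡 m) ∞ M, ∃ L : EuclideanSpace ℝ (Fin m) ≃L[ℝ]
      (EuclideanSpace ℝ (Fin k) × EuclideanSpace ℝ (Fin (m - k))),
      z.1 ∈ φ.source ∧ ∀ y ∈ φ.source, (L (φ y)).1 = Φ y := by
    intro z
    obtain ⟨φ, hφ, L, hz, -, hL⟩ := exists_chart_of_surjective isOpen_univ (mem_univ z.1)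
      hΦ.contMDiffOn (hsurj z.1 (hΦ0 z))
    exact ⟨φ, hφ, L, hz, fun y hy ↦ (hL y hy).2⟩
  choose φ hφ L hz hL using key
  let c : Z → OpenPartialHomeomorph Z (EuclideanSpace ℝ (Fin (m - k))) :=
    fun z ↦ levelChart hZ z (φ z) (L z) (hL z)
  let cs : ChartedSpace (EuclideanSpace ℝ (Fin (m - k))) Z :=
    { atlas := range c
      chartAt := c
      mem_chart_source := fun z ↦ hz z
      chart_mem_atlas := fun z ↦ mem_range_self z }
  have hman : IsManifold (𝓡 (m - k)) ∞ Z := by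
    refine isManifold_of_contDiffOn _ _ _ ?_
    rintro _ _ ⟨z, rfl⟩ ⟨z', rfl⟩
    have h1 : ContDiffOn ℝ ∞ (φ z' ∘ (φ z).symm) ((φ z).symm.trans (φ z')).source := by
      rw [← contMDiffOn_iff_contDiffOn]
      exact (contMDiffOn_of_mem_maximalAtlas (I := 𝓡 m) (hφ z')).comp
        ((contMDiffOn_symm_of_mem_maximalAtlas (I := 𝓡 m) (hφ z)).mono fun y hy ↦ hy.1)
        fun y hy ↦ hy.2
    have h2 : ContDiff ℝ ∞ fun w : EuclideanSpace ℝ (Fin (m - k)) ↦ (L z).symm (0, w) :=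
      (L z).symm.contDiff.comp (contDiff_const.prodMk contDiff_id)
    have h3 : ContDiff ℝ ∞ fun w ↦ (L z' w).2 := contDiff_snd.comp (L z').contDiff
    have hmem : ∀ w ∈ ((c z).symm.trans (c z')).source,
        w ∈ (c z).target ∧ (φ z).symm ((L z).symm (0, w)) ∈ (φ z').source := by
      intro w hw
      have h4 : ((c z).symm w).1 ∈ (φ z').source := hw.2
      rw [coe_levelChart_symm hZ z (hL z) hw.1] at h4
      exact ⟨hw.1, h4⟩
    refine (h3.comp_contDiffOn (h1.comp (h2.contDiffOn
      (s := ((c z).symm.trans (c z')).source)) ?_)).congr_mono ?_ ?_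
    · intro w hw
      exact ⟨(hmem w hw).1, (hmem w hw).2⟩
    · intro w hw
      have hw' := hw.1
      simp only [modelWithCornersSelf_coe_symm, preimage_id_eq, id_eq] at hw'
      change (L z' (φ z' ((c z).symm w).1)).2 = (L z' (φ z' ((φ z).symm ((L z).symm (0, w))))).2
      rw [coe_levelChart_symm hZ z (hL z) (hmem w hw').1]
    · intro w hw; exact hw.1
  have himm : IsImmersion (𝓡 (m - k)) (𝓡 m) ∞ (Subtype.val : Z → M) := by
    refine IsImmersionOfComplement.isImmersion (F := EuclideanSpace ℝ (Fin k)) fun z ↦ ?_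
    refine IsImmersionAtOfComplement.mk_of_charts
      ((ContinuousLinearEquiv.prodComm ℝ _ _).trans (L z).symm) (c z) (φ z) (hz z) (hz z)
      (IsManifold.chart_mem_maximalAtlas z) (hφ z) (fun y hy ↦ hy) ?_
    intro w hw
    have hw' : w ∈ (c z).target := by simpa using hw
    have h4 : φ z ((c z).symm w).1 = (L z).symm (0, w) := by
      rw [coe_levelChart_symm hZ z (hL z) hw']
      exact (φ z).right_inv hw'
    simpa using h4
  have hemb : IsSmoothEmbedding (𝓡 (m - k)) (𝓡 m) ∞ (Subtype.val : Z → M) :=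
    ⟨himm, IsEmbedding.subtypeVal⟩
  refine ⟨@CleanLevel.mk m M _ _ A V _ _ f (m - k) cs hman hemb
    fun x u ↦ ?_⟩
  rw [hker x.1 (hΦ0 x) u]
  let T : EuclideanSpace ℝ (Fin m) →L[ℝ] EuclideanSpace ℝ (Fin k) := mvfderiv (𝓡 m) Φ x.1
  let S : EuclideanSpace ℝ (Fin (m - k)) →L[ℝ] EuclideanSpace ℝ (Fin m) :=
    mfderiv (𝓡 (m - k)) (𝓡 m) (Subtype.val : Z → M) x
  have hT : Function.Surjective T := hsurj x.1 (hΦ0 x)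
  have hS : Function.Injective S := injective_mfderiv_of_isImmersion himm x
  have hTS : ∀ z, T (S z) = 0 := by
    intro z
    have h1 := mvfderiv_comp_vec (g := Φ) (f := (Subtype.val : Z → M)) (x := x) (I := 𝓡 (m - k))
      (I' := 𝓡 m) (hΦ.contMDiffAt.mdifferentiableAt (by simp))
      (himm.contMDiff.contMDiffAt.mdifferentiableAt (by simp)) z
    have h2 : (fun z : Z ↦ Φ z.1) = fun _ ↦ 0 := funext hΦ0
    rw [h2, mvfderiv_const] at h1
    exact h1.symm
  have hrange : LinearMap.range S.toLinearMap = LinearMap.ker T.toLinearMap := by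
    apply Submodule.eq_of_le_of_finrank_eq
    · rintro _ ⟨z, rfl⟩
      exact hTS z
    · rw [LinearMap.finrank_range_of_inj hS]
      have h1 := LinearMap.finrank_range_add_finrank_ker T.toLinearMap
      rw [LinearMap.range_eq_top.2 hT] at h1
      simp at h1 ⊢
      omega
  exact SetLike.ext_iff.1 hrange u

end RegularLevel

end

section

section InfAct

variable {m n k : ℕ} {G : Type*} [Group G] [TopologicalSpace G]
  [ChartedSpace (EuclideanSpace ℝ (Fin k)) G] [LieGroup (𝓡 k) ∞ G]
  {M N : Type*} [TopologicalSpace M] [ChartedSpace (EuclideanSpace ℝ (Fin m)) M]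
  [IsManifold (𝓡 m) ∞ M] [MulAction G M] [ContMDiffSMul (𝓡 k) (𝓡 m) ∞ G M]
  [TopologicalSpace N] [ChartedSpace (EuclideanSpace ℝ (Fin n)) N]
  [IsManifold (𝓡 n) ∞ N] [MulAction G N] [ContMDiffSMul (𝓡 k) (𝓡 n) ∞ G N]

lemma contMDiff_const_smul {m : ℕ} (k : ℕ) {G : Type*} [Group G] [TopologicalSpace G]
    [ChartedSpace (EuclideanSpace ℝ (Fin k)) G] {M : Type*} [TopologicalSpace M]
    [ChartedSpace (EuclideanSpace ℝ (Fin m)) M] [MulAction G M]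
    [ContMDiffSMul (𝓡 k) (𝓡 m) ∞ G M] (g : G) :
    ContMDiff (𝓡 m) (𝓡 m) ∞ (fun x : M ↦ g • x) :=
  ContMDiffSMul.contMDiff_const_smul (I := 𝓡 k) g

lemma contMDiff_smul_const (x : M) : ContMDiff (𝓡 k) (𝓡 m) ∞ (fun g : G ↦ g • x) :=
  contMDiff_id.smul contMDiff_const

lemma contMDiff_inv_smul_const (x : M) : ContMDiff (𝓡 k) (𝓡 m) ∞ (fun g : G ↦ g⁻¹ • x) :=
  (contMDiff_inv (𝓡 k) ∞).smul contMDiff_const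

lemma mdiff_const_smul {m : ℕ} (k : ℕ) {G : Type*} [Group G] [TopologicalSpace G]
    [ChartedSpace (EuclideanSpace ℝ (Fin k)) G] {M : Type*} [TopologicalSpace M]
    [ChartedSpace (EuclideanSpace ℝ (Fin m)) M] [MulAction G M]
    [ContMDiffSMul (𝓡 k) (𝓡 m) ∞ G M] (g : G) (x : M) :
    MDifferentiableAt (𝓡 m) (𝓡 m) (fun x : M ↦ g • x) x :=
  (contMDiff_const_smul k g).contMDiffAt.mdifferentiableAt (by simp)

lemma mdiff_inv_smul_const (x : M) (g : G) :
    MDifferentiableAt (𝓡 k) (𝓡 m) (fun g : G ↦ g⁻¹ • x) g :=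
  (contMDiff_inv_smul_const x).contMDiffAt.mdifferentiableAt (by simp)

/-- Equivariant maps intertwine the infinitesimal actions. -/
lemma mfderiv_infAct {f : M → N} (hf : ∀ (g : G) (x : M), f (g • x) = g • f x) (x : M)
    (hfd : MDifferentiableAt (𝓡 m) (𝓡 n) f x) (a : GroupLieAlgebra (𝓡 k) G) :
    mfderiv (𝓡 m) (𝓡 n) f x (infAct G x a) = infAct G (f x) a := by
  have hfd' : MDifferentiableAt (𝓡 m) (𝓡 n) f ((1 : G)⁻¹ • x) := by simpa using hfd
  have h1 := mfderiv_comp_apply (I := 𝓡 k) (I' := 𝓡 m) (I'' := 𝓡 n) (1 : G)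
    (f := fun g : G ↦ g⁻¹ • x) (g := f) hfd' (mdiff_inv_smul_const x 1) a
  have h2 : f ∘ (fun g : G ↦ g⁻¹ • x) = fun g : G ↦ g⁻¹ • f x := funext fun g ↦ hf _ _
  rw [h2] at h1
  have h3 : (1 : G)⁻¹ • x = x := by simp
  have h4 : ∀ y, y = x → (mfderiv (𝓡 m) (𝓡 n) f y
      (mfderiv (𝓡 k) (𝓡 m) (fun g : G ↦ g⁻¹ • x) 1 a : EuclideanSpace ℝ (Fin m)) :
      EuclideanSpace ℝ (Fin n)) = mfderiv (𝓡 m) (𝓡 n) f x (infAct G x a) := by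
    rintro y rfl; rfl
  exact ((h1.trans (h4 _ h3)).symm : _)

lemma mfderiv_const_smul_infAct (g : G) (x : M) (a : GroupLieAlgebra (𝓡 k) G) :
    mfderiv (𝓡 m) (𝓡 m) (fun y : M ↦ g • y) x (infAct G x a) =
      infAct G (g • x) (adjoint g a) := by
  have e1 : (1 : G)⁻¹ • x = x := by simp
  have e2 : g * 1 * g⁻¹ = 1 := by simp
  have h1 := mfderiv_comp_apply (I := 𝓡 k) (I' := 𝓡 m) (I'' := 𝓡 m) (1 : G)
    (f := fun h : G ↦ h⁻¹ • x) (g := fun y : M ↦ g • y) (mdiff_const_smul k g _)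
    (mdiff_inv_smul_const x 1) a
  have hc : MDifferentiableAt (𝓡 k) (𝓡 k) (fun h : G ↦ g * h * g⁻¹) 1 :=
    ((contMDiff_const.mul contMDiff_id).mul contMDiff_const :
      ContMDiff (𝓡 k) (𝓡 k) ∞ (fun h : G ↦ g * h * g⁻¹)).contMDiffAt.mdifferentiableAt (by simp)
  have h2 := mfderiv_comp_apply (I := 𝓡 k) (I' := 𝓡 k) (I'' := 𝓡 m) (1 : G)
    (f := fun h : G ↦ g * h * g⁻¹) (g := fun h : G ↦ h⁻¹ • (g • x)) (mdiff_inv_smul_const _ _)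
    hc a
  have h3 : (fun h : G ↦ h⁻¹ • (g • x)) ∘ (fun h : G ↦ g * h * g⁻¹) =
      (fun y : M ↦ g • y) ∘ (fun h : G ↦ h⁻¹ • x) := by
    funext h; simp [smul_smul, mul_assoc]
  rw [h3] at h2
  have h4 : ∀ y, y = x → (mfderiv (𝓡 m) (𝓡 m) (fun y : M ↦ g • y) y
      (mfderiv (𝓡 k) (𝓡 m) (fun g : G ↦ g⁻¹ • x) 1 a : EuclideanSpace ℝ (Fin m)) :
      EuclideanSpace ℝ (Fin m)) = mfderiv (𝓡 m) (𝓡 m) (fun y : M ↦ g • y) x (infAct G x a) := by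
    rintro y rfl; rfl
  have h5 : ∀ h, h = 1 → (mfderiv (𝓡 k) (𝓡 m) (fun h : G ↦ h⁻¹ • (g • x)) h
      (adjoint g a : EuclideanSpace ℝ (Fin k)) : EuclideanSpace ℝ (Fin m)) =
      infAct G (g • x) (adjoint g a) := by
    rintro y rfl; rfl
  exact ((h4 _ e1).symm.trans (h1.symm.trans (h2.trans (h5 _ e2))))

lemma adjoint_inv_adjoint (g : G) (a : GroupLieAlgebra (𝓡 k) G) :
    adjoint g⁻¹ (adjoint g a) = a := by
  have hc : ∀ g : G, ContMDiff (𝓡 k) (𝓡 k) ∞ (fun h : G ↦ g * h * g⁻¹) := fun g ↦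
    (contMDiff_const.mul contMDiff_id).mul contMDiff_const
  have h1 := mfderiv_comp_apply (I := 𝓡 k) (I' := 𝓡 k) (I'' := 𝓡 k) (1 : G)
    (f := fun h : G ↦ g * h * g⁻¹) (g := fun h : G ↦ g⁻¹ * h * g⁻¹⁻¹)
    ((hc _).contMDiffAt.mdifferentiableAt (by simp))
    ((hc _).contMDiffAt.mdifferentiableAt (by simp)) a
  have h2 : (fun h : G ↦ g⁻¹ * h * g⁻¹⁻¹) ∘ (fun h : G ↦ g * h * g⁻¹) = id := by
    funext h; simp [mul_assoc]
  rw [h2] at h1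
  have h3 : (mfderiv (𝓡 k) (𝓡 k) (id : G → G) 1 a : EuclideanSpace ℝ (Fin k)) = a := by
    rw [mfderiv_id]; rfl
  have h5 : ∀ h, h = 1 → (mfderiv (𝓡 k) (𝓡 k) (fun h : G ↦ g⁻¹ * h * g⁻¹⁻¹) h
      (adjoint g a : EuclideanSpace ℝ (Fin k)) : EuclideanSpace ℝ (Fin k)) =
      adjoint g⁻¹ (adjoint g a) := by
    rintro y rfl; rfl
  exact ((h5 _ (by simp : g * 1 * g⁻¹ = 1)).symm.trans (h1.symm.trans h3))

/-- The orbit map at a point with trivial stabilizer has injective differential at `1`. -/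
lemma injective_mfderiv_smul_const [T2Space M] {x : M} (hfree : ∀ g : G, g • x = x → g = 1) :
    Function.Injective (mfderiv (𝓡 k) (𝓡 m) (fun g : G ↦ g • x) 1) := by
  let T : GroupLieAlgebra (𝓡 k) G →L[ℝ] EuclideanSpace ℝ (Fin m) :=
    mfderiv (𝓡 k) (𝓡 m) (fun g : G ↦ g • x) 1
  suffices ∀ b, T b = 0 → b = 0 from (injective_iff_map_eq_zero T).2 this
  intro b hb
  have hψ : ContMDiff (𝓡 k) (𝓡 m) ∞ (fun g : G ↦ g • x) := contMDiff_smul_const x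
  have hψd : ∀ g, MDifferentiableAt (𝓡 k) (𝓡 m) (fun g : G ↦ g • x) g := fun g ↦
    hψ.contMDiffAt.mdifferentiableAt (by simp)
  have hv0 : ∀ g : G, (mfderiv (𝓡 k) (𝓡 m) (fun g : G ↦ g • x) g
      (mulInvariantVectorField b g) : EuclideanSpace ℝ (Fin m)) = 0 := by
    intro g
    have hl : MDifferentiableAt (𝓡 k) (𝓡 k) (fun h : G ↦ g * h) 1 :=
      (contMDiff_mul_left (I := 𝓡 k) (n := ∞) (a := g)).contMDiffAt.mdifferentiableAt (by simp)
    have h1 := mfderiv_comp_apply (I := 𝓡 k) (I' := 𝓡 k) (I'' := 𝓡 m) (1 : G)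
      (f := fun h : G ↦ g * h) (g := fun h : G ↦ h • x) (hψd _) hl b
    have h2 := mfderiv_comp_apply (I := 𝓡 k) (I' := 𝓡 m) (I'' := 𝓡 m) (1 : G)
      (f := fun h : G ↦ h • x) (g := fun y : M ↦ g • y) (mdiff_const_smul k g _) (hψd 1) b
    have h3 : (fun y : M ↦ g • y) ∘ (fun h : G ↦ h • x) = (fun h : G ↦ h • x) ∘ (fun h ↦ g * h) := by
      funext h; simp [smul_smul]
    rw [h3] at h2
    have h4 : (mfderiv (𝓡 m) (𝓡 m) (fun y : M ↦ g • y) ((1 : G) • x) (T b) :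
        EuclideanSpace ℝ (Fin m)) = 0 := by rw [hb]; exact map_zero _
    have h5 : ∀ h, h = g → (mfderiv (𝓡 k) (𝓡 m) (fun g : G ↦ g • x) h
        (mulInvariantVectorField b g : EuclideanSpace ℝ (Fin k)) : EuclideanSpace ℝ (Fin m)) =
        mfderiv (𝓡 k) (𝓡 m) (fun g : G ↦ g • x) g (mulInvariantVectorField b g) := by
      rintro y rfl; rfl
    exact (h5 _ (mul_one g)).symm.trans (h1.symm.trans (h2.trans h4))
  have : LieGroup (𝓡 k) (minSmoothness ℝ 3) G := by
    simpa using LieGroup.of_le (I := 𝓡 k) (G := G) (m := 3) (n := ∞) (WithTop.coe_le_coe.2 le_top)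
  obtain ⟨γ, hγ0, hγ⟩ := exists_isMIntegralCurveAt_of_contMDiffAt_boundaryless (t₀ := 0)
    (v := mulInvariantVectorField (I := 𝓡 k) b) (x₀ := (1 : G))
    ((contMDiffAt_mulInvariantVectorField b).of_le (by simp))
  let φ := extChartAt (𝓡 m) x
  have hγc : ContinuousAt γ 0 := hγ.self_of_nhds.continuousAt
  have hnear : ∀ᶠ t in 𝓝 (0 : ℝ), γ t • x ∈ (chartAt (EuclideanSpace ℝ (Fin m)) x).source := by
    have h1 : ContinuousAt (fun t ↦ γ t • x) 0 :=
      ContinuousAt.comp (g := fun g : G ↦ g • x) hψ.continuous.continuousAt hγc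
    refine h1.eventually_mem ?_
    simp only [hγ0, one_smul]
    exact chart_source_mem_nhds _ x
  obtain ⟨ε, hε, hball⟩ := Metric.eventually_nhds_iff_ball.1 (hγ.and hnear)
  have hder : ∀ t ∈ Metric.ball (0 : ℝ) ε, HasFDerivAt (fun t ↦ φ (γ t • x)) (0 : ℝ →L[ℝ] _) t := by
    intro t ht
    obtain ⟨h1, h2⟩ := hball t ht
    have h3 := (hψd (γ t)).hasMFDerivAt.comp t h1
    have h4 := (mdifferentiableAt_extChartAt (I := 𝓡 m) h2).hasMFDerivAt.comp t h3
    rw [hasMFDerivAt_iff_hasFDerivAt] at h4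
    refine HasFDerivAt.congr_fderiv h4 (ContinuousLinearMap.ext fun (s : ℝ) ↦ ?_)
    let S : EuclideanSpace ℝ (Fin k) →L[ℝ] EuclideanSpace ℝ (Fin m) :=
      mfderiv (𝓡 k) (𝓡 m) (fun g : G ↦ g • x) (γ t)
    let S' : EuclideanSpace ℝ (Fin m) →L[ℝ] EuclideanSpace ℝ (Fin m) :=
      mfderiv (𝓡 m) 𝓘(ℝ, EuclideanSpace ℝ (Fin m)) φ (γ t • x)
    let v : EuclideanSpace ℝ (Fin k) := mulInvariantVectorField b (γ t)
    have h8 : ∀ r : ℝ, S' (S (r • v)) = 0 := fun r ↦ by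
      rw [map_smul, show S v = 0 from hv0 _, smul_zero, map_zero]
    exact h8 s
  have hconst : ∀ t ∈ Metric.ball (0 : ℝ) ε, γ t = 1 := by
    intro t ht
    have h1 := (convex_ball (0 : ℝ) ε).is_const_of_fderivWithin_eq_zero (𝕜 := ℝ)
      (f := fun t ↦ φ (γ t • x)) (fun s hs ↦ (hder s hs).differentiableAt.differentiableWithinAt)
      (fun s hs ↦ by
        rw [fderivWithin_of_isOpen Metric.isOpen_ball hs]; exact (hder s hs).fderiv)
      ht (Metric.mem_ball_self hε)
    apply hfree
    refine φ.injOn (by simpa [φ] using (hball t ht).2) (mem_extChartAt_source x) ?_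
    simpa [hγ0] using h1
  have h1 : HasMFDerivAt 𝓘(ℝ, ℝ) (𝓡 k) γ 0 (0 : ℝ →L[ℝ] _) :=
    (hasMFDerivAt_const (1 : G) (0 : ℝ)).congr_of_eventuallyEq
      (Filter.eventually_of_mem (Metric.ball_mem_nhds _ hε) hconst)
  have h2 := hasMFDerivAt_unique hγ.self_of_nhds h1
  have h3 := congrArg (fun S : ℝ →L[ℝ] EuclideanSpace ℝ (Fin k) ↦ S 1) h2
  have h4 : (mulInvariantVectorField (I := 𝓡 k) b (γ 0) : EuclideanSpace ℝ (Fin k)) = 0 := by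
    have h5 : ((1 : ℝ) • (mulInvariantVectorField (I := 𝓡 k) b (γ 0)) : EuclideanSpace ℝ (Fin k))
      = 0 := h3
    rwa [one_smul] at h5
  have h6 : ∀ g : G, g = 1 → (mulInvariantVectorField (I := 𝓡 k) b g : EuclideanSpace ℝ (Fin k))
      = b := by
    rintro g rfl
    have h7 : (fun h : G ↦ 1 * h) = id := by funext h; simp
    have h8 : (mulInvariantVectorField (I := 𝓡 k) b (1 : G) : EuclideanSpace ℝ (Fin k)) =
      mfderiv (𝓡 k) (𝓡 k) (fun h : G ↦ 1 * h) 1 b := rfl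
    rw [h8, h7, mfderiv_id]; rfl
  exact (h6 _ hγ0).symm.trans h4

/-- `infAct` is, up to an involution of the Lie algebra, the derivative of the orbit map. -/
lemma infAct_eq_mfderiv_smul (x : M) :
    ∃ J : GroupLieAlgebra (𝓡 k) G →L[ℝ] GroupLieAlgebra (𝓡 k) G,
    (∀ a, J (J a) = a) ∧ ∀ a : GroupLieAlgebra (𝓡 k) G, (infAct G x a : EuclideanSpace ℝ (Fin m)) =
      mfderiv (𝓡 k) (𝓡 m) (fun g : G ↦ g • x) 1 (J a) := by
  have hi : ∀ g, MDifferentiableAt (𝓡 k) (𝓡 k) (fun g : G ↦ g⁻¹) g := fun g ↦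
    (contMDiff_inv (𝓡 k) ∞).contMDiffAt.mdifferentiableAt (by simp)
  have hψd : ∀ g, MDifferentiableAt (𝓡 k) (𝓡 m) (fun g : G ↦ g • x) g := fun g ↦
    (contMDiff_smul_const x).contMDiffAt.mdifferentiableAt (by simp)
  let J : EuclideanSpace ℝ (Fin k) →L[ℝ] EuclideanSpace ℝ (Fin k) :=
    mfderiv (𝓡 k) (𝓡 k) (fun g : G ↦ g⁻¹) 1
  refine ⟨J, fun a ↦ ?_, fun a ↦ ?_⟩
  · have h1 := mfderiv_comp_apply (I := 𝓡 k) (I' := 𝓡 k) (I'' := 𝓡 k) (1 : G)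
      (f := fun g : G ↦ g⁻¹) (g := fun g : G ↦ g⁻¹) (hi _) (hi _) a
    have h2 : (fun g : G ↦ g⁻¹) ∘ (fun g : G ↦ g⁻¹) = id := by funext g; simp
    rw [h2] at h1
    have h3 : (mfderiv (𝓡 k) (𝓡 k) (id : G → G) 1 a : EuclideanSpace ℝ (Fin k)) = a := by
      rw [mfderiv_id]; rfl
    have h4 : ∀ h : G, h = 1 → (mfderiv (𝓡 k) (𝓡 k) (fun g : G ↦ g⁻¹) h
      (J a : EuclideanSpace ℝ (Fin k)) : EuclideanSpace ℝ (Fin k)) = J (J a) := by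
      rintro h rfl; rfl
    exact (h4 _ inv_one).symm.trans (h1.symm.trans h3)
  · have h1 := mfderiv_comp_apply (I := 𝓡 k) (I' := 𝓡 k) (I'' := 𝓡 m) (1 : G)
      (f := fun g : G ↦ g⁻¹) (g := fun g : G ↦ g • x) (hψd _) (hi _) a
    have h4 : ∀ h : G, h = 1 → (mfderiv (𝓡 k) (𝓡 m) (fun g : G ↦ g • x) h
      (J a : EuclideanSpace ℝ (Fin k)) : EuclideanSpace ℝ (Fin m)) =
      mfderiv (𝓡 k) (𝓡 m) (fun g : G ↦ g • x) 1 (J a) := by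
      rintro h rfl; rfl
    exact h1.trans (h4 _ inv_one)

/-- At a point with trivial stabilizer the infinitesimal action is injective. -/
lemma injective_infAct [T2Space M] {x : M} (hfree : ∀ g : G, g • x = x → g = 1) :
    Function.Injective (infAct (m := m) (k := k) G x) := by
  obtain ⟨J, hJ, h⟩ := infAct_eq_mfderiv_smul (G := G) (k := k) (m := m) x
  intro a b hab
  have h1 : (mfderiv (𝓡 k) (𝓡 m) (fun g : G ↦ g • x) 1 (J a) : EuclideanSpace ℝ (Fin m)) =
      mfderiv (𝓡 k) (𝓡 m) (fun g : G ↦ g • x) 1 (J b) := (h a).symm.trans (hab.trans (h b))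
  have h2 := injective_mfderiv_smul_const (k := k) (m := m) hfree h1
  rw [← hJ a, h2, hJ]

end InfAct

end

section

section Slices

/-- A slice of a free action: `N` is an open set on which every point is `h y • σ (s y)`, and the
points of the slice `σ '' W` lie on distinct orbits. -/
structure OrbitSlice (k d : ℕ) (G Z : Type*) [TopologicalSpace G]
    [ChartedSpace (EuclideanSpace ℝ (Fin k)) G] [Group G] [TopologicalSpace Z]
    [ChartedSpace (EuclideanSpace ℝ (Fin d)) Z] [MulAction G Z] where
  W : Set (EuclideanSpace ℝ (Fin (d - k)))
  N : Set Z
  σ : EuclideanSpace ℝ (Fin (d - k)) → Z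
  s : Z → EuclideanSpace ℝ (Fin (d - k))
  h : Z → G
  isOpen_W : IsOpen W
  isOpen_N : IsOpen N
  contMDiffOn_σ : ContMDiffOn (𝓡 (d - k)) (𝓡 d) ∞ σ W
  contMDiffOn_s : ContMDiffOn (𝓡 d) (𝓡 (d - k)) ∞ s N
  contMDiffOn_h : ContMDiffOn (𝓡 d) (𝓡 k) ∞ h N
  s_mem : ∀ y ∈ N, s y ∈ W
  smul_σ : ∀ y ∈ N, h y • σ (s y) = y
  σ_mem : ∀ w ∈ W, σ w ∈ N
  s_σ : ∀ w ∈ W, s (σ w) = w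
  eq_of_smul : ∀ (g : G), ∀ w ∈ W, ∀ w' ∈ W, g • σ w = σ w' → w = w'

variable {d k : ℕ} {G : Type*} [Group G] [TopologicalSpace G]
  [ChartedSpace (EuclideanSpace ℝ (Fin k)) G] [LieGroup (𝓡 k) ∞ G] [CompactSpace G]
  {Z : Type*} [TopologicalSpace Z] [ChartedSpace (EuclideanSpace ℝ (Fin d)) Z]
  [IsManifold (𝓡 d) ∞ Z] [T2Space Z] [MulAction G Z] [ContMDiffSMul (𝓡 k) (𝓡 d) ∞ G Z]

theorem exists_orbitSlice (z : Z) (hfree : ∀ g : G, g • z = z → g = 1) :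
    ∃ S : OrbitSlice k d G Z, z ∈ S.N := by
  let T : EuclideanSpace ℝ (Fin k) →L[ℝ] EuclideanSpace ℝ (Fin d) :=
    mfderiv (𝓡 k) (𝓡 d) (fun g : G ↦ g • z) 1
  have hT : Function.Injective T := injective_mfderiv_smul_const hfree
  obtain ⟨S, hS⟩ := (LinearMap.range T.toLinearMap).exists_isCompl
  have hrT : Module.finrank ℝ (LinearMap.range T.toLinearMap) = k := by
    simpa using LinearMap.finrank_range_of_inj hT
  have hSd : Module.finrank ℝ S = d - k := by
    have := Submodule.finrank_add_eq_of_isCompl hS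
    simp only [hrT, finrank_euclideanSpace, Fintype.card_fin] at this
    omega
  let c₀ : EuclideanSpace ℝ (Fin (d - k)) ≃ₗ[ℝ] S := LinearEquiv.ofFinrankEq _ _ (by simp [hSd])
  let L : (EuclideanSpace ℝ (Fin k) × EuclideanSpace ℝ (Fin (d - k))) ≃L[ℝ]
      EuclideanSpace ℝ (Fin d) :=
    (((LinearEquiv.ofInjective T.toLinearMap hT).prodCongr c₀).trans
      (Submodule.prodEquivOfIsCompl _ _ hS)).toContinuousLinearEquiv
  let J : EuclideanSpace ℝ (Fin (d - k)) →L[ℝ] EuclideanSpace ℝ (Fin d) :=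
    L.toContinuousLinearMap.comp (ContinuousLinearMap.inr ℝ _ _)
  have hL : ∀ u w, L (u, w) = T u + J w := fun u w ↦ by
    simp [L, J, Submodule.coe_prodEquivOfIsCompl']
  let z' : Z := (1 : G) • z
  have hz' : z' = z := one_smul G z
  let φ := extChartAt (𝓡 d) z'
  let c := extChartAt (𝓡 k) (1 : G)
  have hzφ : z ∈ φ.source := by
    exact (congrArg (· ∈ φ.source) hz').mp (mem_extChartAt_source (I := 𝓡 d) z')
  let Ψ : EuclideanSpace ℝ (Fin k) × EuclideanSpace ℝ (Fin (d - k)) → Z :=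
    fun q ↦ c.symm q.1 • φ.symm (φ z + J q.2)
  let U₁ : Set (EuclideanSpace ℝ (Fin k) × EuclideanSpace ℝ (Fin (d - k))) :=
    {q | q.1 ∈ c.target ∧ φ z + J q.2 ∈ φ.target}
  have hJc : Continuous fun w ↦ φ z + J w := continuous_const.add J.continuous
  have hU₁ : IsOpen U₁ := ((isOpen_extChartAt_target (I := 𝓡 k) (1 : G)).preimage continuous_fst).inter
    ((isOpen_extChartAt_target (I := 𝓡 d) z').preimage (hJc.comp continuous_snd))
  have hσ : ContMDiffOn (𝓡 (d - k)) (𝓡 d) ∞ (fun w ↦ φ.symm (φ z + J w))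
      {w | φ z + J w ∈ φ.target} :=
    (contMDiffOn_extChartAt_symm (I := 𝓡 d) (n := ∞) z').comp
      (contDiff_const.add J.contDiff).contMDiff.contMDiffOn fun w hw ↦ hw
  have hΨ : ContMDiffOn 𝓘(ℝ, EuclideanSpace ℝ (Fin k) × EuclideanSpace ℝ (Fin (d - k))) (𝓡 d) ∞
      Ψ U₁ := by
    refine ContMDiffOn.smul (I := 𝓡 k) ?_ ?_
    · exact (contMDiffOn_extChartAt_symm (I := 𝓡 k) (n := ∞) (1 : G)).comp
        contDiff_fst.contMDiff.contMDiffOn fun q hq ↦ hq.1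
    · exact hσ.comp contDiff_snd.contMDiff.contMDiffOn fun q hq ↦ hq.2
  let U₀ := U₁ ∩ Ψ ⁻¹' φ.source
  have hU₀ : IsOpen U₀ := hΨ.continuousOn.isOpen_inter_preimage hU₁ (isOpen_extChartAt_source z')
  let Φ : EuclideanSpace ℝ (Fin k) × EuclideanSpace ℝ (Fin (d - k)) → EuclideanSpace ℝ (Fin d) :=
    fun q ↦ φ (Ψ q)
  have hΦ : ContDiffOn ℝ ∞ Φ U₀ := by
    rw [← contMDiffOn_iff_contDiffOn]
    refine (contMDiffOn_extChartAt (I := 𝓡 d) (x := z') (n := ∞)).comp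
      (hΨ.mono inter_subset_left) fun q hq ↦ ?_
    simpa [φ] using hq.2
  have hJ0 : φ z + J 0 = φ z := by rw [map_zero, add_zero]
  have hΨ0 : ∀ a, Ψ (a, 0) = c.symm a • z := fun a ↦ by
    simp only [Ψ]; rw [hJ0, φ.left_inv hzφ]
  have hc1 : c.symm (c 1) = 1 := c.left_inv (mem_extChartAt_source (1 : G))
  have hp : (c 1, (0 : EuclideanSpace ℝ (Fin (d - k)))) ∈ U₀ := by
    refine ⟨⟨mem_extChartAt_target (1 : G), ?_⟩, ?_⟩
    · change φ z + J 0 ∈ φ.target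
      rw [hJ0]; exact φ.map_source hzφ
    · change Ψ (c 1, 0) ∈ φ.source
      rw [hΨ0, hc1]; exact mem_extChartAt_source z'
  have hΦ' : HasFDerivAt Φ (L : _ →L[ℝ] _) (c 1, 0) := by
    have h0 := ((hΦ.contDiffAt (hU₀.mem_nhds hp)).differentiableAt (by simp)).hasFDerivAt
    refine h0.congr_fderiv (ContinuousLinearMap.ext fun q ↦ ?_)
    have h1 : HasFDerivAt (fun a : EuclideanSpace ℝ (Fin k) ↦ Φ (a, 0)) T (c 1) := by
      have h2 := hasFDerivAt_writtenInExtChartAt (m := k) (n := d)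
        (f := fun g : G ↦ g • z) (x := 1)
        ((contMDiff_smul_const z).contMDiffAt.mdifferentiableAt (by simp))
      have h3 : (fun a ↦ Φ (a, 0)) = writtenInExtChartAt (𝓡 k) (𝓡 d) 1 (fun g : G ↦ g • z) := by
        funext a; simp only [Φ]; rw [hΨ0]; rfl
      rw [h3]; exact h2
    have h1' : HasFDerivAt (fun a : EuclideanSpace ℝ (Fin k) ↦ Φ (a, 0)) _ (c 1) :=
      HasFDerivAt.comp (g := Φ) (f := fun a ↦ (a, 0)) (c 1) h0 ((hasFDerivAt_id (c 1)).prodMk (hasFDerivAt_const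
        (0 : EuclideanSpace ℝ (Fin (d - k))) (c 1)))
    have h4 : HasFDerivAt (fun w : EuclideanSpace ℝ (Fin (d - k)) ↦ Φ (c 1, w)) J 0 := by
      have h5 : HasFDerivAt (fun w ↦ φ z + J w) J 0 := J.hasFDerivAt.const_add (φ z)
      refine h5.congr_of_eventuallyEq ?_
      filter_upwards [((isOpen_extChartAt_target (I := 𝓡 d) z').preimage hJc).mem_nhds
        (show φ z + J 0 ∈ φ.target from hp.1.2)] with w hw
      simp only [Φ, Ψ, hc1, one_smul]
      exact φ.right_inv hw
    have h4' : HasFDerivAt (fun w : EuclideanSpace ℝ (Fin (d - k)) ↦ Φ (c 1, w)) _ 0 :=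
      HasFDerivAt.comp (g := Φ) (f := fun w ↦ (c 1, w)) 0 h0 ((hasFDerivAt_const (c 1)
        (0 : EuclideanSpace ℝ (Fin (d - k)))).prodMk (hasFDerivAt_id _))
    have e1 := congrArg (fun B : _ →L[ℝ] _ ↦ B q.1) (h1'.unique h1)
    have e2 := congrArg (fun B : _ →L[ℝ] _ ↦ B q.2) (h4'.unique h4)
    have e3 : q = (q.1, (0 : EuclideanSpace ℝ (Fin (d - k)))) + ((0 : EuclideanSpace ℝ (Fin k)), q.2) := by
      simp
    have e1' : fderiv ℝ Φ (c 1, 0) (q.1, 0) = T q.1 := e1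
    have e2' : fderiv ℝ Φ (c 1, 0) (0, q.2) = J q.2 := e2
    calc fderiv ℝ Φ (c 1, 0) q = T q.1 + J q.2 := by
          conv_lhs => rw [e3, map_add, e1', e2']
      _ = L q := (hL _ _).symm
  obtain ⟨e, hpe, heU, heq, hes⟩ := exists_openPartialHomeomorph_of_hasFDerivAt hU₀ hΦ hp hΦ'
  let σ : EuclideanSpace ℝ (Fin (d - k)) → Z := fun w ↦ φ.symm (φ z + J w)
  have hσ0 : σ 0 = z := by simp only [σ]; rw [hJ0, φ.left_inv hzφ]
  obtain ⟨A, B, hA, hB, hcA, h0B, hAB⟩ := isOpen_prod_iff.1 e.open_source (c 1) 0 hpe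
  let V : Set G := c.source ∩ c ⁻¹' A
  have hV : IsOpen V := (continuousOn_extChartAt (I := 𝓡 k) (1 : G)).isOpen_inter_preimage
    (isOpen_extChartAt_source (1 : G)) hA
  have h1V : (1 : G) ∈ V := ⟨mem_extChartAt_source (1 : G), hcA⟩
  have hBt : ∀ w ∈ B, (c 1, w) ∈ U₀ := fun w hw ↦ heU (hAB ⟨hcA, hw⟩)
  have hσB : ContMDiffOn (𝓡 (d - k)) (𝓡 d) ∞ σ B := hσ.mono fun w hw ↦ (hBt w hw).1.2
  have hσc : ContinuousAt σ 0 := (hσB.contMDiffAt (hB.mem_nhds h0B)).continuousAt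
  have hcomp : ∀ᶠ p in 𝓝 ((0, 0) : EuclideanSpace ℝ (Fin (d - k)) × EuclideanSpace ℝ (Fin (d - k))),
      ∀ g ∈ Vᶜ, g • σ p.1 ≠ σ p.2 := by
    refine IsCompact.eventually_forall_of_forall_eventually hV.isClosed_compl.isCompact ?_
    intro g hg
    have hne : g • σ 0 ≠ σ 0 := by
      rw [hσ0]; intro h; exact hg ((hfree g h) ▸ h1V)
    have hsm : Continuous fun p : G × Z ↦ p.1 • p.2 :=
      (contMDiff_smul (I := 𝓡 k) (I' := 𝓡 d) (n := ∞) (G := G) (M := Z)).continuous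
    have t1 : ContinuousAt (fun q : (EuclideanSpace ℝ (Fin (d - k)) ×
        EuclideanSpace ℝ (Fin (d - k))) × G ↦ q.2 • σ q.1.1) ((0, 0), g) := by
      refine ContinuousAt.comp (g := fun p : G × Z ↦ p.1 • p.2)
        (f := fun q : (EuclideanSpace ℝ (Fin (d - k)) × EuclideanSpace ℝ (Fin (d - k))) × G ↦
          (q.2, σ q.1.1)) hsm.continuousAt ?_
      refine continuousAt_snd.prodMk (ContinuousAt.comp (g := σ) hσc ?_)
      exact continuousAt_fst.comp continuousAt_fst
    have t2 : ContinuousAt (fun q : (EuclideanSpace ℝ (Fin (d - k)) ×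
        EuclideanSpace ℝ (Fin (d - k))) × G ↦ σ q.1.2) ((0, 0), g) := by
      refine ContinuousAt.comp (g := σ) hσc ?_
      exact continuousAt_snd.comp continuousAt_fst
    have t3 := (t1.prodMk t2).eventually_mem (isClosed_diagonal.isOpen_compl.mem_nhds hne)
    exact t3
  rw [nhds_prod_eq] at hcomp
  obtain ⟨P, hP, P', hP', hPP⟩ := Filter.eventually_prod_iff.1 hcomp
  obtain ⟨W, hWsub, hW, h0W⟩ := mem_nhds_iff.1 (hP.and (hP'.and (hB.mem_nhds h0B)))
  have hWB : W ⊆ B := fun w hw ↦ (hWsub hw).2.2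
  have hφN : IsOpen (φ.source ∩ φ ⁻¹' e.target) :=
    (continuousOn_extChartAt (I := 𝓡 d) z').isOpen_inter_preimage
      (isOpen_extChartAt_source z') e.open_target
  have hes' : ContMDiffOn (𝓡 d) 𝓘(ℝ, EuclideanSpace ℝ (Fin k) × EuclideanSpace ℝ (Fin (d - k))) ∞
      (fun y ↦ e.symm (φ y)) (φ.source ∩ φ ⁻¹' e.target) :=
    hes.contMDiffOn.comp ((contMDiffOn_extChartAt (I := 𝓡 d) (x := z') (n := ∞)).mono
      fun y hy ↦ by simpa [φ] using hy.1) fun y hy ↦ hy.2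
  have hs1 : ContMDiffOn (𝓡 d) (𝓡 (d - k)) ∞ (fun y ↦ (e.symm (φ y)).2)
      (φ.source ∩ φ ⁻¹' e.target) :=
    contDiff_snd.contMDiff.comp_contMDiffOn hes'
  have hh1 : ContMDiffOn (𝓡 d) (𝓡 k) ∞ (fun y ↦ c.symm (e.symm (φ y)).1)
      (φ.source ∩ φ ⁻¹' e.target) :=
    (contMDiffOn_extChartAt_symm (I := 𝓡 k) (n := ∞) (1 : G)).comp
      (contDiff_fst.contMDiff.comp_contMDiffOn hes') fun y hy ↦ (heU (e.map_target hy.2)).1.1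
  have hφσ : ∀ w ∈ B, σ w ∈ φ.source ∧ φ (σ w) = e (c 1, w) := fun w hw ↦ by
    refine ⟨φ.map_target (hBt w hw).1.2, ?_⟩
    rw [heq]
    simp only [Φ, Ψ, hc1, one_smul, σ]
  have hes1 : ∀ w ∈ B, φ (σ w) ∈ e.target ∧ e.symm (φ (σ w)) = (c 1, w) := fun w hw ↦ by
    rw [(hφσ w hw).2]
    exact ⟨e.map_source (hAB ⟨hcA, hw⟩), e.left_inv (hAB ⟨hcA, hw⟩)⟩
  refine ⟨{ W := W, N := (φ.source ∩ φ ⁻¹' e.target) ∩ (fun y ↦ (e.symm (φ y)).2) ⁻¹' W, σ := σ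
            s := fun y ↦ (e.symm (φ y)).2, h := fun y ↦ c.symm (e.symm (φ y)).1
            isOpen_W := hW
            isOpen_N := hs1.continuousOn.isOpen_inter_preimage hφN hW
            contMDiffOn_σ := hσB.mono hWB
            contMDiffOn_s := hs1.mono inter_subset_left
            contMDiffOn_h := hh1.mono inter_subset_left
            s_mem := fun y hy ↦ hy.2
            smul_σ := fun y hy ↦ ?_
            σ_mem := fun w hw ↦ ?_
            s_σ := fun w hw ↦ ?_
            eq_of_smul := fun g w hw w' hw' hg ↦ ?_ }, ?_⟩
  · have h1 := e.map_target hy.1.2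
    have h2 : φ (Ψ (e.symm (φ y))) = φ y := by
      have := e.right_inv hy.1.2
      rwa [heq] at this
    exact φ.injOn (heU h1).2 hy.1.1 h2
  · refine ⟨⟨(hφσ w (hWB hw)).1, (hes1 w (hWB hw)).1⟩, ?_⟩
    change (e.symm (φ (σ w))).2 ∈ W
    rw [(hes1 w (hWB hw)).2]; exact hw
  · rw [(hes1 w (hWB hw)).2]
  · have hgV : g ∈ V := by
      by_contra hgV
      exact hPP (hWsub hw).1 (hWsub hw').2.1 g hgV hg
    have h1 : (c g, w) ∈ e.source := hAB ⟨hgV.2, hWB hw⟩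
    have h2 : e (c g, w) = e (c 1, w') := by
      rw [← (hφσ w' (hWB hw')).2, heq, ← hg]
      simp only [Φ, Ψ, σ]
      rw [c.left_inv hgV.1]
    exact congrArg Prod.snd (e.injOn h1 (hAB ⟨hcA, hWB hw'⟩) h2)
  · have h := hes1 0 h0B
    rw [hσ0] at h
    refine ⟨⟨hzφ, h.1⟩, ?_⟩
    change (e.symm (φ z)).2 ∈ W
    rw [h.2]; exact h0W

/-- On a neighbourhood of a point with trivial stabilizer, points of the same orbit differ by a
group element of the form `h y * (h y')⁻¹` with `h` smooth. -/
theorem exists_orbit_translation (z : Z) (hfree : ∀ g : G, g • z = z → g = 1) :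
    ∃ (N : Set Z) (h : Z → G), IsOpen N ∧ z ∈ N ∧ ContMDiffOn (𝓡 d) (𝓡 k) ∞ h N ∧
      ∀ y ∈ N, ∀ y' ∈ N, (∃ g : G, g • y = y') → (h y * (h y')⁻¹) • y' = y := by
  obtain ⟨S, hz⟩ := exists_orbitSlice (k := k) (d := d) z hfree
  refine ⟨S.N, S.h, S.isOpen_N, hz, S.contMDiffOn_h, fun y hy y' hy' ⟨g, hg⟩ ↦ ?_⟩
  have h1 : (S.h y')⁻¹ • y' = S.σ (S.s y') := by rw [inv_smul_eq_iff, S.smul_σ y' hy']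
  have h2 : ((S.h y')⁻¹ * g * S.h y) • S.σ (S.s y) = S.σ (S.s y') := by
    rw [mul_smul, mul_smul, S.smul_σ y hy, hg, h1]
  have h3 := S.eq_of_smul _ _ (S.s_mem y hy) _ (S.s_mem y' hy') h2
  rw [mul_smul, h1, ← h3, S.smul_σ y hy]

variable {r : Setoid Z}

lemma isOpenMap_mk_orbit {G Z : Type*} [Group G] [TopologicalSpace Z] [MulAction G Z]
    [ContinuousConstSMul G Z] {r : Setoid Z} (hr : ∀ x y, r x y ↔ ∃ g : G, g • x = y) :
    IsOpenMap (Quotient.mk r) := fun U hU ↦ by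
  have h1 : Quotient.mk r ⁻¹' (Quotient.mk r '' U) = ⋃ g : G, (fun x : Z ↦ g • x) ⁻¹' U := by
    ext x
    simp only [mem_preimage, mem_image, mem_iUnion]
    constructor
    · rintro ⟨y, hy, hxy⟩
      obtain ⟨g, hg⟩ := (hr x y).1 (Setoid.symm (Quotient.exact hxy))
      exact ⟨g, hg ▸ hy⟩
    · rintro ⟨g, hg⟩
      exact ⟨_, hg, Quotient.sound (Setoid.symm ((hr _ _).2 ⟨g, rfl⟩))⟩
  change IsOpen (Quotient.mk r ⁻¹' (Quotient.mk r '' U))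
  rw [h1]
  exact isOpen_iUnion fun g ↦ hU.preimage (continuous_const_smul g)

/-- The chart of the quotient defined by a slice. -/
def OrbitSlice.chart (S : OrbitSlice k d G Z) (hr : ∀ x y, r x y ↔ ∃ g : G, g • x = y) :
    OpenPartialHomeomorph (Quotient r) (EuclideanSpace ℝ (Fin (d - k))) :=
  have : ContinuousConstSMul G Z := ⟨fun g ↦ (contMDiff_const_smul (m := d) k g).continuous⟩
  have hopen : IsOpenMap (Quotient.mk r) := isOpenMap_mk_orbit hr
  have hs : ∀ y ∈ S.N, ∀ y' ∈ S.N, Quotient.mk r y = Quotient.mk r y' → S.s y = S.s y' := by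
    intro y hy y' hy' hyy
    obtain ⟨g, hg⟩ := (hr y y').1 (Quotient.exact hyy)
    refine S.eq_of_smul ((S.h y')⁻¹ * g * S.h y) _ (S.s_mem y hy) _ (S.s_mem y' hy') ?_
    rw [mul_smul, mul_smul, S.smul_σ y hy, hg, inv_smul_eq_iff, S.smul_σ y' hy']
  { toFun := fun q ↦ open scoped Classical in
      if h : ∃ y ∈ S.N, Quotient.mk r y = q then S.s h.choose else 0
    invFun := fun w ↦ Quotient.mk r (S.σ w)
    source := Quotient.mk r '' S.N
    target := S.W
    map_source' := by
      rintro q hq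
      have hq' : ∃ y ∈ S.N, Quotient.mk r y = q := hq
      rw [dif_pos hq']
      exact S.s_mem _ hq'.choose_spec.1
    map_target' := fun w hw ↦ ⟨S.σ w, S.σ_mem w hw, rfl⟩
    left_inv' := by
      rintro q hq
      have hq' : ∃ y ∈ S.N, Quotient.mk r y = q := hq
      rw [dif_pos hq']
      refine Eq.trans (Quotient.sound ((hr _ _).2 ⟨S.h hq'.choose, ?_⟩)) hq'.choose_spec.2
      exact S.smul_σ _ hq'.choose_spec.1
    right_inv' := fun w hw ↦ by
      have hq' : ∃ y ∈ S.N, Quotient.mk r y = Quotient.mk r (S.σ w) := ⟨S.σ w, S.σ_mem w hw, rfl⟩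
      rw [dif_pos hq', hs _ hq'.choose_spec.1 _ (S.σ_mem w hw) hq'.choose_spec.2, S.s_σ w hw]
    open_source := hopen _ S.isOpen_N
    open_target := S.isOpen_W
    continuousOn_toFun := by
      rw [continuousOn_open_iff (hopen _ S.isOpen_N)]
      intro O hO
      have h1 := hopen _ (S.contMDiffOn_s.continuousOn.isOpen_inter_preimage S.isOpen_N hO)
      convert h1 using 1
      ext q
      simp only [mem_inter_iff, mem_image, mem_preimage]
      constructor
      · rintro ⟨hq', hqO⟩
        rw [dif_pos hq'] at hqO
        exact ⟨_, ⟨hq'.choose_spec.1, hqO⟩, hq'.choose_spec.2⟩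
      · rintro ⟨y, ⟨hy, hyO⟩, rfl⟩
        have hq' : ∃ y' ∈ S.N, Quotient.mk r y' = Quotient.mk r y := ⟨y, hy, rfl⟩
        refine ⟨hq', ?_⟩
        rw [dif_pos hq', hs _ hq'.choose_spec.1 _ hy hq'.choose_spec.2]
        exact hyO
    continuousOn_invFun := continuous_quot_mk.comp_continuousOn S.contMDiffOn_σ.continuousOn }

lemma OrbitSlice.chart_mk (S : OrbitSlice k d G Z) (hr : ∀ x y, r x y ↔ ∃ g : G, g • x = y)
    {y : Z} (hy : y ∈ S.N) : S.chart hr (Quotient.mk r y) = S.s y := by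
  have hq' : ∃ y' ∈ S.N, Quotient.mk r y' = Quotient.mk r y := ⟨y, hy, rfl⟩
  have h1 : S.chart hr (Quotient.mk r y) = S.s hq'.choose := dif_pos hq'
  rw [h1]
  obtain ⟨g, hg⟩ := (hr _ y).1 (Quotient.exact hq'.choose_spec.2)
  refine S.eq_of_smul ((S.h y)⁻¹ * g * S.h hq'.choose) _ (S.s_mem _ hq'.choose_spec.1) _
    (S.s_mem y hy) ?_
  rw [mul_smul, mul_smul, S.smul_σ _ hq'.choose_spec.1, hg, inv_smul_eq_iff, S.smul_σ y hy]

/-- The quotient of a manifold by a free smooth action of a compact Lie group. -/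
theorem exists_quotient_manifold [SecondCountableTopology Z]
    (hr : ∀ x y, r x y ↔ ∃ g : G, g • x = y) (hfree : ∀ (z : Z) (g : G), g • z = z → g = 1) :
    ∃ (_ : ChartedSpace (EuclideanSpace ℝ (Fin (d - k))) (Quotient r)),
      IsManifold (𝓡 (d - k)) ∞ (Quotient r) ∧ T2Space (Quotient r) ∧
      SecondCountableTopology (Quotient r) ∧
      IsSubmersion (𝓡 d) (𝓡 (d - k)) ∞ (Quotient.mk r) := by
  have : ContinuousConstSMul G Z := ⟨fun g ↦ (contMDiff_const_smul (m := d) k g).continuous⟩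
  have hopen : IsOpenMap (Quotient.mk r) := isOpenMap_mk_orbit hr
  have hsc : SecondCountableTopology (Quotient r) :=
    TopologicalSpace.Quotient.secondCountableTopology hopen
  have hq : IsOpenQuotientMap (Quotient.mk r) :=
    ⟨Quotient.mk_surjective, continuous_quot_mk, hopen⟩
  have hsm : Continuous fun p : G × Z ↦ p.1 • p.2 :=
    (contMDiff_smul (I := 𝓡 k) (I' := 𝓡 d) (n := ∞) (G := G) (M := Z)).continuous
  have ht2 : T2Space (Quotient r) := by
    rw [t2Space_iff_of_isOpenQuotientMap hq]
    have h1 : IsClosed {p : G × (Z × Z) | p.1 • p.2.1 = p.2.2} :=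
      isClosed_eq (hsm.comp (continuous_fst.prodMk (continuous_fst.comp continuous_snd)))
        (continuous_snd.comp continuous_snd)
    have h2 := isClosedMap_snd_of_compactSpace _ h1
    convert h2 using 1
    ext ⟨x, y⟩
    simp only [mem_image, Prod.exists, exists_eq_right]
    exact ⟨fun h ↦ (hr x y).1 (Quotient.exact h), fun h ↦ Quotient.sound ((hr x y).2 h)⟩
  choose S hS using fun z : Z ↦ exists_orbitSlice (k := k) (d := d) z (hfree z)
  let cs : ChartedSpace (EuclideanSpace ℝ (Fin (d - k))) (Quotient r) :=
    { atlas := {e | ∃ S : OrbitSlice k d G Z, e = S.chart hr}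
      chartAt := fun q ↦ (S q.out).chart hr
      mem_chart_source := fun q ↦ ⟨q.out, hS _, Quotient.out_eq q⟩
      chart_mem_atlas := fun q ↦ ⟨_, rfl⟩ }
  have hgs : ∀ (S S' : OrbitSlice k d G Z) (z : Z), Quotient.mk r z ∈ (S'.chart hr).source →
      ∃ g : G, g • z ∈ S'.N := by
    rintro S S' z ⟨y, hy, hyz⟩
    obtain ⟨g, hg⟩ := (hr z y).1 (Quotient.exact hyz.symm)
    exact ⟨g, hg ▸ hy⟩
  have hmg : ∀ (g : G) (z : Z), Quotient.mk r (g • z) = Quotient.mk r z := fun g z ↦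
    (Quotient.sound ((hr _ _).2 ⟨g, rfl⟩)).symm
  have hloc : ∀ (S' : OrbitSlice k d G Z) (z : Z), Quotient.mk r z ∈ (S'.chart hr).source →
      ContMDiffAt (𝓡 d) (𝓡 (d - k)) ∞ (fun y ↦ S'.chart hr (Quotient.mk r y)) z := by
    intro S' z hz
    obtain ⟨g, hg⟩ := hgs S' S' z hz
    have hc := contMDiff_const_smul (m := d) k (M := Z) g
    have h1 : ContMDiffAt (𝓡 d) (𝓡 (d - k)) ∞ (fun y : Z ↦ S'.s (g • y)) z :=
      ContMDiffAt.comp z (S'.contMDiffOn_s.contMDiffAt (S'.isOpen_N.mem_nhds hg)) hc.contMDiffAt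
    refine h1.congr_of_eventuallyEq ?_
    filter_upwards [hc.continuous.continuousAt.eventually_mem (S'.isOpen_N.mem_nhds hg)] with y hy
    rw [← hmg g y, S'.chart_mk hr hy]
  have hmfd : IsManifold (𝓡 (d - k)) ∞ (Quotient r) := by
    refine isManifold_of_contDiffOn _ _ _ ?_
    rintro e e' ⟨S, rfl⟩ ⟨S', rfl⟩
    simp only [modelWithCornersSelf_coe, modelWithCornersSelf_coe_symm, Function.id_comp,
      Function.comp_id, preimage_id, range_id, inter_univ]
    intro w hw
    have h1 := hloc S' (S.σ w) hw.2
    have h2 : ContMDiffAt (𝓡 (d - k)) (𝓡 (d - k)) ∞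
        (fun v ↦ S'.chart hr (Quotient.mk r (S.σ v))) w :=
      ContMDiffAt.comp (g := fun y ↦ S'.chart hr (Quotient.mk r y)) (f := S.σ) w h1 (S.contMDiffOn_σ.contMDiffAt (S.isOpen_W.mem_nhds hw.1))
    exact h2.contDiffAt.contDiffWithinAt
  refine ⟨cs, hmfd, ht2, hsc, ?_⟩
  have hsmooth : ContMDiff (𝓡 d) (𝓡 (d - k)) ∞ (Quotient.mk r) := by
    intro z
    have h1 : ContMDiffAt (𝓡 d) (𝓡 (d - k)) ∞ (fun y ↦ (S z).chart hr (Quotient.mk r y)) z :=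
      hloc (S z) z ⟨z, hS z, rfl⟩
    have hmem : (S z).chart hr ∈ IsManifold.maximalAtlas (𝓡 (d - k)) ∞ (Quotient r) :=
      IsManifold.subset_maximalAtlas ⟨S z, rfl⟩
    have h2 := contMDiffOn_symm_of_mem_maximalAtlas hmem
    have h3 : (S z).chart hr (Quotient.mk r z) ∈ ((S z).chart hr).target :=
      ((S z).chart hr).map_source ⟨z, hS z, rfl⟩
    have h4 := ContMDiffAt.comp (x := z) (g := ((S z).chart hr).symm)
      (f := fun y ↦ (S z).chart hr (Quotient.mk r y))
      (h2.contMDiffAt (((S z).chart hr).open_target.mem_nhds h3)) h1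
    refine h4.congr_of_eventuallyEq ?_
    filter_upwards [(S z).isOpen_N.mem_nhds (hS z)] with y hy
    exact (((S z).chart hr).left_inv ⟨y, hy, rfl⟩).symm
  refine isSubmersion_of_surjective hsmooth fun z v ↦ ?_
  have hmem : (S z).chart hr ∈ IsManifold.maximalAtlas (𝓡 (d - k)) ∞ (Quotient r) :=
    IsManifold.subset_maximalAtlas ⟨S z, rfl⟩
  have hzs : Quotient.mk r z ∈ ((S z).chart hr).source := ⟨z, hS z, rfl⟩
  let ρ : Quotient r → Z := fun q ↦ (S z).h z • (S z).σ ((S z).chart hr q)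
  have hρ : ContMDiffOn (𝓡 (d - k)) (𝓡 d) ∞ ρ ((S z).chart hr).source :=
    (contMDiff_const_smul k ((S z).h z)).comp_contMDiffOn ((S z).contMDiffOn_σ.comp
      (contMDiffOn_of_mem_maximalAtlas hmem) fun q hq ↦ ((S z).chart hr).map_source hq)
  exact ⟨_, mfderiv_section (f := Quotient.mk r) (σ := ρ)
    (hsmooth.contMDiffAt.mdifferentiableAt (by simp)) ((S z).chart hr).open_source hzs
    (by simp only [ρ]; rw [(S z).chart_mk hr (hS z), (S z).smul_σ z (hS z)]) hρ
    (fun q hq ↦ (hmg _ _).trans (((S z).chart hr).left_inv hq)) v⟩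

end Slices

end

section

section LevelAction

variable {m k : ℕ} {G : Type*} [Group G] [TopologicalSpace G]
  [ChartedSpace (EuclideanSpace ℝ (Fin k)) G] [LieGroup (𝓡 k) ∞ G]
  {M : Type*} [TopologicalSpace M] [ChartedSpace (EuclideanSpace ℝ (Fin m)) M]
  [IsManifold (𝓡 m) ∞ M] [MulAction G M] [ContMDiffSMul (𝓡 k) (𝓡 m) ∞ G M]
  {A V : Type*} [NormedAddCommGroup V] [NormedSpace ℝ V] {f : M → A → V}

namespace CleanLevel

variable (L : CleanLevel m f)

lemma isImmersion_incl : IsImmersion (𝓡 L.dim) (𝓡 m) ∞ L.incl :=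
  letI := L.charted
  L.embedding.isImmersion

lemma contMDiff_incl : ContMDiff (𝓡 L.dim) (𝓡 m) ∞ L.incl := L.isImmersion_incl.contMDiff

lemma mdiff_incl (z : L.Space) : MDifferentiableAt (𝓡 L.dim) (𝓡 m) L.incl z :=
  L.contMDiff_incl.contMDiffAt.mdifferentiableAt (by simp)

lemma injective_mfderiv_incl (z : L.Space) :
    Function.Injective (mfderiv (𝓡 L.dim) (𝓡 m) L.incl z) :=
  injective_mfderiv_of_isImmersion L.isImmersion_incl z

lemma incl_injective : Function.Injective L.incl := Subtype.val_injective

lemma incl_mem (z : L.Space) (a : A) : f (L.incl z) a = 0 := z.2 a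

/-- The action of `G` on an invariant level. -/
@[reducible] def action (hinv : ∀ (g : G) (x : M), (∀ a, f x a = 0) → ∀ a, f (g • x) a = 0) :
    MulAction G L.Space where
  smul g z := ⟨g • L.incl z, hinv g _ z.2⟩
  one_smul z := L.incl_injective (one_smul G (L.incl z))
  mul_smul g h z := L.incl_injective (mul_smul g h (L.incl z))

variable {L}

lemma incl_action_smul (hinv : ∀ (g : G) (x : M), (∀ a, f x a = 0) → ∀ a, f (g • x) a = 0)
    (g : G) (z : L.Space) : letI := L.action hinv; L.incl (g • z) = g • L.incl z := rfl

lemma contMDiffSMul_action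
    (hinv : ∀ (g : G) (x : M), (∀ a, f x a = 0) → ∀ a, f (g • x) a = 0) :
    letI := L.action hinv; ContMDiffSMul (𝓡 k) (𝓡 L.dim) ∞ G L.Space := by
  let _ := L.action hinv
  have h1 : ContMDiff ((𝓡 k).prod (𝓡 L.dim)) (𝓡 m) ∞
      (fun p : G × L.Space ↦ p.1 • L.incl p.2) :=
    contMDiff_fst.smul (L.contMDiff_incl.comp contMDiff_snd)
  refine ⟨(ContMDiff.iff_comp_isImmersion L.isImmersion_incl).2 ⟨?_, h1⟩⟩
  exact h1.continuous.subtype_mk _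

lemma orbitSetoid_iff
    (hinv : ∀ (g : G) (x : M), (∀ a, f x a = 0) → ∀ a, f (g • x) a = 0) (x y : L.Space) :
    letI := L.action hinv; L.orbitSetoid G x y ↔ ∃ g : G, g • x = y := by
  let _ := L.action hinv
  have h1 : L.orbitSetoid G x y ↔ L.incl x ∈ MulAction.orbit G (L.incl y) := Iff.rfl
  rw [h1]
  constructor
  · rintro ⟨g, hg⟩
    refine ⟨g⁻¹, L.incl_injective ?_⟩
    have h2 : L.incl (g⁻¹ • x) = g⁻¹ • L.incl x := rfl
    rw [h2, inv_smul_eq_iff]; exact hg.symm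
  · rintro ⟨g, rfl⟩
    have h2 : L.incl (g • x) = g • L.incl x := rfl
    exact ⟨g⁻¹, by rw [h2]; simp⟩

instance [T2Space M] : T2Space L.Space := inferInstanceAs (T2Space {x : M // ∀ a, f x a = 0})

instance [SecondCountableTopology M] : SecondCountableTopology L.Space :=
  TopologicalSpace.Subtype.secondCountableTopology {x | ∀ a, f x a = 0}

theorem nonempty_levelQuotient {m : ℕ} (k : ℕ) {G : Type*} [Group G] [TopologicalSpace G]
    [ChartedSpace (EuclideanSpace ℝ (Fin k)) G] [LieGroup (𝓡 k) ∞ G] [CompactSpace G]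
    {M : Type*} [TopologicalSpace M] [ChartedSpace (EuclideanSpace ℝ (Fin m)) M]
    [IsManifold (𝓡 m) ∞ M] [T2Space M] [SecondCountableTopology M] [MulAction G M]
    [ContMDiffSMul (𝓡 k) (𝓡 m) ∞ G M]
    {A V : Type*} [NormedAddCommGroup V] [NormedSpace ℝ V] {f : M → A → V} {L : CleanLevel m f}
    (hinv : ∀ (g : G) (x : M), (∀ a, f x a = 0) → ∀ a, f (g • x) a = 0)
    (hfree : ∀ x : M, (∀ a, f x a = 0) → ∀ g : G, g • x = x → g = 1) :
    Nonempty (LevelQuotient G L) := by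
  let _ := L.action hinv
  have := L.contMDiffSMul_action (k := k) hinv
  obtain ⟨c, h1, h2, h3, h4⟩ := exists_quotient_manifold (k := k) (d := L.dim) (G := G)
    (Z := L.Space) (r := L.orbitSetoid G) (orbitSetoid_iff hinv)
    (fun z g hg ↦ hfree _ z.2 g (congrArg L.incl hg))
  exact ⟨{ dim := _, charted := c, isManifold := h1, t2 := h2, secondCountable := h3
           submersion := h4 }⟩

end CleanLevel

namespace LevelQuotient

variable {L : CleanLevel m f} (Q : LevelQuotient G L)

lemma isSubmersion_proj : IsSubmersion (𝓡 L.dim) (𝓡 Q.dim) ∞ Q.proj := Q.submersion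

lemma contMDiff_proj : ContMDiff (𝓡 L.dim) (𝓡 Q.dim) ∞ Q.proj := Q.isSubmersion_proj.contMDiff

lemma mdiff_proj (z : L.Space) : MDifferentiableAt (𝓡 L.dim) (𝓡 Q.dim) Q.proj z :=
  Q.contMDiff_proj.contMDiffAt.mdifferentiableAt (by simp)

lemma surjective_mfderiv_proj (z : L.Space) :
    Function.Surjective (mfderiv (𝓡 L.dim) (𝓡 Q.dim) Q.proj z) :=
  surjective_mfderiv_of_isSubmersion Q.isSubmersion_proj z

lemma proj_surjective : Function.Surjective Q.proj := Quotient.mk_surjective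

lemma proj_eq_iff {z z' : L.Space} : Q.proj z = Q.proj z' ↔ ∃ g : G, g • L.incl z = L.incl z' := by
  have h1 : Q.proj z = Q.proj z' ↔ L.incl z ∈ MulAction.orbit G (L.incl z') := by
    exact Quotient.eq (r := L.orbitSetoid G)
  rw [h1]
  constructor
  · rintro ⟨g, hg⟩
    exact ⟨g⁻¹, by rw [inv_smul_eq_iff]; exact hg.symm⟩
  · rintro ⟨g, hg⟩
    exact ⟨g⁻¹, by rw [← hg]; simp⟩

/-- Near a point of the level, points on the same orbit differ by a smoothly varying group
element. -/
theorem exists_translation [CompactSpace G] [T2Space M]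
    (hinv : ∀ (g : G) (x : M), (∀ a, f x a = 0) → ∀ a, f (g • x) a = 0)
    (hfree : ∀ x : M, (∀ a, f x a = 0) → ∀ g : G, g • x = x → g = 1) (z : L.Space) :
    ∃ (N : Set L.Space) (h : L.Space → G), IsOpen N ∧ z ∈ N ∧
      ContMDiffOn (𝓡 L.dim) (𝓡 k) ∞ h N ∧
      ∀ y ∈ N, ∀ y' ∈ N, Q.proj y = Q.proj y' → (h y * (h y')⁻¹) • L.incl y' = L.incl y := by
  let _ := L.action hinv
  have := L.contMDiffSMul_action (k := k) hinv
  obtain ⟨N, h, hN, hzN, hh, hy⟩ := exists_orbit_translation (k := k) (d := L.dim) (G := G)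
    (Z := L.Space) z (fun g hg ↦ hfree _ z.2 g (congrArg L.incl hg))
  refine ⟨N, h, hN, hzN, hh, fun y hyN y' hyN' hyy ↦ ?_⟩
  obtain ⟨g, hg⟩ := Q.proj_eq_iff.1 hyy
  exact congrArg L.incl (hy y hyN y' hyN' ⟨g, L.incl_injective hg⟩)

theorem mfderiv_proj_infAct
    (hinv : ∀ (g : G) (x : M), (∀ a, f x a = 0) → ∀ a, f (g • x) a = 0) (z : L.Space)
    (a : GroupLieAlgebra (𝓡 k) G) :
    ∃ u : TangentSpace (𝓡 L.dim) z, mfderiv (𝓡 L.dim) (𝓡 m) L.incl z u = infAct G (L.incl z) a ∧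
      mfderiv (𝓡 L.dim) (𝓡 Q.dim) Q.proj z u = 0 := by
  let _ := L.action hinv
  have := L.contMDiffSMul_action (k := k) hinv
  refine ⟨infAct G z a, mfderiv_infAct (fun g x ↦ rfl) z (L.mdiff_incl z) a, ?_⟩
  have e1 : (1 : G)⁻¹ • z = z := by simp
  have h1 := mfderiv_comp_apply (I := 𝓡 k) (I' := 𝓡 L.dim) (I'' := 𝓡 Q.dim) (1 : G)
    (f := fun g : G ↦ g⁻¹ • z) (g := Q.proj) (Q.mdiff_proj _) (mdiff_inv_smul_const z 1) a
  have h2 : Q.proj ∘ (fun g : G ↦ g⁻¹ • z) = fun _ ↦ Q.proj z := funext fun g ↦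
    Q.proj_eq_iff.2 ⟨g, congrArg L.incl (smul_inv_smul g z)⟩
  rw [h2, mfderiv_const] at h1
  have h3 : ∀ y, y = z → (mfderiv (𝓡 L.dim) (𝓡 Q.dim) Q.proj y
      (mfderiv (𝓡 k) (𝓡 L.dim) (fun g : G ↦ g⁻¹ • z) 1 a : EuclideanSpace ℝ (Fin L.dim)) :
      EuclideanSpace ℝ (Fin Q.dim)) = mfderiv (𝓡 L.dim) (𝓡 Q.dim) Q.proj z (infAct G z a) := by
    rintro y rfl; rfl
  exact (h3 _ e1).symm.trans h1.symm

/-- The kernel of the differential of the projection consists of the infinitesimal action. -/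
theorem exists_infAct_of_mfderiv_proj_eq_zero [CompactSpace G] [T2Space M]
    (hinv : ∀ (g : G) (x : M), (∀ a, f x a = 0) → ∀ a, f (g • x) a = 0)
    (hfree : ∀ x : M, (∀ a, f x a = 0) → ∀ g : G, g • x = x → g = 1) (z : L.Space)
    (u : TangentSpace (𝓡 L.dim) z) (hu : mfderiv (𝓡 L.dim) (𝓡 Q.dim) Q.proj z u = 0) :
    ∃ a : GroupLieAlgebra (𝓡 k) G,
      infAct G (L.incl z) a = mfderiv (𝓡 L.dim) (𝓡 m) L.incl z u := by
  obtain ⟨N, h, hN, hzN, hh, hy⟩ := Q.exists_translation (k := k) hinv hfree z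
  obtain ⟨σ, O, hO, hzO, hσz, hσ, hσp⟩ := exists_local_section Q.isSubmersion_proj z
  have hσd : MDifferentiableAt (𝓡 Q.dim) (𝓡 L.dim) σ (Q.proj z) :=
    (hσ.contMDiffAt (hO.mem_nhds hzO)).mdifferentiableAt (by simp)
  have hτd : MDifferentiableAt (𝓡 L.dim) (𝓡 L.dim) (fun y ↦ σ (Q.proj y)) z :=
    hσd.comp z (Q.mdiff_proj z)
  have hhd : MDifferentiableAt (𝓡 L.dim) (𝓡 k) h z :=
    (hh.contMDiffAt (hN.mem_nhds hzN)).mdifferentiableAt (by simp)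
  have hτ0 : (mfderiv (𝓡 L.dim) (𝓡 L.dim) (fun y ↦ σ (Q.proj y)) z u :
      EuclideanSpace ℝ (Fin L.dim)) = 0 := by
    refine (mfderiv_comp_apply z hσd (Q.mdiff_proj z) u).trans ?_
    rw [hu]; exact map_zero _
  have hσz' : σ (Q.proj z) = z := hσz
  let κ : L.Space → G := fun y ↦ h y * (h (σ (Q.proj y)))⁻¹
  have hhd' : MDifferentiableAt (𝓡 L.dim) (𝓡 k) h (σ (Q.proj z)) := by rwa [hσz']
  have hκs : ContMDiffAt (𝓡 L.dim) (𝓡 k) ∞ κ z := by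
    have h1 : ContMDiffAt (𝓡 L.dim) (𝓡 L.dim) ∞ (fun y ↦ σ (Q.proj y)) z :=
      ContMDiffAt.comp z (hσ.contMDiffAt (hO.mem_nhds hzO)) Q.contMDiff_proj.contMDiffAt
    have h2 : ContMDiffAt (𝓡 L.dim) (𝓡 k) ∞ h (σ (Q.proj z)) := by
      rw [hσz']; exact hh.contMDiffAt (hN.mem_nhds hzN)
    exact (hh.contMDiffAt (hN.mem_nhds hzN)).mul (ContMDiffAt.comp z h2 h1).inv
  have hκd : MDifferentiableAt (𝓡 L.dim) (𝓡 k) κ z := hκs.mdifferentiableAt (by simp)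
  have hκ1 : κ z = 1 := by simp only [κ, hσz', mul_inv_cancel]
  have hev : ∀ᶠ y in 𝓝 z, L.incl y = κ y • L.incl (σ (Q.proj y)) := by
    have h1 : ∀ᶠ y in 𝓝 z, σ (Q.proj y) ∈ N :=
      hτd.continuousAt.eventually_mem (hN.mem_nhds (by rwa [hσz']))
    filter_upwards [hN.mem_nhds hzN, h1, Q.contMDiff_proj.continuous.continuousAt.eventually_mem
      (hO.mem_nhds hzO)] with y hyN hσN hyO
    exact (hy y hyN _ hσN (hσp _ hyO).symm).symm
  let Φ : G × M → M := fun p ↦ p.1 • p.2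
  have hΦ : ∀ p, MDifferentiableAt ((𝓡 k).prod (𝓡 m)) (𝓡 m) Φ p := fun p ↦
    (contMDiff_smul (I := 𝓡 k) (I' := 𝓡 m) (n := ∞)
      (G := G) (M := M)).contMDiffAt.mdifferentiableAt (by simp)
  have hι : MDifferentiableAt (𝓡 L.dim) (𝓡 m) (fun y ↦ L.incl (σ (Q.proj y))) z :=
    (L.mdiff_incl _).comp z hτd
  have hι0 : (mfderiv (𝓡 L.dim) (𝓡 m) (fun y ↦ L.incl (σ (Q.proj y))) z u :
      EuclideanSpace ℝ (Fin m)) = 0 := by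
    refine (mfderiv_comp_apply z (L.mdiff_incl _) hτd u).trans ?_
    rw [hτ0]; exact map_zero _
  have hp := hκd.prodMk hι
  have h3 := mfderiv_comp_apply z (g := Φ) (hΦ _) hp u
  have h4 : mfderiv (𝓡 L.dim) (𝓡 m) L.incl z u = mfderiv (𝓡 L.dim) (𝓡 m)
      (Φ ∘ fun y ↦ (κ y, L.incl (σ (Q.proj y)))) z u :=
    congrArg (fun T : EuclideanSpace ℝ (Fin L.dim) →L[ℝ] EuclideanSpace ℝ (Fin m) ↦ T u)
      (Filter.EventuallyEq.mfderiv_eq hev)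
  have h5 := mfderiv_prod_eq_add_apply (hΦ (κ z, L.incl (σ (Q.proj z))))
    (v := mfderiv (𝓡 L.dim) ((𝓡 k).prod (𝓡 m)) (fun y ↦ (κ y, L.incl (σ (Q.proj y)))) z u)
  let w : EuclideanSpace ℝ (Fin k) := mfderiv (𝓡 L.dim) (𝓡 k) κ z u
  have h6 : ((mfderiv (𝓡 L.dim) ((𝓡 k).prod (𝓡 m)) (fun y ↦ (κ y, L.incl (σ (Q.proj y)))) z u).1 :
      EuclideanSpace ℝ (Fin k)) = w := by
    rw [mfderiv_prodMk hκd hι]; rfl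
  have h7 : ((mfderiv (𝓡 L.dim) ((𝓡 k).prod (𝓡 m)) (fun y ↦ (κ y, L.incl (σ (Q.proj y)))) z u).2 :
      EuclideanSpace ℝ (Fin m)) = 0 := by
    rw [mfderiv_prodMk hκd hι]; exact hι0
  obtain ⟨J, hJ, hJ'⟩ := infAct_eq_mfderiv_smul (G := G) (k := k) (m := m) (L.incl z)
  refine ⟨J w, ?_⟩
  have h8 : ∀ (g : G) (x : M), g = 1 → x = L.incl z →
      (mfderiv (𝓡 k) (𝓡 m) (fun g : G ↦ Φ (g, x)) g w : EuclideanSpace ℝ (Fin m)) =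
      mfderiv (𝓡 k) (𝓡 m) (fun g : G ↦ g • L.incl z) 1 w := by
    rintro g x rfl rfl; rfl
  have h9 : (mfderiv (𝓡 L.dim) (𝓡 m) L.incl z u : EuclideanSpace ℝ (Fin m)) =
      mfderiv (𝓡 k) (𝓡 m) (fun g : G ↦ g • L.incl z) 1 w := by
    refine (h4.trans (h3.trans (h5.trans ?_)))
    rw [h6, h7]
    refine Eq.trans (congrArg₂ (· + ·) (h8 (κ z) _ hκ1 (congrArg L.incl hσz')) (map_zero _)) ?_
    exact add_zero _
  exact (hJ' (J w)).trans ((congrArg _ (hJ w)).trans h9.symm)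

end LevelQuotient

end LevelAction

end

section

/-- The model space of `m`-dimensional manifolds. -/
abbrev Eu (m : ℕ) := EuclideanSpace ℝ (Fin m)

section Frames

variable {m n : ℕ} {M N : Type*}
  [TopologicalSpace M] [ChartedSpace (EuclideanSpace ℝ (Fin m)) M] [IsManifold (𝓡 m) ∞ M]
  [TopologicalSpace N] [ChartedSpace (EuclideanSpace ℝ (Fin n)) N] [IsManifold (𝓡 n) ∞ N]

/-- The tangent vector at `y` with coordinates `v` in the preferred chart at `x`. -/
def fld (x y : M) : Eu m →L[ℝ] TangentSpace (𝓡 m) y :=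
  (trivializationAt (Eu m) (TangentSpace (𝓡 m) (M := M)) x).symmL ℝ y

/-- The coordinates of tangent vectors at `y` in the preferred chart at `x`. -/
def coord (x y : M) : TangentSpace (𝓡 m) y →L[ℝ] Eu m :=
  (trivializationAt (Eu m) (TangentSpace (𝓡 m) (M := M)) x).continuousLinearMapAt ℝ y

lemma fld_coord {x y : M} (hy : y ∈ (chartAt (Eu m) x).source) (u : TangentSpace (𝓡 m) y) :
    fld x y (coord x y u) = u :=
  (trivializationAt (Eu m) (TangentSpace (𝓡 m) (M := M)) x).symmL_continuousLinearMapAt (R := ℝ)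
    (by simpa using hy) u

lemma coord_fld {x y : M} (hy : y ∈ (chartAt (Eu m) x).source) (v : Eu m) :
    coord x y (fld x y v) = v :=
  (trivializationAt (Eu m) (TangentSpace (𝓡 m) (M := M)) x).continuousLinearMapAt_symmL (R := ℝ)
    (by simpa using hy) v

lemma coord_self (x : M) (u : TangentSpace (𝓡 m) x) : (coord x x u : Eu m) = u := by
  have h := TangentBundle.continuousLinearMapAt_trivializationAt_eq_core (𝕜 := ℝ) (I := 𝓡 m)
    (b₀ := x) (b := x) (mem_chart_source _ x)
  have h1 : (coord x x u : Eu m) =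
      (tangentBundleCore (𝓡 m) M).coordChange (achart (Eu m) x) (achart (Eu m) x) x u :=
    congrArg (fun T : Eu m →L[ℝ] Eu m ↦ T u) h
  rw [h1]
  exact (tangentBundleCore (𝓡 m) M).coordChange_self (achart (Eu m) x) x (mem_chart_source _ x) u

lemma fld_self (x : M) (v : Eu m) : (fld x x v : Eu m) = v := by
  have h := fld_coord (mem_chart_source (Eu m) x) (v : TangentSpace (𝓡 m) x)
  rw [show coord x x (v : TangentSpace (𝓡 m) x) = v from coord_self x v] at h
  exact h

lemma localExt_tangent {x : M} (u : TangentSpace (𝓡 m) x) (y : M) :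
    localExt ℝ (Eu m) u y = fld x y u := by
  have h1 : (trivializationAt (Eu m) (TangentSpace (𝓡 m) (M := M)) x).linearMapAt ℝ x u =
    (coord x x u : Eu m) := rfl
  unfold localExt
  rw [h1, coord_self]; rfl

lemma smoothFieldAt_iff {V : Π y : M, TangentSpace (𝓡 m) y} {x y : M}
    (hy : y ∈ (chartAt (Eu m) x).source) :
    SmoothFieldAt V y ↔ ContMDiffAt (𝓡 m) 𝓘(ℝ, Eu m) ∞ (fun y ↦ coord x y (V y)) y := by
  unfold SmoothFieldAt
  have hb : y ∈ (trivializationAt (Eu m) (TangentSpace (𝓡 m) (M := M)) x).baseSet := by simpa using hy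
  rw [Bundle.Trivialization.contMDiffAt_section_iff
    (e := trivializationAt (Eu m) (TangentSpace (𝓡 m) (M := M)) x) hb]
  refine Filter.EventuallyEq.contMDiffAt_iff ?_
  filter_upwards [(trivializationAt (Eu m) (TangentSpace (𝓡 m) (M := M)) x).open_baseSet.mem_nhds
    hb] with z hz
  exact (Bundle.Trivialization.continuousLinearMapAt_apply_of_mem (R := ℝ) _ hz (V z)).symm

lemma smoothFieldAt_fld {x y : M} (hy : y ∈ (chartAt (Eu m) x).source) (v : Eu m) :
    SmoothFieldAt (fun y ↦ fld x y v) y := by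
  rw [smoothFieldAt_iff hy]
  refine contMDiffAt_const (c := v) |>.congr_of_eventuallyEq ?_
  filter_upwards [(chartAt (Eu m) x).open_source.mem_nhds hy] with z hz
  exact coord_fld hz v

lemma coord_eq_mfderiv {x y : M} (hy : y ∈ (chartAt (Eu m) x).source)
    (u : TangentSpace (𝓡 m) y) :
    (coord x y u : Eu m) = mfderiv (𝓡 m) 𝓘(ℝ, Eu m) (extChartAt (𝓡 m) x) y u :=
  congrArg (fun T : Eu m →L[ℝ] Eu m ↦ T u)
    (TangentBundle.continuousLinearMapAt_trivializationAt (𝕜 := ℝ) (I := 𝓡 m) hy)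

lemma fld_eq_mfderiv {x y : M} (hy : y ∈ (chartAt (Eu m) x).source) (v : Eu m) :
    (fld x y v : Eu m) = mfderiv 𝓘(ℝ, Eu m) (𝓡 m) (extChartAt (𝓡 m) x).symm
      (extChartAt (𝓡 m) x y) v := by
  have h := TangentBundle.symmL_trivializationAt (𝕜 := ℝ) (I := 𝓡 m) hy
  rw [ModelWithCorners.range_eq_univ, mfderivWithin_univ] at h
  exact congrArg (fun T : Eu m →L[ℝ] Eu m ↦ T v) h

/-- In charts, the differential is the derivative of the coordinate expression. -/
lemma coord_mfderiv {f : N → M} {x : M} {z : N} (hz : f z ∈ (chartAt (Eu m) x).source)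
    (hf : MDifferentiableAt (𝓡 n) (𝓡 m) f z) (u : TangentSpace (𝓡 n) z) :
    coord x (f z) (mfderiv (𝓡 n) (𝓡 m) f z u) =
      mvfderiv (𝓡 n) (fun z' ↦ extChartAt (𝓡 m) x (f z')) z u := by
  rw [coord_eq_mfderiv hz]
  exact (mfderiv_comp_apply z (mdifferentiableAt_extChartAt hz) hf u).symm

section Deriv

variable {W : Type*} [NormedAddCommGroup W] [NormedSpace ℝ W]

lemma mvfderiv_fld {f : M → W} {x y : M} (hy : y ∈ (chartAt (Eu m) x).source)
    (hf : MDifferentiableAt (𝓡 m) 𝓘(ℝ, W) f y) (v : Eu m) :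
    mvfderiv (𝓡 m) f y (fld x y v) =
      fderiv ℝ (fun p ↦ f ((extChartAt (𝓡 m) x).symm p)) (extChartAt (𝓡 m) x y) v := by
  set φ := extChartAt (𝓡 m) x
  have hy' : y ∈ φ.source := by simpa [φ] using hy
  have e1 : φ.symm (φ y) = y := φ.left_inv hy'
  have hsd : MDifferentiableAt 𝓘(ℝ, Eu m) (𝓡 m) φ.symm (φ y) :=
    ((contMDiffOn_extChartAt_symm (I := 𝓡 m) (n := ∞) x).contMDiffAt
      ((isOpen_extChartAt_target x).mem_nhds (φ.map_source hy'))).mdifferentiableAt (by simp)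
  have hf' : MDifferentiableAt (𝓡 m) 𝓘(ℝ, W) f (φ.symm (φ y)) := by rwa [e1]
  have h1 := mvfderiv_comp_vec (I := 𝓘(ℝ, Eu m)) (x := φ y) hf' hsd v
  rw [mvfderiv_eq_fderiv] at h1
  rw [h1]
  have h2 : ∀ z, z = y → (mvfderiv (𝓡 m) f z (mfderiv 𝓘(ℝ, Eu m) (𝓡 m) φ.symm (φ y) v : Eu m)) =
      mvfderiv (𝓡 m) f y (fld x y v) := by
    rintro z rfl
    exact congrArg (mvfderiv (𝓡 m) f z) (fld_eq_mfderiv hy v).symm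
  exact (h2 _ e1).symm

lemma contDiffAt_comp_extChartAt_symm {f : M → W} {x y : M}
    (hy : y ∈ (chartAt (Eu m) x).source) (hf : ContMDiffAt (𝓡 m) 𝓘(ℝ, W) ∞ f y) :
    ContDiffAt ℝ ∞ (fun p ↦ f ((extChartAt (𝓡 m) x).symm p)) (extChartAt (𝓡 m) x y) := by
  set φ := extChartAt (𝓡 m) x
  have hy' : y ∈ φ.source := by simpa [φ] using hy
  have e1 : φ.symm (φ y) = y := φ.left_inv hy'
  have hf' : ContMDiffAt (𝓡 m) 𝓘(ℝ, W) ∞ f (φ.symm (φ y)) := by rwa [e1]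
  exact (ContMDiffAt.comp (φ y) hf' ((contMDiffOn_extChartAt_symm (I := 𝓡 m) (n := ∞) x).contMDiffAt
    ((isOpen_extChartAt_target x).mem_nhds (φ.map_source hy')))).contDiffAt

lemma contMDiffAt_of_comp_extChartAt_symm {f : M → W} {x y : M}
    (hy : y ∈ (chartAt (Eu m) x).source)
    (hf : ContDiffAt ℝ ∞ (fun p ↦ f ((extChartAt (𝓡 m) x).symm p)) (extChartAt (𝓡 m) x y)) :
    ContMDiffAt (𝓡 m) 𝓘(ℝ, W) ∞ f y := by
  set φ := extChartAt (𝓡 m) x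
  have hy' : y ∈ φ.source := by simpa [φ] using hy
  have h1 : ContMDiffAt (𝓡 m) 𝓘(ℝ, W) ∞ (fun z ↦ f (φ.symm (φ z))) y :=
    ContMDiffAt.comp (g := fun p ↦ f (φ.symm p)) y hf.contMDiffAt (contMDiffAt_extChartAt' hy)
  refine h1.congr_of_eventuallyEq ?_
  filter_upwards [(isOpen_extChartAt_source (I := 𝓡 m) x).mem_nhds hy'] with z hz
  rw [φ.left_inv hz]

end Deriv

/-- The coordinate expression of the Lie bracket. -/
lemma mlieBracket_eq {U V : Π y : M, TangentSpace (𝓡 m) y} (x : M) :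
    (VectorField.mlieBracket (𝓡 m) U V x : Eu m) =
      VectorField.lieBracket ℝ
        (fun p ↦ coord x ((extChartAt (𝓡 m) x).symm p) (U ((extChartAt (𝓡 m) x).symm p)))
        (fun p ↦ coord x ((extChartAt (𝓡 m) x).symm p) (V ((extChartAt (𝓡 m) x).symm p)))
        (extChartAt (𝓡 m) x x) := by
  set φ := extChartAt (𝓡 m) x
  have hpb : ∀ U : Π y : M, TangentSpace (𝓡 m) y,
      (VectorField.mpullbackWithin 𝓘(ℝ, Eu m) (𝓡 m) φ.symm U (range (𝓡 m)) : Eu m → Eu m)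
        =ᶠ[𝓝 (φ x)] fun p ↦ coord x (φ.symm p) (U (φ.symm p)) := by
    intro U
    filter_upwards [(isOpen_extChartAt_target (I := 𝓡 m) x).mem_nhds
      (mem_extChartAt_target x)] with p hp
    have hp' : φ.symm p ∈ (chartAt (Eu m) x).source := by simpa [φ] using φ.map_target hp
    have hb : φ.symm p ∈ (trivializationAt (Eu m) (TangentSpace (𝓡 m) (M := M)) x).baseSet := by
      simpa using hp'
    have h := TangentBundle.symmL_trivializationAt (𝕜 := ℝ) (I := 𝓡 m) hp'
    have h1 : φ (φ.symm p) = p := φ.right_inv hp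
    let S : Eu m →L[ℝ] Eu m := fld x (φ.symm p)
    let S' : Eu m →L[ℝ] Eu m := coord x (φ.symm p)
    let e : Eu m ≃L[ℝ] Eu m := ContinuousLinearEquiv.equivOfInverse S S'
      (fun v ↦ coord_fld hp' v) (fun v ↦ fld_coord hp' v)
    let R : Eu m →L[ℝ] Eu m := mfderivWithin 𝓘(ℝ, Eu m) (𝓡 m) φ.symm (range (𝓡 m)) p
    have h2 : R = (e : Eu m →L[ℝ] Eu m) := by
      have h3 : ∀ q, q = p → (mfderivWithin 𝓘(ℝ, Eu m) (𝓡 m) φ.symm (range (𝓡 m)) q :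
        Eu m →L[ℝ] Eu m) = R := by
        rintro q rfl; rfl
      exact (h3 _ h1).symm.trans h.symm
    have h5 : ∀ u : Eu m, R.inverse u = S' u := by
      rw [h2, ContinuousLinearMap.inverse_equiv]; exact fun u ↦ rfl
    exact h5 (U (φ.symm p))
  let T : Eu m →L[ℝ] Eu m := mfderiv (𝓡 m) 𝓘(ℝ, Eu m) φ x
  have h3 : T = ContinuousLinearMap.id ℝ (Eu m) := by
    refine ContinuousLinearMap.ext fun u ↦ ?_
    exact (coord_eq_mfderiv (mem_chart_source (Eu m) x) u).symm.trans (coord_self x u)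
  have h2 : (φ.symm ⁻¹' univ ∩ range (𝓡 m)) = univ := by
    rw [ModelWithCorners.range_eq_univ]; simp
  have h4 : ∀ (v : Eu m), T.inverse v = v := by rw [h3]; simp
  let U' : Eu m → Eu m := VectorField.mpullbackWithin 𝓘(ℝ, Eu m) (𝓡 m) φ.symm U (range (𝓡 m))
  let V' : Eu m → Eu m := VectorField.mpullbackWithin 𝓘(ℝ, Eu m) (𝓡 m) φ.symm V (range (𝓡 m))
  have h1 : (VectorField.mlieBracket (𝓡 m) U V x : Eu m) =
      VectorField.lieBracketWithin ℝ U' V' (φ.symm ⁻¹' univ ∩ range (𝓡 m)) (φ x) := h4 _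
  have h5 : VectorField.lieBracketWithin ℝ U' V' (φ.symm ⁻¹' univ ∩ range (𝓡 m)) (φ x) =
      VectorField.lieBracket ℝ U' V' (φ x) := by rw [h2, VectorField.lieBracketWithin_univ]
  exact h1.trans (h5.trans ((hpb U).lieBracket_vectorField_eq (hpb V)))

lemma mlieBracket_fld (x : M) (u v : Eu m) :
    (VectorField.mlieBracket (𝓡 m) (fun y ↦ fld x y u) (fun y ↦ fld x y v) x : Eu m) = 0 := by
  rw [mlieBracket_eq]
  have h : ∀ u : Eu m, (fun p ↦ coord x ((extChartAt (𝓡 m) x).symm p)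
      (fld x ((extChartAt (𝓡 m) x).symm p) u)) =ᶠ[𝓝 (extChartAt (𝓡 m) x x)] fun _ ↦ u := by
    intro u
    filter_upwards [(isOpen_extChartAt_target (I := 𝓡 m) x).mem_nhds
      (mem_extChartAt_target x)] with p hp
    exact coord_fld (by simpa using (extChartAt (𝓡 m) x).map_target hp) u
  rw [(h u).lieBracket_vectorField_eq (h v)]
  simp [VectorField.lieBracket]
  rfl

/-- The differential of `f` in the charts at `x` and at `f x`. -/
lemma mfderiv_fld {f : N → M} {x : N} {y : N} (hy : y ∈ (chartAt (Eu n) x).source)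
    (hfy : f y ∈ (chartAt (Eu m) (f x)).source) (hf : MDifferentiableAt (𝓡 n) (𝓡 m) f y)
    (v : Eu n) :
    mfderiv (𝓡 n) (𝓡 m) f y (fld x y v) = fld (f x) (f y)
      (fderiv ℝ (writtenInExtChartAt (𝓡 n) (𝓡 m) x f) (extChartAt (𝓡 n) x y) v) := by
  rw [← fld_coord hfy (mfderiv (𝓡 n) (𝓡 m) f y (fld x y v)), coord_mfderiv hfy hf,
    mvfderiv_fld (f := fun z ↦ extChartAt (𝓡 m) (f x) (f z)) hy
      ((mdifferentiableAt_extChartAt hfy).comp y hf)]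
  rfl

section FormCalculus

variable {W : Type*} [NormedAddCommGroup W] [NormedSpace ℝ W]

lemma contDiffAt_clm_of_apply {D E : Type*} [NormedAddCommGroup D] [NormedSpace ℝ D]
    [NormedAddCommGroup E] [NormedSpace ℝ E] [FiniteDimensional ℝ E] {f : D → E →L[ℝ] W} {x : D}
    (hf : ∀ v, ContDiffAt ℝ ∞ (fun y ↦ f y v) x) : ContDiffAt ℝ ∞ f x := by
  let b := Module.finBasis ℝ E
  have h1 : f = fun y ↦ ∑ i, ContinuousLinearMap.smulRightL ℝ E W
      (LinearMap.toContinuousLinearMap (b.coord i)) (f y (b i)) := by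
    funext y
    ext v
    conv_lhs => rw [← b.sum_repr v, map_sum]
    simp
  rw [h1]
  exact ContDiffAt.sum fun i _ ↦ (ContinuousLinearMap.contDiff _).contDiffAt.comp x (hf (b i))

/-- A form on an open subset of a vector space is closed at `p`. -/
def IsClosedAt {E : Type*} [NormedAddCommGroup E] [NormedSpace ℝ E] (β : E → E →L[ℝ] E →L[ℝ] W)
    (p : E) : Prop :=
  ∀ a b c, fderiv ℝ β p a b c - fderiv ℝ β p b a c + fderiv ℝ β p c a b = 0

lemma fderiv_clm₂ {D E E' : Type*} [NormedAddCommGroup D] [NormedSpace ℝ D]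
    [NormedAddCommGroup E] [NormedSpace ℝ E] [NormedAddCommGroup E'] [NormedSpace ℝ E']
    {β : D → E →L[ℝ] E' →L[ℝ] W} {U : D → E} {V : D → E'}
    {p : D} (hβ : DifferentiableAt ℝ β p) (hU : DifferentiableAt ℝ U p)
    (hV : DifferentiableAt ℝ V p) (v : D) :
    fderiv ℝ (fun q ↦ β q (U q) (V q)) p v =
      fderiv ℝ β p v (U p) (V p) + β p (fderiv ℝ U p v) (V p) + β p (U p) (fderiv ℝ V p v) := by
  have h := (hβ.hasFDerivAt.clm_apply hU.hasFDerivAt).clm_apply hV.hasFDerivAt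
  rw [h.fderiv]
  simp
  abel

/-- The pull back of closed forms. -/
lemma IsClosedAt.pullback {D E : Type*} [NormedAddCommGroup D] [NormedSpace ℝ D]
    [NormedAddCommGroup E] [NormedSpace ℝ E] {β : E → E →L[ℝ] E →L[ℝ] W} {f : D → E} {p : D}
    (hβ : IsClosedAt β (f p)) (hβd : DifferentiableAt ℝ β (f p))
    (halt : ∀ v, β (f p) v v = 0) (hf : ContDiffAt ℝ ∞ f p)
    {γ : D → D →L[ℝ] D →L[ℝ] W}
    (hγ : ∀ᶠ q in 𝓝 p, ∀ a b, γ q a b = β (f q) (fderiv ℝ f q a) (fderiv ℝ f q b))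
    (hγd : DifferentiableAt ℝ γ p) : IsClosedAt γ p := by
  have hfd : DifferentiableAt ℝ f p := hf.differentiableAt (by simp)
  have hf2 : DifferentiableAt ℝ (fderiv ℝ f) p :=
    (hf.fderiv_right (m := 1) (WithTop.coe_le_coe.2 le_top)).differentiableAt (by simp)
  have hsymm : ∀ a b, fderiv ℝ (fderiv ℝ f) p a b = fderiv ℝ (fderiv ℝ f) p b a := fun a b ↦
    (hf.isSymmSndFDerivAt (by
      simp only [minSmoothness_of_isRCLikeNormedField]; exact WithTop.coe_le_coe.2 le_top)).eq a b
  have hswap : ∀ u v, β (f p) u v = - β (f p) v u := by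
    intro u v
    have h := halt (u + v)
    simp only [map_add, add_apply, halt, zero_add, add_zero] at h
    exact eq_neg_of_add_eq_zero_right h
  have key : ∀ a b c, fderiv ℝ γ p a b c =
      fderiv ℝ β (f p) (fderiv ℝ f p a) (fderiv ℝ f p b) (fderiv ℝ f p c)
        + β (f p) (fderiv ℝ (fderiv ℝ f) p a b) (fderiv ℝ f p c)
        + β (f p) (fderiv ℝ f p b) (fderiv ℝ (fderiv ℝ f) p a c) := by
    intro a b c
    have h1 : fderiv ℝ (fun q ↦ γ q b c) p a = fderiv ℝ γ p a b c := by
      have := fderiv_clm₂ hγd (differentiableAt_const b) (differentiableAt_const c) a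
      simpa using this
    have h2 : (fun q ↦ γ q b c) =ᶠ[𝓝 p]
        fun q ↦ β (f q) (fderiv ℝ f q b) (fderiv ℝ f q c) := by
      filter_upwards [hγ] with q hq using hq b c
    have hd : ∀ b, DifferentiableAt ℝ (fun q ↦ fderiv ℝ f q b) p := fun b ↦
      hf2.clm_apply (differentiableAt_const b)
    have hd' : ∀ b, fderiv ℝ (fun q ↦ fderiv ℝ f q b) p a = fderiv ℝ (fderiv ℝ f) p a b := by
      intro b
      rw [(hf2.hasFDerivAt.clm_apply (hasFDerivAt_const b p)).fderiv]
      simp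
    have h3 : fderiv ℝ (fun q ↦ β (f q)) p a = fderiv ℝ β (f p) (fderiv ℝ f p a) := by
      have := (HasFDerivAt.comp (g := β) (f := f) p hβd.hasFDerivAt hfd.hasFDerivAt).fderiv
      exact congrArg (fun T ↦ T a) this
    rw [← h1, h2.fderiv_eq, fderiv_clm₂ (β := fun q ↦ β (f q)) (DifferentiableAt.comp (g := β) p hβd hfd) (hd b) (hd c),
      hd', hd']
    rw [h3]
  intro a b c
  rw [key, key, key, hsymm b a, hsymm c a, hsymm c b,
    hswap (fderiv ℝ f p b) (fderiv ℝ (fderiv ℝ f) p a c)]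
  have h := hβ (fderiv ℝ f p a) (fderiv ℝ f p b) (fderiv ℝ f p c)
  rw [← h]
  abel

/-- The expression of a form in the preferred chart at `x`. -/
def formIn (Ω : TwoForm m M W) (x : M) (p : Eu m) : Eu m →L[ℝ] Eu m →L[ℝ] W :=
  LinearMap.toContinuousLinearMap (LinearMap.toContinuousLinearMap.toLinearMap ∘ₗ
    (Ω ((extChartAt (𝓡 m) x).symm p)).compl₁₂ (fld x ((extChartAt (𝓡 m) x).symm p)).toLinearMap
      (fld x ((extChartAt (𝓡 m) x).symm p)).toLinearMap)

lemma formIn_apply (Ω : TwoForm m M W) (x : M) (p a b : Eu m) :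
    formIn Ω x p a b = Ω ((extChartAt (𝓡 m) x).symm p) (fld x ((extChartAt (𝓡 m) x).symm p) a)
      (fld x ((extChartAt (𝓡 m) x).symm p) b) := rfl

lemma form_eq_formIn (Ω : TwoForm m M W) {x y : M} (hy : y ∈ (chartAt (Eu m) x).source)
    (u v : TangentSpace (𝓡 m) y) :
    Ω y u v = formIn Ω x (extChartAt (𝓡 m) x y) (coord x y u) (coord x y v) := by
  rw [formIn_apply]
  have h : ∀ z, z = y → Ω z (fld x z (coord x y u)) (fld x z (coord x y v)) = Ω y u v := by
    rintro z rfl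
    rw [fld_coord hy, fld_coord hy]
  exact (h _ ((extChartAt (𝓡 m) x).left_inv (by simpa using hy))).symm

lemma IsClosedForm.contDiffAt_formIn {Ω : TwoForm m M W} (hΩ : IsClosedForm Ω) {x y : M}
    (hy : y ∈ (chartAt (Eu m) x).source) :
    ContDiffAt ℝ ∞ (formIn Ω x) (extChartAt (𝓡 m) x y) := by
  refine contDiffAt_clm_of_apply fun a ↦ contDiffAt_clm_of_apply fun b ↦ ?_
  exact contDiffAt_comp_extChartAt_symm hy
    (hΩ.smooth y _ _ (smoothFieldAt_fld hy a) (smoothFieldAt_fld hy b))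

lemma mvfderiv_form_fld {Ω : TwoForm m M W} {x : M}
    (hd : DifferentiableAt ℝ (formIn Ω x) (extChartAt (𝓡 m) x x))
    (hs : ∀ b c, ContMDiffAt (𝓡 m) 𝓘(ℝ, W) ∞ (fun y ↦ Ω y (fld x y b) (fld x y c)) x)
    (a b c : Eu m) :
    mvfderiv (𝓡 m) (fun y ↦ Ω y (fld x y b) (fld x y c)) x (fld x x a) =
      fderiv ℝ (formIn Ω x) (extChartAt (𝓡 m) x x) a b c := by
  rw [mvfderiv_fld (f := fun y ↦ Ω y (fld x y b) (fld x y c)) (mem_chart_source _ x)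
    ((hs b c).mdifferentiableAt (by simp))]
  have h := fderiv_clm₂ hd (differentiableAt_const b) (differentiableAt_const c) a
  refine Eq.trans h ?_
  simp

lemma IsClosedForm.isClosedAt {Ω : TwoForm m M W} (hΩ : IsClosedForm Ω) (x : M) :
    IsClosedAt (formIn Ω x) (extChartAt (𝓡 m) x x) := by
  intro a b c
  have hx := mem_chart_source (Eu m) x
  have hd := (hΩ.contDiffAt_formIn hx).differentiableAt (by simp)
  have hs : ∀ b c, ContMDiffAt (𝓡 m) 𝓘(ℝ, W) ∞ (fun y ↦ Ω y (fld x y b) (fld x y c)) x :=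
    fun b c ↦ hΩ.smooth x _ _ (smoothFieldAt_fld hx b) (smoothFieldAt_fld hx c)
  have h := hΩ.closed x _ _ _ (smoothFieldAt_fld hx a) (smoothFieldAt_fld hx b)
    (smoothFieldAt_fld hx c)
  have hb : ∀ a b c : Eu m, Ω x (VectorField.mlieBracket (𝓡 m) (fun y ↦ fld x y a)
      (fun y ↦ fld x y b) x) (fld x x c) = 0 := by
    intro a b c
    have h1 : VectorField.mlieBracket (𝓡 m) (fun y ↦ fld x y a) (fun y ↦ fld x y b) x = 0 :=
      mlieBracket_fld x a b
    rw [h1]; simp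
  rw [hb, hb, hb, mvfderiv_form_fld hd hs, mvfderiv_form_fld hd hs, mvfderiv_form_fld hd hs] at h
  simpa using h

/-- Closed forms are recognized in charts. -/
lemma isClosedForm_of_formIn {Ω : TwoForm m M W}
    (halt : ∀ (x : M) (v : TangentSpace (𝓡 m) x), Ω x v v = 0)
    (hsm : ∀ x, ContDiffAt ℝ ∞ (formIn Ω x) (extChartAt (𝓡 m) x x))
    (hcl : ∀ x, IsClosedAt (formIn Ω x) (extChartAt (𝓡 m) x x)) : IsClosedForm Ω := by
  have hsmooth : ∀ (x : M) (U V : Π y : M, TangentSpace (𝓡 m) y), SmoothFieldAt U x →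
      SmoothFieldAt V x → ContMDiffAt (𝓡 m) 𝓘(ℝ, W) ∞ (fun y ↦ Ω y (U y) (V y)) x := by
    intro x U V hU hV
    have hx := mem_chart_source (Eu m) x
    rw [smoothFieldAt_iff hx] at hU hV
    have h1 : ContMDiffAt (𝓡 m) 𝓘(ℝ, Eu m →L[ℝ] Eu m →L[ℝ] W) ∞
        (fun y ↦ formIn Ω x (extChartAt (𝓡 m) x y)) x :=
      ContMDiffAt.comp (g := formIn Ω x) x (hsm x).contMDiffAt (contMDiffAt_extChartAt' hx)
    refine ((h1.clm_apply hU).clm_apply hV).congr_of_eventuallyEq ?_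
    filter_upwards [(chartAt (Eu m) x).open_source.mem_nhds hx] with y hy
    exact form_eq_formIn Ω hy _ _
  refine ⟨halt, hsmooth, fun x U V T hU hV hT ↦ ?_⟩
  have hx := mem_chart_source (Eu m) x
  set φ := extChartAt (𝓡 m) x
  have hd := (hsm x).differentiableAt (by simp)
  let co (U : Π y : M, TangentSpace (𝓡 m) y) : Eu m → Eu m :=
    fun p ↦ coord x (φ.symm p) (U (φ.symm p))
  have hco : ∀ U : Π y : M, TangentSpace (𝓡 m) y, SmoothFieldAt U x →
      DifferentiableAt ℝ (co U) (φ x) := fun U hU ↦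
    (contDiffAt_comp_extChartAt_symm hx ((smoothFieldAt_iff hx).1 hU)).differentiableAt (by simp)
  have hφx : φ.symm (φ x) = x := φ.left_inv (mem_extChartAt_source x)
  have hco0 : ∀ U : Π y : M, TangentSpace (𝓡 m) y, co U (φ x) = (U x : Eu m) := by
    intro U
    have : ∀ z, z = x → (coord x z (U z) : Eu m) = U x := by
      rintro z rfl; exact coord_self z _
    exact this _ hφx
  let β := formIn Ω x
  have hβ0 : ∀ u v : Eu m, β (φ x) u v = Ω x u v := by
    intro u v
    have h := form_eq_formIn Ω hx (u : TangentSpace (𝓡 m) x) (v : TangentSpace (𝓡 m) x)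
    have e1 : coord x x (u : TangentSpace (𝓡 m) x) = u := coord_self x u
    have e2 : coord x x (v : TangentSpace (𝓡 m) x) = v := coord_self x v
    rw [e1, e2] at h
    exact h.symm
  have hder : ∀ U V T : Π y : M, TangentSpace (𝓡 m) y, SmoothFieldAt V x → SmoothFieldAt T x →
      mvfderiv (𝓡 m) (fun y ↦ Ω y (V y) (T y)) x (U x) =
        fderiv ℝ β (φ x) (co U (φ x)) (co V (φ x)) (co T (φ x))
        + β (φ x) (fderiv ℝ (co V) (φ x) (co U (φ x))) (co T (φ x))
        + β (φ x) (co V (φ x)) (fderiv ℝ (co T) (φ x) (co U (φ x))) := by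
    intro U V T hV hT
    have h1 := mvfderiv_fld (f := fun y ↦ Ω y (V y) (T y)) hx
      ((hsmooth x V T hV hT).mdifferentiableAt (by simp)) (co U (φ x))
    have h2 : fld x x (co U (φ x)) = U x := by
      rw [hco0]; exact fld_self x (U x)
    rw [h2] at h1
    rw [h1, ← fderiv_clm₂ hd (hco V hV) (hco T hT)]
    congr 1
    refine Filter.EventuallyEq.fderiv_eq ?_
    filter_upwards [(isOpen_extChartAt_target (I := 𝓡 m) x).mem_nhds
      (mem_extChartAt_target x)] with p hp
    have hp' : φ.symm p ∈ (chartAt (Eu m) x).source := by simpa [φ] using φ.map_target hp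
    have h3 := form_eq_formIn Ω hp' (V (φ.symm p)) (T (φ.symm p))
    have h4 : φ (φ.symm p) = p := φ.right_inv hp
    rw [h3]
    change formIn Ω x (φ (φ.symm p)) _ _ = _
    rw [h4]
  have hbr : ∀ U V T : Π y : M, TangentSpace (𝓡 m) y,
      Ω x (VectorField.mlieBracket (𝓡 m) U V x) (T x) =
        β (φ x) (fderiv ℝ (co V) (φ x) (co U (φ x))) (co T (φ x))
        - β (φ x) (fderiv ℝ (co U) (φ x) (co V (φ x))) (co T (φ x)) := by
    intro U V T
    have h1 : (VectorField.mlieBracket (𝓡 m) U V x : Eu m) =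
      fderiv ℝ (co V) (φ x) (co U (φ x)) - fderiv ℝ (co U) (φ x) (co V (φ x)) := mlieBracket_eq x
    have h2 := hβ0 (VectorField.mlieBracket (𝓡 m) U V x) (T x)
    rw [h1, ← hco0 T, map_sub, sub_apply] at h2
    rw [h2, ← h1, hco0 T]
  have hswap : ∀ u v, β (φ x) u v = - β (φ x) v u := by
    intro u v
    have halt' : ∀ v, β (φ x) v v = 0 := fun v ↦ (hβ0 v v).trans (halt x v)
    have h := halt' (u + v)
    simp only [map_add, add_apply, halt', zero_add, add_zero] at h
    exact eq_neg_of_add_eq_zero_right h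
  rw [hder U V T hV hT, hder V U T hU hT, hder T U V hU hV, hbr U V T, hbr U T V, hbr V T U]
  have h := hcl x (co U (φ x)) (co V (φ x)) (co T (φ x))
  rw [hswap (co V (φ x)) (fderiv ℝ (co T) (φ x) (co U (φ x))),
    hswap (co U (φ x)) (fderiv ℝ (co T) (φ x) (co V (φ x))),
    hswap (co U (φ x)) (fderiv ℝ (co V) (φ x) (co T (φ x))), ← h]
  abel

/-- A form which locally is a pull back of a closed form is closed. -/
theorem isClosedForm_of_local_pullback {α : TwoForm n N W} {Ω : TwoForm m M W}
    (hΩ : IsClosedForm Ω)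
    (h : ∀ x : N, ∃ (f : N → M) (O : Set N), IsOpen O ∧ x ∈ O ∧ ContMDiffOn (𝓡 n) (𝓡 m) ∞ f O ∧
      ∀ y ∈ O, ∀ u v : TangentSpace (𝓡 n) y,
        α y u v = Ω (f y) (mfderiv (𝓡 n) (𝓡 m) f y u) (mfderiv (𝓡 n) (𝓡 m) f y v)) :
    IsClosedForm α := by
  have key : ∀ x, ContDiffAt ℝ ∞ (formIn α x) (extChartAt (𝓡 n) x x) ∧
      IsClosedAt (formIn α x) (extChartAt (𝓡 n) x x) := by
    intro x
    obtain ⟨f, O, hO, hx, hf, hα⟩ := h x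
    obtain ⟨hDo, hfl⟩ := contDiffOn_writtenInExtChartAt x hO hf
    set φ := extChartAt (𝓡 n) x
    set fl := writtenInExtChartAt (𝓡 n) (𝓡 m) x f
    set D := φ.target ∩ φ.symm ⁻¹' (O ∩ f ⁻¹' (extChartAt (𝓡 m) (f x)).source)
    have hxD : φ x ∈ D := by
      refine ⟨mem_extChartAt_target x, ?_⟩
      simp [φ, hx]
    have hflx : fl (φ x) = extChartAt (𝓡 m) (f x) (f x) := by
      simp [fl, φ, writtenInExtChartAt]
    have hfx : ContDiffAt ℝ ∞ fl (φ x) := hfl.contDiffAt (hDo.mem_nhds hxD)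
    have hββ : ContDiffAt ℝ ∞ (formIn Ω (f x)) (fl (φ x)) := by
      rw [hflx]; exact hΩ.contDiffAt_formIn (mem_chart_source _ _)
    have hform : ∀ᶠ q in 𝓝 (φ x), ∀ a b, formIn α x q a b =
        formIn Ω (f x) (fl q) (fderiv ℝ fl q a) (fderiv ℝ fl q b) := by
      filter_upwards [hDo.mem_nhds hxD] with q hq a b
      have hy : φ.symm q ∈ (chartAt (Eu n) x).source := by simpa [φ] using φ.map_target hq.1
      have hfy : f (φ.symm q) ∈ (chartAt (Eu m) (f x)).source := by simpa using hq.2.2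
      have hfd : MDifferentiableAt (𝓡 n) (𝓡 m) f (φ.symm q) :=
        (hf.contMDiffAt (hO.mem_nhds hq.2.1)).mdifferentiableAt (by simp)
      have hq' : φ (φ.symm q) = q := φ.right_inv hq.1
      rw [formIn_apply, hα _ hq.2.1, mfderiv_fld hy hfy hfd, mfderiv_fld hy hfy hfd,
        form_eq_formIn Ω hfy, coord_fld hfy, coord_fld hfy]
      change formIn Ω (f x) _ (fderiv ℝ fl (φ (φ.symm q)) a) (fderiv ℝ fl (φ (φ.symm q)) b) = _
      rw [hq']
      rfl
    have hsm : ContDiffAt ℝ ∞ (formIn α x) (φ x) := by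
      refine contDiffAt_clm_of_apply fun a ↦ contDiffAt_clm_of_apply fun b ↦ ?_
      have h1 : ContDiffAt ℝ ∞ (fderiv ℝ fl) (φ x) := hfx.fderiv_right (by simp)
      refine (((hββ.comp (φ x) hfx).clm_apply (h1.clm_apply (contDiffAt_const (c := a)))).clm_apply
        (h1.clm_apply (contDiffAt_const (c := b)))).congr_of_eventuallyEq ?_
      filter_upwards [hform] with q hq using hq a b
    refine ⟨hsm, IsClosedAt.pullback (f := fl) (β := formIn Ω (f x)) ?_
      (hββ.differentiableAt (by simp)) ?_ hfx hform (hsm.differentiableAt (by simp))⟩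
    · rw [hflx]; exact hΩ.isClosedAt (f x)
    · intro v; exact hΩ.alternating _ _
  refine isClosedForm_of_formIn (fun x v ↦ ?_) (fun x ↦ (key x).1) (fun x ↦ (key x).2)
  obtain ⟨f, O, hO, hx, hf, hα⟩ := h x
  rw [hα x hx]; exact hΩ.alternating _ _

end FormCalculus

end Frames

end

section

section Kernels

/-- Kernels of a smooth family of linear maps, of locally constant dimension, are spanned by smooth
sections. -/
lemma exists_kernel_frame {D E W : Type*} [NormedAddCommGroup D] [NormedSpace ℝ D]
    [NormedAddCommGroup E] [NormedSpace ℝ E] [FiniteDimensional ℝ E] [NormedAddCommGroup W]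
    [NormedSpace ℝ W] [FiniteDimensional ℝ W] {β : D → E →L[ℝ] W} {U : Set D} (hU : IsOpen U)
    (hβ : ContDiffOn ℝ ∞ β U) {p : D} (hp : p ∈ U) :
    ∃ (e : Fin (Module.finrank ℝ (LinearMap.ker (β p).toLinearMap)) → D → E) (O : Set D),
      IsOpen O ∧ p ∈ O ∧ O ⊆ U ∧ (∀ i, ContDiffOn ℝ ∞ (e i) O) ∧
      ∀ q ∈ O, LinearIndependent ℝ (fun i ↦ e i q) ∧
        LinearMap.ker (β q).toLinearMap ≤ Submodule.span ℝ (range fun i ↦ e i q) := by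
  obtain ⟨S, hS⟩ := (LinearMap.ker (β p).toLinearMap).exists_isCompl
  have hinj : LinearMap.ker ((β p).toLinearMap ∘ₗ S.subtype) = ⊥ := by
    rw [LinearMap.ker_eq_bot']
    intro s hs
    have : (s : E) ∈ LinearMap.ker (β p).toLinearMap ⊓ S := ⟨hs, s.2⟩
    rw [hS.inf_eq_bot] at this
    exact Subtype.ext this
  obtain ⟨L, hL⟩ := LinearMap.exists_leftInverse_of_injective _ hinj
  let P : W →L[ℝ] E := LinearMap.toContinuousLinearMap (S.subtype ∘ₗ L)
  have hP : ∀ v, β p (P (β p v)) = β p v := by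
    intro v
    obtain ⟨k, hk, s, hs, rfl⟩ := Submodule.mem_sup.1
      ((hS.sup_eq_top ▸ Submodule.mem_top : v ∈ LinearMap.ker (β p).toLinearMap ⊔ S))
    have hk' : β p k = 0 := hk
    have h1 : L (β p s) = ⟨s, hs⟩ := congrArg (fun T ↦ T (⟨s, hs⟩ : S)) hL
    rw [map_add, hk', zero_add]
    change β p ((L (β p s) : S) : E) = _
    rw [h1]
  let Θ : D → E →L[ℝ] E := fun q ↦ ContinuousLinearMap.id ℝ E + P.comp (β q - β p)
  have hΘ : ContDiffOn ℝ ∞ Θ U :=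
    contDiffOn_const.add (contDiffOn_const.clm_comp (hβ.sub contDiffOn_const))
  have hΘp : Θ p = ContinuousLinearMap.id ℝ E := by simp [Θ]
  let O : Set D := U ∩ Θ ⁻¹' (range ((↑) : (E ≃L[ℝ] E) → E →L[ℝ] E))
  have hO : IsOpen O := hΘ.continuousOn.isOpen_inter_preimage hU ContinuousLinearEquiv.isOpen
  let b := Module.finBasis ℝ (LinearMap.ker (β p).toLinearMap)
  refine ⟨fun i q ↦ (Θ q).inverse (b i), O, hO, ⟨hp, ContinuousLinearEquiv.refl ℝ E, hΘp.symm⟩,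
    inter_subset_left, fun i q hq ↦ ?_, fun q hq ↦ ?_⟩
  · obtain ⟨T, hT⟩ := hq.2
    have h1 : ContDiffAt ℝ ∞ Θ q := hΘ.contDiffAt (hU.mem_nhds hq.1)
    have h2 : ContDiffAt ℝ ∞ (ContinuousLinearMap.inverse : (E →L[ℝ] E) → E →L[ℝ] E) (Θ q) := by
      rw [← hT]; exact contDiffAt_map_inverse T
    exact ((h2.comp q h1).clm_apply contDiffAt_const).contDiffWithinAt
  · obtain ⟨T, hT⟩ := hq.2
    have h1 : (fun i ↦ (Θ q).inverse (b i : E)) =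
        (T.symm.toLinearEquiv.toLinearMap ∘ₗ Submodule.subtype _) ∘ b := by
      funext i; rw [← hT, ContinuousLinearMap.inverse_equiv]; rfl
    simp only [h1]
    refine ⟨b.linearIndependent.map' _ ?_, ?_⟩
    · rw [LinearMap.ker_eq_bot]
      exact T.symm.injective.comp Subtype.val_injective
    · rw [range_comp, Submodule.span_image, b.span_eq]
      intro v hv
      have hv' : β q v = 0 := hv
      have h2 : Θ q v = v - P (β p v) := by
        change v + P (β q v - β p v) = _
        rw [hv', zero_sub, map_neg, sub_eq_add_neg]
      have h3 : Θ q v ∈ LinearMap.ker (β p).toLinearMap := by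
        rw [h2, LinearMap.mem_ker]
        change β p _ = 0
        rw [map_sub, hP, sub_self]
      refine ⟨⟨Θ q v, h3⟩, Submodule.mem_top, ?_⟩
      change T.symm (Θ q v) = v
      rw [← hT]; exact T.symm_apply_apply v

variable {m : ℕ} {M : Type*} [TopologicalSpace M] [ChartedSpace (EuclideanSpace ℝ (Fin m)) M]
  [IsManifold (𝓡 m) ∞ M]

lemma finrank_radical_eq (Ω : TwoForm m M ℂ) {x y : M} (hy : y ∈ (chartAt (Eu m) x).source) :
    LinearMap.ker (formIn Ω x (extChartAt (𝓡 m) x y)).toLinearMap =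
      (radical Ω y).comap (fld x y).toLinearMap := by
  ext v
  simp only [LinearMap.mem_ker, Submodule.mem_comap, radical]
  constructor
  · intro h
    ext u
    have h1 := form_eq_formIn Ω hy (fld x y v) u
    rw [coord_fld hy] at h1
    have h2 : formIn Ω x (extChartAt (𝓡 m) x y) v = 0 := h
    rw [h2] at h1
    exact h1
  · intro h
    refine ContinuousLinearMap.ext fun u ↦ ?_
    have h1 := form_eq_formIn Ω hy (fld x y v) (fld x y u)
    rw [coord_fld hy, coord_fld hy] at h1
    have h2 : Ω y (fld x y v) = 0 := h
    rw [h2] at h1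
    exact h1.symm

/-- The radical of a smooth form of locally constant rank is a subbundle. -/
theorem isSubbundle_radical {Ω : TwoForm m M ℂ} (hΩ : IsClosedForm Ω)
    (hr : ∀ x, ∀ᶠ y in 𝓝 x, Module.finrank ℝ (radical Ω y) = Module.finrank ℝ (radical Ω x)) :
    IsSubbundle (radical Ω) := by
  intro x
  set φ := extChartAt (𝓡 m) x
  have hx := mem_chart_source (Eu m) x
  have hsm : ContDiffOn ℝ ∞ (formIn Ω x) φ.target := by
    intro p hp
    have h1 : φ.symm p ∈ (chartAt (Eu m) x).source := by simpa [φ] using φ.map_target hp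
    have h2 := hΩ.contDiffAt_formIn h1
    rw [φ.right_inv hp] at h2
    exact h2.contDiffWithinAt
  have hker : ∀ y ∈ (chartAt (Eu m) x).source,
      (LinearMap.ker (formIn Ω x (φ y)).toLinearMap).map (fld x y).toLinearMap = radical Ω y := by
    intro y hy
    rw [finrank_radical_eq Ω hy]
    exact Submodule.map_comap_eq_of_surjective (fun u ↦ ⟨coord x y u, fld_coord hy u⟩) _
  have hfinj : ∀ y ∈ (chartAt (Eu m) x).source, Function.Injective (fld x y) := fun y hy u v h ↦ by
    rw [← coord_fld hy u, h, coord_fld hy]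
  have hrank : ∀ y ∈ (chartAt (Eu m) x).source,
      Module.finrank ℝ (LinearMap.ker (formIn Ω x (φ y)).toLinearMap) =
        Module.finrank ℝ (radical Ω y) := by
    intro y hy
    rw [← hker y hy]
    exact (LinearEquiv.finrank_eq (Submodule.equivMapOfInjective _ (hfinj y hy) _))
  obtain ⟨e, O, hO, hpO, hOU, he, hspan⟩ := exists_kernel_frame (isOpen_extChartAt_target x) hsm
    (mem_extChartAt_target x)
  obtain ⟨O', hO'sub, hO', hxO'⟩ := eventually_nhds_iff.1 (hr x)
  refine ⟨_, fun i y ↦ fld x y (e i (φ y)), (φ.source ∩ φ ⁻¹' O) ∩ O', ?_, ?_, ?_⟩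
  · exact ((continuousOn_extChartAt x).isOpen_inter_preimage (isOpen_extChartAt_source x) hO).inter
      hO'
  · exact ⟨⟨mem_extChartAt_source x, hpO⟩, hxO'⟩
  · rintro y ⟨⟨hyφ, hyO⟩, hyO'⟩
    have hy : y ∈ (chartAt (Eu m) x).source := by simpa [φ] using hyφ
    refine ⟨fun i ↦ ?_, ?_, ?_⟩
    · rw [smoothFieldAt_iff hy]
      have h1 : ContMDiffAt (𝓡 m) 𝓘(ℝ, Eu m) ∞ (fun y ↦ e i (φ y)) y :=
        ContMDiffAt.comp (g := e i) y ((he i).contDiffAt (hO.mem_nhds hyO)).contMDiffAt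
          (contMDiffAt_extChartAt' hy)
      refine h1.congr_of_eventuallyEq ?_
      filter_upwards [(chartAt (Eu m) x).open_source.mem_nhds hy] with z hz
      exact coord_fld hz _
    · exact (hspan (φ y) hyO).1.map' (fld x y).toLinearMap (LinearMap.ker_eq_bot.2 (hfinj y hy))
    · have h1 : (range fun i ↦ fld x y (e i (φ y))) =
          (fld x y).toLinearMap '' (range fun i ↦ e i (φ y)) := by
        rw [← range_comp]; rfl
      rw [h1, Submodule.span_image, ← hker y hy]
      congr 1
      refine (Submodule.eq_of_le_of_finrank_eq (hspan (φ y) hyO).2 ?_).symm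
      rw [finrank_span_eq_card (hspan (φ y) hyO).1, hrank y hy, hO'sub y hyO', ← hrank x hx]
      exact (Fintype.card_fin _).symm

lemma IsSubbundle.eventually_finrank_eq {D : Π x : M, Submodule ℝ (TangentSpace (𝓡 m) x)}
    (hD : IsSubbundle D) (x : M) :
    ∀ᶠ y in 𝓝 x, Module.finrank ℝ (D y) = Module.finrank ℝ (D x) := by
  obtain ⟨d, e, O, hO, hxO, h⟩ := hD x
  filter_upwards [hO.mem_nhds hxO] with y hy
  rw [← (h y hy).2.2, ← (h x hxO).2.2, finrank_span_eq_card (h y hy).2.1,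
    finrank_span_eq_card (h x hxO).2.1]

end Kernels

end

section

section Calculus

variable {n : ℕ} {N : Type*}
  [TopologicalSpace N] [ChartedSpace (EuclideanSpace ℝ (Fin n)) N] [IsManifold (𝓡 n) ∞ N]
  {V W : Type*} [NormedAddCommGroup V] [NormedSpace ℝ V] [NormedAddCommGroup W] [NormedSpace ℝ W]

lemma mvfderiv_eq_fderiv_comp {f : N → W} {y : N} (hf : MDifferentiableAt (𝓡 n) 𝓘(ℝ, W) f y)
    (u : TangentSpace (𝓡 n) y) :
    mvfderiv (𝓡 n) f y u =
      fderiv ℝ (fun p ↦ f ((extChartAt (𝓡 n) y).symm p)) (extChartAt (𝓡 n) y y) (u : Eu n) := by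
  exact (congrArg (mvfderiv (𝓡 n) f y) (fld_self y u).symm).trans
    (mvfderiv_fld (mem_chart_source _ y) hf u)

lemma differentiableAt_comp_extChartAt_symm {f : N → W} {y : N}
    (hf : MDifferentiableAt (𝓡 n) 𝓘(ℝ, W) f y) :
    DifferentiableAt ℝ (fun p ↦ f ((extChartAt (𝓡 n) y).symm p)) (extChartAt (𝓡 n) y y) := by
  have h := (mdifferentiableAt_iff _ _).1 hf
  have h2 := h.2
  rw [ModelWithCorners.range_eq_univ, differentiableWithinAt_univ] at h2
  exact h2

lemma mvfderiv_clm_apply {T : N → V →L[ℝ] W} {w : N → V} {y : N}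
    (hT : MDifferentiableAt (𝓡 n) 𝓘(ℝ, V →L[ℝ] W) T y)
    (hw : MDifferentiableAt (𝓡 n) 𝓘(ℝ, V) w y) (u : TangentSpace (𝓡 n) y) :
    mvfderiv (𝓡 n) (fun z ↦ T z (w z)) y u =
      mvfderiv (𝓡 n) T y u (w y) + T y (mvfderiv (𝓡 n) w y u) := by
  have hTw : MDifferentiableAt (𝓡 n) 𝓘(ℝ, W) (fun z ↦ T z (w z)) y := hT.clm_apply hw
  have e : (extChartAt (𝓡 n) y).symm (extChartAt (𝓡 n) y y) = y := extChartAt_to_inv y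
  rw [mvfderiv_eq_fderiv_comp hTw, mvfderiv_eq_fderiv_comp hT, mvfderiv_eq_fderiv_comp hw,
    fderiv_clm_apply (differentiableAt_comp_extChartAt_symm hT)
      (differentiableAt_comp_extChartAt_symm hw)]
  rw [e]
  exact add_comm _ _

lemma mvfderiv_fun_add {f g : N → W} {y : N} (hf : MDifferentiableAt (𝓡 n) 𝓘(ℝ, W) f y)
    (hg : MDifferentiableAt (𝓡 n) 𝓘(ℝ, W) g y) (u : TangentSpace (𝓡 n) y) :
    mvfderiv (𝓡 n) (fun z ↦ f z + g z) y u = mvfderiv (𝓡 n) f y u + mvfderiv (𝓡 n) g y u := by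
  have h := mvfderiv_add hf hg
  exact congrArg (fun T : TangentSpace (𝓡 n) y →L[ℝ] W ↦ T u) h

lemma mvfderiv_const_apply (c : W) (y : N) (u : TangentSpace (𝓡 n) y) :
    mvfderiv (𝓡 n) (fun _ : N ↦ c) y u = 0 := by
  have h := mvfderiv_eq_fderiv_comp (f := fun _ : N ↦ c) (y := y) mdifferentiableAt_const u
  rw [h, fderiv_fun_const]
  rfl

end Calculus

namespace HermitianBundle

variable {m n : ℕ} {F : Type u} [NormedAddCommGroup F] [NormedSpace ℂ F]
  {M : Type v} [TopologicalSpace M] [ChartedSpace (EuclideanSpace ℝ (Fin m)) M]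
  [IsManifold (𝓡 m) ∞ M] (E : HermitianBundle.{u, v, w} m F M)
  {N : Type*} [TopologicalSpace N] [ChartedSpace (EuclideanSpace ℝ (Fin n)) N]
  [IsManifold (𝓡 n) ∞ N]

/-- The domain of the preferred trivialization of `E` at `x`. -/
def dom (x : M) : Set M := (trivializationAt F E.Fib x).baseSet

/-- The inverse at `y` of the preferred trivialization of `E` at `x`. -/
def frame (x y : M) : F →L[ℝ] E.Fib y := (trivializationAt F E.Fib x).symmL ℝ y

/-- The preferred trivialization of `E` at `x`, on the fibre at `y`. -/
def comps (x y : M) : E.Fib y →L[ℝ] F := (trivializationAt F E.Fib x).continuousLinearMapAt ℝ y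

lemma isOpen_dom (x : M) : IsOpen (E.dom x) := (trivializationAt F E.Fib x).open_baseSet

lemma mem_dom (x : M) : x ∈ E.dom x := FiberBundle.mem_baseSet_trivializationAt' x

variable {E}

lemma frame_comps {x y : M} (hy : y ∈ E.dom x) (e : E.Fib y) : E.frame x y (E.comps x y e) = e :=
  (trivializationAt F E.Fib x).symmL_continuousLinearMapAt (R := ℝ) hy e

lemma comps_frame {x y : M} (hy : y ∈ E.dom x) (f : F) : E.comps x y (E.frame x y f) = f :=
  (trivializationAt F E.Fib x).continuousLinearMapAt_symmL (R := ℝ) hy f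

lemma comps_apply {x y : M} (hy : y ∈ E.dom x) (e : E.Fib y) :
    E.comps x y e = (trivializationAt F E.Fib x ⟨y, e⟩).2 :=
  (trivializationAt F E.Fib x).continuousLinearMapAt_apply_of_mem ℝ hy e

lemma frame_eq_symmₗ (x y : M) (f : F) :
    E.frame x y f = (trivializationAt F E.Fib x).symmₗ ℂ y f := by
  by_cases hy : y ∈ (trivializationAt F E.Fib x).baseSet
  · rw [frame, Bundle.Trivialization.symmL_apply _ hy, Bundle.Trivialization.symmₗ_apply _ hy]
  · rw [frame, Bundle.Trivialization.symmL_apply_of_notMem _ hy,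
      Bundle.Trivialization.symmₗ_apply_of_notMem _ hy]

lemma frame_smul (x y : M) (c : ℂ) (f : F) : E.frame x y (c • f) = c • E.frame x y f := by
  rw [frame_eq_symmₗ, frame_eq_symmₗ, map_smul]

lemma comps_smul {x y : M} (hy : y ∈ E.dom x) (c : ℂ) (e : E.Fib y) :
    E.comps x y (c • e) = c • E.comps x y e := by
  rw [comps_apply hy, comps_apply hy]
  exact (Bundle.Trivialization.linear ℂ (trivializationAt F E.Fib x) hy).map_smul c e

lemma localExt_eq {x : M} (e : E.Fib x) (y : M) :
    localExt ℂ F e y = E.frame x y (E.comps x x e) := by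
  have h : (trivializationAt F E.Fib x).linearMapAt ℂ x e = E.comps x x e := by
    rw [comps_apply (E.mem_dom x)]
    exact (trivializationAt F E.Fib x).continuousLinearMapAt_apply_of_mem ℂ (E.mem_dom x) e
  rw [localExt, h, frame_eq_symmₗ]

section

variable {IN : Type*} [NormedAddCommGroup IN] [NormedSpace ℝ IN] {HN : Type*} [TopologicalSpace HN]
  {JN : ModelWithCorners ℝ IN HN} {P : Type*} [TopologicalSpace P] [ChartedSpace HN P]

lemma contMDiffAt_mk_iff {f : P → M} {σ : Π z, E.Fib (f z)} {x : M} {z : P}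
    (hf : ContMDiffAt JN (𝓡 m) ∞ f z) (hz : f z ∈ E.dom x) :
    ContMDiffAt JN ((𝓡 m).prod 𝓘(ℝ, F)) ∞ (fun z ↦ Bundle.TotalSpace.mk' F (f z) (σ z)) z ↔
      ContMDiffAt JN 𝓘(ℝ, F) ∞ (fun z ↦ E.comps x (f z) (σ z)) z := by
  rw [Bundle.Trivialization.contMDiffAt_iff (e := trivializationAt F E.Fib x)
    (f := fun z ↦ Bundle.TotalSpace.mk' F (f z) (σ z))
    ((trivializationAt F E.Fib x).mem_source.2 hz)]
  have he : (fun z ↦ (trivializationAt F E.Fib x ⟨f z, σ z⟩).2) =ᶠ[𝓝 z]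
      fun z ↦ E.comps x (f z) (σ z) := by
    filter_upwards [hf.continuousAt.preimage_mem_nhds ((E.isOpen_dom x).mem_nhds hz)] with y hy
    exact (comps_apply hy _).symm
  exact ⟨fun h ↦ h.2.congr_of_eventuallyEq he.symm, fun h ↦ ⟨hf, h.congr_of_eventuallyEq he⟩⟩

end

lemma smoothAt_iff {s : Π y, E.Fib y} {x y : M} (hy : y ∈ E.dom x) :
    E.SmoothAt s y ↔ ContMDiffAt (𝓡 m) 𝓘(ℝ, F) ∞ (fun y ↦ E.comps x y (s y)) y :=
  contMDiffAt_mk_iff (f := fun y ↦ y) contMDiffAt_id hy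

lemma mdiff_iff {s : Π y, E.Fib y} {x y : M} (hy : y ∈ E.dom x) :
    MDifferentiableAt (𝓡 m) ((𝓡 m).prod 𝓘(ℝ, F)) (fun y ↦ Bundle.TotalSpace.mk' F y (s y)) y ↔
      MDifferentiableAt (𝓡 m) 𝓘(ℝ, F) (fun y ↦ E.comps x y (s y)) y := by
  have : ContMDiffVectorBundle 1 F E.Fib (𝓡 m) := ContMDiffVectorBundle.of_le (n := ∞) (by
    exact_mod_cast le_top)
  have h := Bundle.Trivialization.mdifferentiableAt_section_iff (𝓡 m)
    (e := trivializationAt F E.Fib x) s hy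
  have he : (fun y ↦ (trivializationAt F E.Fib x ⟨y, s y⟩).2) =ᶠ[𝓝 y]
      fun z ↦ E.comps x z (s z) := by
    filter_upwards [(E.isOpen_dom x).mem_nhds hy] with y hy
    exact (comps_apply hy _).symm
  exact h.trans ⟨fun h ↦ h.congr_of_eventuallyEq he.symm, fun h ↦ h.congr_of_eventuallyEq he⟩

lemma mdiff_frame {x y : M} (hy : y ∈ E.dom x) {f : M → F}
    (hf : MDifferentiableAt (𝓡 m) 𝓘(ℝ, F) f y) :
    MDifferentiableAt (𝓡 m) ((𝓡 m).prod 𝓘(ℝ, F))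
      (fun y ↦ Bundle.TotalSpace.mk' F y (E.frame x y (f y))) y := by
  rw [mdiff_iff hy]
  refine hf.congr_of_eventuallyEq ?_
  filter_upwards [(E.isOpen_dom x).mem_nhds hy] with y hy
  exact comps_frame hy _

lemma smoothAt_frame {x y : M} (hy : y ∈ E.dom x) {f : M → F}
    (hf : ContMDiffAt (𝓡 m) 𝓘(ℝ, F) ∞ f y) : E.SmoothAt (fun y ↦ E.frame x y (f y)) y := by
  rw [smoothAt_iff hy]
  refine hf.congr_of_eventuallyEq ?_
  filter_upwards [(E.isOpen_dom x).mem_nhds hy] with y hy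
  exact comps_frame hy _

lemma conn_congr {s t : Π y, E.Fib y} {y : M} (h : ∀ᶠ z in 𝓝 y, s z = t z)
    (hs : MDifferentiableAt (𝓡 m) ((𝓡 m).prod 𝓘(ℝ, F)) (fun y ↦ Bundle.TotalSpace.mk' F y (s y)) y) :
    E.conn s y = E.conn t y := by
  refine E.conn.isCovariantDerivativeOn.congr_of_eventuallyEq (s := Set.univ) hs ?_
    Filter.univ_mem h
  refine hs.congr_of_eventuallyEq ?_
  filter_upwards [h] with z hz
  rw [hz]

variable [FiniteDimensional ℂ F]

/-- The connection form in the preferred trivialization at `x`, at a point of its domain. -/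
def connFormOfMem {x y : M} (hy : y ∈ E.dom x) : Eu m →L[ℝ] F →L[ℝ] F :=
  (LinearMap.toContinuousLinearMap
    { toFun := fun f ↦ (E.comps x y).comp
        (E.conn (fun z ↦ E.frame x z f) y : Eu m →L[ℝ] E.Fib y)
      map_add' := fun f g ↦ by
        have h := E.conn.isCovariantDerivativeOn.add (s := Set.univ)
          (mdiff_frame hy (mdifferentiableAt_const (c := f)))
          (mdiff_frame hy (mdifferentiableAt_const (c := g)))
        have h1 : (fun z ↦ E.frame x z (f + g)) =
          (fun z ↦ E.frame x z f) + fun z ↦ E.frame x z g := by funext z; simp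
        rw [h1, h]; exact ContinuousLinearMap.comp_add _ _ _
      map_smul' := fun c f ↦ by
        have h := E.conn.isCovariantDerivativeOn.smul_const (s := Set.univ) c
          (mdiff_frame hy (mdifferentiableAt_const (c := f)))
        have h1 : (fun z ↦ E.frame x z (c • f)) = c • (fun z ↦ E.frame x z f) := by
          funext z; simp
        rw [h1, h]; exact ContinuousLinearMap.comp_smul _ _ _ } : F →L[ℝ] Eu m →L[ℝ] F).flip

open scoped Classical in
variable (E) in
/-- The connection form in the preferred trivialization at `x`. -/
def connForm (x y : M) : TangentSpace (𝓡 m) y →L[ℝ] F →L[ℝ] F :=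
  if hy : y ∈ E.dom x then connFormOfMem hy else 0

lemma connForm_apply {x y : M} (hy : y ∈ E.dom x) (u : TangentSpace (𝓡 m) y) (f : F) :
    E.connForm x y u f = E.comps x y (E.conn (fun z ↦ E.frame x z f) y u) := by
  have h : E.connForm x y = connFormOfMem hy := dif_pos hy
  exact congrArg (fun T : Eu m →L[ℝ] F →L[ℝ] F ↦ T u f) h

lemma connForm_smul {x y : M} (hy : y ∈ E.dom x) (u : TangentSpace (𝓡 m) y) (c : ℂ) (f : F) :
    E.connForm x y u (c • f) = c • E.connForm x y u f := by
  rw [connForm_apply hy, connForm_apply hy, ← comps_smul hy, ← E.conn_smul _ _ _ _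
    (mdiff_frame hy (mdifferentiableAt_const (c := f)))]
  have : (fun z ↦ E.frame x z (c • f)) = c • (fun z ↦ E.frame x z f) := by
    funext z; exact frame_smul x z c f
  rw [this]

/-- The covariant derivative in a trivialization. -/
lemma comps_conn_frame {x y : M} (hy : y ∈ E.dom x) {f : M → F}
    (hf : MDifferentiableAt (𝓡 m) 𝓘(ℝ, F) f y) (u : TangentSpace (𝓡 m) y) :
    E.comps x y (E.conn (fun z ↦ E.frame x z (f z)) y u) =
      E.connForm x y u (f y) + mvfderiv (𝓡 m) f y u := by
  let b := Module.finBasis ℝ F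
  let c : Fin (Module.finrank ℝ F) → F →L[ℝ] ℝ := fun i ↦
    LinearMap.toContinuousLinearMap (b.coord i)
  have hc : ∀ g : F, ∑ i, c i g • b i = g := fun g ↦ b.sum_repr g
  have hci : ∀ i, MDifferentiableAt (𝓡 m) 𝓘(ℝ, ℝ) (fun z ↦ c i (f z)) y := fun i ↦
    (c i).mdifferentiableAt.comp y hf
  have key : ∀ s : Finset (Fin (Module.finrank ℝ F)),
      MDifferentiableAt (𝓡 m) ((𝓡 m).prod 𝓘(ℝ, F))
        (fun z ↦ Bundle.TotalSpace.mk' F z (E.frame x z (∑ i ∈ s, c i (f z) • b i))) y ∧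
      E.comps x y (E.conn (fun z ↦ E.frame x z (∑ i ∈ s, c i (f z) • b i)) y u) =
        E.connForm x y u (∑ i ∈ s, c i (f y) • b i) + ∑ i ∈ s, c i (mvfderiv (𝓡 m) f y u) • b i := by
    intro s
    induction s using Finset.cons_induction with
    | empty =>
      simp only [Finset.sum_empty, map_zero, add_zero]
      refine ⟨by simpa using mdiff_frame hy (mdifferentiableAt_const (c := (0 : F))), ?_⟩
      have h := E.conn.isCovariantDerivativeOn.zero (s := Set.univ) (x := y)
      have h0 : (fun z : M ↦ (0 : E.Fib z)) = 0 := rfl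
      rw [h0, h]; simp
    | cons i s hi ih =>
      have h1 : (fun z ↦ E.frame x z (∑ i ∈ Finset.cons i s hi, c i (f z) • b i)) =
          ((fun z ↦ c i (f z)) • fun z ↦ E.frame x z (b i)) +
            fun z ↦ E.frame x z (∑ i ∈ s, c i (f z) • b i) := by
        funext z; simp only [Finset.sum_cons, map_add, map_smul]; rfl
      have hb := mdiff_frame hy (mdifferentiableAt_const (c := b i))
      have hm : MDifferentiableAt (𝓡 m) ((𝓡 m).prod 𝓘(ℝ, F)) (fun z ↦ Bundle.TotalSpace.mk' F z
          (((fun z ↦ c i (f z)) • fun z ↦ E.frame x z (b i)) z)) y := by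
        have : MDifferentiableAt (𝓡 m) 𝓘(ℝ, F) (fun z ↦ c i (f z) • b i) y :=
          (hci i).smul mdifferentiableAt_const
        simpa using mdiff_frame hy this
      have h2 := E.conn.isCovariantDerivativeOn.add (s := Set.univ) hm ih.1
      have h3 := E.conn.isCovariantDerivativeOn.leibniz (s := Set.univ) hb (hci i)
      have h4 : mvfderiv (𝓡 m) (fun z ↦ c i (f z)) y u = c i (mvfderiv (𝓡 m) f y u) :=
        mvfderiv_clm_comp (c i) hf u
      refine ⟨?_, ?_⟩
      · have : MDifferentiableAt (𝓡 m) 𝓘(ℝ, F)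
            (fun z ↦ ∑ i ∈ Finset.cons i s hi, c i (f z) • b i) y := by
          have : (fun z ↦ ∑ i ∈ Finset.cons i s hi, c i (f z) • b i) =
            ((∑ i ∈ Finset.cons i s hi, (c i).smulRight (b i)) : F →L[ℝ] F) ∘ f := by
            funext z; simp
          rw [this]
          exact ContinuousLinearMap.mdifferentiableAt _ |>.comp y hf
        exact mdiff_frame hy this
      · rw [h1, h2, h3]
        simp only [Finset.sum_cons, map_add, add_apply, ih.2, smul_apply, map_smul,
          ContinuousLinearMap.smulRight_apply, h4, comps_frame hy, connForm_apply hy (f := b i)]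
        abel
  have := (key Finset.univ).2
  simpa only [hc] using this

/-- The covariant derivative in a trivialization. -/
lemma comps_conn {x y : M} (hy : y ∈ E.dom x) {s : Π y, E.Fib y}
    (hs : MDifferentiableAt (𝓡 m) ((𝓡 m).prod 𝓘(ℝ, F)) (fun y ↦ Bundle.TotalSpace.mk' F y (s y)) y)
    (u : TangentSpace (𝓡 m) y) :
    E.comps x y (E.conn s y u) =
      E.connForm x y u (E.comps x y (s y)) + mvfderiv (𝓡 m) (fun z ↦ E.comps x z (s z)) y u := by
  rw [← comps_conn_frame hy ((mdiff_iff hy).1 hs)]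
  congr 2
  refine conn_congr ?_ hs
  filter_upwards [(E.isOpen_dom x).mem_nhds hy] with z hz
  exact (frame_comps hz _).symm

lemma contMDiffAt_transition {x x' y : M} (hy : y ∈ E.dom x) (hy' : y ∈ E.dom x') :
    ContMDiffAt (𝓡 m) 𝓘(ℝ, F →L[ℝ] F) ∞ (fun z ↦ (E.comps x' z).comp (E.frame x z)) y := by
  have h := contMDiffAt_coordChangeL (𝕜 := ℝ) (n := ∞) (IB := 𝓡 m)
    (e := trivializationAt F E.Fib x) (e' := trivializationAt F E.Fib x') hy hy'
  refine h.congr_of_eventuallyEq ?_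
  filter_upwards [(E.isOpen_dom x).mem_nhds hy, (E.isOpen_dom x').mem_nhds hy'] with z hz hz'
  ext f
  have := Bundle.Trivialization.coordChangeL_apply (R := ℝ) (trivializationAt F E.Fib x)
    (trivializationAt F E.Fib x') ⟨hz, hz'⟩ f
  refine (comps_apply hz' _).trans (Eq.trans ?_ this.symm)
  exact congrArg (fun e ↦ (trivializationAt F E.Fib x' ⟨z, e⟩).2)
    (Bundle.Trivialization.symmL_apply (R := ℝ) (trivializationAt F E.Fib x) hz f)

/-- The pull back connection in a trivialization. -/
lemma comps_pullbackConn {f : N → M} {σ : Π z, E.Fib (f z)} {x : M} {z : N}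
    (hf : MDifferentiableAt (𝓡 n) (𝓡 m) f z) (hz : f z ∈ E.dom x)
    (hσ : MDifferentiableAt (𝓡 n) 𝓘(ℝ, F) (fun z ↦ E.comps x (f z) (σ z)) z)
    (u : TangentSpace (𝓡 n) z) :
    E.comps x (f z) (E.pullbackConn f σ z u) =
      E.connForm x (f z) (mfderiv (𝓡 n) (𝓡 m) f z u) (E.comps x (f z) (σ z)) +
        mvfderiv (𝓡 n) (fun z ↦ E.comps x (f z) (σ z)) z u := by
  set y := f z with hy
  have hyy := E.mem_dom y
  set w : N → F := fun z' ↦ E.comps y (f z') (σ z') with hw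
  have hfe : ∀ O : Set M, IsOpen O → y ∈ O → ∀ᶠ z' in 𝓝 z, f z' ∈ O := fun O hO h ↦
    hf.continuousAt.preimage_mem_nhds (hO.mem_nhds h)
  have hT : ∀ {x x' : M}, y ∈ E.dom x → y ∈ E.dom x' → MDifferentiableAt (𝓡 m) 𝓘(ℝ, F →L[ℝ] F)
      (fun z ↦ (E.comps x' z).comp (E.frame x z)) y := fun h h' ↦
    (contMDiffAt_transition h h').mdifferentiableAt (by simp)
  have hTf : ∀ {x x' : M}, y ∈ E.dom x → y ∈ E.dom x' → MDifferentiableAt (𝓡 n) 𝓘(ℝ, F →L[ℝ] F)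
      (fun z ↦ (E.comps x' (f z)).comp (E.frame x (f z))) z := fun h h' ↦
    MDifferentiableAt.comp z (hT h h') hf
  have hwd : MDifferentiableAt (𝓡 n) 𝓘(ℝ, F) w z := by
    refine ((hTf hz hyy).clm_apply hσ).congr_of_eventuallyEq ?_
    filter_upwards [hfe _ (E.isOpen_dom x) hz] with z' hz'
    simp only [ContinuousLinearMap.comp_apply, hw, frame_comps hz']
  have h1 : ∀ᶠ z' in 𝓝 z, E.comps x (f z') (σ z') =
      ((E.comps x (f z')).comp (E.frame y (f z'))) (w z') := by
    filter_upwards [hfe _ (E.isOpen_dom y) hyy] with z' hz'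
    simp only [ContinuousLinearMap.comp_apply, hw, frame_comps hz']
  have h2 : mvfderiv (𝓡 n) (fun z ↦ E.comps x (f z) (σ z)) z u =
      mvfderiv (𝓡 m) (fun q ↦ (E.comps x q).comp (E.frame y q)) y
        (mfderiv (𝓡 n) (𝓡 m) f z u) (w z) +
      E.comps x y (E.frame y y (mvfderiv (𝓡 n) w z u)) := by
    rw [mvfderiv_congr_of_eventuallyEq h1, mvfderiv_clm_apply (hTf hyy hz) hwd]
    congr 1
    rw [mvfderiv_comp_vec (g := fun q ↦ (E.comps x q).comp (E.frame y q)) (hT hyy hz) hf]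
  have h3 : (fun q ↦ localExt ℂ F (σ z) q) = fun q ↦ E.frame y q (w z) := by
    funext q; exact localExt_eq (σ z) q
  have h4 : mvfderiv (𝓡 n) (fun z' ↦ (trivializationAt F E.Fib (f z) ⟨f z', σ z'⟩).2) z u =
      mvfderiv (𝓡 n) w z u := by
    refine mvfderiv_congr_of_eventuallyEq ?_ u
    filter_upwards [hfe _ (E.isOpen_dom y) hyy] with z' hz'
    exact (comps_apply hz' _).symm
  have h5 : E.pullbackConn f σ z u = E.conn (fun q ↦ E.frame y q (w z)) y
      (mfderiv (𝓡 n) (𝓡 m) f z u) + E.frame y y (mvfderiv (𝓡 n) w z u) := by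
    unfold pullbackConn
    rw [h4, ← frame_eq_symmₗ]
    exact congrArg (fun s ↦ E.conn s y (mfderiv (𝓡 n) (𝓡 m) f z u) +
      E.frame y y (mvfderiv (𝓡 n) w z u)) h3
  have h6 : MDifferentiableAt (𝓡 m) ((𝓡 m).prod 𝓘(ℝ, F))
      (fun q ↦ Bundle.TotalSpace.mk' F q (E.frame y q (w z))) y :=
    mdiff_frame hyy mdifferentiableAt_const
  rw [h5, h2, map_add, comps_conn hz h6]
  have h7 : E.frame y y (w z) = σ z := frame_comps hyy _
  have h8 : mvfderiv (𝓡 m) (fun q ↦ E.comps x q (E.frame y q (w z))) y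
      (mfderiv (𝓡 n) (𝓡 m) f z u) = mvfderiv (𝓡 m) (fun q ↦ (E.comps x q).comp (E.frame y q)) y
        (mfderiv (𝓡 n) (𝓡 m) f z u) (w z) := by
    have := mvfderiv_clm_apply (hT hyy hz) (mdifferentiableAt_const (c := w z))
      (mfderiv (𝓡 n) (𝓡 m) f z u)
    rw [mvfderiv_const_apply, map_zero, add_zero] at this
    exact this
  rw [h7, h8, add_assoc]

end HermitianBundle

end

section

section Calculus

variable {D D' F : Type*} [NormedAddCommGroup D] [NormedSpace ℝ D] [NormedAddCommGroup D']
  [NormedSpace ℝ D'] [NormedAddCommGroup F] [NormedSpace ℝ F]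

/-- The curvature `da + a ∧ a` of the connection form `a`. -/
def curvForm (a : D → D →L[ℝ] F →L[ℝ] F) (p : D) (u v : D) : F →L[ℝ] F :=
  fderiv ℝ a p u v - fderiv ℝ a p v u + (a p u).comp (a p v) - (a p v).comp (a p u)

lemma fderiv_apply_const {W : Type*} [NormedAddCommGroup W] [NormedSpace ℝ W] {a : D → D' →L[ℝ] W}
    {p : D} (ha : DifferentiableAt ℝ a p) (u : D) (v : D') :
    fderiv ℝ (fun q ↦ a q v) p u = fderiv ℝ a p u v := by
  rw [fderiv_clm_apply ha (differentiableAt_const v)]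
  simp

lemma curvForm_pullback {β : D' → D' →L[ℝ] F →L[ℝ] F} {f : D → D'} {p : D}
    (hβ : DifferentiableAt ℝ β (f p)) (hf : ContDiffAt ℝ ∞ f p) (u v : D) :
    curvForm (fun q ↦ (β (f q)).comp (fderiv ℝ f q)) p u v =
      curvForm β (f p) (fderiv ℝ f p u) (fderiv ℝ f p v) := by
  have hfd : DifferentiableAt ℝ f p := hf.differentiableAt (by simp)
  have hfd2 : DifferentiableAt ℝ (fderiv ℝ f) p :=
    (hf.fderiv_right (m := 1) (WithTop.coe_le_coe.2 le_top)).differentiableAt (by simp)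
  have hs : IsSymmSndFDerivAt ℝ f p := hf.isSymmSndFDerivAt (by
    simp only [minSmoothness_of_isRCLikeNormedField]; exact WithTop.coe_le_coe.2 le_top)
  have hc : DifferentiableAt ℝ (fun q ↦ β (f q)) p := DifferentiableAt.comp (g := β) (f := f) p hβ hfd
  have h1 : ∀ u v, fderiv ℝ (fun q ↦ (β (f q)).comp (fderiv ℝ f q)) p u v =
      fderiv ℝ β (f p) (fderiv ℝ f p u) (fderiv ℝ f p v) + β (f p) (fderiv ℝ (fderiv ℝ f) p u v) := by
    intro u v
    have hcd : DifferentiableAt ℝ (fun q ↦ (β (f q)).comp (fderiv ℝ f q)) p := hc.clm_comp hfd2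
    rw [← fderiv_apply_const hcd]
    have : (fun q ↦ ((β (f q)).comp (fderiv ℝ f q)) v) = fun q ↦ β (f q) (fderiv ℝ f q v) := rfl
    rw [this, fderiv_clm_apply hc (hfd2.clm_apply (differentiableAt_const v))]
    have h2 : fderiv ℝ (fun q ↦ β (f q)) p = (fderiv ℝ β (f p)).comp (fderiv ℝ f p) :=
      fderiv_comp (g := β) (f := f) p hβ hfd
    simp only [add_apply, ContinuousLinearMap.comp_apply, ContinuousLinearMap.flip_apply, h2,
      fderiv_apply_const hfd2]
    exact add_comm _ _
  unfold curvForm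
  rw [h1, h1, hs.eq u v]
  simp only [ContinuousLinearMap.comp_apply]
  abel

/-- Connection forms related by a gauge transformation have conjugate curvatures. -/
lemma curvForm_gauge {Φ : D → F →L[ℝ] F} {a b : D → D →L[ℝ] F →L[ℝ] F} {p : D}
    (hΦ : ContDiffAt ℝ ∞ Φ p) (ha : DifferentiableAt ℝ a p) (hb : DifferentiableAt ℝ b p)
    (h : ∀ᶠ q in 𝓝 p, ∀ u, fderiv ℝ Φ q u = (Φ q).comp (a q u) - (b q u).comp (Φ q)) (u v : D) :
    (Φ p).comp (curvForm a p u v) = (curvForm b p u v).comp (Φ p) := by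
  have hd : DifferentiableAt ℝ Φ p := hΦ.differentiableAt (by simp)
  have hd2 : DifferentiableAt ℝ (fderiv ℝ Φ) p :=
    (hΦ.fderiv_right (m := 1) (WithTop.coe_le_coe.2 le_top)).differentiableAt (by simp)
  have hs : IsSymmSndFDerivAt ℝ Φ p := hΦ.isSymmSndFDerivAt (by
    simp only [minSmoothness_of_isRCLikeNormedField]; exact WithTop.coe_le_coe.2 le_top)
  have h0 := h.self_of_nhds
  have h1 : ∀ u v, fderiv ℝ (fderiv ℝ Φ) p u v =
      (fderiv ℝ Φ p u).comp (a p v) + (Φ p).comp (fderiv ℝ a p u v)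
        - ((fderiv ℝ b p u v).comp (Φ p) + (b p v).comp (fderiv ℝ Φ p u)) := by
    intro u v
    rw [← fderiv_apply_const hd2]
    have hav : DifferentiableAt ℝ (fun q ↦ a q v) p := ha.clm_apply (differentiableAt_const v)
    have hbv : DifferentiableAt ℝ (fun q ↦ b q v) p := hb.clm_apply (differentiableAt_const v)
    have h2 : (fun q ↦ fderiv ℝ Φ q v) =ᶠ[𝓝 p]
        fun q ↦ (Φ q).comp (a q v) - (b q v).comp (Φ q) := by
      filter_upwards [h] with q hq using hq v
    rw [h2.fderiv_eq, fderiv_fun_sub (hd.clm_comp hav) (hbv.clm_comp hd),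
      fderiv_clm_comp hd hav, fderiv_clm_comp hbv hd]
    simp only [_root_.sub_apply, add_apply, ContinuousLinearMap.comp_apply,
      ContinuousLinearMap.flip_apply, ContinuousLinearMap.compL_apply, fderiv_apply_const ha,
      fderiv_apply_const hb]
    abel
  have h3 := h1 u v
  rw [hs.eq u v, h1 v u, h0, h0] at h3
  ext f
  have h4 := congrArg (fun T : F →L[ℝ] F ↦ T f) h3
  simp only [_root_.sub_apply, add_apply, ContinuousLinearMap.comp_apply, map_sub] at h4
  simp only [curvForm, _root_.sub_apply, add_apply, ContinuousLinearMap.comp_apply, map_sub,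
    map_add]
  rw [← sub_eq_zero] at h4 ⊢
  rw [← neg_eq_zero, ← h4]
  abel

end Calculus

namespace HermitianBundle

variable {m n : ℕ} {F : Type u} [NormedAddCommGroup F] [NormedSpace ℂ F]
  {M : Type v} [TopologicalSpace M] [ChartedSpace (EuclideanSpace ℝ (Fin m)) M]
  [IsManifold (𝓡 m) ∞ M] (E : HermitianBundle.{u, v, w} m F M)
  {N : Type*} [TopologicalSpace N] [ChartedSpace (EuclideanSpace ℝ (Fin n)) N]
  [IsManifold (𝓡 n) ∞ N] [FiniteDimensional ℂ F]

/-- The connection form in the preferred trivialization and the preferred chart at `x`. -/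
def connIn (x : M) (p : Eu m) : Eu m →L[ℝ] F →L[ℝ] F :=
  (E.connForm x ((extChartAt (𝓡 m) x).symm p)).comp (fld x ((extChartAt (𝓡 m) x).symm p))

variable {E}

lemma connIn_apply {x y : M} (hy : y ∈ (chartAt (Eu m) x).source) (u : TangentSpace (𝓡 m) y) :
    E.connIn x (extChartAt (𝓡 m) x y) (coord x y u) = E.connForm x y u := by
  have h : (extChartAt (𝓡 m) x).symm (extChartAt (𝓡 m) x y) = y :=
    (extChartAt (𝓡 m) x).left_inv (by simpa using hy)
  have key : ∀ y', y' = y → E.connForm x y' (fld x y' (coord x y u)) = E.connForm x y u := by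
    rintro y' rfl
    rw [fld_coord hy]
  exact key _ h

lemma connIn_fld {x y : M} (hy : y ∈ (chartAt (Eu m) x).source) (u : Eu m) :
    E.connIn x (extChartAt (𝓡 m) x y) u = E.connForm x y (fld x y u) := by
  rw [← connIn_apply hy, coord_fld hy]

lemma eventually_extChartAt_symm {x y : M} (hy : y ∈ (chartAt (Eu m) x).source) {O : Set M}
    (hO : O ∈ 𝓝 y) : ∀ᶠ p in 𝓝 (extChartAt (𝓡 m) x y), (extChartAt (𝓡 m) x).symm p ∈ O := by
  have hy' : y ∈ (extChartAt (𝓡 m) x).source := by simpa using hy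
  have h := continuousAt_extChartAt_symm'' (I := 𝓡 m) (x := x) (y := extChartAt (𝓡 m) x y)
    ((extChartAt (𝓡 m) x).map_source hy')
  refine h.preimage_mem_nhds ?_
  rwa [(extChartAt (𝓡 m) x).left_inv hy']

lemma contMDiffAt_connForm_fld {x y : M} (hy : y ∈ (chartAt (Eu m) x).source) (hyd : y ∈ E.dom x)
    (u : Eu m) (f : F) :
    ContMDiffAt (𝓡 m) 𝓘(ℝ, F) ∞ (fun z ↦ E.connForm x z (fld x z u) f) y := by
  have h1 : E.SmoothAt (fun z ↦ E.frame x z f) y := smoothAt_frame hyd contMDiffAt_const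
  have h2 := E.conn_smooth y _ _ h1 (smoothFieldAt_fld hy u)
  have h3 := (smoothAt_iff hyd).1 h2
  refine h3.congr_of_eventuallyEq ?_
  filter_upwards [(E.isOpen_dom x).mem_nhds hyd] with z hz
  exact connForm_apply hz _ _

lemma contDiffAt_connIn {x y : M} (hy : y ∈ (chartAt (Eu m) x).source) (hyd : y ∈ E.dom x) :
    ContDiffAt ℝ ∞ (E.connIn x) (extChartAt (𝓡 m) x y) :=
  contDiffAt_clm_of_apply fun u ↦ contDiffAt_clm_of_apply fun f ↦
    contDiffAt_comp_extChartAt_symm hy (contMDiffAt_connForm_fld hy hyd u f)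

/-- The curvature in a trivialization. -/
lemma comps_curvature (x : M) (u v : TangentSpace (𝓡 m) x) (e : E.Fib x) :
    E.comps x x (E.curvature x u v e) =
      curvForm (E.connIn x) (extChartAt (𝓡 m) x x) u v (E.comps x x e) := by
  have hx := mem_chart_source (Eu m) x
  have hxd := E.mem_dom x
  set f := E.comps x x e
  let s : Π y, E.Fib y := fun y ↦ E.frame x y f
  have hs : E.SmoothAt s x := smoothAt_frame hxd contMDiffAt_const
  have h1 : E.curvature x u v e = E.curvAux s (fun y ↦ fld x y u) (fun y ↦ fld x y v) x := by
    have a1 : (localExt ℂ F e : Π y, E.Fib y) = s := by funext y; exact localExt_eq e y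
    have a2 : ∀ u : TangentSpace (𝓡 m) x,
        (localExt ℝ (Eu m) u : Π y : M, TangentSpace (𝓡 m) y) = fun y ↦ fld x y u := by
      intro u; funext y; exact localExt_tangent u y
    change E.curvAux (localExt ℂ F e) (localExt ℝ (Eu m) u) (localExt ℝ (Eu m) v) x = _
    rw [a1, a2, a2]
  have hA := (contDiffAt_connIn hx hxd).differentiableAt (by simp)
  have key : ∀ u v : Eu m, E.comps x x (E.conn (fun y ↦ E.conn s y (fld x y v)) x (fld x x u)) =
      E.connIn x (extChartAt (𝓡 m) x x) u (E.connIn x (extChartAt (𝓡 m) x x) v f) +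
        fderiv ℝ (E.connIn x) (extChartAt (𝓡 m) x x) u v f := by
    intro u v
    have hV := E.conn_smooth x s _ hs (smoothFieldAt_fld hx v)
    rw [comps_conn hxd (SmoothAt.mdiff hV), ← connIn_fld hx, ← connForm_apply hxd, ← connIn_fld hx]
    congr 1
    have h3 : ∀ᶠ y in 𝓝 x, E.comps x y (E.conn s y (fld x y v)) = E.connForm x y (fld x y v) f := by
      filter_upwards [(E.isOpen_dom x).mem_nhds hxd] with z hz
      exact (connForm_apply hz _ _).symm
    rw [mvfderiv_congr_of_eventuallyEq h3, mvfderiv_fld hx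
      ((contMDiffAt_connForm_fld hx hxd v f).mdifferentiableAt (by simp)),
      ← fderiv_apply_const hA, ← fderiv_apply_const (hA.clm_apply (differentiableAt_const v))]
    rfl
  have hself : ∀ u : TangentSpace (𝓡 m) x, (fld x x (u : Eu m)) = u := fun u ↦ fld_self x u
  have hb : E.conn s x (VectorField.mlieBracket (𝓡 m) (fun y ↦ fld x y u) (fun y ↦ fld x y v) x)
      = 0 := by
    rw [show VectorField.mlieBracket (𝓡 m) (fun y ↦ fld x y u) (fun y ↦ fld x y v) x = 0 from
      mlieBracket_fld x u v, map_zero]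
  rw [h1, curvAux, hb, sub_zero, map_sub, key u v, key v u]
  simp only [curvForm, _root_.sub_apply, add_apply, ContinuousLinearMap.comp_apply]
  abel

section Morphism

variable {m' : ℕ} {M' : Type*} [TopologicalSpace M'] [ChartedSpace (EuclideanSpace ℝ (Fin m')) M']
  [IsManifold (𝓡 m') ∞ M'] {E' : HermitianBundle m' F M'}

/-- A parallel morphism between the pull backs of two bundles intertwines the curvatures. -/
theorem curvature_eq_of_pullbackConn {f : N → M} {f' : N → M'} (hf : ContMDiff (𝓡 n) (𝓡 m) ∞ f)
    (hf' : ContMDiff (𝓡 n) (𝓡 m') ∞ f') (Ψ : Π z, E'.Fib (f' z) →ₗ[ℂ] E.Fib (f z))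
    (hΨ : ∀ z (s : Π y, E'.Fib y), E'.SmoothAt s (f' z) →
      ContMDiffAt (𝓡 n) ((𝓡 m).prod 𝓘(ℝ, F)) ∞
        (fun z' ↦ Bundle.TotalSpace.mk' F (f z') (Ψ z' (s (f' z')))) z)
    (hconn : ∀ z (s : Π y, E'.Fib y), E'.SmoothAt s (f' z) → ∀ u : TangentSpace (𝓡 n) z,
      E.pullbackConn f (fun z' ↦ Ψ z' (s (f' z'))) z u =
        Ψ z (E'.conn s (f' z) (mfderiv (𝓡 n) (𝓡 m') f' z u)))
    (z : N) (u v : TangentSpace (𝓡 n) z) (e : E'.Fib (f' z)) :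
    E.curvature (f z) (mfderiv (𝓡 n) (𝓡 m) f z u) (mfderiv (𝓡 n) (𝓡 m) f z v) (Ψ z e) =
      Ψ z (E'.curvature (f' z) (mfderiv (𝓡 n) (𝓡 m') f' z u) (mfderiv (𝓡 n) (𝓡 m') f' z v) e) := by
  revert e
  set x := f z
  set x' := f' z
  intro e
  let χ := extChartAt (𝓡 n) z
  have hz := mem_chart_source (Eu n) z
  let Φ : N → F →L[ℝ] F := fun y ↦ LinearMap.toContinuousLinearMap
    ((E.comps x (f y)).toLinearMap ∘ₗ (Ψ y).restrictScalars ℝ ∘ₗ (E'.frame x' (f' y)).toLinearMap)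
  have hΦa : ∀ y g, Φ y g = E.comps x (f y) (Ψ y (E'.frame x' (f' y) g)) := fun _ _ ↦ rfl
  let fh := writtenInExtChartAt (𝓡 n) (𝓡 m) z f
  let fh' := writtenInExtChartAt (𝓡 n) (𝓡 m') z f'
  let a : Eu n → Eu n →L[ℝ] F →L[ℝ] F := fun p ↦ (E'.connIn x' (fh' p)).comp (fderiv ℝ fh' p)
  let b : Eu n → Eu n →L[ℝ] F →L[ℝ] F := fun p ↦ (E.connIn x (fh p)).comp (fderiv ℝ fh p)
  have hΦs : ∀ y, f y ∈ E.dom x → f' y ∈ E'.dom x' → ∀ g,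
      ContMDiffAt (𝓡 n) 𝓘(ℝ, F) ∞ (fun y ↦ Φ y g) y := by
    intro y hy hy' g
    have h1 := hΨ y (fun q ↦ E'.frame x' q g) (smoothAt_frame hy' contMDiffAt_const)
    exact (contMDiffAt_mk_iff (hf.contMDiffAt) hy).1 h1
  have hc : fh (χ z) = extChartAt (𝓡 m) x x := by
    simp only [fh, writtenInExtChartAt, Function.comp, χ, extChartAt_to_inv]; rfl
  have hc' : fh' (χ z) = extChartAt (𝓡 m') x' x' := by
    simp only [fh', writtenInExtChartAt, Function.comp, χ, extChartAt_to_inv]; rfl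
  have hfh : ContDiffAt ℝ ∞ fh (χ z) := by
    have h := (contMDiffAt_iff.1 (hf z)).2
    rw [ModelWithCorners.range_eq_univ, contDiffWithinAt_univ] at h
    exact h
  have hfh' : ContDiffAt ℝ ∞ fh' (χ z) := by
    have h := (contMDiffAt_iff.1 (hf' z)).2
    rw [ModelWithCorners.range_eq_univ, contDiffWithinAt_univ] at h
    exact h
  have hb1 : DifferentiableAt ℝ (E.connIn x) (fh (χ z)) := by
    rw [hc]; exact (contDiffAt_connIn (mem_chart_source _ x) (E.mem_dom x)).differentiableAt (by simp)
  have ha1 : DifferentiableAt ℝ (E'.connIn x') (fh' (χ z)) := by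
    rw [hc']
    exact (contDiffAt_connIn (mem_chart_source _ x') (E'.mem_dom x')).differentiableAt (by simp)
  have hΦd : ContDiffAt ℝ ∞ (fun p ↦ Φ (χ.symm p)) (χ z) :=
    contDiffAt_clm_of_apply fun g ↦ contDiffAt_comp_extChartAt_symm hz
      (hΦs z (E.mem_dom x) (E'.mem_dom x') g)
  have hO : IsOpen ((chartAt (Eu n) z).source ∩ (f ⁻¹' (E.dom x ∩ (chartAt (Eu m) x).source)) ∩
      (f' ⁻¹' (E'.dom x' ∩ (chartAt (Eu m') x').source))) :=
    ((chartAt (Eu n) z).open_source.inter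
      (((E.isOpen_dom x).inter (chartAt (Eu m) x).open_source).preimage hf.continuous)).inter
      (((E'.isOpen_dom x').inter (chartAt (Eu m') x').open_source).preimage hf'.continuous)
  have hzO : z ∈ ((chartAt (Eu n) z).source ∩ (f ⁻¹' (E.dom x ∩ (chartAt (Eu m) x).source)) ∩
      (f' ⁻¹' (E'.dom x' ∩ (chartAt (Eu m') x').source))) :=
    ⟨⟨hz, E.mem_dom x, mem_chart_source _ x⟩, E'.mem_dom x', mem_chart_source _ x'⟩
  have hgauge : ∀ᶠ p in 𝓝 (χ z), ∀ u, fderiv ℝ (fun p ↦ Φ (χ.symm p)) p u =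
      (Φ (χ.symm p)).comp (a p u) - (b p u).comp (Φ (χ.symm p)) := by
    filter_upwards [eventually_extChartAt_symm hz (hO.mem_nhds hzO),
      extChartAt_target_mem_nhds (I := 𝓡 n) z] with p hp hpt u
    set y := χ.symm p
    have hpy : χ y = p := χ.right_inv hpt
    obtain ⟨⟨hy, hyd, hyc⟩, hyd', hyc'⟩ := hp
    have hdiff : DifferentiableAt ℝ (fun p ↦ Φ (χ.symm p)) p := by
      have : ContDiffAt ℝ ∞ (fun p ↦ Φ (χ.symm p)) (χ y) :=
        contDiffAt_clm_of_apply fun g ↦ contDiffAt_comp_extChartAt_symm hy (hΦs y hyd hyd' g)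
      rw [hpy] at this
      exact this.differentiableAt (by simp)
    ext g
    have h1 := hconn y (fun q ↦ E'.frame x' q g) (smoothAt_frame hyd' contMDiffAt_const)
      (fld z y u)
    have hmd : MDifferentiableAt (𝓡 n) 𝓘(ℝ, F) (fun y ↦ Φ y g) y :=
      (hΦs y hyd hyd' g).mdifferentiableAt (by simp)
    have hfm := hf.mdifferentiableAt (x := y) (by simp)
    have hfm' := hf'.mdifferentiableAt (x := y) (by simp)
    have h2 := congrArg (E.comps x (f y)) h1
    rw [comps_pullbackConn (σ := fun z ↦ Ψ z (E'.frame x' (f' z) g)) hfm hyd hmd] at h2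
    have h3 : mvfderiv (𝓡 n) (fun y ↦ Φ y g) y (fld z y u) =
        fderiv ℝ (fun p ↦ Φ (χ.symm p)) p u g := by
      rw [mvfderiv_fld hy hmd, ← fderiv_apply_const hdiff]
      exact congrArg (fun q ↦ fderiv ℝ (fun p ↦ Φ (χ.symm p) g) q u) hpy
    have h4 : E.connForm x (f y) (mfderiv (𝓡 n) (𝓡 m) f y (fld z y u)) = b p u := by
      rw [mfderiv_fld hy hyc hfm, ← connIn_fld hyc]
      change E.connIn x (extChartAt (𝓡 m) x (f y)) (fderiv ℝ fh (χ y) u) = _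
      rw [hpy]; rfl
    have h5 : Ψ y (E'.conn (fun q ↦ E'.frame x' q g) (f' y)
        (mfderiv (𝓡 n) (𝓡 m') f' y (fld z y u))) = Ψ y (E'.frame x' (f' y) (a p u g)) := by
      have e1 : E'.connForm x' (f' y) (mfderiv (𝓡 n) (𝓡 m') f' y (fld z y u)) = a p u := by
        rw [mfderiv_fld hy hyc' hfm', ← connIn_fld hyc']
        change E'.connIn x' (extChartAt (𝓡 m') x' (f' y)) (fderiv ℝ fh' (χ y) u) = _
        rw [hpy]; rfl
      rw [← e1, connForm_apply hyd', frame_comps hyd']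
    rw [h5, h4] at h2
    have h6 : b p u (Φ y g) + fderiv ℝ (fun p ↦ Φ (χ.symm p)) p u g = Φ y (a p u g) := by
      rw [← h3]; exact h2
    exact eq_sub_of_add_eq' h6
  have had : DifferentiableAt ℝ a (χ z) :=
    (DifferentiableAt.comp (g := E'.connIn x') (f := fh') _ ha1
      (hfh'.differentiableAt (by simp))).clm_comp
      ((hfh'.fderiv_right (m := 1) (WithTop.coe_le_coe.2 le_top)).differentiableAt (by simp))
  have hbd : DifferentiableAt ℝ b (χ z) :=
    (DifferentiableAt.comp (g := E.connIn x) (f := fh) _ hb1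
      (hfh.differentiableAt (by simp))).clm_comp
      ((hfh.fderiv_right (m := 1) (WithTop.coe_le_coe.2 le_top)).differentiableAt (by simp))
  have hmain := curvForm_gauge hΦd had hbd hgauge u v
  rw [show curvForm a (χ z) u v = _ from curvForm_pullback ha1 hfh' u v,
    show curvForm b (χ z) u v = _ from curvForm_pullback hb1 hfh u v] at hmain
  have hχz : χ.symm (χ z) = z := extChartAt_to_inv z
  simp only [hχz] at hmain
  have hder : ∀ u : TangentSpace (𝓡 n) z, (mfderiv (𝓡 n) (𝓡 m) f z u : Eu m) =
      fderiv ℝ fh (χ z) u := by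
    intro u
    have h : mfderiv (𝓡 n) (𝓡 m) f z = fderivWithin ℝ fh (range (𝓡 n)) (χ z) :=
      (hf.mdifferentiableAt (x := z) (by simp)).mfderiv
    rw [ModelWithCorners.range_eq_univ, fderivWithin_univ] at h
    exact congrArg (fun T : Eu n →L[ℝ] Eu m ↦ T u) h
  have hder' : ∀ u : TangentSpace (𝓡 n) z, (mfderiv (𝓡 n) (𝓡 m') f' z u : Eu m') =
      fderiv ℝ fh' (χ z) u := by
    intro u
    have h : mfderiv (𝓡 n) (𝓡 m') f' z = fderivWithin ℝ fh' (range (𝓡 n)) (χ z) :=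
      (hf'.mdifferentiableAt (x := z) (by simp)).mfderiv
    rw [ModelWithCorners.range_eq_univ, fderivWithin_univ] at h
    exact congrArg (fun T : Eu n →L[ℝ] Eu m' ↦ T u) h
  have hfin := congrArg (fun T : F →L[ℝ] F ↦ T (E'.comps x' x' e)) hmain
  rw [← hder, ← hder, ← hder', ← hder', hc, hc'] at hfin
  have e2 := comps_curvature (E := E) x (mfderiv (𝓡 n) (𝓡 m) f z u) (mfderiv (𝓡 n) (𝓡 m) f z v)
    (Ψ z e)
  have e3 := comps_curvature (E := E') x' (mfderiv (𝓡 n) (𝓡 m') f' z u)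
    (mfderiv (𝓡 n) (𝓡 m') f' z v) e
  have e4 : Φ z (E'.comps x' x' e) = E.comps x x (Ψ z e) := by
    rw [hΦa]
    exact congrArg (fun t ↦ E.comps x x (Ψ z t)) (frame_comps (E'.mem_dom x') e)
  simp only [ContinuousLinearMap.comp_apply] at hfin
  rw [e4] at hfin
  have e5 : Φ z (E'.comps x' x' (E'.curvature x' (mfderiv (𝓡 n) (𝓡 m') f' z u)
      (mfderiv (𝓡 n) (𝓡 m') f' z v) e)) = E.comps x x (Ψ z (E'.curvature x'
      (mfderiv (𝓡 n) (𝓡 m') f' z u) (mfderiv (𝓡 n) (𝓡 m') f' z v) e)) := by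
    rw [hΦa]
    exact congrArg (fun t ↦ E.comps x x (Ψ z t)) (frame_comps (E'.mem_dom x') _)
  have e6 : E.comps x x (E.curvature x (mfderiv (𝓡 n) (𝓡 m) f z u)
      (mfderiv (𝓡 n) (𝓡 m) f z v) (Ψ z e)) = E.comps x x (Ψ z (E'.curvature x'
      (mfderiv (𝓡 n) (𝓡 m') f' z u) (mfderiv (𝓡 n) (𝓡 m') f' z v) e)) := by
    rw [e2, ← e5, e3]
    exact hfin.symm
  have e7 := congrArg (E.frame x x) e6
  rw [frame_comps (E.mem_dom x), frame_comps (E.mem_dom x)] at e7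
  exact e7

end Morphism

end HermitianBundle

end

section

section Trace

variable {F : Type*} [NormedAddCommGroup F] [NormedSpace ℂ F] [FiniteDimensional ℂ F]

variable (F) in
/-- The complex trace, on real linear endomorphisms. -/
def ctrace : (F →L[ℝ] F) →L[ℝ] ℂ :=
  ∑ i, ((LinearMap.toContinuousLinearMap ((Module.finBasis ℂ F).coord i)).restrictScalars ℝ).comp
    (ContinuousLinearMap.apply ℝ F (Module.finBasis ℂ F i))

lemma ctrace_eq (L : F →ₗ[ℂ] F) {φ : F →L[ℝ] F} (h : ∀ f, φ f = L f) :
    ctrace F φ = LinearMap.trace ℂ F L := by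
  rw [LinearMap.trace_eq_matrix_trace ℂ (Module.finBasis ℂ F), Matrix.trace]
  simp [ctrace, LinearMap.toMatrix_apply, h]

/-- A complex linear endomorphism, from a real linear one. -/
def toComplexLinear (φ : F →L[ℝ] F) (h : ∀ (c : ℂ) f, φ (c • f) = c • φ f) : F →ₗ[ℂ] F where
  toFun := φ
  map_add' := map_add φ
  map_smul' := h

lemma ctrace_comm {φ ψ : F →L[ℝ] F} (hφ : ∀ (c : ℂ) f, φ (c • f) = c • φ f)
    (hψ : ∀ (c : ℂ) f, ψ (c • f) = c • ψ f) :
    ctrace F (φ.comp ψ) = ctrace F (ψ.comp φ) := by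
  rw [ctrace_eq (toComplexLinear φ hφ * toComplexLinear ψ hψ) (fun _ ↦ rfl),
    ctrace_eq (toComplexLinear ψ hψ * toComplexLinear φ hφ) (fun _ ↦ rfl), LinearMap.trace_mul_comm]

lemma fderiv_smul_of_forall {D : Type*} [NormedAddCommGroup D] [NormedSpace ℝ D]
    {R : D → F →L[ℝ] F} {p : D} (hR : DifferentiableAt ℝ R p)
    (h : ∀ᶠ q in 𝓝 p, ∀ (c : ℂ) f, R q (c • f) = c • R q f) (u : D) (c : ℂ) (f : F) :
    fderiv ℝ R p u (c • f) = c • fderiv ℝ R p u f := by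
  rw [← fderiv_apply_const hR, ← fderiv_apply_const hR]
  have h1 : (fun q ↦ R q (c • f)) =ᶠ[𝓝 p] fun q ↦ (c • ContinuousLinearMap.id ℝ F) (R q f) := by
    filter_upwards [h] with q hq
    rw [hq]; rfl
  have hd : DifferentiableAt ℝ (fun q ↦ R q f) p := hR.clm_apply (differentiableAt_const f)
  rw [h1.fderiv_eq]
  exact congrArg (fun T : D →L[ℝ] F ↦ T u)
    ((c • ContinuousLinearMap.id ℝ F).hasFDerivAt.comp p hd.hasFDerivAt).fderiv

end Trace

section MixedDerivative

variable {D D' F W : Type*} [NormedAddCommGroup D] [NormedSpace ℝ D] [NormedAddCommGroup D']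
  [NormedSpace ℝ D'] [NormedAddCommGroup F] [NormedSpace ℝ F]
  [NormedAddCommGroup W] [NormedSpace ℝ W]

/-- For a family `R (p, ·)` of gauge transformations between the pull backs of a connection form `α`
under a family of maps `θ (p, ·)` and `α` itself, starting at the identity, the derivative of the
trace of the infinitesimal generator is given by the curvature. -/
lemma fderiv_trace_generator {R : D × D' → F →L[ℝ] F} {θ : D × D' → D'}
    {α : D' → D' →L[ℝ] F →L[ℝ] F} {p₀ : D} {q₀ : D'}
    (hR : ContDiffAt ℝ ∞ R (p₀, q₀)) (hθ : ContDiffAt ℝ ∞ θ (p₀, q₀)) (hα : ContDiffAt ℝ ∞ α q₀)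
    (hR1 : ∀ᶠ q in 𝓝 q₀, R (p₀, q) = ContinuousLinearMap.id ℝ F)
    (hθ1 : ∀ᶠ q in 𝓝 q₀, θ (p₀, q) = q)
    (h : ∀ᶠ p in 𝓝 (p₀, q₀), ∀ w : D', fderiv ℝ R p (0, w) =
      (R p).comp (α (θ p) (fderiv ℝ θ p (0, w))) - (α p.2 w).comp (R p))
    (T : (F →L[ℝ] F) →L[ℝ] W) (a : D) (w : D')
    (hT : T ((fderiv ℝ R (p₀, q₀) (a, 0)).comp (α q₀ w)) =
      T ((α q₀ w).comp (fderiv ℝ R (p₀, q₀) (a, 0))))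
    (hT' : ∀ u v, T ((α q₀ u).comp (α q₀ v)) = T ((α q₀ v).comp (α q₀ u))) :
    DifferentiableAt ℝ (fun q ↦ T (fderiv ℝ R (p₀, q) (a, 0) -
      α q (fderiv ℝ θ (p₀, q) (a, 0)))) q₀ ∧
    fderiv ℝ (fun q ↦ T (fderiv ℝ R (p₀, q) (a, 0) - α q (fderiv ℝ θ (p₀, q) (a, 0)))) q₀ w =
      T (curvForm α q₀ (fderiv ℝ θ (p₀, q₀) (a, 0)) w) := by
  have hθ0 : θ (p₀, q₀) = q₀ := hθ1.self_of_nhds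
  have hR0 : R (p₀, q₀) = ContinuousLinearMap.id ℝ F := hR1.self_of_nhds
  have hRd : DifferentiableAt ℝ R (p₀, q₀) := hR.differentiableAt (by simp)
  have hRd2 : DifferentiableAt ℝ (fderiv ℝ R) (p₀, q₀) :=
    (hR.fderiv_right (m := 1) (WithTop.coe_le_coe.2 le_top)).differentiableAt (by simp)
  have hθd : DifferentiableAt ℝ θ (p₀, q₀) := hθ.differentiableAt (by simp)
  have hθd2 : DifferentiableAt ℝ (fderiv ℝ θ) (p₀, q₀) :=
    (hθ.fderiv_right (m := 1) (WithTop.coe_le_coe.2 le_top)).differentiableAt (by simp)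
  have hαd : DifferentiableAt ℝ α q₀ := hα.differentiableAt (by simp)
  have hαd' : DifferentiableAt ℝ α (θ (p₀, q₀)) := by rwa [hθ0]
  have hs : IsSymmSndFDerivAt ℝ R (p₀, q₀) := hR.isSymmSndFDerivAt (by
    simp only [minSmoothness_of_isRCLikeNormedField]; exact WithTop.coe_le_coe.2 le_top)
  let i : D' → D × D' := fun q ↦ (p₀, q)
  have hi : HasFDerivAt i (ContinuousLinearMap.inr ℝ D D') q₀ := by
    have h1 := (hasFDerivAt_const p₀ q₀).prodMk (hasFDerivAt_id (𝕜 := ℝ) q₀)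
    exact h1
  have hθi : fderiv ℝ θ (p₀, q₀) (0, w) = w := by
    have h1 : HasFDerivAt (θ ∘ i) ((fderiv ℝ θ (p₀, q₀)).comp (ContinuousLinearMap.inr ℝ D D')) q₀ :=
      HasFDerivAt.comp (g := θ) (f := i) q₀ hθd.hasFDerivAt hi
    have h2 : HasFDerivAt (θ ∘ i) (ContinuousLinearMap.id ℝ D') q₀ :=
      (hasFDerivAt_id q₀).congr_of_eventuallyEq hθ1
    have := congrArg (fun S : D' →L[ℝ] D' ↦ S w) (h1.unique h2)
    simpa using this
  set a1 : D × D' → (D × D') →L[ℝ] F →L[ℝ] F := fun p ↦ (α (θ p)).comp (fderiv ℝ θ p) with ha1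
  have ha1d : DifferentiableAt ℝ a1 (p₀, q₀) :=
    (DifferentiableAt.comp (g := α) (f := θ) _ hαd' hθd).clm_comp hθd2
  -- the derivative of the hypothesis in the direction `a`
  have hN : DifferentiableAt ℝ (fun p ↦ fderiv ℝ R p (a, 0) - a1 p (a, 0)) (p₀, q₀) :=
    (hRd2.clm_apply (differentiableAt_const _)).sub (ha1d.clm_apply (differentiableAt_const _))
  have hN1 : (fun q ↦ fderiv ℝ R (p₀, q) (a, 0) - α q (fderiv ℝ θ (p₀, q) (a, 0))) =ᶠ[𝓝 q₀]
      fun q ↦ (fun p ↦ fderiv ℝ R p (a, 0) - a1 p (a, 0)) (i q) := by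
    filter_upwards [hθ1] with q hq
    simp only [i, ha1, ContinuousLinearMap.comp_apply, hq]
  have hNi : HasFDerivAt (fun q ↦ fderiv ℝ R (p₀, q) (a, 0) - α q (fderiv ℝ θ (p₀, q) (a, 0)))
      ((fderiv ℝ (fun p ↦ fderiv ℝ R p (a, 0) - a1 p (a, 0)) (p₀, q₀)).comp
        (ContinuousLinearMap.inr ℝ D D')) q₀ :=
    (HasFDerivAt.comp (g := fun p ↦ fderiv ℝ R p (a, 0) - a1 p (a, 0)) (f := i) q₀
      hN.hasFDerivAt hi).congr_of_eventuallyEq hN1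
  have hTN := T.hasFDerivAt.comp q₀ hNi
  refine ⟨hTN.differentiableAt, ?_⟩
  have e1 : fderiv ℝ (fun q ↦ T (fderiv ℝ R (p₀, q) (a, 0) - α q (fderiv ℝ θ (p₀, q) (a, 0)))) q₀ w
      = T (fderiv ℝ (fun p ↦ fderiv ℝ R p (a, 0) - a1 p (a, 0)) (p₀, q₀) (0, w)) :=
    congrArg (fun S : D' →L[ℝ] W ↦ S w) hTN.fderiv
  have e2 : fderiv ℝ (fun p ↦ fderiv ℝ R p (a, 0) - a1 p (a, 0)) (p₀, q₀) (0, w) =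
      fderiv ℝ (fderiv ℝ R) (p₀, q₀) (0, w) (a, 0) - fderiv ℝ a1 (p₀, q₀) (0, w) (a, 0) := by
    rw [fderiv_fun_sub (hRd2.clm_apply (differentiableAt_const _))
      (ha1d.clm_apply (differentiableAt_const _)), _root_.sub_apply, fderiv_apply_const hRd2,
      fderiv_apply_const ha1d]
  have e3 : fderiv ℝ (fderiv ℝ R) (p₀, q₀) (a, 0) (0, w) =
      (fderiv ℝ R (p₀, q₀) (a, 0)).comp (α q₀ w) + fderiv ℝ a1 (p₀, q₀) (a, 0) (0, w)
        - (α q₀ w).comp (fderiv ℝ R (p₀, q₀) (a, 0)) := by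
    have h1 : (fun p ↦ fderiv ℝ R p (0, w)) =ᶠ[𝓝 (p₀, q₀)]
        fun p ↦ (R p).comp (a1 p (0, w)) - (α p.2 w).comp (R p) := by
      filter_upwards [h] with p hp using hp w
    have hαs : HasFDerivAt (fun p : D × D' ↦ α p.2 w)
        (((fderiv ℝ α q₀).flip w).comp (ContinuousLinearMap.snd ℝ D D')) (p₀, q₀) := by
      have h2 : HasFDerivAt (fun q ↦ α q w) ((fderiv ℝ α q₀).flip w) q₀ := by
        have := (hαd.clm_apply (differentiableAt_const w)).hasFDerivAt
        rw [fderiv_clm_apply hαd (differentiableAt_const w)] at this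
        simpa using this
      exact HasFDerivAt.comp (g := fun q ↦ α q w) (f := fun p : D × D' ↦ p.2) (p₀, q₀) h2
        hasFDerivAt_snd
    have ha1w := ha1d.clm_apply (differentiableAt_const ((0 : D), w))
    rw [← fderiv_apply_const hRd2, h1.fderiv_eq,
      fderiv_fun_sub (hRd.clm_comp ha1w) (hαs.differentiableAt.clm_comp hRd),
      fderiv_clm_comp hRd ha1w, fderiv_clm_comp hαs.differentiableAt hRd, hαs.fderiv]
    ext f
    have e0 : a1 (p₀, q₀) (0, w) = α q₀ w := by
      simp only [ha1, ContinuousLinearMap.comp_apply, hθi, hθ0]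
    simp [e0, hR0, fderiv_apply_const ha1d]
    abel
  have e4 := curvForm_pullback hαd' hθ (a, (0 : D')) ((0 : D), w)
  rw [hθ0, hθi] at e4
  have e5 : T (curvForm a1 (p₀, q₀) (a, 0) (0, w)) =
      T (fderiv ℝ a1 (p₀, q₀) (a, 0) (0, w)) - T (fderiv ℝ a1 (p₀, q₀) (0, w) (a, 0)) := by
    have h1 := hT' (fderiv ℝ θ (p₀, q₀) (a, 0)) w
    have e0 : a1 (p₀, q₀) (0, w) = α q₀ w := by
      simp only [ha1, ContinuousLinearMap.comp_apply, hθi, hθ0]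
    have e0' : a1 (p₀, q₀) (a, 0) = α q₀ (fderiv ℝ θ (p₀, q₀) (a, 0)) := by
      simp only [ha1, ContinuousLinearMap.comp_apply, hθ0]
    unfold curvForm
    rw [e0, e0', map_sub, map_add, map_sub, h1]
    abel
  rw [e1, e2, hs.eq, e3, map_sub, map_sub, map_add, hT, ← e4, show
    (fun q ↦ (α (θ q)).comp (fderiv ℝ θ q)) = a1 from rfl, e5]
  abel

end MixedDerivative

namespace HermitianBundle

variable {m : ℕ} {F : Type u} [NormedAddCommGroup F] [NormedSpace ℂ F]
  {M : Type v} [TopologicalSpace M] [ChartedSpace (EuclideanSpace ℝ (Fin m)) M]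
  [IsManifold (𝓡 m) ∞ M] (E : HermitianBundle.{u, v, w} m F M)

/-- The preferred trivialization of `E` at `x`, on the fibre at a point of its domain. -/
def frameEquiv {x y : M} (hy : y ∈ E.dom x) : F ≃ₗ[ℂ] E.Fib y where
  toFun := E.frame x y
  invFun := E.comps x y
  left_inv := comps_frame hy
  right_inv := frame_comps hy
  map_add' := map_add _
  map_smul' := frame_smul x y

instance [FiniteDimensional ℂ F] (x : M) : FiniteDimensional ℂ (E.Fib x) :=
  (E.frameEquiv (E.mem_dom x)).finiteDimensional

lemma trace_eq_ctrace [FiniteDimensional ℂ F] {x y : M} (hy : y ∈ E.dom x)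
    {L : E.Fib y →ₗ[ℂ] E.Fib y} {φ : F →L[ℝ] F}
    (h : ∀ e, E.comps x y (L e) = φ (E.comps x y e)) :
    LinearMap.trace ℂ (E.Fib y) L = ctrace F φ := by
  rw [← LinearMap.trace_conj' L (E.frameEquiv hy).symm]
  refine (ctrace_eq _ fun f ↦ ?_).symm
  rw [LinearEquiv.conj_apply]
  change φ f = E.comps x y (L (E.frame x y f))
  rw [h, comps_frame hy]

variable {E}

/-- The curvature is skew Hermitian. -/
lemma inner_curvature [FiniteDimensional ℂ F] (x : M) (u v : TangentSpace (𝓡 m) x) (e e' : E.Fib x) :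
    inner ℂ (E.curvature x u v e) e' + inner ℂ e (E.curvature x u v e') = 0 := by
  have hx := mem_chart_source (Eu m) x
  let s : Π y, E.Fib y := localExt ℂ F e
  let t : Π y, E.Fib y := localExt ℂ F e'
  let X : Eu m → Π y : M, TangentSpace (𝓡 m) y := fun u y ↦ fld x y u
  have hs : E.SmoothAt s x := smoothAt_localExt e
  have ht : E.SmoothAt t x := smoothAt_localExt e'
  have hX : ∀ u, SmoothFieldAt (X u) x := fun u ↦ smoothFieldAt_fld hx u
  have hXe : ∀ u : TangentSpace (𝓡 m) x,
      (localExt ℝ (Eu m) u : Π y : M, TangentSpace (𝓡 m) y) = X u := by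
    intro u; funext y; exact localExt_tangent u y
  have hself : ∀ u : TangentSpace (𝓡 m) x, X u x = u := fun u ↦ fld_self x u
  let h : M → ℂ := fun y ↦ inner ℂ (s y) (t y)
  have hh : ContMDiffAt (𝓡 m) 𝓘(ℝ, ℂ) ∞ h x := E.smooth_inner x s t hs ht
  have hh' : ContDiffAt ℝ ∞ (fun p ↦ h ((extChartAt (𝓡 m) x).symm p)) (extChartAt (𝓡 m) x x) :=
    contDiffAt_comp_extChartAt_symm hx hh
  have key : ∀ u v : TangentSpace (𝓡 m) x,
      fderiv ℝ (fderiv ℝ (fun p ↦ h ((extChartAt (𝓡 m) x).symm p))) (extChartAt (𝓡 m) x x) u v =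
        inner ℂ (E.conn (fun y ↦ E.conn s y (X v y)) x u) (t x) +
        inner ℂ (E.conn s x v) (E.conn t x u) + (inner ℂ (E.conn s x u) (E.conn t x v) +
        inner ℂ (s x) (E.conn (fun y ↦ E.conn t y (X v y)) x u)) := by
    intro u v
    have h1 : ∀ᶠ y in 𝓝 x, mvfderiv (𝓡 m) h y (X v y) =
        inner ℂ (E.conn s y (X v y)) (t y) + inner ℂ (s y) (E.conn t y (X v y)) := by
      filter_upwards [hs.eventually_mdiff, ht.eventually_mdiff] with y h1 h2
      exact E.conn_unitary y s t (X v y) h1 h2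
    have h2 : ∀ᶠ p in 𝓝 (extChartAt (𝓡 m) x x),
        fderiv ℝ (fun p ↦ h ((extChartAt (𝓡 m) x).symm p)) p v =
        mvfderiv (𝓡 m) h ((extChartAt (𝓡 m) x).symm p) (X v ((extChartAt (𝓡 m) x).symm p)) := by
      have h3 : ∀ᶠ y in 𝓝 x, MDifferentiableAt (𝓡 m) 𝓘(ℝ, ℂ) h y := by
        have h4 : ContMDiffAt (𝓡 m) 𝓘(ℝ, ℂ) 1 h x := hh.of_le (by simp)
        filter_upwards [(contMDiffAt_iff_contMDiffAt_nhds (by simp)).1 h4] with y hy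
        exact ContMDiffAt.mdifferentiableAt hy (by simp)
      filter_upwards [eventually_extChartAt_symm hx h3, eventually_extChartAt_symm hx
        ((chartAt (Eu m) x).open_source.mem_nhds hx),
        extChartAt_target_mem_nhds (I := 𝓡 m) x] with p hp hp2 hp3
      have h5 := mvfderiv_fld hp2 hp (v : Eu m)
      rw [(extChartAt (𝓡 m) x).right_inv hp3] at h5
      exact h5.symm
    have hfd : DifferentiableAt ℝ (fderiv ℝ (fun p ↦ h ((extChartAt (𝓡 m) x).symm p)))
        (extChartAt (𝓡 m) x x) :=
      (hh'.fderiv_right (m := 1) (WithTop.coe_le_coe.2 le_top)).differentiableAt (by simp)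
    have hS := E.conn_smooth x s (X v) hs (hX v)
    have hT := E.conn_smooth x t (X v) ht (hX v)
    have hi1 := E.smooth_inner x _ t hS ht
    have hi2 := E.smooth_inner x s _ hs hT
    have hg : ContMDiffAt (𝓡 m) 𝓘(ℝ, ℂ) ∞ (fun y ↦ mvfderiv (𝓡 m) h y (X v y)) x :=
      (hi1.add hi2).congr_of_eventuallyEq h1
    have h6 := mvfderiv_eq_fderiv_comp (hg.mdifferentiableAt (by simp)) u
    have h7 : fderiv ℝ (fderiv ℝ (fun p ↦ h ((extChartAt (𝓡 m) x).symm p))) (extChartAt (𝓡 m) x x)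
        u v = mvfderiv (𝓡 m) (fun y ↦ mvfderiv (𝓡 m) h y (X v y)) x u := by
      refine Eq.trans ?_ h6.symm
      have h8 := fderiv_apply_const hfd (u : Eu m) (v : Eu m)
      refine h8.symm.trans ?_
      exact congrArg (fun S : Eu m →L[ℝ] ℂ ↦ S u) (Filter.EventuallyEq.fderiv_eq h2)
    rw [h7, mvfderiv_congr_of_eventuallyEq h1, mvfderiv_fun_add (hi1.mdifferentiableAt (by simp))
      (hi2.mdifferentiableAt (by simp)), E.conn_unitary x _ t u (SmoothAt.mdiff hS) ht.mdiff,
      E.conn_unitary x s _ u hs.mdiff (SmoothAt.mdiff hT), hself]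
  have hsymm : IsSymmSndFDerivAt ℝ (fun p ↦ h ((extChartAt (𝓡 m) x).symm p))
      (extChartAt (𝓡 m) x x) := hh'.isSymmSndFDerivAt (by
    simp only [minSmoothness_of_isRCLikeNormedField]; exact WithTop.coe_le_coe.2 le_top)
  have hsx : s x = e := localExt_self e
  have htx : t x = e' := localExt_self e'
  have hbr : ∀ r : Π y, E.Fib y, E.conn r x (VectorField.mlieBracket (𝓡 m) (X u) (X v) x) = 0 := by
    intro r
    rw [show VectorField.mlieBracket (𝓡 m) (X u) (X v) x = 0 from mlieBracket_fld x u v, map_zero]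
  have hF : ∀ e₁ : E.Fib x, E.curvature x u v e₁ =
      E.conn (fun y ↦ E.conn (localExt ℂ F e₁) y (X v y)) x u -
        E.conn (fun y ↦ E.conn (localExt ℂ F e₁) y (X u y)) x v := by
    intro e₁
    change E.curvAux (localExt ℂ F e₁) (localExt ℝ (Eu m) u) (localExt ℝ (Eu m) v) x = _
    rw [hXe, hXe, curvAux, hbr, sub_zero, hself, hself]
  have k1 := (key u v).symm.trans ((hsymm.eq u v).trans (key v u))
  rw [hF, hF, inner_sub_left, inner_sub_right]
  rw [hsx, htx] at k1
  linear_combination k1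

/-- The trace part of the curvature is a real form. -/
lemma traceCurvature_im [FiniteDimensional ℂ F] (x : M) (u v : TangentSpace (𝓡 m) x) :
    (E.traceCurvature x u v).im = 0 := by
  let b := stdOrthonormalBasis ℂ (E.Fib x)
  have h1 := LinearMap.trace_eq_sum_inner (E.curvature x u v) b
  have h2 : (LinearMap.trace ℂ (E.Fib x) (E.curvature x u v)).re = 0 := by
    rw [h1, Complex.re_sum]
    refine Finset.sum_eq_zero fun i _ ↦ ?_
    have h3 := inner_curvature x u v (b i) (b i)
    rw [← inner_conj_symm] at h3
    have := congrArg Complex.re h3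
    simp only [Complex.add_re, Complex.conj_re, Complex.zero_re] at this
    linarith
  change (Complex.I / (Module.finrank ℂ F : ℂ) *
    LinearMap.trace ℂ (E.Fib x) (E.curvature x u v)).im = 0
  have h4 : Complex.I / (Module.finrank ℂ F : ℂ) = (((Module.finrank ℂ F : ℝ)⁻¹ : ℝ) : ℂ) *
      Complex.I := by
    push_cast; ring
  rw [h4, mul_assoc, Complex.im_ofReal_mul, Complex.I_mul_im, h2, mul_zero]

end HermitianBundle

end

section

namespace EquivariantStructure

variable {m k : ℕ} {F : Type u} [NormedAddCommGroup F] [NormedSpace ℂ F]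
  {M : Type v} [TopologicalSpace M] [ChartedSpace (EuclideanSpace ℝ (Fin m)) M]
  [IsManifold (𝓡 m) ∞ M] {E : HermitianBundle.{u, v, w} m F M}
  {G : Type*} [Group G] [TopologicalSpace G]
  [ChartedSpace (EuclideanSpace ℝ (Fin k)) G] [LieGroup (𝓡 k) ∞ G]
  [MulAction G M] [ContMDiffSMul (𝓡 k) (𝓡 m) ∞ G M]
  (A : EquivariantStructure k G E)

lemma act_congr {g g' : G} (hg : g = g') {x y : M} (h : g • x = y) (h' : g' • x = y)
    (e : E.Fib x) : A.act g h e = A.act g' h' e := by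
  subst hg; rfl

lemma orbitSection_eq (s : Π y, E.Fib y) {g : G} {x y : M} (h : g • y = x) :
    A.orbitSection s x g = A.act g h (s y) := by
  have key : ∀ y' (h' : g • y' = x), y' = y → A.act g h' (s y') = A.act g h (s y) := by
    rintro y' h' rfl; rfl
  exact key _ _ (by rw [← h, inv_smul_smul])

lemma contMDiffAt_act {IN : Type*} [NormedAddCommGroup IN] [NormedSpace ℝ IN] {HN : Type*}
    [TopologicalSpace HN] {JN : ModelWithCorners ℝ IN HN} {P : Type*} [TopologicalSpace P]
    [ChartedSpace HN P] {h : P → G} {f f' : P → M} {z : P} (hh : ContMDiffAt JN (𝓡 k) ∞ h z)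
    (hf : ∀ z, h z • f z = f' z) {σ : Π z, E.Fib (f z)}
    (hσ : ContMDiffAt JN ((𝓡 m).prod 𝓘(ℝ, F)) ∞ (fun z ↦ Bundle.TotalSpace.mk' F (f z) (σ z)) z) :
    ContMDiffAt JN ((𝓡 m).prod 𝓘(ℝ, F)) ∞
      (fun z ↦ Bundle.TotalSpace.mk' F (f' z) (A.act (h z) (hf z) (σ z))) z := by
  have h1 := ContMDiffAt.comp z (A.smooth.contMDiffAt (x := (h z, Bundle.TotalSpace.mk' F (f z) (σ z))))
    (hh.prodMk hσ)
  refine h1.congr_of_eventuallyEq (Eventually.of_forall fun z' ↦ ?_)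
  exact A.mk_act _ _ _

lemma smoothAt_orbitSection {s : Π y, E.Fib y} {g : G} {y : M} (hs : E.SmoothAt s (g⁻¹ • y)) :
    E.SmoothAt (fun y ↦ A.orbitSection s y g) y := by
  refine A.contMDiffAt_act (h := fun _ ↦ g) (f := fun y ↦ g⁻¹ • y) (f' := fun y ↦ y)
    contMDiffAt_const (fun z ↦ smul_inv_smul g z) (σ := fun y ↦ s (g⁻¹ • y)) ?_
  unfold HermitianBundle.SmoothAt at hs
  exact ContMDiffAt.comp y hs (contMDiff_const_smul k g⁻¹).contMDiffAt

lemma conn_orbitSection (g : G) (y : M) (s : Π y, E.Fib y) (hs : E.SmoothAt s (g⁻¹ • y))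
    (w : TangentSpace (𝓡 m) y) :
    E.conn (fun y ↦ A.orbitSection s y g) y w = A.act g (smul_inv_smul g y)
      (E.conn s (g⁻¹ • y) (mfderiv (𝓡 m) (𝓡 m) (fun y : M ↦ g⁻¹ • y) y w)) := by
  have key : ∀ x (hx : g • x = y), E.SmoothAt s x → ∀ u, mfderiv (𝓡 m) (𝓡 m) (fun y : M ↦ g • y) x u
      = (w : Eu m) → E.conn (fun y ↦ A.orbitSection s y g) y w = A.act g hx (E.conn s x u) := by
    rintro x rfl hs u hu
    rw [← A.conn_invariant g x s u hs]
    exact congrArg (E.conn (fun y ↦ A.orbitSection s y g) (g • x)) hu.symm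
  refine key _ _ hs _ ?_
  have h1 := mfderiv_comp_apply (I := 𝓡 m) (I' := 𝓡 m) (I'' := 𝓡 m) y
    (f := fun y : M ↦ g⁻¹ • y) (g := fun y : M ↦ g • y) (mdiff_const_smul k g (g⁻¹ • y))
    (mdiff_const_smul k g⁻¹ y) w
  refine Eq.trans h1.symm ?_
  have h2 : (fun y : M ↦ g • y) ∘ (fun y : M ↦ g⁻¹ • y) = id := by
    funext y; exact smul_inv_smul g y
  have h3 : ∀ f : M → M, f = id → (mfderiv (𝓡 m) (𝓡 m) f y w : Eu m) = w := by
    rintro f rfl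
    have h4 : mfderiv (𝓡 m) (𝓡 m) (id : M → M) y = ContinuousLinearMap.id ℝ _ := mfderiv_id
    exact congrArg (fun T : TangentSpace (𝓡 m) y →L[ℝ] TangentSpace (𝓡 m) y ↦ T w) h4
  exact h3 _ h2

/-- The action of `g` from the fibre at `g⁻¹ y` to the fibre at `y`, in a trivialization. -/
def actIn (x : M) (p : G × M) : F →L[ℝ] F :=
  (E.comps x p.2).comp
    (((A.act p.1 (smul_inv_smul p.1 p.2)).toContinuousLinearEquiv.toContinuousLinearMap.restrictScalars
      ℝ).comp (E.frame x (p.1⁻¹ • p.2)))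

lemma actIn_apply (x : M) (p : G × M) (f : F) :
    A.actIn x p f = E.comps x p.2 (A.orbitSection (fun z ↦ E.frame x z f) p.2 p.1) := rfl

lemma comps_orbitSection {x y : M} {g : G} (hy : g⁻¹ • y ∈ E.dom x) (s : Π y, E.Fib y) :
    E.comps x y (A.orbitSection s y g) = A.actIn x (g, y) (E.comps x (g⁻¹ • y) (s (g⁻¹ • y))) := by
  rw [actIn_apply]
  simp only [orbitSection]
  rw [HermitianBundle.frame_comps hy]

lemma actIn_one {x y : M} (hy : y ∈ E.dom x) : A.actIn x (1, y) = ContinuousLinearMap.id ℝ F := by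
  ext f
  rw [actIn_apply, A.orbitSection_eq _ (one_smul G y), A.act_one, HermitianBundle.comps_frame hy]
  rfl

lemma actIn_smul {x y : M} {g : G} (hy : y ∈ E.dom x) (c : ℂ) (f : F) :
    A.actIn x (g, y) (c • f) = c • A.actIn x (g, y) f := by
  rw [actIn_apply, actIn_apply, ← HermitianBundle.comps_smul hy]
  simp only [orbitSection, HermitianBundle.frame_smul, map_smul]

lemma contMDiffAt_actIn {x y : M} {g : G} (hy : y ∈ E.dom x) (hgy : g⁻¹ • y ∈ E.dom x) (f : F) :
    ContMDiffAt ((𝓡 k).prod (𝓡 m)) 𝓘(ℝ, F) ∞ (fun p ↦ A.actIn x p f) (g, y) := by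
  refine (HermitianBundle.contMDiffAt_mk_iff (f := fun p : G × M ↦ p.2) contMDiffAt_snd hy).1 ?_
  refine A.contMDiffAt_act (h := fun p : G × M ↦ p.1) (f := fun p ↦ p.1⁻¹ • p.2) contMDiffAt_fst
    (fun p ↦ smul_inv_smul p.1 p.2) (σ := fun p ↦ E.frame x (p.1⁻¹ • p.2) f) ?_
  have h1 : E.SmoothAt (fun z ↦ E.frame x z f) (g⁻¹ • y) :=
    HermitianBundle.smoothAt_frame hgy contMDiffAt_const
  have h2 : ContMDiffAt ((𝓡 k).prod (𝓡 m)) (𝓡 m) ∞ (fun p : G × M ↦ p.1⁻¹ • p.2) (g, y) :=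
    (((contMDiff_inv (𝓡 k) ∞).comp contMDiff_fst).smul contMDiff_snd).contMDiffAt
  unfold HermitianBundle.SmoothAt at h1
  exact ContMDiffAt.comp (g, y) h1 h2

lemma contMDiffAt_actIn_left {x y : M} {g : G} (hy : y ∈ E.dom x) (hgy : g⁻¹ • y ∈ E.dom x) (f : F) :
    ContMDiffAt (𝓡 k) 𝓘(ℝ, F) ∞ (fun h ↦ A.actIn x (h, y) f) g :=
  ContMDiffAt.comp g (A.contMDiffAt_actIn hy hgy f) (contMDiffAt_id.prodMk contMDiffAt_const)

lemma contMDiffAt_actIn_right {x y : M} {g : G} (hy : y ∈ E.dom x) (hgy : g⁻¹ • y ∈ E.dom x) (f : F) :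
    ContMDiffAt (𝓡 m) 𝓘(ℝ, F) ∞ (fun z ↦ A.actIn x (g, z) f) y :=
  ContMDiffAt.comp y (A.contMDiffAt_actIn hy hgy f) (contMDiffAt_const.prodMk contMDiffAt_id)

variable [FiniteDimensional ℂ F]

lemma _root_.ABrane.contMDiffAt_clm_of_apply {n : ℕ} {N : Type*} [TopologicalSpace N]
    [ChartedSpace (EuclideanSpace ℝ (Fin n)) N] [IsManifold (𝓡 n) ∞ N] {V W : Type*}
    [NormedAddCommGroup V] [NormedSpace ℝ V] [FiniteDimensional ℝ V] [NormedAddCommGroup W]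
    [NormedSpace ℝ W] {T : N → V →L[ℝ] W} {y : N}
    (h : ∀ v, ContMDiffAt (𝓡 n) 𝓘(ℝ, W) ∞ (fun z ↦ T z v) y) :
    ContMDiffAt (𝓡 n) 𝓘(ℝ, V →L[ℝ] W) ∞ T y :=
  contMDiffAt_of_comp_extChartAt_symm (mem_chart_source _ y)
    (contDiffAt_clm_of_apply fun v ↦ contDiffAt_comp_extChartAt_symm (mem_chart_source _ y) (h v))

/-- The zeroth order operator `L_a - ∇_{χ(a)}`, in a trivialization. -/
def generator (x : M) (a : GroupLieAlgebra (𝓡 k) G) (y : M) : F →L[ℝ] F :=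
  mvfderiv (𝓡 k) (fun g : G ↦ A.actIn x (g, y)) 1 a - E.connForm x y (infAct G y a)

lemma mdiff_actIn_left {x y : M} (hy : y ∈ E.dom x) :
    MDifferentiableAt (𝓡 k) 𝓘(ℝ, F →L[ℝ] F) (fun g : G ↦ A.actIn x (g, y)) 1 :=
  (contMDiffAt_clm_of_apply fun f ↦ A.contMDiffAt_actIn_left hy
    (by simpa using hy) f).mdifferentiableAt (by simp)

lemma comps_lieDeriv_sub {x y : M} (hy : y ∈ E.dom x) (a : GroupLieAlgebra (𝓡 k) G)
    {s : Π y, E.Fib y} (hs : E.SmoothAt s y) :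
    E.comps x y (A.lieDeriv a s y - E.conn s y (infAct G y a)) =
      A.generator x a y (E.comps x y (s y)) := by
  have e1 : (1 : G)⁻¹ • y = y := by simp
  have h1 : mvfderiv (𝓡 k) (fun g ↦ E.comps x y (A.orbitSection s y g)) 1 a =
      E.comps x y (A.lieDeriv a s y) := mvfderiv_clm_comp (E.comps x y) (A.mdiff_orbitSection hs) a
  have hcont : ContinuousAt (fun g : G ↦ g⁻¹ • y) 1 :=
    (contMDiff_inv_smul_const (k := k) (m := m) y).continuous.continuousAt
  have h2 : ∀ᶠ g in 𝓝 (1 : G), E.comps x y (A.orbitSection s y g) =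
      A.actIn x (g, y) (E.comps x (g⁻¹ • y) (s (g⁻¹ • y))) := by
    filter_upwards [hcont.preimage_mem_nhds ((E.isOpen_dom x).mem_nhds
      (show (1 : G)⁻¹ • y ∈ E.dom x by rwa [e1]))] with g hg
    exact A.comps_orbitSection hg s
  have hcs : ∀ y', y' = y → MDifferentiableAt (𝓡 m) 𝓘(ℝ, F) (fun z ↦ E.comps x z (s z)) y' := by
    rintro y' rfl
    exact (HermitianBundle.mdiff_iff hy).1 hs.mdiff
  have h3 : MDifferentiableAt (𝓡 k) 𝓘(ℝ, F) (fun g : G ↦ E.comps x (g⁻¹ • y) (s (g⁻¹ • y))) 1 :=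
    MDifferentiableAt.comp (1 : G) (g := fun z ↦ E.comps x z (s z)) (f := fun g : G ↦ g⁻¹ • y)
      (hcs _ e1) (mdiff_inv_smul_const y 1)
  have h4 : mvfderiv (𝓡 k) (fun g : G ↦ E.comps x (g⁻¹ • y) (s (g⁻¹ • y))) 1 a =
      mvfderiv (𝓡 m) (fun z ↦ E.comps x z (s z)) y (infAct G y a) := by
    rw [mvfderiv_comp_vec (g := fun z ↦ E.comps x z (s z)) (f := fun g : G ↦ g⁻¹ • y)
      (hcs _ e1) (mdiff_inv_smul_const y 1)]
    have h5 : ∀ y' (u : Eu m), y' = y → mvfderiv (𝓡 m) (fun z ↦ E.comps x z (s z)) y' u =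
        mvfderiv (𝓡 m) (fun z ↦ E.comps x z (s z)) y u := by
      rintro y' u rfl; rfl
    exact h5 _ _ e1
  have h6 : ∀ y', y' = y → E.comps x y' (s y') = E.comps x y (s y) := by
    rintro y' rfl; rfl
  rw [map_sub, ← h1, mvfderiv_congr_of_eventuallyEq h2, mvfderiv_clm_apply (A.mdiff_actIn_left hy) h3,
    h4, HermitianBundle.comps_conn hy hs.mdiff, A.actIn_one hy, h6 _ e1, generator]
  simp only [_root_.sub_apply, ContinuousLinearMap.id_apply]
  abel

lemma comps_momentSection {x y : M} (hy : y ∈ E.dom x)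
    (μ : M → Module.Dual ℝ (GroupLieAlgebra (𝓡 k) G)) (a : GroupLieAlgebra (𝓡 k) G) (e : E.Fib y) :
    E.comps x y (A.momentSection μ y a e) =
      A.generator x a y (E.comps x y e) + (μ y a : ℂ) • E.comps x y e := by
  change E.comps x y (A.lieDeriv a (localExt ℂ F e) y - E.conn (localExt ℂ F e) y (infAct G y a)
    + (μ y a : ℂ) • e) = _
  rw [map_add, HermitianBundle.comps_smul hy,
    A.comps_lieDeriv_sub hy a (HermitianBundle.smoothAt_localExt e), localExt_self]

/-- The moment section does not depend on the extension. -/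
lemma momentSection_apply {y : M} (μ : M → Module.Dual ℝ (GroupLieAlgebra (𝓡 k) G))
    (a : GroupLieAlgebra (𝓡 k) G) {s : Π y, E.Fib y} (hs : E.SmoothAt s y) :
    A.momentSection μ y a (s y) =
      A.lieDeriv a s y - E.conn s y (infAct G y a) + (μ y a : ℂ) • s y := by
  have hy := E.mem_dom y
  have h := A.comps_momentSection hy μ a (s y)
  rw [← A.comps_lieDeriv_sub hy a hs, ← HermitianBundle.comps_smul hy, ← map_add] at h
  have h2 := congrArg (E.frame y y) h
  rwa [HermitianBundle.frame_comps hy, HermitianBundle.frame_comps hy] at h2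

/-- The moment trace in a trivialization. -/
lemma momentTrace_eq [Nontrivial F] {x y : M} (hy : y ∈ E.dom x)
    (μ : M → Module.Dual ℝ (GroupLieAlgebra (𝓡 k) G)) (a : GroupLieAlgebra (𝓡 k) G) :
    A.momentTrace μ y a = Complex.I / (Module.finrank ℂ F : ℂ) * ctrace F (A.generator x a y) +
      Complex.I * (μ y a : ℂ) := by
  have hr : (Module.finrank ℂ F : ℂ) ≠ 0 := by
    exact_mod_cast (Module.finrank_pos (R := ℂ) (M := F)).ne'
  have h1 := E.trace_eq_ctrace hy (L := A.momentSection μ y a)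
    (φ := A.generator x a y + (μ y a : ℂ) • ContinuousLinearMap.id ℝ F)
    (fun e ↦ by rw [A.comps_momentSection hy]; rfl)
  have h2 : ctrace F ((μ y a : ℂ) • ContinuousLinearMap.id ℝ F) =
      (μ y a : ℂ) * (Module.finrank ℂ F : ℂ) := by
    rw [ctrace_eq ((μ y a : ℂ) • LinearMap.id) (fun _ ↦ rfl), map_smul, LinearMap.trace_id,
      smul_eq_mul]
  rw [momentTrace, h1, map_add, h2]
  field_simp

lemma momentTrace_of_lieDeriv_eq [Nontrivial F] {y : M}
    (μ : M → Module.Dual ℝ (GroupLieAlgebra (𝓡 k) G)) (a : GroupLieAlgebra (𝓡 k) G)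
    (h : ∀ s : Π y, E.Fib y, E.SmoothAt s y → E.conn s y (infAct G y a) = A.lieDeriv a s y) :
    A.momentTrace μ y a = Complex.I * (μ y a : ℂ) := by
  have hr : (Module.finrank ℂ F : ℂ) ≠ 0 := by
    exact_mod_cast (Module.finrank_pos (R := ℂ) (M := F)).ne'
  have h1 : A.momentSection μ y a = (μ y a : ℂ) • LinearMap.id := by
    ext e
    have h2 := A.momentSection_apply μ a (HermitianBundle.smoothAt_localExt e)
    rw [h _ (HermitianBundle.smoothAt_localExt e), localExt_self, sub_self, zero_add] at h2
    exact h2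
  have hfr : Module.finrank ℂ (E.Fib y) = Module.finrank ℂ F :=
    (E.frameEquiv (E.mem_dom y)).finrank_eq.symm
  rw [momentTrace, h1, map_smul, LinearMap.trace_id, hfr, smul_eq_mul]
  field_simp

/-- The moment section is equivariant. -/
lemma momentSection_act {μ : M → Module.Dual ℝ (GroupLieAlgebra (𝓡 k) G)}
    (hμ : ∀ (g : G) x a, μ (g • x) (adjoint g a) = μ x a) (g : G) (x : M)
    (a : GroupLieAlgebra (𝓡 k) G) (e : E.Fib x) :
    A.momentSection μ (g • x) (adjoint g a) (A.act g rfl e) =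
      A.act g rfl (A.momentSection μ x a e) := by
  set s : Π y, E.Fib y := localExt ℂ F e with hsdef
  have hs : E.SmoothAt s x := HermitianBundle.smoothAt_localExt e
  have hsx : s x = e := localExt_self e
  have hs' : E.SmoothAt s (g⁻¹ • g • x) := by rwa [inv_smul_smul]
  set t : Π y, E.Fib y := fun y ↦ A.orbitSection s y g with ht
  have htx : t (g • x) = A.act g rfl e := by
    rw [ht, ← hsx]; exact A.orbitSection_eq s rfl
  have hts : E.SmoothAt t (g • x) := A.smoothAt_orbitSection hs'
  have hL : A.lieDeriv (adjoint g a) t (g • x) = A.act g rfl (A.lieDeriv a s x) := by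
    let c : G → G := fun h ↦ g⁻¹ * h * g⁻¹⁻¹
    have hc1 : c 1 = 1 := by simp [c]
    have hcd : MDifferentiableAt (𝓡 k) (𝓡 k) c 1 :=
      ((contMDiff_const.mul contMDiff_id).mul contMDiff_const :
        ContMDiff (𝓡 k) (𝓡 k) ∞ c).contMDiffAt.mdifferentiableAt (by simp)
    let T : E.Fib x →L[ℝ] E.Fib (g • x) :=
      (A.act g (rfl : g • x = g • x)).toContinuousLinearEquiv.toContinuousLinearMap.restrictScalars ℝ
    have h1 : A.orbitSection t (g • x) = fun h ↦ T (A.orbitSection s x (c h)) := by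
      funext h
      have h2 : h • h⁻¹ • g • x = g • x := smul_inv_smul _ _
      have h3 : g • g⁻¹ • h⁻¹ • g • x = h⁻¹ • g • x := smul_inv_smul _ _
      have h4 : c h • g⁻¹ • h⁻¹ • g • x = x := by simp [c, smul_smul, mul_assoc]
      have h5 : (h * g) • g⁻¹ • h⁻¹ • g • x = g • x := by rw [mul_smul, h3, h2]
      have h6 : (g * c h) • g⁻¹ • h⁻¹ • g • x = g • x := by rw [mul_smul, h4]
      rw [A.orbitSection_eq t h2, ht]
      change A.act h h2 (A.orbitSection s (h⁻¹ • g • x) g) = A.act g rfl (A.orbitSection s x (c h))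
      rw [A.orbitSection_eq s h3, A.orbitSection_eq s h4, ← A.act_mul h g h3 h2 h5,
        ← A.act_mul g (c h) h4 rfl h6]
      exact A.act_congr (by simp [c, mul_assoc]) _ _ _
    have hod : ∀ g', g' = 1 → MDifferentiableAt (𝓡 k) 𝓘(ℝ, E.Fib x) (A.orbitSection s x) g' := by
      rintro g' rfl; exact A.mdiff_orbitSection hs
    have hoc : MDifferentiableAt (𝓡 k) 𝓘(ℝ, E.Fib x) (fun h ↦ A.orbitSection s x (c h)) 1 :=
      MDifferentiableAt.comp (1 : G) (hod _ hc1) hcd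
    have h7 : ∀ g' (u : Eu k), g' = 1 → mvfderiv (𝓡 k) (A.orbitSection s x) g' u =
        mvfderiv (𝓡 k) (A.orbitSection s x) 1 u := by
      rintro g' u rfl; rfl
    unfold lieDeriv
    rw [h1, mvfderiv_clm_comp T hoc, mvfderiv_comp_vec (g := A.orbitSection s x) (f := c)
      (hod _ hc1) hcd]
    have h8 : (mfderiv (𝓡 k) (𝓡 k) c 1 (adjoint g a) : Eu k) = a := adjoint_inv_adjoint g a
    refine congrArg T (Eq.trans (h7 _ _ hc1) ?_)
    exact congrArg (fun u : Eu k ↦ mvfderiv (𝓡 k) (A.orbitSection s x) 1 u) h8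
  have hC : E.conn t (g • x) (infAct G (g • x) (adjoint g a)) =
      A.act g rfl (E.conn s x (infAct G x a)) := by
    rw [← mfderiv_const_smul_infAct]
    exact A.conn_invariant g x s _ hs
  rw [← htx, A.momentSection_apply μ _ hts, hL, hC, hμ, htx, ← hsx, A.momentSection_apply μ a hs,
    map_add, map_sub, map_smul]

lemma momentTrace_smul {μ : M → Module.Dual ℝ (GroupLieAlgebra (𝓡 k) G)}
    (hμ : ∀ (g : G) x a, μ (g • x) (adjoint g a) = μ x a) (g : G) (x : M)
    (a : GroupLieAlgebra (𝓡 k) G) :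
    A.momentTrace μ (g • x) (adjoint g a) = A.momentTrace μ x a := by
  unfold momentTrace
  rw [← LinearMap.trace_conj' (A.momentSection μ x a) (A.act g (rfl : g • x = g • x)).toLinearEquiv]
  congr 2
  ext e
  rw [LinearEquiv.conj_apply]
  have h := A.momentSection_act hμ g x a ((A.act g rfl).symm e)
  rw [LinearIsometryEquiv.apply_symm_apply] at h
  exact h

lemma momentTrace_level_smul {μ : M → Module.Dual ℝ (GroupLieAlgebra (𝓡 k) G)}
    (hμ : ∀ (g : G) x a, μ (g • x) (adjoint g a) = μ x a) (g : G) (x : M)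
    (hx : ∀ a, A.momentTrace μ x a = 0) (a : GroupLieAlgebra (𝓡 k) G) :
    A.momentTrace μ (g • x) a = 0 := by
  have h := adjoint_inv_adjoint g⁻¹ a
  rw [inv_inv] at h
  rw [← h, A.momentTrace_smul hμ]
  exact hx _

end EquivariantStructure

end

section

namespace EquivariantStructure

variable {m k : ℕ} {F : Type u} [NormedAddCommGroup F] [NormedSpace ℂ F]
  {M : Type v} [TopologicalSpace M] [ChartedSpace (EuclideanSpace ℝ (Fin m)) M]
  [IsManifold (𝓡 m) ∞ M] {E : HermitianBundle.{u, v, w} m F M}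
  {G : Type*} [Group G] [TopologicalSpace G]
  [ChartedSpace (EuclideanSpace ℝ (Fin k)) G] [LieGroup (𝓡 k) ∞ G]
  [MulAction G M] [ContMDiffSMul (𝓡 k) (𝓡 m) ∞ G M] [FiniteDimensional ℂ F]
  (A : EquivariantStructure k G E)

/-- The derivative of the trace of `L_a - ∇_{χ(a)}` is the trace of the contraction of the curvature
with `χ(a)`. -/
theorem mvfderiv_ctrace_generator (x : M) (a : GroupLieAlgebra (𝓡 k) G) :
    MDifferentiableAt (𝓡 m) 𝓘(ℝ, ℂ) (fun y ↦ ctrace F (A.generator x a y)) x ∧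
    ∀ w : TangentSpace (𝓡 m) x, mvfderiv (𝓡 m) (fun y ↦ ctrace F (A.generator x a y)) x w =
      LinearMap.trace ℂ (E.Fib x) (E.curvature x (infAct G x a) w) := by
  let ψ := extChartAt (𝓡 k) (1 : G)
  let φ := extChartAt (𝓡 m) x
  let U : Set M := E.dom x ∩ (chartAt (Eu m) x).source
  have hU : IsOpen U := (E.isOpen_dom x).inter (chartAt (Eu m) x).open_source
  have hxU : x ∈ U := ⟨E.mem_dom x, mem_chart_source _ x⟩
  let c : Eu k × Eu m → G × M := fun p ↦ (ψ.symm p.1, φ.symm p.2)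
  have hcs : ∀ p : Eu k × Eu m, p.1 ∈ ψ.target → p.2 ∈ φ.target →
      ContMDiffAt 𝓘(ℝ, Eu k × Eu m) ((𝓡 k).prod (𝓡 m)) ∞ c p := by
    intro p h1 h2
    have a1 : ContMDiffAt 𝓘(ℝ, Eu k) (𝓡 k) ∞ ψ.symm p.1 :=
      (contMDiffOn_extChartAt_symm (1 : G)).contMDiffAt
        ((isOpen_extChartAt_target (I := 𝓡 k) (1 : G)).mem_nhds h1)
    have a2 : ContMDiffAt 𝓘(ℝ, Eu m) (𝓡 m) ∞ φ.symm p.2 :=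
      (contMDiffOn_extChartAt_symm x).contMDiffAt
        ((isOpen_extChartAt_target (I := 𝓡 m) x).mem_nhds h2)
    exact (ContMDiffAt.comp p a1 contDiff_fst.contMDiff.contMDiffAt).prodMk
      (ContMDiffAt.comp p a2 contDiff_snd.contMDiff.contMDiffAt)
  let p₀ : Eu k := ψ 1
  let q₀ : Eu m := φ x
  have hψ1 : ψ.symm p₀ = 1 := extChartAt_to_inv (1 : G)
  have hφx : φ.symm q₀ = x := extChartAt_to_inv x
  have hp₀ : p₀ ∈ ψ.target := mem_extChartAt_target (I := 𝓡 k) (1 : G)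
  have hq₀ : q₀ ∈ φ.target := mem_extChartAt_target (I := 𝓡 m) x
  have hθ₀ : ContMDiff ((𝓡 k).prod (𝓡 m)) (𝓡 m) ∞ (fun p : G × M ↦ p.1⁻¹ • p.2) :=
    ((contMDiff_inv (𝓡 k) ∞).comp contMDiff_fst).smul contMDiff_snd
  let O : Set (Eu k × Eu m) := {p | p.1 ∈ ψ.target ∧ p.2 ∈ φ.target ∧ φ.symm p.2 ∈ U ∧
    (ψ.symm p.1)⁻¹ • φ.symm p.2 ∈ U}
  have hOmem : ∀ p ∈ O, O ∈ 𝓝 p := by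
    rintro p ⟨h1, h2, h3, h4⟩
    have hc := (hcs p h1 h2).continuousAt
    have b1 := (isOpen_extChartAt_target (I := 𝓡 k) (1 : G)).mem_nhds h1
    have b2 := (isOpen_extChartAt_target (I := 𝓡 m) x).mem_nhds h2
    have b3 : ∀ᶠ p in 𝓝 p, (c p).2 ∈ U :=
      (continuous_snd.continuousAt.comp hc).preimage_mem_nhds (hU.mem_nhds h3)
    have b4 : ∀ᶠ p in 𝓝 p, (c p).1⁻¹ • (c p).2 ∈ U :=
      (ContinuousAt.comp (x := p) (f := c) hθ₀.continuous.continuousAt hc).preimage_mem_nhds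
        (hU.mem_nhds h4)
    filter_upwards [continuous_fst.continuousAt.preimage_mem_nhds b1,
      continuous_snd.continuousAt.preimage_mem_nhds b2, b3, b4] with p c1 c2 c3 c4
    exact ⟨c1, c2, c3, c4⟩
  have hO0 : ∀ q, q ∈ φ.target → φ.symm q ∈ U → (p₀, q) ∈ O := by
    intro q h1 h2
    refine ⟨hp₀, h1, h2, ?_⟩
    change (ψ.symm p₀)⁻¹ • φ.symm q ∈ U
    rwa [hψ1, inv_one, one_smul]
  let R : Eu k × Eu m → F →L[ℝ] F := fun p ↦ A.actIn x (c p)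
  let θ : Eu k × Eu m → Eu m := fun p ↦ φ ((c p).1⁻¹ • (c p).2)
  have hR : ∀ p ∈ O, ContDiffAt ℝ ∞ R p := by
    rintro p ⟨h1, h2, h3, h4⟩
    refine contDiffAt_clm_of_apply fun f ↦ ?_
    have := ContMDiffAt.comp p (A.contMDiffAt_actIn (g := ψ.symm p.1) h3.1 h4.1 f) (hcs p h1 h2)
    exact this.contDiffAt
  have hθ : ∀ p ∈ O, ContDiffAt ℝ ∞ θ p := by
    rintro p ⟨h1, h2, h3, h4⟩
    have a1 : ContMDiffAt (𝓡 m) 𝓘(ℝ, Eu m) ∞ φ ((c p).1⁻¹ • (c p).2) := contMDiffAt_extChartAt' h4.2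
    have := ContMDiffAt.comp p a1 (ContMDiffAt.comp p hθ₀.contMDiffAt (hcs p h1 h2))
    exact this.contDiffAt
  have hqe : ∀ᶠ q in 𝓝 q₀, q ∈ φ.target ∧ φ.symm q ∈ U := by
    filter_upwards [(isOpen_extChartAt_target (I := 𝓡 m) x).mem_nhds hq₀,
      HermitianBundle.eventually_extChartAt_symm (mem_chart_source _ x) (hU.mem_nhds hxU)] with q h1 h2
    exact ⟨h1, h2⟩
  have hin : ∀ (p : Eu k × Eu m) , HasFDerivAt (fun q ↦ (p.1, q)) (ContinuousLinearMap.inr ℝ (Eu k) (Eu m)) p.2 :=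
    fun p ↦ (hasFDerivAt_const p.1 p.2).prodMk (hasFDerivAt_id (𝕜 := ℝ) p.2)
  have hinl : ∀ (p : Eu k × Eu m) , HasFDerivAt (fun r ↦ (r, p.2)) (ContinuousLinearMap.inl ℝ (Eu k) (Eu m)) p.1 :=
    fun p ↦ (hasFDerivAt_id (𝕜 := ℝ) p.1).prodMk (hasFDerivAt_const p.2 p.1)
  have hpartial : ∀ {W : Type u} [NormedAddCommGroup W] [NormedSpace ℝ W] (f : Eu k × Eu m → W)
      (p : Eu k × Eu m), DifferentiableAt ℝ f p → ∀ w,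
      fderiv ℝ (fun q ↦ f (p.1, q)) p.2 w = fderiv ℝ f p (0, w) := by
    intro W _ _ f p hf w
    have := HasFDerivAt.comp (g := f) (f := fun q ↦ (p.1, q)) p.2 hf.hasFDerivAt (hin p)
    exact congrArg (fun S : Eu m →L[ℝ] W ↦ S w) this.fderiv
  have hpartial' : ∀ (f : Eu k × Eu m → Eu m)
      (p : Eu k × Eu m), DifferentiableAt ℝ f p → ∀ w,
      fderiv ℝ (fun q ↦ f (p.1, q)) p.2 w = fderiv ℝ f p (0, w) := by
    intro f p hf w
    have := HasFDerivAt.comp (g := f) (f := fun q ↦ (p.1, q)) p.2 hf.hasFDerivAt (hin p)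
    exact congrArg (fun S : Eu m →L[ℝ] Eu m ↦ S w) this.fderiv
  have hpartialG : ∀ (f : Eu k × Eu m → F →L[ℝ] F) (p : Eu k × Eu m), DifferentiableAt ℝ f p → ∀ w,
      fderiv ℝ (fun r ↦ f (r, p.2)) p.1 w = fderiv ℝ f p (w, 0) := by
    intro f p hf w
    have := HasFDerivAt.comp (g := f) (f := fun r ↦ (r, p.2)) p.1 hf.hasFDerivAt (hinl p)
    exact congrArg (fun S : Eu k →L[ℝ] F →L[ℝ] F ↦ S w) this.fderiv
  have hpartialG' : ∀ (f : Eu k × Eu m → Eu m) (p : Eu k × Eu m), DifferentiableAt ℝ f p → ∀ w,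
      fderiv ℝ (fun r ↦ f (r, p.2)) p.1 w = fderiv ℝ f p (w, 0) := by
    intro f p hf w
    have := HasFDerivAt.comp (g := f) (f := fun r ↦ (r, p.2)) p.1 hf.hasFDerivAt (hinl p)
    exact congrArg (fun S : Eu k →L[ℝ] Eu m ↦ S w) this.fderiv
  have hgauge : ∀ p ∈ O, ∀ w : Eu m, fderiv ℝ R p (0, w) =
      (R p).comp (E.connIn x (θ p) (fderiv ℝ θ p (0, w))) - (E.connIn x p.2 w).comp (R p) := by
    intro p hp w
    obtain ⟨h1, h2, h3, h4⟩ := id hp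
    set g := ψ.symm p.1
    set y := φ.symm p.2
    have hφy : φ y = p.2 := φ.right_inv h2
    have hRd : DifferentiableAt ℝ R p := (hR p hp).differentiableAt (by simp)
    ext f
    have hs : E.SmoothAt (fun z ↦ E.frame x z f) (g⁻¹ • y) :=
      HermitianBundle.smoothAt_frame h4.1 contMDiffAt_const
    have k1 := congrArg (E.comps x y) (A.conn_orbitSection g y _ hs (fld x y w))
    rw [HermitianBundle.comps_conn h3.1 (A.smoothAt_orbitSection hs).mdiff] at k1
    have k2 : A.act g (smul_inv_smul g y) (E.conn (fun z ↦ E.frame x z f) (g⁻¹ • y)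
        (mfderiv (𝓡 m) (𝓡 m) (fun y : M ↦ g⁻¹ • y) y (fld x y w))) =
        A.orbitSection (fun z ↦ E.frame x z (E.connForm x (g⁻¹ • y)
        (mfderiv (𝓡 m) (𝓡 m) (fun y : M ↦ g⁻¹ • y) y (fld x y w)) f)) y g := by
      simp only [orbitSection]
      rw [HermitianBundle.connForm_apply h4.1, HermitianBundle.frame_comps h4.1]
    have hmd := (A.contMDiffAt_actIn_right h3.1 h4.1 f).mdifferentiableAt (by simp)
    have k3 : mvfderiv (𝓡 m) (fun z ↦ E.comps x z (A.orbitSection (fun z ↦ E.frame x z f) z g)) y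
        (fld x y w) = fderiv ℝ R p (0, w) f := by
      have j1 := mvfderiv_fld h3.2 hmd w
      refine j1.trans ?_
      have j2 : fderiv ℝ (fun q ↦ R (p.1, q) f) p.2 w = fderiv ℝ (fun p ↦ R p f) p (0, w) :=
        hpartial (fun p ↦ R p f) p (hRd.clm_apply (differentiableAt_const f)) w
      rw [← fderiv_apply_const hRd, ← j2]
      exact congrArg (fun q ↦ fderiv ℝ (fun q ↦ R (p.1, q) f) q w) hφy
    have k4 : E.connForm x y (fld x y w) = E.connIn x p.2 w := by
      rw [← HermitianBundle.connIn_fld h3.2]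
      exact congrArg (fun q ↦ E.connIn x q w) hφy
    have k5 : E.connForm x (g⁻¹ • y) (mfderiv (𝓡 m) (𝓡 m) (fun y : M ↦ g⁻¹ • y) y (fld x y w)) =
        E.connIn x (θ p) (fderiv ℝ θ p (0, w)) := by
      rw [← HermitianBundle.connIn_apply h4.2]
      have hm1 := mdiff_const_smul (m := m) k g⁻¹ y
      have hm2 : MDifferentiableAt (𝓡 m) 𝓘(ℝ, Eu m) (fun z : M ↦ φ (g⁻¹ • z)) y :=
        MDifferentiableAt.comp y (g := φ) (mdifferentiableAt_extChartAt h4.2) hm1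
      have j1 := coord_mfderiv (f := fun y : M ↦ g⁻¹ • y) h4.2 hm1 (fld x y w)
      have j2 := mvfderiv_fld h3.2 hm2 w
      have j3 : fderiv ℝ (fun q ↦ θ (p.1, q)) p.2 w = fderiv ℝ θ p (0, w) :=
        hpartial' θ p ((hθ p hp).differentiableAt (by simp)) w
      have j4 : coord x (g⁻¹ • y) (mfderiv (𝓡 m) (𝓡 m) (fun y : M ↦ g⁻¹ • y) y (fld x y w)) =
          fderiv ℝ θ p (0, w) := by
        rw [← j3]
        refine (j1.trans j2).trans ?_
        exact congrArg (fun q ↦ fderiv ℝ (fun q ↦ θ (p.1, q)) q w) hφy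
      exact congrArg (E.connIn x (θ p)) j4
    rw [k2, k3, k4, k5] at k1
    exact eq_sub_of_add_eq' k1
  -- the generator in the chart
  have hgen : ∀ q, q ∈ φ.target → φ.symm q ∈ U → A.generator x a (φ.symm q) =
      fderiv ℝ R (p₀, q) (a, 0) - E.connIn x q (fderiv ℝ θ (p₀, q) (a, 0)) := by
    intro q h1 h2
    have hp := hO0 q h1 h2
    set y := φ.symm q
    have hφy : φ y = q := φ.right_inv h1
    have k1 : mvfderiv (𝓡 k) (fun g : G ↦ A.actIn x (g, y)) 1 a = fderiv ℝ R (p₀, q) (a, 0) := by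
      have j1 := mvfderiv_eq_fderiv_comp (A.mdiff_actIn_left h2.1) a
      refine j1.trans ?_
      exact hpartialG R (p₀, q) ((hR _ hp).differentiableAt (by simp)) a
    have k2 : E.connForm x y (infAct G y a) = E.connIn x q (fderiv ℝ θ (p₀, q) (a, 0)) := by
      rw [← HermitianBundle.connIn_apply h2.2]
      have e1 : (1 : G)⁻¹ • y = y := by simp
      have h3 : (1 : G)⁻¹ • y ∈ (chartAt (Eu m) x).source := by rw [e1]; exact h2.2
      have hm1 := mdiff_inv_smul_const (k := k) (m := m) y (1 : G)
      have hm2 : MDifferentiableAt (𝓡 k) 𝓘(ℝ, Eu m) (fun g : G ↦ φ (g⁻¹ • y)) 1 :=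
        MDifferentiableAt.comp (1 : G) (g := φ) (f := fun g : G ↦ g⁻¹ • y)
          (mdifferentiableAt_extChartAt h3) hm1
      have j1 := coord_mfderiv (f := fun g : G ↦ g⁻¹ • y) h3 hm1 a
      have j2 := mvfderiv_eq_fderiv_comp hm2 a
      have j3 : fderiv ℝ (fun r ↦ θ (r, q)) p₀ a = fderiv ℝ θ (p₀, q) (a, 0) :=
        hpartialG' θ (p₀, q) ((hθ _ hp).differentiableAt (by simp)) a
      have j0 : ∀ y' (u : Eu m), y' = y → coord x y' u = coord x y u := by
        rintro y' u rfl; rfl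
      have j4 : coord x y (infAct G y a) = fderiv ℝ θ (p₀, q) (a, 0) := by
        rw [← j3]
        exact (j0 _ _ e1).symm.trans (j1.trans j2)
      rw [j4]
      have j6 : ∀ v, E.connIn x (φ y) v = E.connIn x q v := fun v ↦ by rw [hφy]
      exact j6 _
    rw [generator, k1, k2]
  have hx0 : (p₀, q₀) ∈ O := hO0 q₀ hq₀ (by rw [hφx]; exact hxU)
  have hα : ContDiffAt ℝ ∞ (E.connIn x) q₀ :=
    HermitianBundle.contDiffAt_connIn (mem_chart_source _ x) (E.mem_dom x)
  have hR1 : ∀ᶠ q in 𝓝 q₀, R (p₀, q) = ContinuousLinearMap.id ℝ F := by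
    filter_upwards [hqe] with q hq
    change A.actIn x (ψ.symm p₀, φ.symm q) = _
    rw [hψ1]
    exact A.actIn_one hq.2.1
  have hθ1 : ∀ᶠ q in 𝓝 q₀, θ (p₀, q) = q := by
    filter_upwards [hqe] with q hq
    change φ ((ψ.symm p₀)⁻¹ • φ.symm q) = q
    rw [hψ1, inv_one, one_smul]
    exact φ.right_inv hq.1
  have hconnC : ∀ (v : Eu m) (z : ℂ) (f : F), E.connIn x q₀ v (z • f) = z • E.connIn x q₀ v f := by
    intro v z f
    have := HermitianBundle.connIn_fld (E := E) (mem_chart_source (Eu m) x) v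
    rw [show E.connIn x q₀ v = _ from this]
    exact HermitianBundle.connForm_smul (E.mem_dom x) _ z f
  have hRC : ∀ (v : Eu k × Eu m) (z : ℂ) (f : F),
      fderiv ℝ R (p₀, q₀) v (z • f) = z • fderiv ℝ R (p₀, q₀) v f := by
    intro v z f
    refine fderiv_smul_of_forall ((hR _ hx0).differentiableAt (by simp)) ?_ v z f
    filter_upwards [hOmem _ hx0] with p hp z f
    exact A.actIn_smul hp.2.2.1.1 z f
  have main := fun w : Eu m ↦ fderiv_trace_generator (hR _ hx0) (hθ _ hx0) hα hR1 hθ1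
    (by filter_upwards [hOmem _ hx0] with p hp using hgauge p hp) (ctrace F) a w
    (ctrace_comm (hRC _) (hconnC _)) (fun u v ↦ ctrace_comm (hconnC u) (hconnC v))
  have heq : (fun q ↦ ctrace F (A.generator x a (φ.symm q))) =ᶠ[𝓝 q₀] fun q ↦
      ctrace F (fderiv ℝ R (p₀, q) (a, 0) - E.connIn x q (fderiv ℝ θ (p₀, q) (a, 0))) := by
    filter_upwards [hqe] with q hq
    rw [hgen q hq.1 hq.2]
  have hdiff : DifferentiableAt ℝ (fun q ↦ ctrace F (A.generator x a (φ.symm q))) q₀ :=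
    (main 0).1.congr_of_eventuallyEq heq
  have hmd : MDifferentiableAt (𝓡 m) 𝓘(ℝ, ℂ) (fun y ↦ ctrace F (A.generator x a y)) x := by
    have h1 : MDifferentiableAt (𝓡 m) 𝓘(ℝ, ℂ) (fun y ↦ ctrace F (A.generator x a (φ.symm (φ y)))) x :=
      MDifferentiableAt.comp x (g := fun q ↦ ctrace F (A.generator x a (φ.symm q))) (f := φ)
        hdiff.mdifferentiableAt (mdifferentiableAt_extChartAt (mem_chart_source _ x))
    refine h1.congr_of_eventuallyEq ?_
    filter_upwards [(chartAt (Eu m) x).open_source.mem_nhds (mem_chart_source _ x)] with y hy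
    rw [φ.left_inv (by simpa [φ] using hy)]
  refine ⟨hmd, fun w ↦ ?_⟩
  have hχ : fderiv ℝ θ (p₀, q₀) (a, 0) = (infAct G x a : Eu m) := by
    have hm1 := mdiff_inv_smul_const (k := k) (m := m) x (1 : G)
    have e1 : (1 : G)⁻¹ • x = x := by simp
    have h3 : (1 : G)⁻¹ • x ∈ (chartAt (Eu m) x).source := by rw [e1]; exact mem_chart_source _ x
    have hm2 : MDifferentiableAt (𝓡 k) 𝓘(ℝ, Eu m) (fun g : G ↦ φ (g⁻¹ • x)) 1 :=
      MDifferentiableAt.comp (1 : G) (g := φ) (f := fun g : G ↦ g⁻¹ • x)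
        (mdifferentiableAt_extChartAt h3) hm1
    have j1 := coord_mfderiv (f := fun g : G ↦ g⁻¹ • x) h3 hm1 a
    have j2 := mvfderiv_eq_fderiv_comp hm2 a
    have j3 : fderiv ℝ (fun r ↦ θ (r, q₀)) p₀ a = fderiv ℝ θ (p₀, q₀) (a, 0) :=
      hpartialG' θ (p₀, q₀) ((hθ _ hx0).differentiableAt (by simp)) a
    have j0 : ∀ y' (u : Eu m), y' = x → coord x y' u = u := by
      rintro y' u rfl; exact coord_self _ _
    have j5 : (fun g : G ↦ φ (g⁻¹ • φ.symm q₀)) = fun g : G ↦ φ (g⁻¹ • x) := by rw [hφx]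
    rw [← j3]
    refine Eq.trans ?_ (((j0 _ _ e1).symm.trans (j1.trans j2)).symm.symm.symm)
    exact congrArg (fun f : G → Eu m ↦ fderiv ℝ (fun r ↦ f (ψ.symm r)) p₀ a) j5
  have h2 := mvfderiv_eq_fderiv_comp hmd w
  rw [h2]
  have h3 : fderiv ℝ (fun q ↦ ctrace F (A.generator x a (φ.symm q))) q₀ w =
      ctrace F (curvForm (E.connIn x) q₀ (infAct G x a) w) := by
    rw [heq.fderiv_eq, (main w).2, hχ]
  refine h3.trans ?_
  exact (E.trace_eq_ctrace (E.mem_dom x) (fun e ↦ HermitianBundle.comps_curvature x _ _ e)).symm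

/-- The derivative of the moment trace is the contraction of the curvature with the infinitesimal
action. -/
theorem mvfderiv_momentTrace [Nontrivial F] {μ : M → Module.Dual ℝ (GroupLieAlgebra (𝓡 k) G)}
    (x : M) (a : GroupLieAlgebra (𝓡 k) G)
    (hμ : MDifferentiableAt (𝓡 m) 𝓘(ℝ, ℝ) (fun y ↦ μ y a) x) (w : TangentSpace (𝓡 m) x) :
    mvfderiv (𝓡 m) (fun y ↦ A.momentTrace μ y a) x w =
      E.traceCurvature x (infAct G x a) w +
        Complex.I * (mvfderiv (𝓡 m) (fun y ↦ μ y a) x w : ℂ) := by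
  obtain ⟨h1, h2⟩ := A.mvfderiv_ctrace_generator x a
  let c : ℂ := Complex.I / (Module.finrank ℂ F : ℂ)
  let T₁ : ℂ →L[ℝ] ℂ := c • ContinuousLinearMap.id ℝ ℂ
  let T₂ : ℝ →L[ℝ] ℂ := Complex.I • Complex.ofRealCLM
  have h3 : ∀ᶠ y in 𝓝 x, A.momentTrace μ y a =
      T₁ (ctrace F (A.generator x a y)) + T₂ (μ y a) := by
    filter_upwards [(E.isOpen_dom x).mem_nhds (E.mem_dom x)] with y hy
    exact A.momentTrace_eq hy μ a
  have m1 : MDifferentiableAt (𝓡 m) 𝓘(ℝ, ℂ) (fun y ↦ T₁ (ctrace F (A.generator x a y))) x :=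
    T₁.mdifferentiableAt.comp x h1
  have m2 : MDifferentiableAt (𝓡 m) 𝓘(ℝ, ℂ) (fun y ↦ T₂ (μ y a)) x :=
    T₂.mdifferentiableAt.comp x hμ
  rw [mvfderiv_congr_of_eventuallyEq h3, mvfderiv_fun_add m1 m2, mvfderiv_clm_comp T₁ h1,
    mvfderiv_clm_comp T₂ hμ, h2]
  rfl

end EquivariantStructure

end

section

namespace HermitianBundle

variable {m n n' : ℕ} {F : Type u} [NormedAddCommGroup F] [NormedSpace ℂ F]
  {M : Type v} [TopologicalSpace M] [ChartedSpace (EuclideanSpace ℝ (Fin m)) M]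
  [IsManifold (𝓡 m) ∞ M] {E : HermitianBundle.{u, v, w} m F M}
  {N : Type*} [TopologicalSpace N] [ChartedSpace (EuclideanSpace ℝ (Fin n)) N]
  [IsManifold (𝓡 n) ∞ N]
  {P : Type*} [TopologicalSpace P] [ChartedSpace (EuclideanSpace ℝ (Fin n')) P]
  [IsManifold (𝓡 n') ∞ P]

variable (E n) in
/-- The section `σ` of the pull back of `E` along `f` is differentiable at `z`. -/
def MDiffAlong (f : N → M) (σ : Π z, E.Fib (f z)) (z : N) : Prop :=
  MDifferentiableAt (𝓡 n) 𝓘(ℝ, F) (fun z' ↦ E.comps (f z) (f z') (σ z')) z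

lemma comps_injective {x y : M} (hy : y ∈ E.dom x) : Function.Injective (E.comps x y) :=
  (E.frameEquiv hy).symm.injective

lemma MDiffAlong.mdiff_comps [FiniteDimensional ℂ F] {f : N → M} {σ : Π z, E.Fib (f z)} {z : N} {x : M}
    (hf : MDifferentiableAt (𝓡 n) (𝓡 m) f z) (h : E.MDiffAlong n f σ z) (hz : f z ∈ E.dom x) :
    MDifferentiableAt (𝓡 n) 𝓘(ℝ, F) (fun z' ↦ E.comps x (f z') (σ z')) z := by
  have hT : MDifferentiableAt (𝓡 n) 𝓘(ℝ, F →L[ℝ] F)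
      (fun z' ↦ (E.comps x (f z')).comp (E.frame (f z) (f z'))) z :=
    MDifferentiableAt.comp z (g := fun y ↦ (E.comps x y).comp (E.frame (f z) y))
      ((contMDiffAt_transition (E.mem_dom (f z)) hz).mdifferentiableAt (by simp)) hf
  refine (hT.clm_apply h).congr_of_eventuallyEq ?_
  filter_upwards [hf.continuousAt.preimage_mem_nhds
    ((E.isOpen_dom (f z)).mem_nhds (E.mem_dom (f z)))] with z' hz'
  simp only [ContinuousLinearMap.comp_apply, frame_comps hz']

lemma pullbackConn_congr {f : N → M} {σ τ : Π z, E.Fib (f z)} {z : N}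
    (h : ∀ᶠ z' in 𝓝 z, σ z' = τ z') (u : TangentSpace (𝓡 n) z) :
    E.pullbackConn f σ z u = E.pullbackConn f τ z u := by
  unfold pullbackConn
  rw [h.self_of_nhds]
  congr 2
  refine mvfderiv_congr_of_eventuallyEq ?_ u
  filter_upwards [h] with z' hz'
  rw [hz']

variable [FiniteDimensional ℂ F]

/-- The chain rule for pull back connections. -/
lemma pullbackConn_comp {f : N → M} {σ : Π z, E.Fib (f z)} {h : P → N} {p : P}
    (hf : MDifferentiableAt (𝓡 n) (𝓡 m) f (h p)) (hσ : E.MDiffAlong n f σ (h p))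
    (hh : MDifferentiableAt (𝓡 n') (𝓡 n) h p) (u : TangentSpace (𝓡 n') p) :
    E.pullbackConn (fun p ↦ f (h p)) (fun p ↦ σ (h p)) p u =
      E.pullbackConn f σ (h p) (mfderiv (𝓡 n') (𝓡 n) h p u) := by
  have hd := E.mem_dom (f (h p))
  apply comps_injective hd
  have hσ' : MDifferentiableAt (𝓡 n') 𝓘(ℝ, F) (fun p' ↦ E.comps (f (h p)) (f (h p')) (σ (h p'))) p :=
    MDifferentiableAt.comp p (g := fun z ↦ E.comps (f (h p)) (f z) (σ z)) (f := h) hσ hh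
  rw [comps_pullbackConn hf hd hσ, comps_pullbackConn (f := fun p ↦ f (h p))
    (σ := fun p ↦ σ (h p)) (MDifferentiableAt.comp p (g := f) (f := h) hf hh) hd hσ']
  have h1 : (mfderiv (𝓡 n') (𝓡 m) (fun p ↦ f (h p)) p u : Eu m) =
      mfderiv (𝓡 n) (𝓡 m) f (h p) (mfderiv (𝓡 n') (𝓡 n) h p u) :=
    mfderiv_comp_apply (g := f) (f := h) p hf hh u
  have h2 := mvfderiv_comp_vec (g := fun z ↦ E.comps (f (h p)) (f z) (σ z)) (f := h) hσ hh u
  rw [h2]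
  exact congrArg (fun v : Eu m ↦ E.connForm (f (h p)) (f (h p)) v _ + _) h1

lemma pullbackConn_add {f : N → M} {σ τ : Π z, E.Fib (f z)} {z : N}
    (hf : MDifferentiableAt (𝓡 n) (𝓡 m) f z) (hσ : E.MDiffAlong n f σ z) (hτ : E.MDiffAlong n f τ z)
    (u : TangentSpace (𝓡 n) z) :
    E.pullbackConn f (fun z ↦ σ z + τ z) z u = E.pullbackConn f σ z u + E.pullbackConn f τ z u := by
  have hd := E.mem_dom (f z)
  apply comps_injective hd
  have h1 : MDifferentiableAt (𝓡 n) 𝓘(ℝ, F) (fun z' ↦ E.comps (f z) (f z') (σ z' + τ z')) z := by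
    simp only [map_add]; exact hσ.add hτ
  rw [map_add, comps_pullbackConn hf hd hσ, comps_pullbackConn hf hd hτ, comps_pullbackConn hf hd h1]
  simp only [map_add]
  rw [mvfderiv_fun_add hσ hτ]
  abel

lemma pullbackConn_smul {f : N → M} {σ : Π z, E.Fib (f z)} {z : N}
    (hf : MDifferentiableAt (𝓡 n) (𝓡 m) f z) (hσ : E.MDiffAlong n f σ z) (c : ℂ)
    (u : TangentSpace (𝓡 n) z) :
    E.pullbackConn f (fun z ↦ c • σ z) z u = c • E.pullbackConn f σ z u := by
  have hd := E.mem_dom (f z)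
  apply comps_injective hd
  let T : F →L[ℝ] F := c • ContinuousLinearMap.id ℝ F
  have h0 : (fun z' ↦ E.comps (f z) (f z') (c • σ z')) =ᶠ[𝓝 z]
      fun z' ↦ T (E.comps (f z) (f z') (σ z')) := by
    filter_upwards [hf.continuousAt.preimage_mem_nhds ((E.isOpen_dom (f z)).mem_nhds hd)] with z' hz'
    exact comps_smul hz' c _
  have h1 : MDifferentiableAt (𝓡 n) 𝓘(ℝ, F) (fun z' ↦ E.comps (f z) (f z') (c • σ z')) z :=
    (T.mdifferentiableAt.comp z hσ).congr_of_eventuallyEq h0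
  rw [comps_smul hd, comps_pullbackConn hf hd hσ, comps_pullbackConn hf hd h1,
    mvfderiv_congr_of_eventuallyEq h0, mvfderiv_clm_comp T hσ, comps_smul hd, connForm_smul hd,
    smul_add]
  rfl

lemma mvfderiv_fun_smul {g : N → ℝ} {w : N → F} {z : N} (hg : MDifferentiableAt (𝓡 n) 𝓘(ℝ, ℝ) g z)
    (hw : MDifferentiableAt (𝓡 n) 𝓘(ℝ, F) w z) (u : TangentSpace (𝓡 n) z) :
    mvfderiv (𝓡 n) (fun z ↦ g z • w z) z u =
      g z • mvfderiv (𝓡 n) w z u + mvfderiv (𝓡 n) g z u • w z := by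
  let T : ℝ →L[ℝ] F →L[ℝ] F := ContinuousLinearMap.lsmul ℝ ℝ
  have h := mvfderiv_clm_apply (T := fun z ↦ T (g z)) (T.mdifferentiableAt.comp z hg) hw u
  rw [mvfderiv_clm_comp T hg] at h
  exact h.trans (add_comm _ _)

lemma pullbackConn_leibniz {f : N → M} {σ : Π z, E.Fib (f z)} {z : N} {g : N → ℝ}
    (hf : MDifferentiableAt (𝓡 n) (𝓡 m) f z) (hσ : E.MDiffAlong n f σ z)
    (hg : MDifferentiableAt (𝓡 n) 𝓘(ℝ, ℝ) g z) (u : TangentSpace (𝓡 n) z) :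
    E.pullbackConn f (fun z ↦ g z • σ z) z u =
      g z • E.pullbackConn f σ z u + mvfderiv (𝓡 n) g z u • σ z := by
  have hd := E.mem_dom (f z)
  apply comps_injective hd
  have h1 : MDifferentiableAt (𝓡 n) 𝓘(ℝ, F) (fun z' ↦ E.comps (f z) (f z') (g z' • σ z')) z := by
    simp only [map_smul]; exact hg.smul hσ
  rw [map_add, map_smul, map_smul, comps_pullbackConn hf hd hσ, comps_pullbackConn hf hd h1]
  simp only [map_smul]
  rw [mvfderiv_fun_smul hg hσ, smul_add, add_assoc]

variable (E) in
/-- The Hermitian metric in a trivialization. -/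
def metricIn (x y : M) : F →L[ℝ] F →L[ℝ] ℂ :=
  LinearMap.toContinuousLinearMap (LinearMap.toContinuousLinearMap.toLinearMap ∘ₗ
    LinearMap.mk₂ ℝ (fun f g ↦ inner ℂ (E.frame x y f) (E.frame x y g))
      (fun f f' g ↦ by rw [map_add, inner_add_left])
      (fun c f g ↦ by rw [map_smul, RCLike.real_smul_eq_coe_smul (K := ℂ) c, inner_smul_left]; simp)
      (fun f g g' ↦ by rw [map_add, inner_add_right])
      (fun c f g ↦ by rw [map_smul, RCLike.real_smul_eq_coe_smul (K := ℂ) c, inner_smul_right]; simp))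

lemma metricIn_apply (x y : M) (f g : F) :
    E.metricIn x y f g = inner ℂ (E.frame x y f) (E.frame x y g) := rfl

lemma contMDiffAt_metricIn {x y : M} (hy : y ∈ E.dom x) :
    ContMDiffAt (𝓡 m) 𝓘(ℝ, F →L[ℝ] F →L[ℝ] ℂ) ∞ (E.metricIn x) y :=
  contMDiffAt_clm_of_apply fun _ ↦ contMDiffAt_clm_of_apply fun _ ↦
    E.smooth_inner y _ _ (smoothAt_frame hy contMDiffAt_const) (smoothAt_frame hy contMDiffAt_const)

lemma mvfderiv_metricIn {x y : M} (hy : y ∈ E.dom x) (v : TangentSpace (𝓡 m) y) (f g : F) :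
    mvfderiv (𝓡 m) (E.metricIn x) y v f g =
      E.metricIn x y (E.connForm x y v f) g + E.metricIn x y f (E.connForm x y v g) := by
  have hm := (contMDiffAt_metricIn hy).mdifferentiableAt (by simp)
  have h1 := E.conn_unitary y (fun z ↦ E.frame x z f) (fun z ↦ E.frame x z g) v
    (mdiff_frame hy mdifferentiableAt_const) (mdiff_frame hy mdifferentiableAt_const)
  have h2 := mvfderiv_clm_apply hm (mdifferentiableAt_const (c := f)) v
  have h3 := mvfderiv_clm_apply (hm.clm_apply (mdifferentiableAt_const (c := f)))
    (mdifferentiableAt_const (c := g)) v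
  rw [mvfderiv_const_apply, map_zero, add_zero] at h2 h3
  rw [h2] at h3
  rw [← h3, metricIn_apply, metricIn_apply, connForm_apply hy, connForm_apply hy, frame_comps hy,
    frame_comps hy, ← h1]
  rfl

lemma inner_eq_metricIn {x y : M} (hy : y ∈ E.dom x) (e e' : E.Fib y) :
    inner ℂ e e' = E.metricIn x y (E.comps x y e) (E.comps x y e') := by
  rw [metricIn_apply, frame_comps hy, frame_comps hy]

lemma mvfderiv_inner {f : N → M} {σ τ : Π z, E.Fib (f z)} {z : N}
    (hf : MDifferentiableAt (𝓡 n) (𝓡 m) f z) (hσ : E.MDiffAlong n f σ z) (hτ : E.MDiffAlong n f τ z)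
    (u : TangentSpace (𝓡 n) z) :
    mvfderiv (𝓡 n) (fun z ↦ inner ℂ (σ z) (τ z)) z u =
      inner ℂ (E.pullbackConn f σ z u) (τ z) + inner ℂ (σ z) (E.pullbackConn f τ z u) := by
  have hd := E.mem_dom (f z)
  have hm := (contMDiffAt_metricIn hd).mdifferentiableAt (by simp)
  have hmf : MDifferentiableAt (𝓡 n) 𝓘(ℝ, F →L[ℝ] F →L[ℝ] ℂ) (fun z' ↦ E.metricIn (f z) (f z')) z :=
    MDifferentiableAt.comp z (g := E.metricIn (f z)) (f := f) hm hf
  have h0 : (fun z' ↦ inner ℂ (σ z') (τ z')) =ᶠ[𝓝 z] fun z' ↦ E.metricIn (f z) (f z')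
      (E.comps (f z) (f z') (σ z')) (E.comps (f z) (f z') (τ z')) := by
    filter_upwards [hf.continuousAt.preimage_mem_nhds ((E.isOpen_dom (f z)).mem_nhds hd)] with z' hz'
    exact inner_eq_metricIn hz' _ _
  rw [mvfderiv_congr_of_eventuallyEq h0, mvfderiv_clm_apply (hmf.clm_apply hσ) hτ,
    mvfderiv_clm_apply hmf hσ, mvfderiv_comp_vec (g := E.metricIn (f z)) (f := f) hm hf,
    inner_eq_metricIn hd, inner_eq_metricIn hd, comps_pullbackConn hf hd hσ,
    comps_pullbackConn hf hd hτ]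
  simp only [add_apply, map_add]
  rw [mvfderiv_metricIn hd]
  ring

variable (E) in
/-- The pull back connection as a continuous linear map of the direction. -/
def pullbackConnL (f : N → M) (σ : Π z, E.Fib (f z)) (z : N) :
    TangentSpace (𝓡 n) z →L[ℝ] E.Fib (f z) :=
  (E.conn (localExt ℂ F (σ z)) (f z)).comp (mfderiv (𝓡 n) (𝓡 m) f z) +
    (E.frame (f z) (f z)).comp
      (mvfderiv (𝓡 n) (fun y ↦ (trivializationAt F E.Fib (f z) ⟨f y, σ y⟩).2) z)

lemma pullbackConnL_apply (f : N → M) (σ : Π z, E.Fib (f z)) (z : N) (u : TangentSpace (𝓡 n) z) :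
    E.pullbackConnL f σ z u = E.pullbackConn f σ z u := by
  unfold pullbackConn
  rw [← frame_eq_symmₗ]
  rfl

end HermitianBundle

namespace EquivariantStructure

open HermitianBundle

variable {m k n : ℕ} {F : Type u} [NormedAddCommGroup F] [NormedSpace ℂ F]
  {M : Type v} [TopologicalSpace M] [ChartedSpace (EuclideanSpace ℝ (Fin m)) M]
  [IsManifold (𝓡 m) ∞ M] {E : HermitianBundle.{u, v, w} m F M}
  {G : Type*} [Group G] [TopologicalSpace G]
  [ChartedSpace (EuclideanSpace ℝ (Fin k)) G] [LieGroup (𝓡 k) ∞ G]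
  [MulAction G M] [ContMDiffSMul (𝓡 k) (𝓡 m) ∞ G M] [FiniteDimensional ℂ F]
  (A : EquivariantStructure k G E)
  {P : Type*} [TopologicalSpace P] [ChartedSpace (EuclideanSpace ℝ (Fin n)) P]
  [IsManifold (𝓡 n) ∞ P]

/-- The pull back connection is invariant under the action of an element of the group. -/
lemma pullbackConn_const_act (g : G) {a : P → M} {s : Π z, E.Fib (a z)} {p : P}
    (ha : MDifferentiableAt (𝓡 n) (𝓡 m) a p) (hs : E.MDiffAlong n a s p) :
    E.MDiffAlong n (fun z ↦ g • a z) (fun z ↦ A.act g rfl (s z)) p ∧ ∀ u : TangentSpace (𝓡 n) p,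
    E.pullbackConn (fun z ↦ g • a z) (fun z ↦ A.act g rfl (s z)) p u =
      A.act g rfl (E.pullbackConn a s p u) := by
  set x := a p with hx
  have hdx := E.mem_dom x
  have hdx' := E.mem_dom (g • x)
  have hgm : ∀ y : M, MDifferentiableAt (𝓡 m) (𝓡 m) (fun y : M ↦ g • y) y := mdiff_const_smul k g
  have hb : MDifferentiableAt (𝓡 n) (𝓡 m) (fun z ↦ g • a z) p :=
    MDifferentiableAt.comp p (g := fun y : M ↦ g • y) (f := a) (hgm _) ha
  let Γ : M → F →L[ℝ] F := fun y ↦ (E.comps (g • x) (g • y)).comp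
    (((A.act g (rfl : g • y = g • y)).toContinuousLinearEquiv.toContinuousLinearMap.restrictScalars
      ℝ).comp (E.frame x y))
  have hΓa : ∀ y f, Γ y f = E.comps (g • x) (g • y) (A.act g rfl (E.frame x y f)) := fun _ _ ↦ rfl
  have hΓ : ContMDiffAt (𝓡 m) 𝓘(ℝ, F →L[ℝ] F) ∞ Γ x := by
    refine contMDiffAt_clm_of_apply fun f ↦ ?_
    refine (contMDiffAt_mk_iff (f := fun y : M ↦ g • y)
      (σ := fun y ↦ A.act g rfl (E.frame x y f)) (contMDiff_const_smul k g).contMDiffAt hdx').1 ?_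
    exact A.contMDiffAt_act (h := fun _ ↦ g) (f := fun y ↦ y) (f' := fun y ↦ g • y)
      contMDiffAt_const (fun _ ↦ rfl) (σ := fun y ↦ E.frame x y f)
      (smoothAt_frame hdx contMDiffAt_const)
  have hΓd : MDifferentiableAt (𝓡 m) 𝓘(ℝ, F →L[ℝ] F) Γ x := hΓ.mdifferentiableAt (by simp)
  have hΓad : MDifferentiableAt (𝓡 n) 𝓘(ℝ, F →L[ℝ] F) (fun z ↦ Γ (a z)) p :=
    MDifferentiableAt.comp p (g := Γ) (f := a) hΓd ha
  have hev : (fun z ↦ E.comps (g • x) (g • a z) (A.act g rfl (s z))) =ᶠ[𝓝 p]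
      fun z ↦ Γ (a z) (E.comps x (a z) (s z)) := by
    filter_upwards [ha.continuousAt.preimage_mem_nhds ((E.isOpen_dom x).mem_nhds hdx)] with z hz
    rw [hΓa, frame_comps hz]
  have hM : E.MDiffAlong n (fun z ↦ g • a z) (fun z ↦ A.act g rfl (s z)) p :=
    (hΓad.clm_apply hs).congr_of_eventuallyEq hev
  refine ⟨hM, fun u ↦ ?_⟩
  apply comps_injective hdx'
  have hact : ∀ e : E.Fib x, E.comps (g • x) (g • x) (A.act g rfl e) = Γ x (E.comps x x e) := by
    intro e; rw [hΓa, frame_comps hdx]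
  have hinvar : ∀ (v : TangentSpace (𝓡 m) x) (f : F), E.connForm (g • x) (g • x)
      (mfderiv (𝓡 m) (𝓡 m) (fun y : M ↦ g • y) x v) (Γ x f) + mvfderiv (𝓡 m) Γ x v f =
        Γ x (E.connForm x x v f) := by
    intro v f
    have hs0 : E.SmoothAt (fun y ↦ E.frame x y f) x := smoothAt_frame hdx contMDiffAt_const
    have hs0' : E.SmoothAt (fun y ↦ E.frame x y f) (g⁻¹ • g • x) := by rwa [inv_smul_smul]
    have k1 := congrArg (E.comps (g • x) (g • x)) (A.conn_invariant g x _ v hs0)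
    rw [hact, ← connForm_apply hdx] at k1
    have hsm := A.smoothAt_orbitSection hs0'
    rw [show (fun y ↦ A.act g (smul_inv_smul g y) (E.frame x (g⁻¹ • y) f)) =
      fun y ↦ A.orbitSection (fun y ↦ E.frame x y f) y g from rfl, comps_conn hdx' hsm.mdiff] at k1
    rw [← k1, A.orbitSection_eq (fun y ↦ E.frame x y f) (rfl : g • x = g • x), ← hΓa]
    congr 1
    have k2 := mvfderiv_comp_vec (g := fun z ↦ E.comps (g • x) z
      (A.orbitSection (fun y ↦ E.frame x y f) z g)) (f := fun y : M ↦ g • y) (x := x)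
      ((mdiff_iff hdx').1 hsm.mdiff) (hgm x) v
    rw [← k2]
    have k3 := mvfderiv_clm_apply hΓd (mdifferentiableAt_const (c := f)) v
    rw [mvfderiv_const_apply, map_zero, add_zero] at k3
    rw [← k3]
    congr 2
    funext y
    rw [hΓa, A.orbitSection_eq (fun y ↦ E.frame x y f) (rfl : g • y = g • y)]
  have hder : (mfderiv (𝓡 n) (𝓡 m) (fun z ↦ g • a z) p u : Eu m) =
      mfderiv (𝓡 m) (𝓡 m) (fun y : M ↦ g • y) x (mfderiv (𝓡 n) (𝓡 m) a p u) :=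
    mfderiv_comp_apply (g := fun y : M ↦ g • y) (f := a) p (hgm _) ha u
  have hL := comps_pullbackConn (f := fun z ↦ g • a z) (σ := fun z ↦ A.act g rfl (s z)) hb hdx' hM u
  refine hL.trans ?_
  rw [hact (E.pullbackConn a s p u), comps_pullbackConn ha hdx hs, map_add, ← hinvar, mvfderiv_congr_of_eventuallyEq hev,
    mvfderiv_clm_apply hΓad hs, mvfderiv_comp_vec (g := Γ) (f := a) hΓd ha]
  have e1 := hev.self_of_nhds
  simp only at e1
  rw [e1, show E.connForm (g • x) (g • a p) (mfderiv (𝓡 n) (𝓡 m) (fun z ↦ g • a z) p u) =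
    E.connForm (g • x) (g • x) (mfderiv (𝓡 m) (𝓡 m) (fun y : M ↦ g • y) x
      (mfderiv (𝓡 n) (𝓡 m) a p u)) from congrArg (fun v : Eu m ↦ E.connForm (g • x) (g • x) v) hder]
  abel

lemma generator_eq_zero {x y : M} (hy : y ∈ E.dom x) (a : GroupLieAlgebra (𝓡 k) G)
    (h : ∀ s : Π y, E.Fib y, E.SmoothAt s y → E.conn s y (infAct G y a) = A.lieDeriv a s y) :
    A.generator x a y = 0 := by
  ext f
  have hs : E.SmoothAt (fun z ↦ E.frame x z f) y := smoothAt_frame hy contMDiffAt_const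
  have h1 := A.comps_lieDeriv_sub hy a hs
  rw [h _ hs, sub_self, map_zero, comps_frame hy] at h1
  exact h1.symm

lemma _root_.ABrane.contMDiffAt_clm_of_forall_apply {IN : Type*} [NormedAddCommGroup IN]
    [NormedSpace ℝ IN] {HN : Type*} [TopologicalSpace HN] {J : ModelWithCorners ℝ IN HN}
    {N : Type*} [TopologicalSpace N] [ChartedSpace HN N] {V W : Type*}
    [NormedAddCommGroup V] [NormedSpace ℝ V] [FiniteDimensional ℝ V] [NormedAddCommGroup W]
    [NormedSpace ℝ W] {T : N → V →L[ℝ] W} {y : N}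
    (h : ∀ v, ContMDiffAt J 𝓘(ℝ, W) ∞ (fun z ↦ T z v) y) :
    ContMDiffAt J 𝓘(ℝ, V →L[ℝ] W) ∞ T y := by
  let b := Module.finBasis ℝ V
  have h1 : T = fun y ↦ ∑ i, ContinuousLinearMap.smulRightL ℝ V W
      (LinearMap.toContinuousLinearMap (b.coord i)) (T y (b i)) := by
    funext y
    ext v
    conv_lhs => rw [← b.sum_repr v, map_sum]
    simp
  rw [h1]
  exact contMDiffAt_finsetSum fun i _ ↦
    (ContinuousLinearMap.contMDiff _).contMDiffAt.comp y (h (b i))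

lemma _root_.ABrane.mfderiv_comp_prodMk {Y EY HY : Type*} [NormedAddCommGroup EY] [NormedSpace ℝ EY]
    [TopologicalSpace HY] {J' : ModelWithCorners ℝ EY HY} [TopologicalSpace Y] [ChartedSpace HY Y]
    {Φ : G × M → Y} {κ : P → G} {c : P → M} {p : P}
    (hΦ : MDifferentiableAt ((𝓡 k).prod (𝓡 m)) J' Φ (κ p, c p))
    (hκ : MDifferentiableAt (𝓡 n) (𝓡 k) κ p) (hc : MDifferentiableAt (𝓡 n) (𝓡 m) c p)
    (u : TangentSpace (𝓡 n) p) :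
    (mfderiv (𝓡 n) J' (fun z ↦ Φ (κ z, c z)) p u : EY) =
      mfderiv (𝓡 k) J' (fun g ↦ Φ (g, c p)) (κ p) (mfderiv (𝓡 n) (𝓡 k) κ p u) +
        mfderiv (𝓡 m) J' (fun y ↦ Φ (κ p, y)) (c p) (mfderiv (𝓡 n) (𝓡 m) c p u) := by
  have h1 := mfderiv_comp_apply (g := Φ) (f := fun z ↦ (κ z, c z)) p hΦ (hκ.prodMk hc) u
  have h2 := mfderiv_prod_eq_add_apply (v := mfderiv (𝓡 n) ((𝓡 k).prod (𝓡 m)) (fun z ↦ (κ z, c z)) p u)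
    hΦ
  refine h1.trans (h2.trans ?_)
  have h3 := hκ.mfderiv_prod hc
  have h4 : (mfderiv (𝓡 n) ((𝓡 k).prod (𝓡 m)) (fun z ↦ (κ z, c z)) p u : Eu k × Eu m) =
      (mfderiv (𝓡 n) (𝓡 k) κ p u, mfderiv (𝓡 n) (𝓡 m) c p u) :=
    congrArg (fun T : Eu n →L[ℝ] Eu k × Eu m ↦ T u) h3
  exact congrArg₂ (fun (v : Eu k) (w : Eu m) ↦ ((mfderiv (𝓡 k) J' (fun g ↦ Φ (g, c p)) (κ p) v +
        mfderiv (𝓡 m) J' (fun y ↦ Φ (κ p, y)) (c p) w : EY))) (congrArg Prod.fst h4)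
          (congrArg Prod.snd h4)

/-- Where the infinitesimal action on sections is given by the connection, the pull back connection
is invariant under families of elements of the group that start at `1`. -/
lemma pullbackConn_act_of_eq_one {b c : P → M} {κ : P → G} {p : P}
    (hc : MDifferentiableAt (𝓡 n) (𝓡 m) c p)
    (hκ : MDifferentiableAt (𝓡 n) (𝓡 k) κ p) (hκp : κ p = 1)
    (h : ∀ᶠ z in 𝓝 p, κ z • b z = c z)
    (hneat : ∀ (a : GroupLieAlgebra (𝓡 k) G) (s : Π y, E.Fib y), E.SmoothAt s (c p) →
      E.conn s (c p) (infAct G (c p) a) = A.lieDeriv a s (c p))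
    {t : Π z, E.Fib (b z)} {T : Π z, E.Fib (c z)}
    (ht : E.MDiffAlong n b t p) (hT : ∀ᶠ z in 𝓝 p, ∀ h : κ z • b z = c z, T z = A.act (κ z) h (t z))
    (hp : κ p • b p = c p) :
    E.MDiffAlong n c T p ∧ ∀ u : TangentSpace (𝓡 n) p,
      E.pullbackConn c T p u = A.act (κ p) hp (E.pullbackConn b t p u) := by
  set x := c p with hx
  have hdx : c p ∈ E.dom x := E.mem_dom x
  have hbp : b p = x := by rw [hκp, one_smul] at hp; exact hp
  have hdb : b p ∈ E.dom x := by rw [hbp]; exact E.mem_dom x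
  have hθ : ContMDiff ((𝓡 k).prod (𝓡 m)) (𝓡 m) ∞ (fun q : G × M ↦ q.1⁻¹ • q.2) :=
    ((contMDiff_inv (𝓡 k) ∞).comp contMDiff_fst).smul contMDiff_snd
  have hκc : MDifferentiableAt (𝓡 n) ((𝓡 k).prod (𝓡 m)) (fun z ↦ (κ z, c z)) p := hκ.prodMk hc
  have hθd : ∀ q, MDifferentiableAt ((𝓡 k).prod (𝓡 m)) (𝓡 m) (fun q : G × M ↦ q.1⁻¹ • q.2) q :=
    fun q ↦ hθ.contMDiffAt.mdifferentiableAt (by simp)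
  have hbe : b =ᶠ[𝓝 p] fun z ↦ (κ z)⁻¹ • c z := by
    filter_upwards [h] with z hz
    rw [← hz, inv_smul_smul]
  have hb : MDifferentiableAt (𝓡 n) (𝓡 m) b p :=
    (MDifferentiableAt.comp p (g := fun q : G × M ↦ q.1⁻¹ • q.2) (f := fun z ↦ (κ z, c z))
      (hθd _) hκc).congr_of_eventuallyEq hbe
  have htx : MDifferentiableAt (𝓡 n) 𝓘(ℝ, F) (fun z ↦ E.comps x (b z) (t z)) p :=
    ht.mdiff_comps hb hdb
  have hev : (fun z ↦ E.comps x (c z) (T z)) =ᶠ[𝓝 p]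
      fun z ↦ A.actIn x (κ z, c z) (E.comps x (b z) (t z)) := by
    filter_upwards [h, hT, hb.continuousAt.preimage_mem_nhds ((E.isOpen_dom x).mem_nhds hdb)] with
      z hz hTz hbz
    rw [actIn_apply, hTz hz, A.orbitSection_eq _ hz, frame_comps hbz]
  have hgp : (κ p)⁻¹ • c p ∈ E.dom x := by
    have h1 := hbe.self_of_nhds
    simp only at h1
    rw [← h1]; exact hdb
  have hactd : MDifferentiableAt ((𝓡 k).prod (𝓡 m)) 𝓘(ℝ, F →L[ℝ] F) (A.actIn x) (κ p, c p) :=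
    (contMDiffAt_clm_of_forall_apply fun f ↦ A.contMDiffAt_actIn hdx hgp f).mdifferentiableAt
      (by simp)
  have hactc : MDifferentiableAt (𝓡 n) 𝓘(ℝ, F →L[ℝ] F) (fun z ↦ A.actIn x (κ z, c z)) p :=
    MDifferentiableAt.comp p (g := A.actIn x) (f := fun z ↦ (κ z, c z)) hactd hκc
  have hTx : MDifferentiableAt (𝓡 n) 𝓘(ℝ, F) (fun z ↦ E.comps x (c z) (T z)) p :=
    (hactc.clm_apply htx).congr_of_eventuallyEq hev
  refine ⟨hTx, fun u ↦ ?_⟩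
  have hdb' : (mfderiv (𝓡 n) (𝓡 m) b p u : Eu m) =
      (infAct G x (mfderiv (𝓡 n) (𝓡 k) κ p u : Eu k) : Eu m) + (mfderiv (𝓡 n) (𝓡 m) c p u : Eu m) := by
    have h1 : (mfderiv (𝓡 n) (𝓡 m) b p u : Eu m) =
        mfderiv (𝓡 n) (𝓡 m) (fun z ↦ (κ z)⁻¹ • c z) p u :=
      congrArg (fun T : Eu n →L[ℝ] Eu m ↦ T u) hbe.mfderiv_eq
    refine h1.trans ((mfderiv_comp_prodMk (Φ := fun q : G × M ↦ q.1⁻¹ • q.2) (hθd _) hκ hc u).trans ?_)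
    have h2 : ∀ (g : G) (e : Eu k), g = 1 → (mfderiv (𝓡 k) (𝓡 m) (fun g : G ↦ g⁻¹ • c p) g e : Eu m) =
        infAct G x e := by
      rintro g e rfl; rfl
    have h3 : ∀ (g : G) (e : Eu m), g = 1 → (mfderiv (𝓡 m) (𝓡 m) (fun y : M ↦ g⁻¹ • y) (c p) e : Eu m) =
        e := by
      rintro g e rfl
      have h4 : (fun y : M ↦ (1 : G)⁻¹ • y) = id := by funext y; simp
      have h5 : mfderiv (𝓡 m) (𝓡 m) (fun y : M ↦ (1 : G)⁻¹ • y) (c p) = ContinuousLinearMap.id ℝ (Eu m) := by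
        rw [h4]; exact mfderiv_id
      exact congrArg (fun T : Eu m →L[ℝ] Eu m ↦ T e) h5
    exact congrArg₂ (· + ·) (h2 _ _ hκp) (h3 _ _ hκp)
  have hDact : ∀ f, (mvfderiv (𝓡 n) (fun z ↦ A.actIn x (κ z, c z)) p u : F →L[ℝ] F) f =
      E.connForm x (c p) (infAct G (c p) (mfderiv (𝓡 n) (𝓡 k) κ p u : Eu k)) f := by
    intro f
    have h1 := mfderiv_comp_prodMk (J' := 𝓘(ℝ, F →L[ℝ] F)) (Φ := A.actIn x) hactd hκ hc u
    have h2 : ∀ (g : G) (e : Eu k), g = 1 →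
        (mvfderiv (𝓡 k) (fun g : G ↦ A.actIn x (g, c p)) g e : F →L[ℝ] F) =
          E.connForm x (c p) (infAct G (c p) e) := by
      rintro g e rfl
      exact sub_eq_zero.1 (A.generator_eq_zero hdx e (hneat e))
    have h4 : ∀ (g : G) (e : Eu m), g = 1 →
        (mvfderiv (𝓡 m) (fun y : M ↦ A.actIn x (g, y)) (c p) e : F →L[ℝ] F) = 0 := by
      rintro g e rfl
      have h5 : (fun y : M ↦ A.actIn x ((1 : G), y)) =ᶠ[𝓝 (c p)] fun _ ↦ ContinuousLinearMap.id ℝ F := by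
        filter_upwards [(E.isOpen_dom x).mem_nhds hdx] with y hy
        exact A.actIn_one hy
      exact (mvfderiv_congr_of_eventuallyEq h5 _).trans (mvfderiv_const_apply _ _ _)
    have h6 : (mvfderiv (𝓡 n) (fun z ↦ A.actIn x (κ z, c z)) p u : F →L[ℝ] F) =
        E.connForm x (c p) (infAct G (c p) (mfderiv (𝓡 n) (𝓡 k) κ p u : Eu k)) :=
      h1.trans ((congrArg₂ (· + ·) (h2 _ (mfderiv (𝓡 n) (𝓡 k) κ p u : Eu k) hκp)
        (h4 _ (mfderiv (𝓡 n) (𝓡 m) c p u : Eu m) hκp)).trans (add_zero _))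
    rw [h6]
  have hmove : ∀ (y : M) (hy : κ p • y = c p) (hyx : y = c p) (e : E.Fib y),
      E.comps x (c p) (A.act (κ p) hy e) = E.comps x y e := by
    rintro y hy rfl e
    rw [A.act_congr hκp hy (one_smul G _), A.act_one]
  have hmove' : ∀ (y : M) (v : Eu m) (f : F), y = c p → E.connForm x y v f = E.connForm x (c p) v f := by
    rintro y v f rfl; rfl
  have hone : A.actIn x (κ p, c p) = ContinuousLinearMap.id ℝ F := by rw [hκp, A.actIn_one hdx]
  apply comps_injective hdx
  refine Eq.trans ?_ (hmove _ hp hbp _).symm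
  rw [comps_pullbackConn hb hdb htx, comps_pullbackConn hc hdx hTx,
    mvfderiv_congr_of_eventuallyEq hev, mvfderiv_clm_apply hactc htx, hDact]
  have e1 := hev.self_of_nhds
  simp only at e1
  rw [e1, hone]
  have e2 := hmove' (b p) (mfderiv (𝓡 n) (𝓡 m) b p u) (E.comps x (b p) (t p)) hbp
  refine Eq.trans ?_ (congrArg (· + _) e2.symm)
  have e3 : E.connForm x (c p) (mfderiv (𝓡 n) (𝓡 m) b p u : Eu m) (E.comps x (b p) (t p)) =
      E.connForm x (c p) (infAct G (c p) (mfderiv (𝓡 n) (𝓡 k) κ p u : Eu k)) (E.comps x (b p) (t p)) +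
      E.connForm x (c p) (mfderiv (𝓡 n) (𝓡 m) c p u) (E.comps x (b p) (t p)) := by
    refine (congrArg (fun v : Eu m ↦ E.connForm x (c p) v (E.comps x (b p) (t p))) hdb').trans ?_
    exact congrArg (fun T : F →L[ℝ] F ↦ T (E.comps x (b p) (t p)))
      ((E.connForm x (c p) : Eu m →L[ℝ] F →L[ℝ] F).map_add _ _)
  rw [e3]
  simp only [ContinuousLinearMap.id_apply]
  abel

/-- Where the infinitesimal action on sections is given by the connection, the pull back connection
is invariant under smooth families of elements of the group. -/
lemma pullbackConn_act {a c : P → M} {g : P → G} {p : P}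
    (ha : MDifferentiableAt (𝓡 n) (𝓡 m) a p) (hc : MDifferentiableAt (𝓡 n) (𝓡 m) c p)
    (hg : MDifferentiableAt (𝓡 n) (𝓡 k) g p) (h : ∀ᶠ z in 𝓝 p, g z • a z = c z)
    (hneat : ∀ (b : GroupLieAlgebra (𝓡 k) G) (s : Π y, E.Fib y), E.SmoothAt s (c p) →
      E.conn s (c p) (infAct G (c p) b) = A.lieDeriv b s (c p))
    {s : Π z, E.Fib (a z)} {T : Π z, E.Fib (c z)} (hs : E.MDiffAlong n a s p)
    (hT : ∀ᶠ z in 𝓝 p, ∀ h : g z • a z = c z, T z = A.act (g z) h (s z)) (hp : g p • a p = c p) :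
    E.MDiffAlong n c T p ∧ ∀ u : TangentSpace (𝓡 n) p,
      E.pullbackConn c T p u = A.act (g p) hp (E.pullbackConn a s p u) := by
  obtain ⟨h1, h2⟩ := A.pullbackConn_const_act (g p) ha hs
  have hb : ∀ z, g z • a z = c z → (g z * (g p)⁻¹) • g p • a z = c z := by
    intro z hz
    rw [← hz, mul_smul, inv_smul_smul]
  have hd : MDifferentiableAt (𝓡 k) (𝓡 k) (fun x : G ↦ x * (g p)⁻¹) (g p) :=
    (contMDiff_mul_right (I := 𝓡 k) (n := ∞)).contMDiffAt.mdifferentiableAt (by simp)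
  have hp' := hb p hp
  obtain ⟨h3, h4⟩ := A.pullbackConn_act_of_eq_one (b := fun z ↦ g p • a z)
    (κ := fun z ↦ g z * (g p)⁻¹) hc
    (MDifferentiableAt.comp p (g := fun x : G ↦ x * (g p)⁻¹) (f := g) hd hg) (mul_inv_cancel _)
    (h.mono hb) hneat h1 (T := T) (by
      filter_upwards [h, hT] with z hz hTz h'
      rw [hTz hz, ← A.act_mul (g z * (g p)⁻¹) (g p) rfl h' (by rw [inv_mul_cancel_right]; exact hz)]
      exact A.act_congr (by simp) _ _ _) hp'
  refine ⟨h3, fun u ↦ ?_⟩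
  rw [h4, h2, ← A.act_mul (g p * (g p)⁻¹) (g p) rfl hp' (by rw [inv_mul_cancel_right]; exact hp)]
  exact A.act_congr (by simp) _ _ _

end EquivariantStructure

end

section

open Set Filter Topology Manifold Bundle

/-- A family of Hermitian vector spaces with smoothly compatible local trivializations, one around
every point. -/
structure FrameSystem (m : ℕ) (F : Type u) [NormedAddCommGroup F] [NormedSpace ℂ F]
    (M : Type v) [TopologicalSpace M] [ChartedSpace (EuclideanSpace ℝ (Fin m)) M] where
  Fib : M → Type w
  [fibGroup : ∀ y, NormedAddCommGroup (Fib y)]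
  [fibInner : ∀ y, InnerProductSpace ℂ (Fib y)]
  dom : M → Set M
  comps : ∀ x y, Fib y →ₗ[ℝ] F
  frame : ∀ x y, F → Fib y
  isOpen_dom x : IsOpen (dom x)
  mem_dom x : x ∈ dom x
  frame_comps : ∀ x, ∀ y ∈ dom x, ∀ e, frame x y (comps x y e) = e
  comps_frame : ∀ x, ∀ y ∈ dom x, ∀ f, comps x y (frame x y f) = f
  comps_smul : ∀ x, ∀ y ∈ dom x, ∀ (c : ℂ) (e), comps x y (c • e) = c • comps x y e
  contMDiffOn_transition : ∀ x x' f,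
    ContMDiffOn (𝓡 m) 𝓘(ℝ, F) ∞ (fun y ↦ comps x y (frame x' y f)) (dom x ∩ dom x')

namespace FrameSystem

attribute [instance] FrameSystem.fibGroup FrameSystem.fibInner

variable {m : ℕ} {F : Type u} [NormedAddCommGroup F] [NormedSpace ℂ F]
  {M : Type v} [TopologicalSpace M] [ChartedSpace (EuclideanSpace ℝ (Fin m)) M]
  (S : FrameSystem.{u, v, w} m F M)

/-- The local trivialization around `x`. -/
def pretriv (x : M) : Pretrivialization F (π F S.Fib) where
  toFun p := (p.1, S.comps x p.1 p.2)
  invFun p := ⟨p.1, S.frame x p.1 p.2⟩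
  source := π F S.Fib ⁻¹' S.dom x
  target := S.dom x ×ˢ univ
  map_source' _ hp := ⟨hp, mem_univ _⟩
  map_target' _ hp := hp.1
  left_inv' := by
    rintro ⟨y, e⟩ hp
    exact congrArg (TotalSpace.mk y) (S.frame_comps x y hp e)
  right_inv' := by
    rintro ⟨y, f⟩ hp
    exact congrArg (Prod.mk y) (S.comps_frame x y hp.1 f)
  open_target := (S.isOpen_dom x).prod isOpen_univ
  baseSet := S.dom x
  open_baseSet := S.isOpen_dom x
  source_eq := rfl
  target_eq := rfl
  proj_toFun _ _ := rfl

lemma pretriv_symm {x y : M} (hy : y ∈ S.dom x) (f : F) : (S.pretriv x).symm y f = S.frame x y f := by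
  have h := (S.pretriv x).mk_symm hy f
  have h1 : (S.pretriv x).toPartialEquiv.symm (y, f) = TotalSpace.mk y (S.frame x y f) := rfl
  rw [h1] at h
  exact TotalSpace.mk_injective y h

lemma isLinear_real (x : M) : (S.pretriv x).IsLinear ℝ where
  linear y _ := { map_add := (S.comps x y).map_add, map_smul := (S.comps x y).map_smul }

lemma isLinear_complex (x : M) : (S.pretriv x).IsLinear ℂ where
  linear y hy := { map_add := (S.comps x y).map_add, map_smul := S.comps_smul x y hy }

lemma frame_add {x y : M} (hy : y ∈ S.dom x) (f f' : F) :
    S.frame x y (f + f') = S.frame x y f + S.frame x y f' := by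
  rw [← S.frame_comps x y hy (S.frame x y f + S.frame x y f'), map_add, S.comps_frame x y hy,
    S.comps_frame x y hy]

lemma frame_smul {x y : M} (hy : y ∈ S.dom x) (c : ℂ) (f : F) :
    S.frame x y (c • f) = c • S.frame x y f := by
  rw [← S.frame_comps x y hy (c • S.frame x y f), S.comps_smul x y hy, S.comps_frame x y hy]

variable [FiniteDimensional ℂ F]

lemma isInducing_comps (x : M) : IsInducing (S.pretriv x ∘ TotalSpace.mk x) := by
  have hx := S.mem_dom x
  let L : F ≃ₗ[ℂ] S.Fib x :=
    { toFun := S.frame x x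
      map_add' := S.frame_add hx
      map_smul' := S.frame_smul hx
      invFun := S.comps x x
      left_inv := S.comps_frame x x hx
      right_inv := S.frame_comps x x hx }
  have h1 : IsInducing (S.comps x x) := L.toContinuousLinearEquiv.symm.toHomeomorph.isInducing
  have h2 : IsInducing (fun f : F ↦ (x, f)) := isEmbedding_prodMkRight x |>.isInducing
  exact h2.comp h1

open Classical in
/-- The change of trivialization. -/
def change (𝕜 : Type*) [NontriviallyNormedField 𝕜] [CompleteSpace 𝕜] [NormedSpace 𝕜 F]
    [FiniteDimensional 𝕜 F] (x x' y : M) : F →L[𝕜] F :=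
  if h : ∃ T : F →L[𝕜] F, ∀ f, T f = S.comps x y (S.frame x' y f) then h.choose else 0

lemma change_apply_complex {x x' y : M} (hy : y ∈ S.dom x) (hy' : y ∈ S.dom x') (f : F) :
    S.change ℂ x x' y f = S.comps x y (S.frame x' y f) := by
  have h : ∃ T : F →L[ℂ] F, ∀ f, T f = S.comps x y (S.frame x' y f) :=
    ⟨LinearMap.toContinuousLinearMap
      { toFun := fun f ↦ S.comps x y (S.frame x' y f)
        map_add' := fun f f' ↦ by rw [S.frame_add hy', map_add]
        map_smul' := fun c f ↦ by rw [S.frame_smul hy', S.comps_smul x y hy]; rfl }, fun _ ↦ rfl⟩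
  rw [change, dif_pos h]
  exact h.choose_spec f

lemma change_apply_real {x x' y : M} (hy : y ∈ S.dom x) (hy' : y ∈ S.dom x') (f : F) :
    S.change ℝ x x' y f = S.comps x y (S.frame x' y f) := by
  have h : ∃ T : F →L[ℝ] F, ∀ f, T f = S.comps x y (S.frame x' y f) :=
    ⟨(S.change ℂ x x' y).restrictScalars ℝ, fun f ↦ S.change_apply_complex hy hy' f⟩
  rw [change, dif_pos h]
  exact h.choose_spec f

lemma contMDiffOn_change [IsManifold (𝓡 m) ∞ M] (x x' : M) :
    ContMDiffOn (𝓡 m) 𝓘(ℝ, F →L[ℝ] F) ∞ (S.change ℝ x x') (S.dom x ∩ S.dom x') := by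
  intro y hy
  have ho : S.dom x ∩ S.dom x' ∈ 𝓝 y := ((S.isOpen_dom x).inter (S.isOpen_dom x')).mem_nhds hy
  refine (contMDiffAt_clm_of_apply fun f ↦ ?_).contMDiffWithinAt
  refine ((S.contMDiffOn_transition x x' f).contMDiffAt ho).congr_of_eventuallyEq ?_
  filter_upwards [ho] with z hz
  exact S.change_apply_real hz.1 hz.2 f

variable [IsManifold (𝓡 m) ∞ M]

/-- The vector bundle given by the local trivializations, as a complex vector bundle. -/
def complexPrebundle : VectorPrebundle ℂ F S.Fib where
  pretrivializationAtlas := range S.pretriv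
  pretrivialization_linear' := by rintro _ ⟨x, rfl⟩; exact S.isLinear_complex x
  pretrivializationAt := S.pretriv
  mem_base_pretrivializationAt := S.mem_dom
  pretrivialization_mem_atlas x := ⟨x, rfl⟩
  exists_coordChange := by
    rintro _ ⟨x, rfl⟩ _ ⟨x', rfl⟩
    refine ⟨S.change ℂ x' x, ?_, ?_⟩
    · refine continuousOn_clm_apply.2 fun f ↦ ?_
      refine ContinuousOn.congr ((S.contMDiffOn_transition x' x f).continuousOn.mono ?_)
        fun y hy ↦ S.change_apply_complex hy.2 hy.1 f
      exact fun y hy ↦ ⟨hy.2, hy.1⟩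
    · rintro y hy f
      rw [S.change_apply_complex hy.2 hy.1, S.pretriv_symm hy.1]
      rfl
  totalSpaceMk_isInducing := S.isInducing_comps

/-- The vector bundle given by the local trivializations, as a real vector bundle. -/
def realPrebundle : VectorPrebundle ℝ F S.Fib where
  pretrivializationAtlas := range S.pretriv
  pretrivialization_linear' := by rintro _ ⟨x, rfl⟩; exact S.isLinear_real x
  pretrivializationAt := S.pretriv
  mem_base_pretrivializationAt := S.mem_dom
  pretrivialization_mem_atlas x := ⟨x, rfl⟩
  exists_coordChange := by
    rintro _ ⟨x, rfl⟩ _ ⟨x', rfl⟩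
    refine ⟨S.change ℝ x' x, (S.contMDiffOn_change x' x).continuousOn.mono fun y hy ↦ ⟨hy.2, hy.1⟩, ?_⟩
    rintro y hy f
    rw [S.change_apply_real hy.2 hy.1, S.pretriv_symm hy.1]
    rfl
  totalSpaceMk_isInducing := S.isInducing_comps

instance : S.realPrebundle.IsContMDiff (𝓡 m) ∞ where
  exists_contMDiffCoordChange := by
    rintro _ ⟨x, rfl⟩ _ ⟨x', rfl⟩
    refine ⟨S.change ℝ x' x, (S.contMDiffOn_change x' x).mono fun y hy ↦ ⟨hy.2, hy.1⟩, ?_⟩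
    rintro y hy f
    rw [S.change_apply_real hy.2 hy.1, S.pretriv_symm hy.1]
    rfl

instance : TopologicalSpace (TotalSpace F S.Fib) := S.realPrebundle.totalSpaceTopology

instance : FiberBundle F S.Fib := S.realPrebundle.toFiberBundle

instance : VectorBundle ℝ F S.Fib := S.realPrebundle.toVectorBundle

instance : VectorBundle ℂ F S.Fib := S.complexPrebundle.toVectorBundle

instance : ContMDiffVectorBundle ∞ F S.Fib (𝓡 m) := S.realPrebundle.contMDiffVectorBundle (𝓡 m)

lemma contMDiffAt_iff (s : Π y, S.Fib y) (x : M) :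
    ContMDiffAt (𝓡 m) ((𝓡 m).prod 𝓘(ℝ, F)) ∞ (fun y ↦ TotalSpace.mk' F y (s y)) x ↔
      ContMDiffAt (𝓡 m) 𝓘(ℝ, F) ∞ (fun y ↦ S.comps x y (s y)) x :=
  Bundle.contMDiffAt_section x

lemma mdifferentiableAt_iff (s : Π y, S.Fib y) (x : M) :
    MDifferentiableAt (𝓡 m) ((𝓡 m).prod 𝓘(ℝ, F)) (fun y ↦ TotalSpace.mk' F y (s y)) x ↔
      MDifferentiableAt (𝓡 m) 𝓘(ℝ, F) (fun y ↦ S.comps x y (s y)) x :=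
  mdifferentiableAt_section (𝓡 m) s

variable (D : (Π y, S.Fib y) → Π y : M, TangentSpace (𝓡 m) y →L[ℝ] S.Fib y)

/-- A unitary connection on the bundle given by the local trivializations, together with the
smoothness of the metric. -/
structure IsUnitaryConnection : Prop where
  smooth_inner : ∀ (x : M) (s t : Π y, S.Fib y),
    ContMDiffAt (𝓡 m) 𝓘(ℝ, F) ∞ (fun y ↦ S.comps x y (s y)) x →
    ContMDiffAt (𝓡 m) 𝓘(ℝ, F) ∞ (fun y ↦ S.comps x y (t y)) x →
    ContMDiffAt (𝓡 m) 𝓘(ℝ, ℂ) ∞ (fun y ↦ inner ℂ (s y) (t y)) x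
  add : ∀ (x : M) (s t : Π y, S.Fib y) (u : TangentSpace (𝓡 m) x),
    MDifferentiableAt (𝓡 m) 𝓘(ℝ, F) (fun y ↦ S.comps x y (s y)) x →
    MDifferentiableAt (𝓡 m) 𝓘(ℝ, F) (fun y ↦ S.comps x y (t y)) x →
    D (fun y ↦ s y + t y) x u = D s x u + D t x u
  leibniz : ∀ (x : M) (s : Π y, S.Fib y) (g : M → ℝ) (u : TangentSpace (𝓡 m) x),
    MDifferentiableAt (𝓡 m) 𝓘(ℝ, F) (fun y ↦ S.comps x y (s y)) x →
    MDifferentiableAt (𝓡 m) 𝓘(ℝ, ℝ) g x →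
    D (fun y ↦ g y • s y) x u = g x • D s x u + mvfderiv (𝓡 m) g x u • s x
  smul : ∀ (x : M) (c : ℂ) (s : Π y, S.Fib y) (u : TangentSpace (𝓡 m) x),
    MDifferentiableAt (𝓡 m) 𝓘(ℝ, F) (fun y ↦ S.comps x y (s y)) x →
    D (fun y ↦ c • s y) x u = c • D s x u
  unitary : ∀ (x : M) (s t : Π y, S.Fib y) (u : TangentSpace (𝓡 m) x),
    MDifferentiableAt (𝓡 m) 𝓘(ℝ, F) (fun y ↦ S.comps x y (s y)) x →
    MDifferentiableAt (𝓡 m) 𝓘(ℝ, F) (fun y ↦ S.comps x y (t y)) x →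
    mvfderiv (𝓡 m) (fun y ↦ inner ℂ (s y) (t y)) x u =
      inner ℂ (D s x u) (t x) + inner ℂ (s x) (D t x u)
  smooth : ∀ (x : M) (s : Π y, S.Fib y) (V : Π y : M, TangentSpace (𝓡 m) y),
    (∀ᶠ y in 𝓝 x, MDifferentiableAt (𝓡 m) 𝓘(ℝ, F) (fun z ↦ S.comps y z (s z)) y) →
    ContMDiffAt (𝓡 m) 𝓘(ℝ, F) ∞ (fun y ↦ S.comps x y (s y)) x → SmoothFieldAt V x →
    ContMDiffAt (𝓡 m) 𝓘(ℝ, F) ∞ (fun y ↦ S.comps x y (D s y (V y))) x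

variable {S D}

/-- The Hermitian bundle with unitary connection given by local trivializations. -/
def IsUnitaryConnection.bundle (h : S.IsUnitaryConnection D) : HermitianBundle.{u, v, w} m F M where
  Fib := S.Fib
  smooth_inner x s t hs ht :=
    h.smooth_inner x s t ((S.contMDiffAt_iff s x).1 hs) ((S.contMDiffAt_iff t x).1 ht)
  conn :=
    { toFun := D
      isCovariantDerivativeOnUniv :=
        { add := fun {σ σ' x} hσ hσ' _ ↦ ContinuousLinearMap.ext fun u ↦
            h.add x σ σ' u ((S.mdifferentiableAt_iff σ x).1 hσ) ((S.mdifferentiableAt_iff σ' x).1 hσ')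
          leibniz := fun {σ g x} hσ hg _ ↦ ContinuousLinearMap.ext fun u ↦
            h.leibniz x σ g u ((S.mdifferentiableAt_iff σ x).1 hσ) hg } }
  conn_smooth x s V hs hV := by
    refine (S.contMDiffAt_iff _ x).2 (h.smooth x s V ?_ ((S.contMDiffAt_iff s x).1 hs) hV)
    have h1 : ContMDiffAt (𝓡 m) ((𝓡 m).prod 𝓘(ℝ, F)) 1 (fun y ↦ TotalSpace.mk' F y (s y)) x :=
      ContMDiffAt.of_le hs (by simp)
    filter_upwards [(contMDiffAt_iff_contMDiffAt_nhds (by simp)).1 h1] with y hy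
    exact (S.mdifferentiableAt_iff s y).1 (ContMDiffAt.mdifferentiableAt hy (by simp))
  conn_smul x c s u hs := h.smul x c s u ((S.mdifferentiableAt_iff s x).1 hs)
  conn_unitary x s t u hs ht :=
    h.unitary x s t u ((S.mdifferentiableAt_iff s x).1 hs) ((S.mdifferentiableAt_iff t x).1 ht)

end FrameSystem

end

section

section Field

variable {n : ℕ} {N : Type*} [TopologicalSpace N] [ChartedSpace (EuclideanSpace ℝ (Fin n)) N]
  [IsManifold (𝓡 n) ∞ N] {W : Type*} [NormedAddCommGroup W] [NormedSpace ℝ W]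

lemma eventually_mdifferentiableAt {EY HY Y : Type*} [NormedAddCommGroup EY] [NormedSpace ℝ EY]
    [TopologicalSpace HY] {J : ModelWithCorners ℝ EY HY} [TopologicalSpace Y] [ChartedSpace HY Y]
    [IsManifold J ∞ Y] {h : N → Y} {z : N} (hh : ContMDiffAt (𝓡 n) J ∞ h z) :
    ∀ᶠ z' in 𝓝 z, MDifferentiableAt (𝓡 n) J h z' := by
  have : IsManifold J 1 Y := IsManifold.of_le (n := ∞) (by simp)
  have : IsManifold (𝓡 n) 1 N := IsManifold.of_le (n := ∞) (by simp)
  have h1 : ContMDiffAt (𝓡 n) J 1 h z := hh.of_le (by simp)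
  filter_upwards [(contMDiffAt_iff_contMDiffAt_nhds (by simp)).1 h1] with y hy
  exact hy.mdifferentiableAt (by simp)

/-- The derivative of a smooth function along a smooth vector field is smooth. -/
lemma contMDiffAt_mvfderiv_field {h : N → W} {z : N} (hh : ContMDiffAt (𝓡 n) 𝓘(ℝ, W) ∞ h z)
    {V : Π y : N, TangentSpace (𝓡 n) y} (hV : SmoothFieldAt V z) :
    ContMDiffAt (𝓡 n) 𝓘(ℝ, W) ∞ (fun y ↦ mvfderiv (𝓡 n) h y (V y)) z := by
  have hz := mem_chart_source (Eu n) z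
  have h1 : ContDiffAt ℝ ∞ (fderiv ℝ (fun p ↦ h ((extChartAt (𝓡 n) z).symm p)))
      (extChartAt (𝓡 n) z z) :=
    (contDiffAt_comp_extChartAt_symm hz hh).fderiv_right (m := ∞) (by simp)
  have h2 : ContMDiffAt (𝓡 n) 𝓘(ℝ, Eu n →L[ℝ] W) ∞
      (fun y ↦ fderiv ℝ (fun p ↦ h ((extChartAt (𝓡 n) z).symm p)) (extChartAt (𝓡 n) z y)) z :=
    ContMDiffAt.comp z (g := fderiv ℝ (fun p ↦ h ((extChartAt (𝓡 n) z).symm p)))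
      (f := extChartAt (𝓡 n) z) h1.contMDiffAt (contMDiffAt_extChartAt' hz)
  refine (h2.clm_apply ((smoothFieldAt_iff hz).1 hV)).congr_of_eventuallyEq ?_
  filter_upwards [eventually_mdifferentiableAt hh, (chartAt (Eu n) z).open_source.mem_nhds hz] with
    y hy hyz
  rw [← mvfderiv_fld hyz hy, fld_coord hyz]

end Field

namespace HermitianBundle

variable {m n : ℕ} {F : Type u} [NormedAddCommGroup F] [NormedSpace ℂ F]
  {M : Type v} [TopologicalSpace M] [ChartedSpace (EuclideanSpace ℝ (Fin m)) M]
  [IsManifold (𝓡 m) ∞ M] {E : HermitianBundle.{u, v, w} m F M}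
  {N : Type*} [TopologicalSpace N] [ChartedSpace (EuclideanSpace ℝ (Fin n)) N]
  [IsManifold (𝓡 n) ∞ N] [FiniteDimensional ℂ F]

/-- The pull back of a smooth connection is smooth. -/
lemma contMDiffAt_comps_pullbackConn {f : N → M} {σ : Π z, E.Fib (f z)} {z : N}
    (hf : ContMDiffAt (𝓡 n) (𝓡 m) ∞ f z)
    (hσ : ContMDiffAt (𝓡 n) 𝓘(ℝ, F) ∞ (fun z' ↦ E.comps (f z) (f z') (σ z')) z)
    {V : Π y : N, TangentSpace (𝓡 n) y} (hV : SmoothFieldAt V z) :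
    ContMDiffAt (𝓡 n) 𝓘(ℝ, F) ∞ (fun y ↦ E.comps (f z) (f y) (E.pullbackConn f σ y (V y))) z := by
  set x := f z with hx
  have hxc := mem_chart_source (Eu m) x
  have hxd := E.mem_dom x
  let C : M → Eu m →L[ℝ] F →L[ℝ] F := fun y ↦ (E.connForm x y).comp (fld x y)
  have hC : ContMDiffAt (𝓡 m) 𝓘(ℝ, Eu m →L[ℝ] F →L[ℝ] F) ∞ C x :=
    contMDiffAt_clm_of_apply fun u ↦ contMDiffAt_clm_of_apply fun g ↦
      contMDiffAt_connForm_fld hxc hxd u g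
  have hCf : ContMDiffAt (𝓡 n) 𝓘(ℝ, Eu m →L[ℝ] F →L[ℝ] F) ∞ (fun y ↦ C (f y)) z :=
    ContMDiffAt.comp z (g := C) (f := f) hC hf
  have hφ : ContMDiffAt (𝓡 n) 𝓘(ℝ, Eu m) ∞ (fun y ↦ extChartAt (𝓡 m) x (f y)) z :=
    ContMDiffAt.comp z (g := extChartAt (𝓡 m) x) (f := f) (contMDiffAt_extChartAt' hxc) hf
  have hφV := contMDiffAt_mvfderiv_field hφ hV
  refine (((hCf.clm_apply hφV).clm_apply hσ).add
    (contMDiffAt_mvfderiv_field hσ hV)).congr_of_eventuallyEq ?_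
  filter_upwards [eventually_mdifferentiableAt hf, eventually_mdifferentiableAt hσ,
    hf.continuousAt.preimage_mem_nhds ((E.isOpen_dom x).mem_nhds hxd),
    hf.continuousAt.preimage_mem_nhds ((chartAt (Eu m) x).open_source.mem_nhds hxc)] with y h1 h2 h3 h4
  rw [comps_pullbackConn (σ := σ) h1 h3 h2]
  congr 1
  have h5 : fld x (f y) (mvfderiv (𝓡 n) (fun y ↦ extChartAt (𝓡 m) x (f y)) y (V y)) =
      mfderiv (𝓡 n) (𝓡 m) f y (V y) := by
    rw [← coord_mfderiv h4 h1, fld_coord h4]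
  rw [← h5]
  rfl

end HermitianBundle

namespace LevelQuotient

variable {m k n : ℕ} {G : Type*} [Group G] [TopologicalSpace G]
  [ChartedSpace (EuclideanSpace ℝ (Fin k)) G] [LieGroup (𝓡 k) ∞ G]
  {M : Type v} [TopologicalSpace M] [ChartedSpace (EuclideanSpace ℝ (Fin m)) M]
  [IsManifold (𝓡 m) ∞ M] [MulAction G M] [ContMDiffSMul (𝓡 k) (𝓡 m) ∞ G M]
  {ι V : Type*} [NormedAddCommGroup V] [NormedSpace ℝ V] {φ : M → ι → V} {L : CleanLevel m φ}
  (Q : LevelQuotient G L)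
  {P : Type*} [TopologicalSpace P] [ChartedSpace (EuclideanSpace ℝ (Fin n)) P]
  [IsManifold (𝓡 n) ∞ P]

/-- A point of the level over `q`. -/
def rep (q : Q.Space) : L.Space := (Q.proj_surjective q).choose

lemma proj_rep (q : Q.Space) : Q.proj (Q.rep q) = q := (Q.proj_surjective q).choose_spec

lemma exists_sec (q : Q.Space) : ∃ (σ : Q.Space → L.Space) (O : Set Q.Space), IsOpen O ∧ q ∈ O ∧
    ContMDiffOn (𝓡 Q.dim) (𝓡 L.dim) ∞ σ O ∧ ∀ q' ∈ O, Q.proj (σ q') = q' := by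
  obtain ⟨σ, O, h1, h2, -, h3, h4⟩ := exists_local_section Q.isSubmersion_proj (Q.rep q)
  exact ⟨σ, O, h1, Q.proj_rep q ▸ h2, h3, h4⟩

/-- A local section of the projection, defined near `q`. -/
def sec (q : Q.Space) : Q.Space → L.Space := (Q.exists_sec q).choose

/-- The domain of the local section `sec q`. -/
def secDom (q : Q.Space) : Set Q.Space := (Q.exists_sec q).choose_spec.choose

lemma isOpen_secDom (q : Q.Space) : IsOpen (Q.secDom q) := (Q.exists_sec q).choose_spec.choose_spec.1

lemma mem_secDom (q : Q.Space) : q ∈ Q.secDom q := (Q.exists_sec q).choose_spec.choose_spec.2.1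

lemma contMDiffAt_sec {q q' : Q.Space} (h : q' ∈ Q.secDom q) :
    ContMDiffAt (𝓡 Q.dim) (𝓡 L.dim) ∞ (Q.sec q) q' :=
  ((Q.exists_sec q).choose_spec.choose_spec.2.2.1).contMDiffAt ((Q.isOpen_secDom q).mem_nhds h)

lemma proj_sec {q q' : Q.Space} (h : q' ∈ Q.secDom q) : Q.proj (Q.sec q q') = q' :=
  (Q.exists_sec q).choose_spec.choose_spec.2.2.2 q' h

lemma contMDiffAt_incl_sec {q q' : Q.Space} (h : q' ∈ Q.secDom q) :
    ContMDiffAt (𝓡 Q.dim) (𝓡 m) ∞ (fun q' ↦ L.incl (Q.sec q q')) q' :=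
  ContMDiffAt.comp q' (g := L.incl) (f := Q.sec q) L.contMDiff_incl.contMDiffAt (Q.contMDiffAt_sec h)

/-- Two maps to the level with the same projection differ by a smooth family of elements of the
group. -/
lemma exists_smooth_translation [CompactSpace G] [T2Space M]
    (hinv : ∀ (g : G) (x : M), (∀ a, φ x a = 0) → ∀ a, φ (g • x) a = 0)
    (hfree : ∀ x : M, (∀ a, φ x a = 0) → ∀ g : G, g • x = x → g = 1) {α β : P → L.Space} {p : P}
    (hα : ContMDiffAt (𝓡 n) (𝓡 L.dim) ∞ α p) (hβ : ContMDiffAt (𝓡 n) (𝓡 L.dim) ∞ β p)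
    (h : ∀ᶠ z in 𝓝 p, Q.proj (α z) = Q.proj (β z)) :
    ∃ g : P → G, ContMDiffAt (𝓡 n) (𝓡 k) ∞ g p ∧ ∀ᶠ z in 𝓝 p, g z • L.incl (α z) = L.incl (β z) := by
  let _ := L.action hinv
  have := L.contMDiffSMul_action (k := k) hinv
  obtain ⟨g₀, hg₀⟩ := Q.proj_eq_iff.1 h.self_of_nhds
  obtain ⟨N, c, hN, hpN, hc, hcN⟩ := Q.exists_translation (k := k) hinv hfree (α p)
  let β' : P → L.Space := fun z ↦ g₀⁻¹ • β z
  have hβ' : ContMDiffAt (𝓡 n) (𝓡 L.dim) ∞ β' p :=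
    ContMDiffAt.comp p (g := fun y : L.Space ↦ g₀⁻¹ • y) (f := β)
      (contMDiff_const_smul k g₀⁻¹).contMDiffAt hβ
  have hincl : ∀ z, L.incl (β' z) = g₀⁻¹ • L.incl (β z) := fun z ↦ L.incl_action_smul hinv _ _
  have hp : β' p = α p := L.incl_injective (by rw [hincl, ← hg₀, inv_smul_smul])
  have hca : ContMDiffAt (𝓡 n) (𝓡 k) ∞ (fun z ↦ c (α z)) p :=
    ContMDiffAt.comp p (g := c) (f := α) (hc.contMDiffAt (hN.mem_nhds hpN)) hα
  have hcb : ContMDiffAt (𝓡 n) (𝓡 k) ∞ (fun z ↦ c (β' z)) p :=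
    ContMDiffAt.comp p (g := c) (f := β') (hc.contMDiffAt (hN.mem_nhds (hp ▸ hpN))) hβ'
  refine ⟨fun z ↦ g₀ * (c (β' z) * (c (α z))⁻¹), contMDiffAt_const.mul (hcb.mul hca.inv), ?_⟩
  filter_upwards [h, hα.continuousAt.preimage_mem_nhds (hN.mem_nhds hpN),
    hβ'.continuousAt.preimage_mem_nhds (hN.mem_nhds (hp ▸ hpN))] with z h1 h2 h3
  have h4 : Q.proj (β' z) = Q.proj (α z) := by
    rw [h1]
    exact Q.proj_eq_iff.2 ⟨g₀, by rw [hincl, smul_inv_smul]⟩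
  rw [mul_smul, hcN _ h3 _ h2 h4, hincl, smul_inv_smul]

end LevelQuotient

namespace EquivariantStructure

open HermitianBundle

variable {m k n : ℕ} {F : Type u} [NormedAddCommGroup F] [NormedSpace ℂ F]
  {M : Type v} [TopologicalSpace M] [ChartedSpace (EuclideanSpace ℝ (Fin m)) M]
  [IsManifold (𝓡 m) ∞ M] {E : HermitianBundle.{u, v, w} m F M}
  {G : Type*} [Group G] [TopologicalSpace G]
  [ChartedSpace (EuclideanSpace ℝ (Fin k)) G] [LieGroup (𝓡 k) ∞ G]
  [MulAction G M] [ContMDiffSMul (𝓡 k) (𝓡 m) ∞ G M]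
  (A : EquivariantStructure k G E)

open Classical in
/-- The action of an element of the group that maps `x` to `y`. -/
def transport (x y : M) : E.Fib x →L[ℂ] E.Fib y :=
  if h : ∃ g : G, g • x = y then
    (A.act h.choose h.choose_spec).toContinuousLinearEquiv.toContinuousLinearMap else 0

lemma transport_eq {x y : M} (hx : ∀ g : G, g • x = x → g = 1) {g : G} (h : g • x = y)
    (e : E.Fib x) : A.transport x y e = A.act g h e := by
  have hex : ∃ g : G, g • x = y := ⟨g, h⟩
  rw [transport, dif_pos hex]
  refine A.act_congr ?_ hex.choose_spec h e
  have h1 := hx (g⁻¹ * hex.choose) (by rw [mul_smul, hex.choose_spec, ← h, inv_smul_smul])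
  exact (inv_mul_eq_one.1 h1).symm

lemma transport_self {x : M} (hx : ∀ g : G, g • x = x → g = 1) (e : E.Fib x) :
    A.transport x x e = e := by
  rw [A.transport_eq hx (one_smul G x), A.act_one]

lemma transport_trans {x y z : M} (hx : ∀ g : G, g • x = x → g = 1)
    (hy : ∀ g : G, g • y = y → g = 1) (hxy : ∃ g : G, g • x = y) (hyz : ∃ g : G, g • y = z)
    (e : E.Fib x) : A.transport y z (A.transport x y e) = A.transport x z e := by
  obtain ⟨g, hg⟩ := hxy
  obtain ⟨g', hg'⟩ := hyz
  rw [A.transport_eq hx hg, A.transport_eq hy hg', A.transport_eq hx (g := g' * g)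
    (by rw [mul_smul, hg, hg']), ← A.act_mul]

lemma inner_transport {x y : M} (hx : ∀ g : G, g • x = x → g = 1) (hxy : ∃ g : G, g • x = y)
    (e e' : E.Fib x) : inner ℂ (A.transport x y e) (A.transport x y e') = inner ℂ e e' := by
  obtain ⟨g, hg⟩ := hxy
  rw [A.transport_eq hx hg, A.transport_eq hx hg, LinearIsometryEquiv.inner_map_map]

variable {ι V : Type*} [NormedAddCommGroup V] [NormedSpace ℝ V] {φ : M → ι → V} {L : CleanLevel m φ}
  (Q : LevelQuotient G L)
  {P : Type*} [TopologicalSpace P] [ChartedSpace (EuclideanSpace ℝ (Fin n)) P]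
  [IsManifold (𝓡 n) ∞ P] [CompactSpace G] [T2Space M]
  (hinv : ∀ (g : G) (x : M), (∀ a, φ x a = 0) → ∀ a, φ (g • x) a = 0)
  (hfree : ∀ x : M, (∀ a, φ x a = 0) → ∀ g : G, g • x = x → g = 1)
  (hneat : ∀ x : M, (∀ a, φ x a = 0) → ∀ (b : GroupLieAlgebra (𝓡 k) G) (s : Π y, E.Fib y),
    E.SmoothAt s x → E.conn s x (infAct G x b) = A.lieDeriv b s x)

include hinv hfree in
lemma contMDiffAt_transport {α β : P → L.Space} {p : P} (hα : ContMDiffAt (𝓡 n) (𝓡 L.dim) ∞ α p)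
    (hβ : ContMDiffAt (𝓡 n) (𝓡 L.dim) ∞ β p) (h : ∀ᶠ z in 𝓝 p, Q.proj (α z) = Q.proj (β z))
    {s : Π z, E.Fib (L.incl (α z))}
    (hs : ContMDiffAt (𝓡 n) ((𝓡 m).prod 𝓘(ℝ, F)) ∞
      (fun z ↦ Bundle.TotalSpace.mk' F (L.incl (α z)) (s z)) p) :
    ContMDiffAt (𝓡 n) ((𝓡 m).prod 𝓘(ℝ, F)) ∞ (fun z ↦ Bundle.TotalSpace.mk' F (L.incl (β z))
      (A.transport (L.incl (α z)) (L.incl (β z)) (s z))) p := by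
  obtain ⟨g, hg, hgα⟩ := Q.exists_smooth_translation (k := k) hinv hfree hα hβ h
  refine (A.contMDiffAt_act (f := fun z ↦ L.incl (α z)) (f' := fun z ↦ g z • L.incl (α z)) hg
    (fun _ ↦ rfl) hs).congr_of_eventuallyEq ?_
  filter_upwards [hgα] with z hz
  rw [A.transport_eq (hfree _ (L.incl_mem _)) hz]
  exact A.mk_act _ _ _

variable [FiniteDimensional ℂ F]

include hinv hfree hneat in
lemma pullbackConn_transport {α β : P → L.Space} {p : P} (hα : ContMDiffAt (𝓡 n) (𝓡 L.dim) ∞ α p)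
    (hβ : ContMDiffAt (𝓡 n) (𝓡 L.dim) ∞ β p) (h : ∀ᶠ z in 𝓝 p, Q.proj (α z) = Q.proj (β z))
    {s : Π z, E.Fib (L.incl (α z))} (hs : E.MDiffAlong n (fun z ↦ L.incl (α z)) s p) :
    E.MDiffAlong n (fun z ↦ L.incl (β z))
      (fun z ↦ A.transport (L.incl (α z)) (L.incl (β z)) (s z)) p ∧
    ∀ u : TangentSpace (𝓡 n) p, E.pullbackConn (fun z ↦ L.incl (β z))
      (fun z ↦ A.transport (L.incl (α z)) (L.incl (β z)) (s z)) p u =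
        A.transport (L.incl (α p)) (L.incl (β p)) (E.pullbackConn (fun z ↦ L.incl (α z)) s p u) := by
  obtain ⟨g, hg, hgα⟩ := Q.exists_smooth_translation (k := k) hinv hfree hα hβ h
  have ha := (ContMDiffAt.comp p (g := L.incl) (f := α) L.contMDiff_incl.contMDiffAt
    hα).mdifferentiableAt (by simp)
  have hb := (ContMDiffAt.comp p (g := L.incl) (f := β) L.contMDiff_incl.contMDiffAt
    hβ).mdifferentiableAt (by simp)
  have hT : ∀ᶠ z in 𝓝 p, ∀ h : g z • L.incl (α z) = L.incl (β z),
      A.transport (L.incl (α z)) (L.incl (β z)) (s z) = A.act (g z) h (s z) :=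
    Eventually.of_forall fun z h ↦ A.transport_eq (hfree _ (L.incl_mem _)) h _
  obtain ⟨h1, h2⟩ := A.pullbackConn_act (a := fun z ↦ L.incl (α z)) (c := fun z ↦ L.incl (β z))
    (T := fun z ↦ A.transport (L.incl (α z)) (L.incl (β z)) (s z)) ha hb
    (hg.mdifferentiableAt (by simp)) hgα (hneat _ (L.incl_mem _)) hs hT hgα.self_of_nhds
  refine ⟨h1, fun u ↦ ?_⟩
  rw [h2, A.transport_eq (hfree _ (L.incl_mem _))]

end EquivariantStructure

end

section

namespace EquivariantStructure

open HermitianBundle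

variable {m k n : ℕ} {F : Type u} [NormedAddCommGroup F] [NormedSpace ℂ F]
  {M : Type v} [TopologicalSpace M] [ChartedSpace (EuclideanSpace ℝ (Fin m)) M]
  [IsManifold (𝓡 m) ∞ M] {E : HermitianBundle.{u, v, w} m F M}
  {G : Type*} [Group G] [TopologicalSpace G]
  [ChartedSpace (EuclideanSpace ℝ (Fin k)) G] [LieGroup (𝓡 k) ∞ G]
  [MulAction G M] [ContMDiffSMul (𝓡 k) (𝓡 m) ∞ G M]
  (A : EquivariantStructure k G E)
  {ι V : Type*} [NormedAddCommGroup V] [NormedSpace ℝ V] {φ : M → ι → V} {L : CleanLevel m φ}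
  (Q : LevelQuotient G L)
  {P : Type*} [TopologicalSpace P] [ChartedSpace (EuclideanSpace ℝ (Fin n)) P]
  [IsManifold (𝓡 n) ∞ P] [CompactSpace G] [T2Space M]
  (hinv : ∀ (g : G) (x : M), (∀ a, φ x a = 0) → ∀ a, φ (g • x) a = 0)
  (hfree : ∀ x : M, (∀ a, φ x a = 0) → ∀ g : G, g • x = x → g = 1)
  (hneat : ∀ x : M, (∀ a, φ x a = 0) → ∀ (b : GroupLieAlgebra (𝓡 k) G) (s : Π y, E.Fib y),
    E.SmoothAt s x → E.conn s x (infAct G x b) = A.lieDeriv b s x)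

lemma exists_smul_rep_eq_sec {q q' : Q.Space} (h : q' ∈ Q.secDom q) :
    ∃ g : G, g • L.incl (Q.rep q') = L.incl (Q.sec q q') :=
  Q.proj_eq_iff.1 (by rw [Q.proj_rep, Q.proj_sec h])

lemma exists_smul_sec_eq_rep {q q' : Q.Space} (h : q' ∈ Q.secDom q) :
    ∃ g : G, g • L.incl (Q.sec q q') = L.incl (Q.rep q') :=
  Q.proj_eq_iff.1 (by rw [Q.proj_rep, Q.proj_sec h])

/-- The lift of a section of the reduced bundle to the level. -/
def lift (s : Π q : Q.Space, E.Fib (L.incl (Q.rep q))) (z : L.Space) : E.Fib (L.incl z) :=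
  A.transport (L.incl (Q.rep (Q.proj z))) (L.incl z) (s (Q.proj z))

lemma lift_eq (s : Π q : Q.Space, E.Fib (L.incl (Q.rep q))) {z : L.Space} {q : Q.Space}
    (h : Q.proj z = q) : A.lift Q s z = A.transport (L.incl (Q.rep q)) (L.incl z) (s q) := by
  subst h; rfl

include hfree in
lemma transport_lift (s : Π q : Q.Space, E.Fib (L.incl (Q.rep q))) {z z' : L.Space}
    (h : Q.proj z = Q.proj z') :
    A.transport (L.incl z) (L.incl z') (A.lift Q s z) = A.lift Q s z' := by
  rw [A.lift_eq Q s h]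
  exact A.transport_trans (hfree _ (L.incl_mem _)) (hfree _ (L.incl_mem _))
    (Q.proj_eq_iff.1 (by rw [Q.proj_rep, h])) (Q.proj_eq_iff.1 h) _

variable [FiniteDimensional ℂ F]

/-- The bundle to which the restriction of an equivariant bundle to a level descends. -/
def reducedFrames : FrameSystem.{u, v, w} Q.dim F Q.Space where
  Fib q := E.Fib (L.incl (Q.rep q))
  dom q := {q' | q' ∈ Q.secDom q ∧ L.incl (Q.sec q q') ∈ E.dom (L.incl (Q.sec q q))}
  comps q q' := (E.comps (L.incl (Q.sec q q)) (L.incl (Q.sec q q'))).toLinearMap ∘ₗ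
    ((A.transport (L.incl (Q.rep q')) (L.incl (Q.sec q q'))).restrictScalars ℝ).toLinearMap
  frame q q' f := A.transport (L.incl (Q.sec q q')) (L.incl (Q.rep q'))
    (E.frame (L.incl (Q.sec q q)) (L.incl (Q.sec q q')) f)
  isOpen_dom q := ContinuousOn.isOpen_inter_preimage
    (fun q' h ↦ (Q.contMDiffAt_incl_sec h).continuousAt.continuousWithinAt) (Q.isOpen_secDom q)
    (E.isOpen_dom (L.incl (Q.sec q q)))
  mem_dom q := ⟨Q.mem_secDom q, E.mem_dom _⟩
  frame_comps q q' hq e := by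
    have h1 := frame_comps hq.2 (A.transport (L.incl (Q.rep q')) (L.incl (Q.sec q q')) e)
    refine (congrArg (A.transport (L.incl (Q.sec q q')) (L.incl (Q.rep q'))) h1).trans ?_
    rw [A.transport_trans (hfree _ (L.incl_mem _)) (hfree _ (L.incl_mem _))
      (exists_smul_rep_eq_sec Q hq.1) (exists_smul_sec_eq_rep Q hq.1),
      A.transport_self (hfree _ (L.incl_mem _))]
  comps_frame q q' hq f := by
    have h1 : A.transport (L.incl (Q.rep q')) (L.incl (Q.sec q q')) (A.transport
        (L.incl (Q.sec q q')) (L.incl (Q.rep q')) (E.frame (L.incl (Q.sec q q)) (L.incl (Q.sec q q')) f))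
        = E.frame (L.incl (Q.sec q q)) (L.incl (Q.sec q q')) f := by
      rw [A.transport_trans (hfree _ (L.incl_mem _)) (hfree _ (L.incl_mem _))
        (exists_smul_sec_eq_rep Q hq.1) (exists_smul_rep_eq_sec Q hq.1),
        A.transport_self (hfree _ (L.incl_mem _))]
    exact (congrArg (E.comps (L.incl (Q.sec q q)) (L.incl (Q.sec q q'))) h1).trans (comps_frame hq.2 f)
  comps_smul q q' hq c e :=
    (congrArg (E.comps (L.incl (Q.sec q q)) (L.incl (Q.sec q q')))
      ((A.transport (L.incl (Q.rep q')) (L.incl (Q.sec q q'))).map_smul c e)).trans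
      (comps_smul hq.2 c _)
  contMDiffOn_transition q q' f := by
    intro p hp
    refine ContMDiffAt.contMDiffWithinAt ?_
    have h0 : E.SmoothAt (fun y ↦ E.frame (L.incl (Q.sec q' q')) y f) (L.incl (Q.sec q' p)) :=
      smoothAt_frame hp.2.2 contMDiffAt_const
    unfold SmoothAt at h0
    have h1 := ContMDiffAt.comp p (f := fun p ↦ L.incl (Q.sec q' p)) h0
      (Q.contMDiffAt_incl_sec hp.2.1)
    have hev : ∀ᶠ p' in 𝓝 p, p' ∈ Q.secDom q ∧ p' ∈ Q.secDom q' :=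
      ((Q.isOpen_secDom q).inter (Q.isOpen_secDom q')).mem_nhds ⟨hp.1.1, hp.2.1⟩
    have h2 := A.contMDiffAt_transport Q hinv hfree (α := Q.sec q') (β := Q.sec q)
      (s := fun p ↦ E.frame (L.incl (Q.sec q' q')) (L.incl (Q.sec q' p)) f)
      (Q.contMDiffAt_sec hp.2.1) (Q.contMDiffAt_sec hp.1.1)
      (by filter_upwards [hev] with p' h; rw [Q.proj_sec h.1, Q.proj_sec h.2]) h1
    refine ((contMDiffAt_mk_iff (Q.contMDiffAt_incl_sec hp.1.1) hp.1.2).1 h2).congr_of_eventuallyEq ?_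
    filter_upwards [hev] with p' h
    have h3 := A.transport_trans (hfree _ (L.incl_mem (Q.sec q' p')))
      (hfree _ (L.incl_mem (Q.rep p')))
      (exists_smul_sec_eq_rep Q h.2) (exists_smul_rep_eq_sec Q h.1)
      (E.frame (L.incl (Q.sec q' q')) (L.incl (Q.sec q' p')) f)
    exact congrArg (E.comps (L.incl (Q.sec q q)) (L.incl (Q.sec q p'))) h3

/-- The connection of the reduced bundle. -/
def reducedConn (s : Π q : Q.Space, E.Fib (L.incl (Q.rep q))) (q : Q.Space) :
    TangentSpace (𝓡 Q.dim) q →L[ℝ] E.Fib (L.incl (Q.rep q)) :=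
  ((A.transport (L.incl (Q.sec q q)) (L.incl (Q.rep q))).restrictScalars ℝ).comp
    (E.pullbackConnL (fun q' ↦ L.incl (Q.sec q q')) (fun q' ↦ A.lift Q s (Q.sec q q')) q)

lemma reducedConn_apply (s : Π q : Q.Space, E.Fib (L.incl (Q.rep q))) (q : Q.Space)
    (u : TangentSpace (𝓡 Q.dim) q) :
    A.reducedConn Q s q u = A.transport (L.incl (Q.sec q q)) (L.incl (Q.rep q))
      (E.pullbackConn (fun q' ↦ L.incl (Q.sec q q')) (fun q' ↦ A.lift Q s (Q.sec q q')) q u) :=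
  congrArg (A.transport (L.incl (Q.sec q q)) (L.incl (Q.rep q)))
    (E.pullbackConnL_apply (fun q' ↦ L.incl (Q.sec q q')) (fun q' ↦ A.lift Q s (Q.sec q q')) q u)

lemma comps_reducedFrames (s : Π q : Q.Space, E.Fib (L.incl (Q.rep q))) {q q' : Q.Space}
    (h : q' ∈ Q.secDom q) : (A.reducedFrames Q hinv hfree).comps q q' (s q') =
      E.comps (L.incl (Q.sec q q)) (L.incl (Q.sec q q')) (A.lift Q s (Q.sec q q')) := by
  rw [A.lift_eq Q s (Q.proj_sec h)]
  rfl

lemma comps_reducedFrames_eventuallyEq (s : Π q : Q.Space, E.Fib (L.incl (Q.rep q))) (q : Q.Space) :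
    (fun q' ↦ (A.reducedFrames Q hinv hfree).comps q q' (s q')) =ᶠ[𝓝 q] fun q' ↦
      E.comps (L.incl (Q.sec q q)) (L.incl (Q.sec q q')) (A.lift Q s (Q.sec q q')) := by
  filter_upwards [(Q.isOpen_secDom q).mem_nhds (Q.mem_secDom q)] with q' h
  exact A.comps_reducedFrames Q hinv hfree s h

lemma mdiffAlong_lift {s : Π q : Q.Space, E.Fib (L.incl (Q.rep q))} {q : Q.Space}
    (hs : MDifferentiableAt (𝓡 Q.dim) 𝓘(ℝ, F)
      (fun q' ↦ (A.reducedFrames Q hinv hfree).comps q q' (s q')) q) :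
    E.MDiffAlong Q.dim (fun q' ↦ L.incl (Q.sec q q')) (fun q' ↦ A.lift Q s (Q.sec q q')) q :=
  hs.congr_of_eventuallyEq (A.comps_reducedFrames_eventuallyEq Q hinv hfree s q).symm

lemma contMDiffAt_lift_sec {s : Π q : Q.Space, E.Fib (L.incl (Q.rep q))} {q : Q.Space}
    (hs : ContMDiffAt (𝓡 Q.dim) 𝓘(ℝ, F) ∞
      (fun q' ↦ (A.reducedFrames Q hinv hfree).comps q q' (s q')) q) :
    ContMDiffAt (𝓡 Q.dim) 𝓘(ℝ, F) ∞ (fun q' ↦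
      E.comps (L.incl (Q.sec q q)) (L.incl (Q.sec q q')) (A.lift Q s (Q.sec q q'))) q :=
  hs.congr_of_eventuallyEq (A.comps_reducedFrames_eventuallyEq Q hinv hfree s q).symm

lemma contMDiffAt_lift {s : Π q : Q.Space, E.Fib (L.incl (Q.rep q))} (z : L.Space)
    (hs : ContMDiffAt (𝓡 Q.dim) 𝓘(ℝ, F) ∞
      (fun q' ↦ (A.reducedFrames Q hinv hfree).comps (Q.proj z) q' (s q')) (Q.proj z)) :
    ContMDiffAt (𝓡 L.dim) ((𝓡 m).prod 𝓘(ℝ, F)) ∞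
      (fun z' ↦ Bundle.TotalSpace.mk' F (L.incl z') (A.lift Q s z')) z := by
  set q := Q.proj z with hq
  have hqd := Q.mem_secDom q
  have h1 := (contMDiffAt_mk_iff (Q.contMDiffAt_incl_sec hqd) (E.mem_dom (L.incl (Q.sec q q)))).2
    (A.contMDiffAt_lift_sec Q hinv hfree hs)
  have h2 := ContMDiffAt.comp z (f := Q.proj) h1 Q.contMDiff_proj.contMDiffAt
  have h3 : ContMDiffAt (𝓡 L.dim) (𝓡 L.dim) ∞ (fun z' ↦ Q.sec q (Q.proj z')) z :=
    ContMDiffAt.comp z (g := Q.sec q) (f := Q.proj) (Q.contMDiffAt_sec hqd)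
      Q.contMDiff_proj.contMDiffAt
  have hev : ∀ᶠ z' in 𝓝 z, Q.proj (Q.sec q (Q.proj z')) = Q.proj z' := by
    filter_upwards [Q.contMDiff_proj.continuous.continuousAt.preimage_mem_nhds
      ((Q.isOpen_secDom q).mem_nhds hqd)] with z' h
    exact Q.proj_sec h
  refine (A.contMDiffAt_transport Q hinv hfree (α := fun z' ↦ Q.sec q (Q.proj z')) (β := fun z' ↦ z')
    (s := fun z' ↦ A.lift Q s (Q.sec q (Q.proj z'))) h3 contMDiffAt_id hev h2).congr_of_eventuallyEq ?_
  filter_upwards [hev] with z' h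
  rw [A.transport_lift Q hfree s h]

include hinv hfree hneat in
/-- The reduced connection pulls back to the original one. -/
lemma pullbackConn_lift {s : Π q : Q.Space, E.Fib (L.incl (Q.rep q))} {β : P → L.Space} {p : P}
    (hβ : ContMDiffAt (𝓡 n) (𝓡 L.dim) ∞ β p) {q : Q.Space} (hq : Q.proj (β p) = q)
    (hs : MDifferentiableAt (𝓡 Q.dim) 𝓘(ℝ, F)
      (fun q' ↦ (A.reducedFrames Q hinv hfree).comps q q' (s q')) q) (u : TangentSpace (𝓡 n) p) :
    E.pullbackConn (fun z ↦ L.incl (β z)) (fun z ↦ A.lift Q s (β z)) p u =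
      A.transport (L.incl (Q.rep q)) (L.incl (β p)) (A.reducedConn Q s q
        (mfderiv (𝓡 n) (𝓡 Q.dim) (fun z ↦ Q.proj (β z)) p u : Eu Q.dim)) := by
  subst hq
  set q := Q.proj (β p) with hq
  have hqd := Q.mem_secDom q
  have hb : ContMDiffAt (𝓡 n) (𝓡 Q.dim) ∞ (fun z ↦ Q.proj (β z)) p :=
    ContMDiffAt.comp p (g := Q.proj) (f := β) Q.contMDiff_proj.contMDiffAt hβ
  have hα : ContMDiffAt (𝓡 n) (𝓡 L.dim) ∞ (fun z ↦ Q.sec q (Q.proj (β z))) p :=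
    ContMDiffAt.comp p (g := Q.sec q) (f := fun z ↦ Q.proj (β z)) (Q.contMDiffAt_sec hqd) hb
  have hev : ∀ᶠ z in 𝓝 p, Q.proj (Q.sec q (Q.proj (β z))) = Q.proj (β z) := by
    filter_upwards [hb.continuousAt.preimage_mem_nhds
      ((Q.isOpen_secDom q).mem_nhds hqd)] with z h
    exact Q.proj_sec h
  have hsq := A.mdiffAlong_lift Q hinv hfree hs
  have hsd := (Q.contMDiffAt_incl_sec hqd).mdifferentiableAt (by simp : (∞ : WithTop ℕ∞) ≠ 0)
  have hbd := hb.mdifferentiableAt (by simp : (∞ : WithTop ℕ∞) ≠ 0)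
  have hsα : E.MDiffAlong n (fun z ↦ L.incl (Q.sec q (Q.proj (β z))))
      (fun z ↦ A.lift Q s (Q.sec q (Q.proj (β z)))) p :=
    MDifferentiableAt.comp p (f := fun z ↦ Q.proj (β z)) hsq hbd
  have h1 := (A.pullbackConn_transport Q hinv hfree hneat hα hβ hev hsα).2 u
  have h2 : E.pullbackConn (fun z ↦ L.incl (β z)) (fun z ↦ A.lift Q s (β z)) p u =
      E.pullbackConn (fun z ↦ L.incl (β z)) (fun z ↦ A.transport (L.incl (Q.sec q (Q.proj (β z))))
        (L.incl (β z)) (A.lift Q s (Q.sec q (Q.proj (β z))))) p u := by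
    refine pullbackConn_congr ?_ u
    filter_upwards [hev] with z h
    rw [A.transport_lift Q hfree s h]
  have h3 := pullbackConn_comp (E := E) (f := fun q' ↦ L.incl (Q.sec q q'))
    (σ := fun q' ↦ A.lift Q s (Q.sec q q')) (h := fun z ↦ Q.proj (β z)) (p := p) hsd hsq hbd u
  rw [h2, h1, h3, A.reducedConn_apply]
  exact (A.transport_trans (hfree _ (L.incl_mem _)) (hfree _ (L.incl_mem _))
    (exists_smul_sec_eq_rep Q hqd) (Q.proj_eq_iff.1 (by rw [Q.proj_rep])) _).symm

include hneat in
lemma isUnitaryConnection_reducedConn :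
    (A.reducedFrames Q hinv hfree).IsUnitaryConnection (A.reducedConn Q) := by
  have hsd : ∀ q : Q.Space, MDifferentiableAt (𝓡 Q.dim) (𝓡 m) (fun q' ↦ L.incl (Q.sec q q')) q :=
    fun q ↦ (Q.contMDiffAt_incl_sec (Q.mem_secDom q)).mdifferentiableAt (by simp)
  have hsec : ∀ (q : Q.Space), (∃ g : G, g • L.incl (Q.sec q q) = L.incl (Q.rep q)) :=
    fun q ↦ exists_smul_sec_eq_rep Q (Q.mem_secDom q)
  have hback : ∀ (s : Π q : Q.Space, E.Fib (L.incl (Q.rep q))) (q : Q.Space),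
      A.transport (L.incl (Q.sec q q)) (L.incl (Q.rep q)) (A.lift Q s (Q.sec q q)) = s q := by
    intro s q
    rw [A.lift_eq Q s (Q.proj_sec (Q.mem_secDom q)), A.transport_trans (hfree _ (L.incl_mem _))
      (hfree _ (L.incl_mem _)) (exists_smul_rep_eq_sec Q (Q.mem_secDom q)) (hsec q),
      A.transport_self (hfree _ (L.incl_mem _))]
  have hinner : ∀ (s t : Π q : Q.Space, E.Fib (L.incl (Q.rep q))) (q q' : Q.Space),
      q' ∈ Q.secDom q → inner ℂ (s q') (t q') =
        inner ℂ (A.lift Q s (Q.sec q q')) (A.lift Q t (Q.sec q q')) := by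
    intro s t q q' h
    rw [A.lift_eq Q s (Q.proj_sec h), A.lift_eq Q t (Q.proj_sec h),
      A.inner_transport (hfree _ (L.incl_mem _)) (exists_smul_rep_eq_sec Q h)]
  have hinner' : ∀ (s t : Π q : Q.Space, E.Fib (L.incl (Q.rep q))) (q : Q.Space),
      (fun q' ↦ inner ℂ (s q') (t q')) =ᶠ[𝓝 q] fun q' ↦
        inner ℂ (A.lift Q s (Q.sec q q')) (A.lift Q t (Q.sec q q')) := by
    intro s t q
    filter_upwards [(Q.isOpen_secDom q).mem_nhds (Q.mem_secDom q)] with q' h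
    exact hinner s t q q' h
  refine ⟨fun q s t hs ht ↦ ?_, fun q s t u hs ht ↦ ?_, fun q s g u hs hg ↦ ?_, fun q c s u hs ↦ ?_,
    fun q s t u hs ht ↦ ?_, fun q s V hsd' hs hV ↦ ?_⟩
  · have hd := E.mem_dom (L.incl (Q.sec q q))
    have h1 : ContMDiffAt (𝓡 Q.dim) 𝓘(ℝ, F →L[ℝ] F →L[ℝ] ℂ) ∞
        (fun q' ↦ E.metricIn (L.incl (Q.sec q q)) (L.incl (Q.sec q q'))) q :=
      ContMDiffAt.comp q (f := fun q' ↦ L.incl (Q.sec q q')) (contMDiffAt_metricIn hd)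
        (Q.contMDiffAt_incl_sec (Q.mem_secDom q))
    refine ((h1.clm_apply (A.contMDiffAt_lift_sec Q hinv hfree hs)).clm_apply
      (A.contMDiffAt_lift_sec Q hinv hfree ht)).congr_of_eventuallyEq ?_
    filter_upwards [hinner' s t q, (hsd q).continuousAt.preimage_mem_nhds
      ((E.isOpen_dom _).mem_nhds hd)] with q' h2 h3
    exact h2.trans (inner_eq_metricIn h3 _ _)
  · have h1 : (fun q' ↦ A.lift Q (fun y ↦ s y + t y) (Q.sec q q')) =
        fun q' ↦ A.lift Q s (Q.sec q q') + A.lift Q t (Q.sec q q') := by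
      funext q'; exact map_add _ _ _
    refine (A.reducedConn_apply Q _ q u).trans ?_
    rw [h1, pullbackConn_add (hsd q) (A.mdiffAlong_lift Q hinv hfree hs)
      (A.mdiffAlong_lift Q hinv hfree ht), map_add]
    exact congrArg₂ (· + ·) (A.reducedConn_apply Q s q u).symm (A.reducedConn_apply Q t q u).symm
  · have h1 : ∀ᶠ q' in 𝓝 q, A.lift Q (fun y ↦ g y • s y) (Q.sec q q') =
        g q' • A.lift Q s (Q.sec q q') := by
      filter_upwards [(Q.isOpen_secDom q).mem_nhds (Q.mem_secDom q)] with q' h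
      refine Eq.trans ?_ (congrArg (fun y ↦ g y • A.lift Q s (Q.sec q q')) (Q.proj_sec h))
      exact ((A.transport (L.incl (Q.rep (Q.proj (Q.sec q q')))) (L.incl (Q.sec q q'))).restrictScalars
        ℝ).map_smul _ _
    refine (A.reducedConn_apply Q _ q u).trans ?_
    rw [pullbackConn_congr h1, pullbackConn_leibniz (hsd q) (A.mdiffAlong_lift Q hinv hfree hs) hg,
      map_add]
    refine congrArg₂ (· + ·) ?_ ?_
    · refine (((A.transport (L.incl (Q.sec q q)) (L.incl (Q.rep q))).restrictScalars ℝ).map_smul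
        _ _).trans ?_
      exact congrArg (g q • ·) (A.reducedConn_apply Q s q u).symm
    · refine (((A.transport (L.incl (Q.sec q q)) (L.incl (Q.rep q))).restrictScalars ℝ).map_smul
        _ _).trans ?_
      exact congrArg (mvfderiv (𝓡 Q.dim) g q u • ·) (hback s q)
  · have h1 : (fun q' ↦ A.lift Q (fun y ↦ c • s y) (Q.sec q q')) =
        fun q' ↦ c • A.lift Q s (Q.sec q q') := by
      funext q'; exact map_smul _ _ _
    refine (A.reducedConn_apply Q _ q u).trans ?_
    rw [h1, pullbackConn_smul (hsd q) (A.mdiffAlong_lift Q hinv hfree hs), map_smul]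
    exact congrArg (c • ·) (A.reducedConn_apply Q s q u).symm
  · refine (mvfderiv_congr_of_eventuallyEq (hinner' s t q) u).trans ?_
    refine (mvfderiv_inner (hsd q) (A.mdiffAlong_lift Q hinv hfree hs)
      (A.mdiffAlong_lift Q hinv hfree ht) u).trans ?_
    have h1 := A.inner_transport (hfree _ (L.incl_mem (Q.sec q q))) (hsec q)
    refine congrArg₂ (· + ·) ?_ ?_
    · exact (h1 _ _).symm.trans (congrArg₂ (fun e e' : E.Fib (L.incl (Q.rep q)) ↦ inner ℂ e e')
        (A.reducedConn_apply Q s q u).symm (hback t q))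
    · exact (h1 _ _).symm.trans (congrArg₂ (fun e e' : E.Fib (L.incl (Q.rep q)) ↦ inner ℂ e e')
        (hback s q) (A.reducedConn_apply Q t q u).symm)
  · have h1 := contMDiffAt_comps_pullbackConn (Q.contMDiffAt_incl_sec (Q.mem_secDom q))
      (A.contMDiffAt_lift_sec Q hinv hfree hs) hV
    refine h1.congr_of_eventuallyEq ?_
    filter_upwards [hsd', (Q.isOpen_secDom q).mem_nhds (Q.mem_secDom q)] with q' h2 h3
    have h4 := A.pullbackConn_lift Q hinv hfree hneat (Q.contMDiffAt_sec h3) (Q.proj_sec h3) h2 (V q')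
    have h5 : (fun z ↦ Q.proj (Q.sec q z)) =ᶠ[𝓝 q'] id := by
      filter_upwards [(Q.isOpen_secDom q).mem_nhds h3] with z h
      exact Q.proj_sec h
    have h6 : (mfderiv (𝓡 Q.dim) (𝓡 Q.dim) (fun z ↦ Q.proj (Q.sec q z)) q' (V q') : Eu Q.dim) =
        V q' := by
      have h7 : mfderiv (𝓡 Q.dim) (𝓡 Q.dim) (id : Q.Space → Q.Space) q' =
        ContinuousLinearMap.id ℝ (Eu Q.dim) := mfderiv_id
      refine (congrArg (fun T : Eu Q.dim →L[ℝ] Eu Q.dim ↦ T (V q')) h5.mfderiv_eq).trans ?_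
      exact congrArg (fun T : Eu Q.dim →L[ℝ] Eu Q.dim ↦ T (V q')) h7
    refine congrArg (E.comps (L.incl (Q.sec q q)) (L.incl (Q.sec q q'))) ?_
    rw [h4]
    exact congrArg (fun v : Eu Q.dim ↦ A.transport (L.incl (Q.rep q')) (L.incl (Q.sec q q'))
      (A.reducedConn Q s q' v)) h6.symm

include hinv hfree hneat in
/-- Equivariant bundles descend to the quotient of a level if the infinitesimal action on sections
is given by the connection. -/
theorem exists_descent : ∃ (B : HermitianBundle.{u, v, w} Q.dim F Q.Space)
    (iso : ∀ z : L.Space, E.Fib (L.incl z) ≃ₗᵢ[ℂ] B.Fib (Q.proj z)),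
    (∀ (g : G) (z z' : L.Space) (h : g • L.incl z = L.incl z') (e : E.Fib (L.incl z)),
      Bundle.TotalSpace.mk' F (Q.proj z') (iso z' (A.act g h e)) =
        Bundle.TotalSpace.mk' F (Q.proj z) (iso z e)) ∧
    ∀ (z : L.Space) (s : Π y, B.Fib y), B.SmoothAt s (Q.proj z) →
      ContMDiffAt (𝓡 L.dim) ((𝓡 m).prod 𝓘(ℝ, F)) ∞
        (fun z' ↦ Bundle.TotalSpace.mk' F (L.incl z') ((iso z').symm (s (Q.proj z')))) z ∧
      ∀ u : TangentSpace (𝓡 L.dim) z,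
        E.pullbackConn L.incl (fun z' ↦ (iso z').symm (s (Q.proj z'))) z u =
          (iso z).symm (B.conn s (Q.proj z) (mfderiv (𝓡 L.dim) (𝓡 Q.dim) Q.proj z u)) := by
  have hex : ∀ z : L.Space, ∃ g : G, g • L.incl z = L.incl (Q.rep (Q.proj z)) := fun z ↦
    Q.proj_eq_iff.1 (Q.proj_rep _).symm
  have hex' : ∀ z : L.Space, ∃ g : G, g • L.incl (Q.rep (Q.proj z)) = L.incl z := fun z ↦
    Q.proj_eq_iff.1 (Q.proj_rep _)
  let iso : ∀ z : L.Space, E.Fib (L.incl z) ≃ₗᵢ[ℂ] E.Fib (L.incl (Q.rep (Q.proj z))) :=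
    fun z ↦ A.act (hex z).choose (hex z).choose_spec
  have hiso : ∀ z e, iso z e = A.transport (L.incl z) (L.incl (Q.rep (Q.proj z))) e := fun z e ↦
    (A.transport_eq (hfree _ (L.incl_mem z)) (hex z).choose_spec e).symm
  have hsymm : ∀ z e, (iso z).symm e = A.transport (L.incl (Q.rep (Q.proj z))) (L.incl z) e := by
    intro z e
    rw [LinearIsometryEquiv.symm_apply_eq, hiso, A.transport_trans (hfree _ (L.incl_mem _))
      (hfree _ (L.incl_mem _)) (hex' z) (hex z), A.transport_self (hfree _ (L.incl_mem _))]
  have hlift : ∀ s : Π q : Q.Space, E.Fib (L.incl (Q.rep q)),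
      (fun z ↦ (iso z).symm (s (Q.proj z))) = A.lift Q s := fun s ↦ funext fun z ↦ hsymm z _
  refine ⟨(A.isUnitaryConnection_reducedConn Q hinv hfree hneat).bundle, iso, ?_, ?_⟩
  · intro g z z' h e
    have h1 : Q.proj z' = Q.proj z := (Q.proj_eq_iff.2 ⟨g, h⟩).symm
    have h2 : ∀ q q' : Q.Space, q' = q →
        (⟨q', A.transport (L.incl z) (L.incl (Q.rep q')) e⟩ : Bundle.TotalSpace F
          fun q : Q.Space ↦ E.Fib (L.incl (Q.rep q))) =
        ⟨q, A.transport (L.incl z) (L.incl (Q.rep q)) e⟩ := by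
      rintro q q' rfl; rfl
    have h3 : iso z' (A.act g h e) = A.transport (L.incl z) (L.incl (Q.rep (Q.proj z'))) e := by
      rw [hiso, ← A.transport_eq (hfree _ (L.incl_mem _)) h, A.transport_trans
        (hfree _ (L.incl_mem _)) (hfree _ (L.incl_mem _)) ⟨g, h⟩ (hex z')]
    refine (congrArg (Bundle.TotalSpace.mk (Q.proj z')) h3).trans ((h2 _ _ h1).trans ?_)
    exact congrArg (Bundle.TotalSpace.mk (Q.proj z)) (hiso z e).symm
  · intro z s hs
    have hs' := ((A.reducedFrames Q hinv hfree).contMDiffAt_iff s (Q.proj z)).1 hs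
    refine ⟨?_, fun u ↦ ?_⟩
    · have h1 := A.contMDiffAt_lift Q hinv hfree z hs'
      rw [← hlift s] at h1
      exact h1
    · have h1 := A.pullbackConn_lift Q hinv hfree hneat (β := fun z : L.Space ↦ z) contMDiffAt_id rfl
        (hs'.mdifferentiableAt (by simp)) u
      refine Eq.trans ?_ (h1.trans (hsymm z _).symm)
      exact congrArg (fun σ ↦ E.pullbackConn L.incl σ z u) (hlift s)

end EquivariantStructure

end

section

/-- A functional that vanishes on the common kernel of a linear family of functionals belongs to the
family. -/
lemma exists_apply_eq_of_forall {T 𝔤 : Type*} [AddCommGroup T] [Module ℝ T] [AddCommGroup 𝔤]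
    [Module ℝ 𝔤] [FiniteDimensional ℝ 𝔤] (β : 𝔤 →ₗ[ℝ] T →ₗ[ℝ] ℝ) (K : T →ₗ[ℝ] ℝ)
    (h : ∀ v, (∀ a, β a v = 0) → K v = 0) : ∃ a, β a = K := by
  let b := Module.finBasis ℝ 𝔤
  have h1 : K ∈ Submodule.span ℝ (range fun i ↦ β (b i)) := by
    refine mem_span_of_iInf_ker_le_ker fun v hv ↦ h v fun a ↦ ?_
    simp only [Submodule.mem_iInf, LinearMap.mem_ker] at hv
    rw [← b.sum_repr a, map_sum, LinearMap.sum_apply]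
    exact Finset.sum_eq_zero fun i _ ↦ by rw [map_smul, LinearMap.smul_apply, hv, smul_zero]
  obtain ⟨c, hc⟩ := (Submodule.mem_span_range_iff_exists_fun ℝ).1 h1
  exact ⟨∑ i, c i • b i, by rw [map_sum, ← hc]; simp⟩

section

variable {m k : ℕ} {G : Type*} [Group G] [TopologicalSpace G]
  [ChartedSpace (EuclideanSpace ℝ (Fin k)) G] [LieGroup (𝓡 k) ∞ G]
  {M : Type v} [TopologicalSpace M] [ChartedSpace (EuclideanSpace ℝ (Fin m)) M]
  [IsManifold (𝓡 m) ∞ M] [MulAction G M] [ContMDiffSMul (𝓡 k) (𝓡 m) ∞ G M]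

namespace LevelQuotient

variable {ι V : Type*} [NormedAddCommGroup V] [NormedSpace ℝ V] {φ : M → ι → V} {L : CleanLevel m φ}
  (Q : LevelQuotient G L)

/-- The form induced on the quotient of a level. -/
def reducedForm (ωM : TwoForm m M ℝ) : TwoForm Q.dim Q.Space ℝ := fun q ↦
  (ωM (L.incl (Q.sec q q))).compl₁₂
    (mfderiv (𝓡 Q.dim) (𝓡 m) (fun y ↦ L.incl (Q.sec q y)) q).toLinearMap
    (mfderiv (𝓡 Q.dim) (𝓡 m) (fun y ↦ L.incl (Q.sec q y)) q).toLinearMap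

lemma mfderiv_incl_sec {q q' : Q.Space} (h : q' ∈ Q.secDom q) (u : TangentSpace (𝓡 Q.dim) q') :
    (mfderiv (𝓡 Q.dim) (𝓡 m) (fun y ↦ L.incl (Q.sec q y)) q' u : Eu m) =
      mfderiv (𝓡 L.dim) (𝓡 m) L.incl (Q.sec q q') (mfderiv (𝓡 Q.dim) (𝓡 L.dim) (Q.sec q) q' u) :=
  mfderiv_comp_apply q' (L.mdiff_incl _) ((Q.contMDiffAt_sec h).mdifferentiableAt (by simp)) u

lemma mfderiv_proj_sec {q q' : Q.Space} (h : q' ∈ Q.secDom q) (u : TangentSpace (𝓡 Q.dim) q') :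
    (mfderiv (𝓡 L.dim) (𝓡 Q.dim) Q.proj (Q.sec q q')
      (mfderiv (𝓡 Q.dim) (𝓡 L.dim) (Q.sec q) q' u) : Eu Q.dim) = u := by
  have h1 := mfderiv_comp_apply (I := 𝓡 Q.dim) (I' := 𝓡 L.dim) (I'' := 𝓡 Q.dim) (g := Q.proj)
    (f := Q.sec q) q' (Q.mdiff_proj _) ((Q.contMDiffAt_sec h).mdifferentiableAt (by simp)) u
  have h5 : (Q.proj ∘ Q.sec q) =ᶠ[𝓝 q'] id := by
    filter_upwards [(Q.isOpen_secDom q).mem_nhds h] with z h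
    exact Q.proj_sec h
  have h7 : mfderiv (𝓡 Q.dim) (𝓡 Q.dim) (id : Q.Space → Q.Space) q' =
    ContinuousLinearMap.id ℝ (Eu Q.dim) := mfderiv_id
  refine h1.symm.trans ((congrArg (fun T : Eu Q.dim →L[ℝ] Eu Q.dim ↦ T u) h5.mfderiv_eq).trans ?_)
  exact congrArg (fun T : Eu Q.dim →L[ℝ] Eu Q.dim ↦ T u) h7

variable [CompactSpace G] [T2Space M]
  (hinv : ∀ (g : G) (x : M), (∀ a, φ x a = 0) → ∀ a, φ (g • x) a = 0)
  (hfree : ∀ x : M, (∀ a, φ x a = 0) → ∀ g : G, g • x = x → g = 1)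

include hinv hfree in
lemma exists_infAct_of_mfderiv_proj_eq (z : L.Space) (w w' : TangentSpace (𝓡 L.dim) z)
    (hw : mfderiv (𝓡 L.dim) (𝓡 Q.dim) Q.proj z w = mfderiv (𝓡 L.dim) (𝓡 Q.dim) Q.proj z w') :
    ∃ a : GroupLieAlgebra (𝓡 k) G, mfderiv (𝓡 L.dim) (𝓡 m) L.incl z w =
      mfderiv (𝓡 L.dim) (𝓡 m) L.incl z w' + infAct G (L.incl z) a := by
  obtain ⟨a, ha⟩ := Q.exists_infAct_of_mfderiv_proj_eq_zero (k := k) hinv hfree z (w - w')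
    (by rw [map_sub, hw, sub_self])
  rw [map_sub] at ha
  exact ⟨a, eq_add_of_sub_eq' ha.symm⟩

include hinv hfree in
/-- An invariant form which is annihilated by the infinitesimal action is determined by the
projections of tangent vectors to the quotient. -/
lemma apply_eq_of_mfderiv_proj_eq {ωM : TwoForm m M ℝ} (halt : ∀ x v, ωM x v v = 0)
    (hω : ∀ (g : G) (x : M) (u v : TangentSpace (𝓡 m) x),
      ωM (g • x) (mfderiv (𝓡 m) (𝓡 m) (fun y : M ↦ g • y) x u)
        (mfderiv (𝓡 m) (𝓡 m) (fun y : M ↦ g • y) x v) = ωM x u v)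
    (hbasic : ∀ (z : L.Space) (a : GroupLieAlgebra (𝓡 k) G) (v : TangentSpace (𝓡 L.dim) z),
      ωM (L.incl z) (infAct G (L.incl z) a) (mfderiv (𝓡 L.dim) (𝓡 m) L.incl z v) = 0)
    {z z' : L.Space} (h : Q.proj z = Q.proj z') (u v : TangentSpace (𝓡 L.dim) z)
    (u' v' : TangentSpace (𝓡 L.dim) z')
    (hu : (mfderiv (𝓡 L.dim) (𝓡 Q.dim) Q.proj z u : Eu Q.dim) =
      mfderiv (𝓡 L.dim) (𝓡 Q.dim) Q.proj z' u')
    (hv : (mfderiv (𝓡 L.dim) (𝓡 Q.dim) Q.proj z v : Eu Q.dim) =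
      mfderiv (𝓡 L.dim) (𝓡 Q.dim) Q.proj z' v') :
    ωM (L.incl z) (mfderiv (𝓡 L.dim) (𝓡 m) L.incl z u) (mfderiv (𝓡 L.dim) (𝓡 m) L.incl z v) =
      ωM (L.incl z') (mfderiv (𝓡 L.dim) (𝓡 m) L.incl z' u')
        (mfderiv (𝓡 L.dim) (𝓡 m) L.incl z' v') := by
  let _ := L.action hinv
  have := L.contMDiffSMul_action (k := k) hinv
  obtain ⟨g, hg⟩ := Q.proj_eq_iff.1 h
  have hz' : g • z = z' := L.incl_injective hg
  subst hz'
  let τ : Eu L.dim →L[ℝ] Eu L.dim := mfderiv (𝓡 L.dim) (𝓡 L.dim) (fun y : L.Space ↦ g • y) z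
  have hτ1 : ∀ w : TangentSpace (𝓡 L.dim) z,
      (mfderiv (𝓡 L.dim) (𝓡 m) L.incl (g • z) (τ w) : Eu m) =
        mfderiv (𝓡 m) (𝓡 m) (fun y : M ↦ g • y) (L.incl z) (mfderiv (𝓡 L.dim) (𝓡 m) L.incl z w) := by
    intro w
    have a1 := mfderiv_comp_apply (I := 𝓡 L.dim) (I' := 𝓡 L.dim) (I'' := 𝓡 m) (g := L.incl)
      (f := fun y : L.Space ↦ g • y) z (L.mdiff_incl _) (mdiff_const_smul k g z) w
    have a2 := mfderiv_comp_apply (I := 𝓡 L.dim) (I' := 𝓡 m) (I'' := 𝓡 m) (g := fun y : M ↦ g • y)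
      (f := L.incl) z (mdiff_const_smul k g _) (L.mdiff_incl _) w
    exact a1.symm.trans a2
  have hτ2 : ∀ w : TangentSpace (𝓡 L.dim) z,
      (mfderiv (𝓡 L.dim) (𝓡 Q.dim) Q.proj (g • z) (τ w) : Eu Q.dim) =
        mfderiv (𝓡 L.dim) (𝓡 Q.dim) Q.proj z w := by
    intro w
    have a1 := mfderiv_comp_apply (I := 𝓡 L.dim) (I' := 𝓡 L.dim) (I'' := 𝓡 Q.dim) (g := Q.proj)
      (f := fun y : L.Space ↦ g • y) z (Q.mdiff_proj _) (mdiff_const_smul k g z) w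
    have a2 : Q.proj ∘ (fun y : L.Space ↦ g • y) = Q.proj := by
      funext y
      exact (Q.proj_eq_iff.2 ⟨g, rfl⟩).symm
    rw [a2] at a1
    exact a1.symm
  have hdiff : ∀ (w : TangentSpace (𝓡 L.dim) z) (w' : TangentSpace (𝓡 L.dim) (g • z)),
      (mfderiv (𝓡 L.dim) (𝓡 Q.dim) Q.proj z w : Eu Q.dim) =
        mfderiv (𝓡 L.dim) (𝓡 Q.dim) Q.proj (g • z) w' →
      ∃ a : GroupLieAlgebra (𝓡 k) G, (mfderiv (𝓡 L.dim) (𝓡 m) L.incl (g • z) (τ w) : Eu m) =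
        mfderiv (𝓡 L.dim) (𝓡 m) L.incl (g • z) w' + infAct G (L.incl (g • z)) a := by
    intro w w' hw
    exact Q.exists_infAct_of_mfderiv_proj_eq (k := k) hinv hfree (g • z) (τ w) w' ((hτ2 w).trans hw)
  have hskew : ∀ (x : M) (a b : TangentSpace (𝓡 m) x), ωM x a b = -ωM x b a := by
    intro x a b
    have := halt x (a + b)
    simp only [map_add, LinearMap.add_apply, halt, zero_add, add_zero] at this
    linarith
  obtain ⟨a, ha⟩ := hdiff u u' hu
  obtain ⟨b, hb⟩ := hdiff v v' hv
  rw [← hω g]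
  have e1 : ωM (g • L.incl z) (mfderiv (𝓡 m) (𝓡 m) (fun y : M ↦ g • y) (L.incl z)
      (mfderiv (𝓡 L.dim) (𝓡 m) L.incl z u)) (mfderiv (𝓡 m) (𝓡 m) (fun y : M ↦ g • y) (L.incl z)
      (mfderiv (𝓡 L.dim) (𝓡 m) L.incl z v)) = ωM (L.incl (g • z))
        (mfderiv (𝓡 L.dim) (𝓡 m) L.incl (g • z) u' + infAct G (L.incl (g • z)) a)
        (mfderiv (𝓡 L.dim) (𝓡 m) L.incl (g • z) v' + infAct G (L.incl (g • z)) b) :=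
    congrArg₂ (fun p q : Eu m ↦ ωM (L.incl (g • z)) p q) ((hτ1 u).symm.trans ha)
      ((hτ1 v).symm.trans hb)
  rw [e1]
  obtain ⟨w, hw, -⟩ := Q.mfderiv_proj_infAct (k := k) hinv (g • z) b
  simp only [map_add, LinearMap.add_apply]
  rw [hbasic, hskew _ _ (infAct G (L.incl (g • z)) b), hbasic, ← hw, hbasic]
  simp

variable {ωM : TwoForm m M ℝ} (halt : ∀ x v, ωM x v v = 0)
    (hω : ∀ (g : G) (x : M) (u v : TangentSpace (𝓡 m) x),
      ωM (g • x) (mfderiv (𝓡 m) (𝓡 m) (fun y : M ↦ g • y) x u)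
        (mfderiv (𝓡 m) (𝓡 m) (fun y : M ↦ g • y) x v) = ωM x u v)
    (hbasic : ∀ (z : L.Space) (a : GroupLieAlgebra (𝓡 k) G) (v : TangentSpace (𝓡 L.dim) z),
      ωM (L.incl z) (infAct G (L.incl z) a) (mfderiv (𝓡 L.dim) (𝓡 m) L.incl z v) = 0)

include hinv hfree halt hω hbasic

lemma reducedForm_eq {z : L.Space} {q : Q.Space} (hq : Q.proj z = q) (u v : Eu Q.dim)
    (u' v' : TangentSpace (𝓡 L.dim) z)
    (hu : mfderiv (𝓡 L.dim) (𝓡 Q.dim) Q.proj z u' = u)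
    (hv : mfderiv (𝓡 L.dim) (𝓡 Q.dim) Q.proj z v' = v) :
    Q.reducedForm ωM q u v =
      ωM (L.incl z) (mfderiv (𝓡 L.dim) (𝓡 m) L.incl z u') (mfderiv (𝓡 L.dim) (𝓡 m) L.incl z v') := by
  have hqd := Q.mem_secDom q
  have h1 := Q.apply_eq_of_mfderiv_proj_eq (k := k) hinv hfree halt hω hbasic
    (z := Q.sec q q) (z' := z) (by rw [Q.proj_sec hqd, hq])
    (mfderiv (𝓡 Q.dim) (𝓡 L.dim) (Q.sec q) q u) (mfderiv (𝓡 Q.dim) (𝓡 L.dim) (Q.sec q) q v) u' v'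
    ((Q.mfderiv_proj_sec hqd u).trans hu.symm) ((Q.mfderiv_proj_sec hqd v).trans hv.symm)
  refine Eq.trans ?_ h1
  exact congrArg₂ (fun a b : Eu m ↦ ωM (L.incl (Q.sec q q)) a b) (Q.mfderiv_incl_sec hqd u)
    (Q.mfderiv_incl_sec hqd v)

lemma isClosedForm_reducedForm (hcl : IsClosedForm ωM) : IsClosedForm (Q.reducedForm ωM) := by
  refine isClosedForm_of_local_pullback hcl fun q ↦ ⟨fun y ↦ L.incl (Q.sec q y), Q.secDom q,
    Q.isOpen_secDom q, Q.mem_secDom q,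
    fun y hy ↦ (Q.contMDiffAt_incl_sec hy).contMDiffWithinAt, fun y hy u v ↦ ?_⟩
  rw [Q.reducedForm_eq (k := k) hinv hfree halt hω hbasic (Q.proj_sec hy) u v _ _
    (Q.mfderiv_proj_sec hy u) (Q.mfderiv_proj_sec hy v)]
  exact congrArg₂ (fun a b : Eu m ↦ ωM (L.incl (Q.sec q y)) a b) (Q.mfderiv_incl_sec hy u).symm
    (Q.mfderiv_incl_sec hy v).symm

end LevelQuotient

section Hamiltonian

variable {ωM : TwoForm m M ℝ} {μ : M → Module.Dual ℝ (GroupLieAlgebra (𝓡 k) G)}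

lemma IsHamiltonian.map_smul_eq_zero (hμ : IsHamiltonian G ωM μ) (g : G) {x : M} (hx : ∀ a, μ x a = 0)
    (a : GroupLieAlgebra (𝓡 k) G) : μ (g • x) a = 0 := by
  have h := adjoint_inv_adjoint g⁻¹ a
  rw [inv_inv] at h
  rw [← h, hμ.equivariant]
  exact hx _

/-- The zero level of the moment map is a submanifold, if the action on it is free. -/
lemma IsHamiltonian.nonempty_cleanLevel [T2Space M] (hω : IsSymplectic ωM) (hμ : IsHamiltonian G ωM μ)
    (hfree : ∀ x : M, (∀ a, μ x a = 0) → ∀ g : G, g • x = x → g = 1) :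
    Nonempty (CleanLevel m (fun (x : M) (a : GroupLieAlgebra (𝓡 k) G) ↦ μ x a)) := by
  let ν : M → Eu k →L[ℝ] ℝ := fun x ↦ LinearMap.toContinuousLinearMap (μ x : Eu k →ₗ[ℝ] ℝ)
  have hν : ContMDiff (𝓡 m) 𝓘(ℝ, Eu k →L[ℝ] ℝ) ∞ ν := fun x ↦
    contMDiffAt_clm_of_apply fun a ↦ (hμ.smooth a).contMDiffAt
  let D : (Eu k →L[ℝ] ℝ) →L[ℝ] Eu k :=
    (InnerProductSpace.toDual ℝ (Eu k)).symm.toContinuousLinearEquiv.toContinuousLinearMap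
  let Φ : M → Eu k := fun x ↦ D (ν x)
  have hΦ : ContMDiff (𝓡 m) 𝓘(ℝ, Eu k) ∞ Φ := D.contMDiff.comp hν
  have hin : ∀ x (a : Eu k), innerSL ℝ a (Φ x) = μ x a := by
    intro x a
    rw [innerSL_apply_apply, real_inner_comm]
    exact InnerProductSpace.toDual_symm_apply
  have hd : ∀ x (u : TangentSpace (𝓡 m) x) (a : Eu k), inner ℝ a (mvfderiv (𝓡 m) Φ x u) =
      mvfderiv (𝓡 m) (fun y ↦ μ y a) x u := by
    intro x u a
    have h1 := mvfderiv_clm_comp (innerSL ℝ a) (hΦ.contMDiffAt.mdifferentiableAt (by simp) :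
      MDifferentiableAt (𝓡 m) 𝓘(ℝ, Eu k) Φ x) u
    simp only [hin] at h1
    rw [h1, innerSL_apply_apply]
  have hzero : ∀ x, (∀ a : GroupLieAlgebra (𝓡 k) G, μ x a = 0) ↔ Φ x = 0 := by
    intro x
    constructor
    · intro h
      have h1 := hin x (Φ x)
      rw [innerSL_apply_apply] at h1
      exact inner_self_eq_zero.1 (h1.trans (h _))
    · intro h a
      have h1 := hin x a
      rw [h, map_zero] at h1
      exact h1.symm
  refine nonempty_cleanLevel_of_regular hΦ hzero ?_ ?_
  · intro x hx
    let T : Eu m →ₗ[ℝ] Eu k := (mvfderiv (𝓡 m) Φ x).toLinearMap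
    have h1 : (LinearMap.range T)ᗮ = ⊥ := by
      rw [Submodule.eq_bot_iff]
      intro a ha
      have h2 : infAct (k := k) (m := m) G x a = 0 := by
        refine hω.nondegenerate x _ fun u ↦ (hμ.moment x a u).trans ((hd x u a).symm.trans ?_)
        rw [real_inner_comm]
        exact ha _ ⟨u, rfl⟩
      exact injective_infAct (k := k) (m := m) (hfree x ((hzero x).2 hx))
        (h2.trans (map_zero (infAct (k := k) (m := m) G x)).symm)
    exact LinearMap.range_eq_top.1 (Submodule.orthogonal_eq_bot_iff.1 h1)
  · intro x hx u
    constructor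
    · intro h
      have h1 := hd x u (mvfderiv (𝓡 m) Φ x u)
      exact inner_self_eq_zero.1 (h1.trans (h _))
    · intro h a
      exact (hd x u a).symm.trans ((congrArg (inner ℝ (E := Eu k) a) h).trans
        (inner_zero_right (E := Eu k) a))

lemma IsHamiltonian.apply_infAct_eq_zero (hμ : IsHamiltonian G ωM μ)
    (L : CleanLevel m (fun (x : M) (a : GroupLieAlgebra (𝓡 k) G) ↦ μ x a))
    (z : L.Space) (a : GroupLieAlgebra (𝓡 k) G) (v : TangentSpace (𝓡 L.dim) z) :
    ωM (L.incl z) (infAct G (L.incl z) a) (mfderiv (𝓡 L.dim) (𝓡 m) L.incl z v) = 0 := by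
  rw [hμ.moment]
  exact (L.tangent z _).1 ⟨v, rfl⟩ a

lemma IsHamiltonian.mfderiv_proj_eq_zero (hω : IsSymplectic ωM) (hμ : IsHamiltonian G ωM μ)
    {L : CleanLevel m (fun (x : M) (a : GroupLieAlgebra (𝓡 k) G) ↦ μ x a)} (Q : LevelQuotient G L)
    (z : L.Space) (u : TangentSpace (𝓡 L.dim) z)
    (hu : ∀ v : TangentSpace (𝓡 L.dim) z, ωM (L.incl z) (mfderiv (𝓡 L.dim) (𝓡 m) L.incl z u)
      (mfderiv (𝓡 L.dim) (𝓡 m) L.incl z v) = 0) :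
    mfderiv (𝓡 L.dim) (𝓡 Q.dim) Q.proj z u = 0 := by
  have : FiniteDimensional ℝ (GroupLieAlgebra (𝓡 k) G) :=
    inferInstanceAs (FiniteDimensional ℝ (Eu k))
  obtain ⟨a, ha⟩ := exists_apply_eq_of_forall
    ((ωM (L.incl z)).comp (infAct (k := k) (m := m) G (L.incl z)).toLinearMap)
    (ωM (L.incl z) (mfderiv (𝓡 L.dim) (𝓡 m) L.incl z u)) (fun v hv ↦ by
      obtain ⟨v', hv'⟩ := (L.tangent z v).2 fun a ↦ (hμ.moment _ a v).symm.trans (hv a)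
      exact (congrArg (ωM (L.incl z) (mfderiv (𝓡 L.dim) (𝓡 m) L.incl z u)) hv'.symm).trans (hu v'))
  have h3 : infAct G (L.incl z) a = mfderiv (𝓡 L.dim) (𝓡 m) L.incl z u := by
    refine sub_eq_zero.1 (hω.nondegenerate _ _ fun v ↦ ?_)
    rw [map_sub, LinearMap.sub_apply, sub_eq_zero]
    exact congrArg (fun K : TangentSpace (𝓡 m) (L.incl z) →ₗ[ℝ] ℝ ↦ K v) ha
  obtain ⟨w, hw, hw'⟩ := Q.mfderiv_proj_infAct (k := k)
    (fun g _ hx a ↦ hμ.map_smul_eq_zero g hx a) z a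
  rwa [L.injective_mfderiv_incl z (hw.trans h3)] at hw'

/-- Symplectic reduction at a level on which the group acts freely. -/
theorem IsHamiltonian.nonempty_symplecticReduction [CompactSpace G] [T2Space M]
    [SecondCountableTopology M] (hω : IsSymplectic ωM) (hμ : IsHamiltonian G ωM μ)
    (hfree : ∀ x : M, (∀ a, μ x a = 0) → ∀ g : G, g • x = x → g = 1) :
    Nonempty (SymplecticReduction G ωM μ) := by
  obtain ⟨L⟩ := hμ.nonempty_cleanLevel hω hfree
  have hinv : ∀ (g : G) (x : M), (∀ a, μ x a = 0) → ∀ a, μ (g • x) a = 0 :=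
    fun g x hx a ↦ hμ.map_smul_eq_zero g hx a
  obtain ⟨Q⟩ := CleanLevel.nonempty_levelQuotient (L := L) k hinv hfree
  have hb := hμ.apply_infAct_eq_zero L
  have hform := fun {z : L.Space} {q : Q.Space} (hq : Q.proj z = q) ↦
    Q.reducedForm_eq (k := k) hinv hfree hω.alternating hμ.invariant hb hq
  refine ⟨{ level := L, quot := Q, form := Q.reducedForm ωM, isSymplectic := ?_, pullback := ?_ }⟩
  · refine ⟨Q.isClosedForm_reducedForm (k := k) hinv hfree hω.alternating hμ.invariant hb
      hω.toIsClosedForm, fun q u hu ↦ ?_⟩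
    have hqd := Q.mem_secDom q
    have h1 := Q.mfderiv_proj_sec hqd u
    refine h1.symm.trans (hμ.mfderiv_proj_eq_zero hω Q _ _ fun v ↦ ?_)
    exact (hform (Q.proj_sec hqd) _ _ _ v h1 rfl).symm.trans (hu _)
  · intro z u v
    exact hform rfl _ _ u v rfl rfl

end Hamiltonian

end

end

section

section LinearAlgebra

variable {T : Type*} [AddCommGroup T] [Module ℝ T]

/-- The functionals `Ω u` form a complex vector space. -/
def IsComplexStable (Ω : T →ₗ[ℝ] T →ₗ[ℝ] ℂ) : Prop := ∀ u, ∃ w, ∀ v, Ω w v = Complex.I * Ω u v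

variable {Ω : T →ₗ[ℝ] T →ₗ[ℝ] ℂ} (halt : ∀ v, Ω v v = 0) (hΩ : IsComplexStable Ω)

include halt in
lemma apply_swap_of_alternating (u v : T) : Ω u v = -Ω v u := by
  have := halt (u + v)
  simp only [map_add, LinearMap.add_apply, halt, zero_add, add_zero] at this
  exact eq_neg_of_add_eq_zero_right this

include halt hΩ in
lemma apply_eq_zero_of_im {S : Submodule ℝ T}
    (hS : ∀ s ∈ S, ∀ s', (∀ v, Ω s' v = Complex.I * Ω s v) → s' ∈ S)
    {u : T} (hu : ∀ s ∈ S, (Ω u s).im = 0) : ∀ s ∈ S, Ω u s = 0 := by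
  intro s hs
  obtain ⟨s', hs'⟩ := hΩ s
  refine Complex.ext ?_ (hu s hs)
  have h1 := hu s' (hS s hs s' hs')
  rw [apply_swap_of_alternating halt, hs'] at h1
  rw [apply_swap_of_alternating halt]
  simpa using h1

variable {𝔤 : Type*} [AddCommGroup 𝔤] [Module ℝ 𝔤] [FiniteDimensional ℝ 𝔤] {χ : 𝔤 →ₗ[ℝ] T}

include hΩ in
/-- A real functional that vanishes on the `Ω`-orthogonal of the image of `χ` is represented, with
respect to the imaginary part of `Ω`, by an element of the complex span of this image. -/
lemma exists_eq_im_apply (K : T →ₗ[ℝ] ℝ) (hK : ∀ s, (∀ a, Ω (χ a) s = 0) → K s = 0) :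
    ∃ a b w, (∀ v, Ω w v = Complex.I * Ω (χ b) v) ∧ ∀ v, K v = (Ω (χ a + w) v).im := by
  let β : 𝔤 × 𝔤 →ₗ[ℝ] T →ₗ[ℝ] ℝ := LinearMap.coprod
    ((LinearMap.compRight ℝ Complex.imLm).comp (Ω.comp χ))
    ((LinearMap.compRight ℝ Complex.reLm).comp (Ω.comp χ))
  have hβ : ∀ a b v, β (a, b) v = (Ω (χ a) v).im + (Ω (χ b) v).re := fun a b v ↦ rfl
  obtain ⟨⟨a, b⟩, h⟩ := exists_apply_eq_of_forall β K fun v hv ↦ hK v fun a ↦ by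
    have h1 := hv (a, 0)
    have h2 := hv (0, a)
    rw [hβ] at h1 h2
    simp only [map_zero, LinearMap.zero_apply, Complex.zero_re, Complex.zero_im, add_zero,
      zero_add] at h1 h2
    exact Complex.ext h2 h1
  obtain ⟨w, hw⟩ := hΩ (χ b)
  refine ⟨a, b, w, hw, fun v ↦ ?_⟩
  rw [← h, hβ, map_add, LinearMap.add_apply, hw]
  simp

omit [FiniteDimensional ℝ 𝔤] in
include halt in
lemma orthogonal_complexStable (s : T) (hs : ∀ a, Ω (χ a) s = 0) (s' : T)
    (h : ∀ v, Ω s' v = Complex.I * Ω s v) (a : 𝔤) : Ω (χ a) s' = 0 := by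
  rw [apply_swap_of_alternating halt, h, apply_swap_of_alternating halt, hs]
  simp

include halt hΩ in
/-- A form of type `(1,1)` that is annihilated by the image of `χ` along the orthogonal of this image
descends to the quotient of this orthogonal by its radical. -/
lemma apply_eq_zero_of_orthogonal {W : Type*} [AddCommGroup W] [Module ℝ W]
    (B : T →ₗ[ℝ] T →ₗ[ℝ] W) (hrad : ∀ n v, (∀ t, Ω n t = 0) → B n v = 0)
    (hinv : ∀ u v u' v', (∀ t, Ω u' t = Complex.I * Ω u t) → (∀ t, Ω v' t = Complex.I * Ω v t) →
      B u' v' = B u v)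
    (hχ : ∀ a s, (∀ c, Ω (χ c) s = 0) → B (χ a) s = 0)
    (u : T) (hu : ∀ s, (∀ c, Ω (χ c) s = 0) → Ω u s = 0) (s : T) (hs : ∀ c, Ω (χ c) s = 0) :
    B u s = 0 := by
  obtain ⟨a, b, w, hw, hK⟩ := exists_eq_im_apply hΩ (χ := χ) (Complex.imLm ∘ₗ Ω u)
    (fun s hs ↦ by simp [hu s hs])
  have h1 : ∀ t, Ω (u - (χ a + w)) t = 0 := fun t ↦
    apply_eq_zero_of_im halt hΩ (S := ⊤) (fun _ _ _ _ ↦ trivial) (fun t _ ↦ by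
      have := hK t
      rw [map_sub, LinearMap.sub_apply, Complex.sub_im, ← this]
      simp) t trivial
  obtain ⟨s', hs'⟩ := hΩ s
  have h2 : B w s = B (χ b) (-s') := hinv _ _ _ _ hw fun t ↦ by
    rw [map_neg, LinearMap.neg_apply, hs', mul_neg, ← mul_assoc, Complex.I_mul_I]
    simp
  have h3 : B (χ b) (-s') = 0 := hχ b _ fun c ↦ by
    rw [map_neg, orthogonal_complexStable halt s hs s' hs', neg_zero]
  have h4 := hrad _ s h1
  rw [map_sub, map_add, LinearMap.sub_apply, LinearMap.add_apply, hχ a s hs, h2, h3] at h4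
  simpa using h4

include halt hΩ in
/-- The dimension of the radical of the form induced by `Ω` on the quotient by `χ` of the orthogonal
of the image of `χ`. -/
lemma finrank_ker_reduced [FiniteDimensional ℝ T] (hinj : Function.Injective χ)
    {Z Y : Type*} [AddCommGroup Z] [Module ℝ Z] [FiniteDimensional ℝ Z] [AddCommGroup Y] [Module ℝ Y]
    [FiniteDimensional ℝ Y] {D : Z →ₗ[ℝ] T} {P : Z →ₗ[ℝ] Y} (hD : Function.Injective D)
    (hDr : ∀ s, (∃ z, D z = s) ↔ ∀ a, Ω (χ a) s = 0) (hP : Function.Surjective P)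
    (hker : ∀ z, P z = 0 ↔ ∃ a, χ a = D z) (hmem : ∀ a, ∃ z, D z = χ a)
    {Ω' : Y →ₗ[ℝ] Y →ₗ[ℝ] ℂ} (hΩ' : ∀ z z', Ω' (P z) (P z') = Ω (D z) (D z')) :
    Module.finrank ℝ (LinearMap.ker Ω') + Module.finrank ℝ 𝔤 + Module.finrank ℝ Z =
      Module.finrank ℝ T + Module.finrank ℝ (LinearMap.ker Ω) := by
  let b : LinearMap.BilinForm ℝ T := LinearMap.compRight ℝ Complex.imLm ∘ₗ Ω
  have hb : ∀ u v, b u v = (Ω u v).im := fun _ _ ↦ rfl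
  have hrefl : b.IsRefl := fun u v h ↦ by
    rw [hb] at h ⊢
    rw [apply_swap_of_alternating halt, Complex.neg_im, h, neg_zero]
  have hstab : ∀ s ∈ LinearMap.range D, ∀ s', (∀ v, Ω s' v = Complex.I * Ω s v) →
      s' ∈ LinearMap.range D := fun s hs s' h ↦
    (hDr s').2 (orthogonal_complexStable halt s ((hDr s).1 hs) s' h)
  have hO : ∀ u, u ∈ b.orthogonal (LinearMap.range D) ↔ ∀ z, Ω u (D z) = 0 := by
    intro u
    rw [LinearMap.BilinForm.mem_orthogonal_iff]
    constructor
    · intro h z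
      refine apply_eq_zero_of_im halt hΩ hstab (fun s hs ↦ ?_) _ ⟨z, rfl⟩
      rw [← hb]
      exact hrefl _ _ (h s hs)
    · rintro h _ ⟨z, rfl⟩
      refine hrefl _ _ ?_
      rw [hb, h, Complex.zero_im]
  have hN : b.orthogonal ⊤ = LinearMap.ker Ω := by
    ext u
    rw [LinearMap.BilinForm.mem_orthogonal_iff, LinearMap.mem_ker]
    constructor
    · intro h
      ext t
      exact apply_eq_zero_of_im halt hΩ (S := ⊤) (fun _ _ _ _ ↦ trivial)
        (fun t _ ↦ hrefl _ _ (h t trivial)) t trivial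
    · intro h t _
      refine hrefl _ _ ?_
      rw [hb, h]
      simp
  have hNS : LinearMap.range D ⊓ b.orthogonal ⊤ = LinearMap.ker Ω := by
    rw [hN, inf_eq_right]
    intro u hu
    refine (hDr u).2 fun a ↦ ?_
    rw [apply_swap_of_alternating halt, LinearMap.mem_ker.1 hu]
    simp
  have e1 := LinearMap.BilinForm.finrank_add_finrank_orthogonal hrefl (LinearMap.range D)
  rw [hNS, LinearMap.finrank_range_of_inj hD] at e1
  let A : Submodule ℝ Z := (LinearMap.ker Ω').comap P
  have hA : A.map D = b.orthogonal (LinearMap.range D) := by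
    ext u
    rw [hO, Submodule.mem_map]
    constructor
    · rintro ⟨z, hz, rfl⟩ z'
      rw [← hΩ', LinearMap.mem_ker.1 hz, LinearMap.zero_apply]
    · intro h
      obtain ⟨z, rfl⟩ := (hDr u).2 fun a ↦ by
        obtain ⟨y, hy⟩ := hmem a
        rw [← hy, apply_swap_of_alternating halt, h, neg_zero]
      refine ⟨z, LinearMap.mem_ker.2 (LinearMap.ext fun y ↦ ?_), rfl⟩
      obtain ⟨z', rfl⟩ := hP y
      rw [hΩ', h, LinearMap.zero_apply]
  have hkP : (LinearMap.ker P).map D = LinearMap.range χ := by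
    ext u
    rw [Submodule.mem_map, LinearMap.mem_range]
    constructor
    · rintro ⟨z, hz, rfl⟩
      exact (hker z).1 hz
    · rintro ⟨a, rfl⟩
      obtain ⟨z, hz⟩ := hmem a
      exact ⟨z, (hker z).2 ⟨a, hz.symm⟩, hz⟩
  have e2 : Module.finrank ℝ A = Module.finrank ℝ (b.orthogonal (LinearMap.range D)) := by
    rw [← hA]
    exact (LinearEquiv.finrank_eq (Submodule.equivMapOfInjective D hD A))
  have e3 : Module.finrank ℝ (LinearMap.ker P) = Module.finrank ℝ 𝔤 := by
    rw [← LinearMap.finrank_range_of_inj hinj, ← hkP]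
    exact (LinearEquiv.finrank_eq (Submodule.equivMapOfInjective D hD _))
  have e4 := LinearMap.finrank_range_add_finrank_ker (P.domRestrict A)
  have e5 : LinearMap.range (P.domRestrict A) = LinearMap.ker Ω' := by
    rw [LinearMap.range_domRestrict, Submodule.map_comap_eq, LinearMap.range_eq_top.2 hP, top_inf_eq]
  have hle : LinearMap.ker P ≤ A := fun z hz ↦ by
    rw [Submodule.mem_comap, LinearMap.mem_ker.1 hz]
    exact zero_mem _
  have e6 : Module.finrank ℝ (LinearMap.ker (P.domRestrict A)) =
      Module.finrank ℝ (LinearMap.ker P) := by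
    rw [LinearMap.ker_domRestrict]
    exact LinearEquiv.finrank_eq (Submodule.comapSubtypeEquivOfLe hle)
  rw [e5, e6, e3, e2] at e4
  omega

end LinearAlgebra

section TransverseComplexStructure

variable {m : ℕ} {M : Type*} [TopologicalSpace M] [ChartedSpace (EuclideanSpace ℝ (Fin m)) M]
  [IsManifold (𝓡 m) ∞ M] {Ω : TwoForm m M ℂ} {x : M}

lemma mkQ_radical_eq_iff {u v : TangentSpace (𝓡 m) x} :
    (radical Ω x).mkQ u = (radical Ω x).mkQ v ↔ Ω x u = Ω x v := by
  rw [← sub_eq_zero, ← map_sub, Submodule.mkQ_apply, Submodule.Quotient.mk_eq_zero, radical,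
    LinearMap.mem_ker, map_sub, sub_eq_zero]

lemma IsTransverseComplexStructure.apply_eq {I : TQuo Ω x →ₗ[ℝ] TQuo Ω x}
    (hI : IsTransverseComplexStructure Ω x I) {u w : TangentSpace (𝓡 m) x}
    (h : (radical Ω x).mkQ w = I ((radical Ω x).mkQ u)) (v : TangentSpace (𝓡 m) x) :
    Ω x w v = Complex.I * Ω x u v := by
  have h1 := hI.compat u v w h
  have h2 := hI.compat w v (-u) (by rw [h, hI.sq, map_neg])
  rw [map_neg, LinearMap.neg_apply, Complex.neg_im] at h2
  apply Complex.ext <;> simp [h1, h2]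

lemma exists_isTransverseComplexStructure_iff :
    (∃ I, IsTransverseComplexStructure Ω x I) ↔ IsComplexStable (Ω x) := by
  constructor
  · rintro ⟨I, hI⟩ u
    obtain ⟨w, hw⟩ := (radical Ω x).mkQ_surjective (I ((radical Ω x).mkQ u))
    exact ⟨w, hI.apply_eq hw⟩
  · intro h
    choose J hJ using h
    let I0 : TangentSpace (𝓡 m) x →ₗ[ℝ] TQuo Ω x :=
      { toFun := fun u ↦ (radical Ω x).mkQ (J u)
        map_add' := fun u v ↦ by
          rw [← map_add]
          exact mkQ_radical_eq_iff.2 (LinearMap.ext fun t ↦ by simp [hJ, mul_add])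
        map_smul' := fun c u ↦ by
          rw [← map_smul]
          exact mkQ_radical_eq_iff.2 (LinearMap.ext fun t ↦ by simp [hJ]; ring) }
    let I : TQuo Ω x →ₗ[ℝ] TQuo Ω x := (radical Ω x).liftQ I0 fun u hu ↦ by
      refine LinearMap.mem_ker.2 ((mkQ_radical_eq_iff.2 (LinearMap.ext fun t ↦ ?_)).trans
        (map_zero (radical Ω x).mkQ))
      rw [hJ, LinearMap.mem_ker.1 hu]
      simp
    have hI : ∀ u, I ((radical Ω x).mkQ u) = (radical Ω x).mkQ (J u) := fun u ↦ rfl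
    refine ⟨I, ⟨fun u ↦ ?_, fun u v w hw ↦ ?_⟩⟩
    · obtain ⟨u, rfl⟩ := (radical Ω x).mkQ_surjective u
      rw [hI, hI, ← map_neg]
      refine mkQ_radical_eq_iff.2 (LinearMap.ext fun t ↦ ?_)
      rw [hJ, hJ, ← mul_assoc, Complex.I_mul_I]
      simp
    · rw [hI] at hw
      rw [mkQ_radical_eq_iff.1 hw, hJ]
      simp

end TransverseComplexStructure

end

section

variable {m k n : ℕ} {F : Type u} [NormedAddCommGroup F] [NormedSpace ℂ F]
  {M : Type v} [TopologicalSpace M] [ChartedSpace (EuclideanSpace ℝ (Fin m)) M]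
  [IsManifold (𝓡 m) ∞ M] {E : HermitianBundle.{u, v, w} m F M}

section TracelessCurvature

/-- The traceless curvature as a bilinear map. -/
def HermitianBundle.tracelessCurvatureₗ (E : HermitianBundle.{u, v, w} m F M) (x : M) :
    TangentSpace (𝓡 m) x →ₗ[ℝ] TangentSpace (𝓡 m) x →ₗ[ℝ] (E.Fib x →ₗ[ℂ] E.Fib x) :=
  LinearMap.mk₂ ℝ (fun u v ↦ E.tracelessCurvature x u v)
    (fun u u' v ↦ by
      simp only [HermitianBundle.tracelessCurvature, map_add, LinearMap.add_apply, mul_add, add_smul]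
      abel)
    (fun c u v ↦ by
      simp only [HermitianBundle.tracelessCurvature, map_smul, LinearMap.smul_apply, smul_add,
        mul_smul_comm, smul_assoc])
    (fun u v v' ↦ by
      simp only [HermitianBundle.tracelessCurvature, map_add, mul_add, add_smul]
      abel)
    (fun c u v ↦ by
      simp only [HermitianBundle.tracelessCurvature, map_smul, smul_add, mul_smul_comm, smul_assoc])

lemma HermitianBundle.curvature_swap (x : M) (u v : TangentSpace (𝓡 m) x) :
    E.curvature x u v = -E.curvature x v u :=
  LinearMap.ext fun _ ↦ HermitianBundle.curvAux_swap _ _ _ _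

lemma HermitianBundle.tracelessCurvature_swap (x : M) (u v : TangentSpace (𝓡 m) x) :
    E.tracelessCurvature x u v = -E.tracelessCurvature x v u := by
  have h : E.traceCurvature x u v = -E.traceCurvature x v u := by
    simp only [HermitianBundle.traceCurvature, LinearMap.mk₂_apply]
    rw [HermitianBundle.curvature_swap, map_neg, mul_neg]
  rw [HermitianBundle.tracelessCurvature, HermitianBundle.tracelessCurvature, h,
    HermitianBundle.curvature_swap, mul_neg, neg_smul, neg_add]

lemma HermitianBundle.IsTransverseOneOne.apply_eq {Ω : TwoForm m M ℂ} (h : E.IsTransverseOneOne Ω)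
    {x : M} (hΩ : ∃ I, IsTransverseComplexStructure Ω x I) {u v u' v' : TangentSpace (𝓡 m) x}
    (hu : ∀ t, Ω x u' t = Complex.I * Ω x u t) (hv : ∀ t, Ω x v' t = Complex.I * Ω x v t) :
    E.tracelessCurvature x u' v' = E.tracelessCurvature x u v := by
  obtain ⟨I, hI⟩ := hΩ
  have key : ∀ u u' : TangentSpace (𝓡 m) x, (∀ t, Ω x u' t = Complex.I * Ω x u t) →
      (radical Ω x).mkQ u' = I ((radical Ω x).mkQ u) := by
    intro u u' hu
    obtain ⟨w, hw⟩ := (radical Ω x).mkQ_surjective (I ((radical Ω x).mkQ u))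
    rw [← hw]
    exact mkQ_radical_eq_iff.2 (LinearMap.ext fun t ↦ (hu t).trans (hI.apply_eq hw t).symm)
  exact h.invariant x I hI u v u' v' (key u u' hu) (key v v' hv)

end TracelessCurvature

section Pullback

variable [FiniteDimensional ℂ F] {N : Type*} [TopologicalSpace N] [ChartedSpace (EuclideanSpace ℝ (Fin n)) N]
  [IsManifold (𝓡 n) ∞ N] {m' : ℕ} {M' : Type*} [TopologicalSpace M']
  [ChartedSpace (EuclideanSpace ℝ (Fin m')) M'] [IsManifold (𝓡 m') ∞ M']
  {E' : HermitianBundle m' F M'} {f : N → M} {f' : N → M'}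
  (hf : ContMDiff (𝓡 n) (𝓡 m) ∞ f) (hf' : ContMDiff (𝓡 n) (𝓡 m') ∞ f')
  (Ψ : Π z, E.Fib (f z) ≃ₗᵢ[ℂ] E'.Fib (f' z))
  (hΨ : ∀ z (s : Π y, E'.Fib y), E'.SmoothAt s (f' z) →
    ContMDiffAt (𝓡 n) ((𝓡 m).prod 𝓘(ℝ, F)) ∞
      (fun z' ↦ Bundle.TotalSpace.mk' F (f z') ((Ψ z').symm (s (f' z')))) z)
  (hconn : ∀ z (s : Π y, E'.Fib y), E'.SmoothAt s (f' z) → ∀ u : TangentSpace (𝓡 n) z,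
    E.pullbackConn f (fun z' ↦ (Ψ z').symm (s (f' z'))) z u =
      (Ψ z).symm (E'.conn s (f' z) (mfderiv (𝓡 n) (𝓡 m') f' z u)))
  (z : N) (u v : TangentSpace (𝓡 n) z)

include hf hf' hΨ hconn

lemma HermitianBundle.curvature_eq_conj :
    E.curvature (f z) (mfderiv (𝓡 n) (𝓡 m) f z u) (mfderiv (𝓡 n) (𝓡 m) f z v) =
    (Ψ z).symm.toLinearEquiv.conj (E'.curvature (f' z)
      (mfderiv (𝓡 n) (𝓡 m') f' z u) (mfderiv (𝓡 n) (𝓡 m') f' z v)) := by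
  refine LinearMap.ext fun e ↦ ?_
  have h := HermitianBundle.curvature_eq_of_pullbackConn hf hf'
    (fun z ↦ ((Ψ z).symm.toLinearEquiv : E'.Fib (f' z) →ₗ[ℂ] E.Fib (f z)))
    hΨ hconn z u v (Ψ z e)
  have h2 : ((Ψ z).symm.toLinearEquiv : E'.Fib (f' z) →ₗ[ℂ] E.Fib (f z)) (Ψ z e) = e :=
    (Ψ z).symm_apply_apply e
  rw [h2] at h
  exact h

lemma HermitianBundle.traceCurvature_eq :
    E.traceCurvature (f z) (mfderiv (𝓡 n) (𝓡 m) f z u) (mfderiv (𝓡 n) (𝓡 m) f z v) =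
    E'.traceCurvature (f' z) (mfderiv (𝓡 n) (𝓡 m') f' z u) (mfderiv (𝓡 n) (𝓡 m') f' z v) := by
  simp only [HermitianBundle.traceCurvature, LinearMap.mk₂_apply]
  rw [HermitianBundle.curvature_eq_conj hf hf' Ψ hΨ hconn, LinearMap.trace_conj']

lemma HermitianBundle.tracelessCurvature_eq_conj :
    E.tracelessCurvature (f z) (mfderiv (𝓡 n) (𝓡 m) f z u) (mfderiv (𝓡 n) (𝓡 m) f z v) =
    (Ψ z).symm.toLinearEquiv.conj (E'.tracelessCurvature (f' z)
      (mfderiv (𝓡 n) (𝓡 m') f' z u) (mfderiv (𝓡 n) (𝓡 m') f' z v)) := by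
  have h (c : ℂ) (T : E'.Fib (f' z) →ₗ[ℂ] E'.Fib (f' z)) :
      (Ψ z).symm.toLinearEquiv.conj T + c • LinearMap.id =
        (Ψ z).symm.toLinearEquiv.conj (T + c • LinearMap.id) := by
    rw [LinearEquiv.map_add, LinearEquiv.map_smul, LinearEquiv.conj_id]
  rw [HermitianBundle.tracelessCurvature,
    HermitianBundle.curvature_eq_conj hf hf' Ψ hΨ hconn,
    HermitianBundle.traceCurvature_eq hf hf' Ψ hΨ hconn]
  exact h _ _

end Pullback

variable [FiniteDimensional ℂ F]
  {G : Type*} [Group G] [TopologicalSpace G]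
  [ChartedSpace (EuclideanSpace ℝ (Fin k)) G] [LieGroup (𝓡 k) ∞ G]
  [MulAction G M] [ContMDiffSMul (𝓡 k) (𝓡 m) ∞ G M] {A : EquivariantStructure k G E}

namespace BraneReduction

variable {μM : M → Module.Dual ℝ (GroupLieAlgebra (𝓡 k) G)} (B : BraneReduction A μM)
  (z : B.level.Space) (u v : TangentSpace (𝓡 B.level.dim) z)

lemma traceCurvature_incl :
    E.traceCurvature (B.level.incl z) (mfderiv (𝓡 B.level.dim) (𝓡 m) B.level.incl z u)
      (mfderiv (𝓡 B.level.dim) (𝓡 m) B.level.incl z v) =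
    B.bundle.traceCurvature (B.quot.proj z)
      (mfderiv (𝓡 B.level.dim) (𝓡 B.quot.dim) B.quot.proj z u)
      (mfderiv (𝓡 B.level.dim) (𝓡 B.quot.dim) B.quot.proj z v) :=
  HermitianBundle.traceCurvature_eq B.level.contMDiff_incl B.quot.contMDiff_proj B.iso B.smooth
    B.conn z u v

lemma tracelessCurvature_incl :
    E.tracelessCurvature (B.level.incl z) (mfderiv (𝓡 B.level.dim) (𝓡 m) B.level.incl z u)
      (mfderiv (𝓡 B.level.dim) (𝓡 m) B.level.incl z v) =
    (B.iso z).symm.toLinearEquiv.conj (B.bundle.tracelessCurvature (B.quot.proj z)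
      (mfderiv (𝓡 B.level.dim) (𝓡 B.quot.dim) B.quot.proj z u)
      (mfderiv (𝓡 B.level.dim) (𝓡 B.quot.dim) B.quot.proj z v)) :=
  HermitianBundle.tracelessCurvature_eq_conj B.level.contMDiff_incl B.quot.contMDiff_proj B.iso
    B.smooth B.conn z u v

end BraneReduction

variable [Nontrivial F] {X : Type*} [TopologicalSpace X] [ChartedSpace (EuclideanSpace ℝ (Fin n)) X]
  [IsManifold (𝓡 n) ∞ X] [MulAction G X] [ContMDiffSMul (𝓡 k) (𝓡 n) ∞ G X]
  {ωX : TwoForm n X ℝ} {μ : X → Module.Dual ℝ (GroupLieAlgebra (𝓡 k) G)} {ι : M → X}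

lemma IsHamiltonian.momentTrace_smul_eq_zero (hμ : IsHamiltonian G ωX μ)
    (hι : ∀ (g : G) (x : M), ι (g • x) = g • ι x) (g : G) (x : M)
    (hx : ∀ a, A.momentTrace (fun x ↦ μ (ι x)) x a = 0) (a : GroupLieAlgebra (𝓡 k) G) :
    A.momentTrace (fun x ↦ μ (ι x)) (g • x) a = 0 :=
  A.momentTrace_level_smul (fun g x a ↦ by rw [hι]; exact hμ.equivariant g (ι x) a) g x hx a

/-- The differential of the moment trace is the contraction of the form of the brane with the
infinitesimal action. -/
lemma IsHamiltonian.mvfderiv_momentTrace (hμ : IsHamiltonian G ωX μ)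
    (hι : ∀ (g : G) (x : M), ι (g • x) = g • ι x) {x : M} (hd : MDifferentiableAt (𝓡 m) (𝓡 n) ι x)
    (a : GroupLieAlgebra (𝓡 k) G) (w : TangentSpace (𝓡 m) x) :
    mvfderiv (𝓡 m) (fun y ↦ A.momentTrace (fun x ↦ μ (ι x)) y a) x w =
      E.braneForm ωX ι x (infAct G x a) w := by
  have hd' : MDifferentiableAt (𝓡 n) 𝓘(ℝ, ℝ) (fun y ↦ μ y a) (ι x) :=
    (hμ.smooth a).contMDiffAt.mdifferentiableAt (by simp)
  rw [A.mvfderiv_momentTrace x a (MDifferentiableAt.comp (g := fun y ↦ μ y a) (f := ι) x hd' hd) w,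
    mvfderiv_comp_vec (g := fun y ↦ μ y a) (f := ι) hd' hd w, ← hμ.moment]
  exact congrArg (fun y : Eu n ↦ E.traceCurvature x (infAct G x a) w +
    Complex.I * (ωX (ι x) y (mfderiv (𝓡 m) (𝓡 n) ι x w) : ℂ)) (mfderiv_infAct hι x hd a).symm

lemma IsNeat.momentMap_eq_zero (hneat : IsNeat A (fun x ↦ μ (ι x))) {x : M}
    (hx : ∀ a, A.momentTrace (fun x ↦ μ (ι x)) x a = 0) (a : GroupLieAlgebra (𝓡 k) G) :
    μ (ι x) a = 0 := by
  have h := A.momentTrace_of_lieDeriv_eq (fun x ↦ μ (ι x)) a (hneat.infinitesimal x hx a)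
  rw [hx a] at h
  exact_mod_cast (mul_eq_zero.1 h.symm).resolve_left Complex.I_ne_zero

/-- The brane reduction of a neat brane exists. -/
theorem IsNeat.nonempty_braneReduction [CompactSpace G] [T2Space M] [SecondCountableTopology M]
    (hneat : IsNeat A (fun x ↦ μ (ι x))) (hμ : IsHamiltonian G ωX μ)
    (hι : ∀ (g : G) (x : M), ι (g • x) = g • ι x)
    (hfree : ∀ x : X, (∀ a, μ x a = 0) → ∀ g : G, g • x = x → g = 1) :
    Nonempty (BraneReduction A (fun x ↦ μ (ι x))) := by
  obtain ⟨L⟩ := hneat.clean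
  have hinv := hμ.momentTrace_smul_eq_zero (A := A) hι
  have hfree' : ∀ x : M, (∀ a, A.momentTrace (fun x ↦ μ (ι x)) x a = 0) →
      ∀ g : G, g • x = x → g = 1 := fun x hx g hg ↦
    hfree (ι x) (hneat.momentMap_eq_zero hx) g (by rw [← hι, hg])
  obtain ⟨Q⟩ := CleanLevel.nonempty_levelQuotient (L := L) k hinv hfree'
  obtain ⟨B, iso, h1, h2⟩ := A.exists_descent Q hinv hfree' hneat.infinitesimal
  exact ⟨⟨L, Q, B, iso, h1, fun z s hs ↦ (h2 z s hs).1, fun z s hs ↦ (h2 z s hs).2⟩⟩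

end

section

namespace BraneReduction

variable {m k : ℕ} {F : Type u} [NormedAddCommGroup F] [NormedSpace ℂ F]
  {M : Type v} [TopologicalSpace M] [ChartedSpace (EuclideanSpace ℝ (Fin m)) M]
  [IsManifold (𝓡 m) ∞ M] {E : HermitianBundle.{u, v, w} m F M}
  [FiniteDimensional ℂ F]
  {G : Type*} [Group G] [TopologicalSpace G]
  [ChartedSpace (EuclideanSpace ℝ (Fin k)) G] [LieGroup (𝓡 k) ∞ G]
  [MulAction G M] [ContMDiffSMul (𝓡 k) (𝓡 m) ∞ G M] {A : EquivariantStructure k G E}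
  {μM : M → Module.Dual ℝ (GroupLieAlgebra (𝓡 k) G)} (B : BraneReduction A μM)
  {Ω : TwoForm m M ℂ} (hΩ : IsTransverseHolomorphicSymplectic Ω)
  (hν : ∀ x (a : GroupLieAlgebra (𝓡 k) G) (w : TangentSpace (𝓡 m) x),
    mvfderiv (𝓡 m) (fun y ↦ A.momentTrace μM y a) x w = Ω x (infAct G x a) w)
  (hinv : ∀ (g : G) (x : M), (∀ a, A.momentTrace μM x a = 0) → ∀ a, A.momentTrace μM (g • x) a = 0)
  {Ω' : TwoForm B.quot.dim B.quot.Space ℂ}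
  (hΩ' : ∀ (z : B.level.Space) (u v : TangentSpace (𝓡 B.level.dim) z), Ω' (B.quot.proj z)
    (mfderiv (𝓡 B.level.dim) (𝓡 B.quot.dim) B.quot.proj z u)
    (mfderiv (𝓡 B.level.dim) (𝓡 B.quot.dim) B.quot.proj z v) =
    Ω (B.level.incl z) (mfderiv (𝓡 B.level.dim) (𝓡 m) B.level.incl z u)
      (mfderiv (𝓡 B.level.dim) (𝓡 m) B.level.incl z v))

include hν in
lemma exists_mfderiv_incl_eq_iff (z : B.level.Space) (s : TangentSpace (𝓡 m) (B.level.incl z)) :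
    (∃ u, mfderiv (𝓡 B.level.dim) (𝓡 m) B.level.incl z u = s) ↔
      ∀ a : GroupLieAlgebra (𝓡 k) G, Ω (B.level.incl z) (infAct G (B.level.incl z) a) s = 0 := by
  simp only [← hν]
  exact B.level.tangent z s

include hΩ in
lemma isComplexStable (x : M) : IsComplexStable (Ω x) :=
  exists_isTransverseComplexStructure_iff.1 (hΩ.complexStructure x)

include hΩ' in
lemma form_eq {z : B.level.Space} {q : B.quot.Space} (hq : B.quot.proj z = q) (u v : Eu B.quot.dim)
    (u' v' : TangentSpace (𝓡 B.level.dim) z)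
    (hu : mfderiv (𝓡 B.level.dim) (𝓡 B.quot.dim) B.quot.proj z u' = u)
    (hv : mfderiv (𝓡 B.level.dim) (𝓡 B.quot.dim) B.quot.proj z v' = v) :
    Ω' q u v = Ω (B.level.incl z) (mfderiv (𝓡 B.level.dim) (𝓡 m) B.level.incl z u')
      (mfderiv (𝓡 B.level.dim) (𝓡 m) B.level.incl z v') := by
  subst hq hu hv
  exact hΩ' z u' v'

include hΩ hΩ' in
lemma isClosedForm : IsClosedForm Ω' := by
  refine isClosedForm_of_local_pullback hΩ.toIsClosedForm fun q ↦
    ⟨fun y ↦ B.level.incl (B.quot.sec q y), B.quot.secDom q, B.quot.isOpen_secDom q,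
      B.quot.mem_secDom q, fun y hy ↦ (B.quot.contMDiffAt_incl_sec hy).contMDiffWithinAt,
      fun y hy u v ↦ ?_⟩
  rw [B.form_eq hΩ' (B.quot.proj_sec hy) u v _ _
    (B.quot.mfderiv_proj_sec hy u) (B.quot.mfderiv_proj_sec hy v)]
  exact congrArg₂ (fun a b : Eu m ↦ Ω (B.level.incl (B.quot.sec q y)) a b)
    (B.quot.mfderiv_incl_sec hy u).symm (B.quot.mfderiv_incl_sec hy v).symm

include hΩ hν in
lemma exists_rotate (z : B.level.Space) (u : TangentSpace (𝓡 B.level.dim) z) :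
    ∃ u' : TangentSpace (𝓡 B.level.dim) z, ∀ t, Ω (B.level.incl z)
      (mfderiv (𝓡 B.level.dim) (𝓡 m) B.level.incl z u') t = Complex.I * Ω (B.level.incl z)
      (mfderiv (𝓡 B.level.dim) (𝓡 m) B.level.incl z u) t := by
  obtain ⟨w, hw⟩ := isComplexStable hΩ (B.level.incl z)
    (mfderiv (𝓡 B.level.dim) (𝓡 m) B.level.incl z u)
  obtain ⟨u', hu'⟩ := (B.exists_mfderiv_incl_eq_iff hν z w).2
    (orthogonal_complexStable (χ := (infAct (k := k) (m := m) G (B.level.incl z)).toLinearMap)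
      (hΩ.alternating _) _
      ((B.exists_mfderiv_incl_eq_iff hν z _).1 ⟨u, rfl⟩) w hw)
  exact ⟨u', hu' ▸ hw⟩

include hΩ hν hΩ' in
lemma isComplexStable_reduced (q : B.quot.Space) : IsComplexStable (Ω' q) := by
  obtain ⟨z, rfl⟩ := B.quot.proj_surjective q
  intro u
  obtain ⟨u, rfl⟩ := B.quot.surjective_mfderiv_proj z u
  obtain ⟨w, hw⟩ := B.exists_rotate hΩ hν z u
  refine ⟨mfderiv (𝓡 B.level.dim) (𝓡 B.quot.dim) B.quot.proj z w, fun v ↦ ?_⟩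
  obtain ⟨v, rfl⟩ := B.quot.surjective_mfderiv_proj z v
  rw [hΩ', hΩ', hw]

variable [CompactSpace G] [T2Space M]
  (hfree : ∀ x : M, (∀ a, A.momentTrace μM x a = 0) → ∀ g : G, g • x = x → g = 1)

include hΩ hν hΩ' hinv hfree

lemma finrank_radical (z : B.level.Space) :
    Module.finrank ℝ (radical Ω' (B.quot.proj z)) + k + B.level.dim =
      m + Module.finrank ℝ (radical Ω (B.level.incl z)) := by
  have i1 : FiniteDimensional ℝ (TangentSpace (𝓡 m) (B.level.incl z)) :=
    inferInstanceAs (FiniteDimensional ℝ (Eu m))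
  have i2 : FiniteDimensional ℝ (TangentSpace (𝓡 B.level.dim) z) :=
    inferInstanceAs (FiniteDimensional ℝ (Eu B.level.dim))
  have i3 : FiniteDimensional ℝ (TangentSpace (𝓡 B.quot.dim) (B.quot.proj z)) :=
    inferInstanceAs (FiniteDimensional ℝ (Eu B.quot.dim))
  have i4 : FiniteDimensional ℝ (GroupLieAlgebra (𝓡 k) G) :=
    inferInstanceAs (FiniteDimensional ℝ (Eu k))
  have f1 : Module.finrank ℝ (TangentSpace (𝓡 m) (B.level.incl z)) = m :=
    finrank_euclideanSpace_fin
  have f2 : Module.finrank ℝ (TangentSpace (𝓡 B.level.dim) z) = B.level.dim :=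
    finrank_euclideanSpace_fin
  have f3 : Module.finrank ℝ (GroupLieAlgebra (𝓡 k) G) = k := finrank_euclideanSpace_fin
  have h := finrank_ker_reduced
    (hΩ.alternating (B.level.incl z)) (isComplexStable hΩ (B.level.incl z))
    (χ := (infAct (k := k) (m := m) G (B.level.incl z)).toLinearMap)
    (injective_infAct (hfree _ (B.level.incl_mem z)))
    (D := (mfderiv (𝓡 B.level.dim) (𝓡 m) B.level.incl z).toLinearMap)
    (P := (mfderiv (𝓡 B.level.dim) (𝓡 B.quot.dim) B.quot.proj z).toLinearMap)
    (B.level.injective_mfderiv_incl z) (B.exists_mfderiv_incl_eq_iff hν z)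
    (B.quot.surjective_mfderiv_proj z)
    (fun u ↦ ⟨B.quot.exists_infAct_of_mfderiv_proj_eq_zero (k := k) hinv hfree z u, fun ⟨a, ha⟩ ↦ by
      obtain ⟨w, hw, hw'⟩ := B.quot.mfderiv_proj_infAct (k := k) hinv z a
      have h := B.level.injective_mfderiv_incl z (hw.trans ha)
      exact h ▸ hw'⟩)
    (fun a ↦ (B.quot.mfderiv_proj_infAct (k := k) hinv z a).imp fun _ h ↦ h.1)
    (Ω' := Ω' (B.quot.proj z)) (hΩ' z)
  rw [f1, f2, f3] at h
  exact h

/-- The reduced form is transverse holomorphic symplectic. -/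
theorem isTransverseHolomorphicSymplectic : IsTransverseHolomorphicSymplectic Ω' := by
  refine ⟨B.isClosedForm hΩ hΩ', isSubbundle_radical (B.isClosedForm hΩ hΩ') fun q ↦ ?_, fun q ↦
    exists_isTransverseComplexStructure_iff.2 (B.isComplexStable_reduced hΩ hν hΩ' q)⟩
  have hr : ∀ y ∈ B.quot.secDom q, Module.finrank ℝ (radical Ω' y) + k + B.level.dim =
      m + Module.finrank ℝ (radical Ω (B.level.incl (B.quot.sec q y))) := by
    intro y hy
    have := B.finrank_radical hΩ hν hinv hΩ' hfree (B.quot.sec q y)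
    rwa [B.quot.proj_sec hy] at this
  have hq := B.quot.mem_secDom q
  have hc := ((B.quot.contMDiffAt_incl_sec hq).continuousAt).eventually
    (hΩ.subbundle.eventually_finrank_eq (B.level.incl (B.quot.sec q q)))
  filter_upwards [hc, (B.quot.isOpen_secDom q).mem_nhds hq] with y hy hyq
  have h1 := hr y hyq
  have h2 := hr q hq
  rw [hy] at h1
  omega

omit hfree [CompactSpace G] [T2Space M] in
lemma tracelessCurvature_eq_zero (hE : E.IsTransverseOneOne Ω) (z : B.level.Space)
    (u v : TangentSpace (𝓡 B.level.dim) z)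
    (hu : ∀ t, Ω' (B.quot.proj z) (mfderiv (𝓡 B.level.dim) (𝓡 B.quot.dim) B.quot.proj z u) t = 0) :
    E.tracelessCurvature (B.level.incl z) (mfderiv (𝓡 B.level.dim) (𝓡 m) B.level.incl z u)
      (mfderiv (𝓡 B.level.dim) (𝓡 m) B.level.incl z v) = 0 := by
  have hS := B.exists_mfderiv_incl_eq_iff hν z
  have : FiniteDimensional ℝ (GroupLieAlgebra (𝓡 k) G) :=
    inferInstanceAs (FiniteDimensional ℝ (Eu k))
  refine apply_eq_zero_of_orthogonal (χ := (infAct (k := k) (m := m) G (B.level.incl z)).toLinearMap)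
    (hΩ.alternating _) (isComplexStable hΩ _) (E.tracelessCurvatureₗ (B.level.incl z))
    (fun n v hn ↦ (hE.descends _ n v (LinearMap.mem_ker.2 (LinearMap.ext hn))).1)
    (fun u v u' v' h h' ↦ hE.apply_eq (hΩ.complexStructure _) h h') ?_ _ ?_ _
    ((hS _).1 ⟨v, rfl⟩)
  · intro a s hs
    obtain ⟨s, rfl⟩ := (hS s).2 hs
    obtain ⟨w, hw, hw'⟩ := B.quot.mfderiv_proj_infAct (k := k) hinv z a
    have h := B.tracelessCurvature_incl z w s
    rw [hw, hw'] at h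
    have h0 : B.bundle.tracelessCurvature (B.quot.proj z) 0
        (mfderiv (𝓡 B.level.dim) (𝓡 B.quot.dim) B.quot.proj z s) = 0 :=
      LinearMap.map_zero₂ (B.bundle.tracelessCurvatureₗ (B.quot.proj z)) _
    rw [h0] at h
    exact h.trans (LinearEquiv.map_zero _)
  · intro s hs
    obtain ⟨s, rfl⟩ := (hS s).2 hs
    rw [← hΩ', hu]

omit hfree [CompactSpace G] [T2Space M] in
/-- The traceless curvature of the reduction is of transverse type `(1,1)`. -/
theorem isTransverseOneOne (hE : E.IsTransverseOneOne Ω) : B.bundle.IsTransverseOneOne Ω' := by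
  have hzero : ∀ (q : B.quot.Space) (u v : TangentSpace (𝓡 B.quot.dim) q), u ∈ radical Ω' q →
      B.bundle.tracelessCurvature q u v = 0 := by
    intro q u v hu
    obtain ⟨z, rfl⟩ := B.quot.proj_surjective q
    obtain ⟨u, rfl⟩ := B.quot.surjective_mfderiv_proj z u
    obtain ⟨v, rfl⟩ := B.quot.surjective_mfderiv_proj z v
    have h := B.tracelessCurvature_eq_zero hΩ hν hinv hΩ' hE z u v
      (fun t ↦ LinearMap.congr_fun (LinearMap.mem_ker.1 hu) t)
    rw [B.tracelessCurvature_incl] at h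
    exact (LinearEquiv.map_eq_zero_iff _).1 h
  refine ⟨fun q u v hu ↦ ⟨hzero q u v hu, ?_⟩, fun q I hI u v u' v' hu hv ↦ ?_⟩
  · rw [HermitianBundle.tracelessCurvature_swap, hzero q u v hu, neg_zero]
  have hcongr : ∀ a b c : TangentSpace (𝓡 B.quot.dim) q, (∀ t, Ω' q a t = Ω' q b t) →
      B.bundle.tracelessCurvature q a c = B.bundle.tracelessCurvature q b c := by
    intro a b c h
    have h1 : (B.bundle.tracelessCurvatureₗ q) (a - b) c = 0 :=
      hzero q (a - b) c (LinearMap.mem_ker.2 (LinearMap.ext fun t ↦ by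
        rw [map_sub, LinearMap.sub_apply, h, sub_self, LinearMap.zero_apply]))
    rw [map_sub, LinearMap.sub_apply, sub_eq_zero] at h1
    exact h1
  have hu := hI.apply_eq hu
  have hv := hI.apply_eq hv
  obtain ⟨z, rfl⟩ := B.quot.proj_surjective q
  obtain ⟨u, rfl⟩ := B.quot.surjective_mfderiv_proj z u
  obtain ⟨v, rfl⟩ := B.quot.surjective_mfderiv_proj z v
  obtain ⟨a, ha⟩ := B.exists_rotate hΩ hν z u
  obtain ⟨b, hb⟩ := B.exists_rotate hΩ hν z v
  have key : ∀ (a u : TangentSpace (𝓡 B.level.dim) z),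
      (∀ t, Ω (B.level.incl z) (mfderiv (𝓡 B.level.dim) (𝓡 m) B.level.incl z a) t =
        Complex.I * Ω (B.level.incl z) (mfderiv (𝓡 B.level.dim) (𝓡 m) B.level.incl z u) t) →
      ∀ t, Ω' (B.quot.proj z) (mfderiv (𝓡 B.level.dim) (𝓡 B.quot.dim) B.quot.proj z a) t =
        Complex.I * Ω' (B.quot.proj z)
          (mfderiv (𝓡 B.level.dim) (𝓡 B.quot.dim) B.quot.proj z u) t := by
    intro a u h t
    obtain ⟨t, rfl⟩ := B.quot.surjective_mfderiv_proj z t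
    rw [hΩ', hΩ', h]
  rw [hcongr u' _ v' fun t ↦ (hu t).trans (key a u ha t).symm,
    HermitianBundle.tracelessCurvature_swap,
    hcongr v' _ _ fun t ↦ (hv t).trans (key b v hb t).symm,
    ← HermitianBundle.tracelessCurvature_swap]
  have h := hE.apply_eq (hΩ.complexStructure (B.level.incl z)) ha hb
  rw [B.tracelessCurvature_incl, B.tracelessCurvature_incl] at h
  exact LinearEquiv.injective _ h

end BraneReduction

end

section

section InducedMap

variable {m n k : ℕ} {G : Type*} [Group G] [TopologicalSpace G]
  [ChartedSpace (EuclideanSpace ℝ (Fin k)) G] [LieGroup (𝓡 k) ∞ G]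
  {M : Type v} [TopologicalSpace M] [ChartedSpace (EuclideanSpace ℝ (Fin m)) M]
  [IsManifold (𝓡 m) ∞ M] [MulAction G M] [ContMDiffSMul (𝓡 k) (𝓡 m) ∞ G M]
  {X : Type*} [TopologicalSpace X] [ChartedSpace (EuclideanSpace ℝ (Fin n)) X]
  [IsManifold (𝓡 n) ∞ X] [MulAction G X] [ContMDiffSMul (𝓡 k) (𝓡 n) ∞ G X]
  {A V A' V' : Type*} [NormedAddCommGroup V] [NormedSpace ℝ V] [NormedAddCommGroup V']
  [NormedSpace ℝ V'] {φ : M → A → V} {ψ : X → A' → V'} {L : CleanLevel m φ} {L' : CleanLevel n ψ}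
  {ι : M → X} (h0 : ∀ x, (∀ a, φ x a = 0) → ∀ a, ψ (ι x) a = 0)

variable (L L') in
/-- The map of levels induced by `ι`. -/
def CleanLevel.map : L.Space → L'.Space := fun z ↦ ⟨ι (L.incl z), h0 _ (L.incl_mem z)⟩

lemma CleanLevel.incl_map (z : L.Space) : L'.incl (L.map L' h0 z) = ι (L.incl z) := rfl

lemma CleanLevel.contMDiff_map (hs : ContMDiff (𝓡 m) (𝓡 n) ∞ ι) :
    ContMDiff (𝓡 L.dim) (𝓡 L'.dim) ∞ (L.map L' h0) := by
  have h1 : ContMDiff (𝓡 L.dim) (𝓡 n) ∞ (fun z ↦ ι (L.incl z)) := hs.comp L.contMDiff_incl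
  exact (ContMDiff.iff_comp_isImmersion L'.isImmersion_incl).2 ⟨h1.continuous.subtype_mk _, h1⟩

lemma CleanLevel.mfderiv_incl_map (hs : ContMDiff (𝓡 m) (𝓡 n) ∞ ι) (z : L.Space)
    (u : TangentSpace (𝓡 L.dim) z) :
    (mfderiv (𝓡 L'.dim) (𝓡 n) L'.incl (L.map L' h0 z)
      (mfderiv (𝓡 L.dim) (𝓡 L'.dim) (L.map L' h0) z u) : Eu n) =
      mfderiv (𝓡 m) (𝓡 n) ι (L.incl z) (mfderiv (𝓡 L.dim) (𝓡 m) L.incl z u) := by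
  have h1 := mfderiv_comp_apply (I := 𝓡 L.dim) (I' := 𝓡 L'.dim) (I'' := 𝓡 n) (g := L'.incl)
    (f := L.map L' h0) z (L'.mdiff_incl _)
    ((L.contMDiff_map h0 hs).contMDiffAt.mdifferentiableAt (by simp)) u
  have h2 := mfderiv_comp_apply (I := 𝓡 L.dim) (I' := 𝓡 m) (I'' := 𝓡 n) (g := ι) (f := L.incl) z
    (hs.contMDiffAt.mdifferentiableAt (by simp)) (L.mdiff_incl _) u
  exact h1.symm.trans h2

lemma CleanLevel.isEmbedding_map (he : IsEmbedding ι) : IsEmbedding (L.map L' h0) := by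
  have h1 : IsEmbedding (fun z ↦ ι (L.incl z)) := he.comp IsEmbedding.subtypeVal
  exact IsEmbedding.of_comp (h1.continuous.subtype_mk _) continuous_subtype_val h1

namespace LevelQuotient

variable (Q : LevelQuotient G L) (Q' : LevelQuotient G L')

/-- The map of quotients of levels induced by `ι`. -/
def map : Q.Space → Q'.Space := fun q ↦ Q'.proj (L.map L' h0 (Q.rep q))

variable (hι : ∀ (g : G) (x : M), ι (g • x) = g • ι x)

include hι

lemma map_proj (z : L.Space) : Q.map h0 Q' (Q.proj z) = Q'.proj (L.map L' h0 z) := by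
  obtain ⟨g, hg⟩ := Q.proj_eq_iff.1 (Q.proj_rep (Q.proj z))
  exact Q'.proj_eq_iff.2 ⟨g, by rw [L.incl_map, L.incl_map, ← hι, hg]⟩

lemma contMDiff_map (hs : ContMDiff (𝓡 m) (𝓡 n) ∞ ι) :
    ContMDiff (𝓡 Q.dim) (𝓡 Q'.dim) ∞ (Q.map h0 Q') := by
  intro q
  have hq := Q.mem_secDom q
  have h1 : ContMDiffAt (𝓡 Q.dim) (𝓡 Q'.dim) ∞ (fun y ↦ Q'.proj (L.map L' h0 (Q.sec q y))) q :=
    ContMDiffAt.comp q (g := fun z ↦ Q'.proj (L.map L' h0 z)) (f := Q.sec q)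
      (Q'.contMDiff_proj.comp (L.contMDiff_map h0 hs)).contMDiffAt (Q.contMDiffAt_sec hq)
  refine h1.congr_of_eventuallyEq ?_
  filter_upwards [(Q.isOpen_secDom q).mem_nhds hq] with y hy
  rw [← Q.map_proj h0 Q' hι, Q.proj_sec hy]

lemma mfderiv_map_proj (hs : ContMDiff (𝓡 m) (𝓡 n) ∞ ι) (z : L.Space)
    (u : TangentSpace (𝓡 L.dim) z) :
    (mfderiv (𝓡 Q.dim) (𝓡 Q'.dim) (Q.map h0 Q') (Q.proj z)
      (mfderiv (𝓡 L.dim) (𝓡 Q.dim) Q.proj z u) : Eu Q'.dim) =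
      mfderiv (𝓡 L'.dim) (𝓡 Q'.dim) Q'.proj (L.map L' h0 z)
        (mfderiv (𝓡 L.dim) (𝓡 L'.dim) (L.map L' h0) z u) := by
  have h1 := mfderiv_comp_apply (I := 𝓡 L.dim) (I' := 𝓡 Q.dim) (I'' := 𝓡 Q'.dim)
    (g := Q.map h0 Q') (f := Q.proj) z
    ((Q.contMDiff_map h0 Q' hι hs).contMDiffAt.mdifferentiableAt (by simp)) (Q.mdiff_proj z) u
  have h2 := mfderiv_comp_apply (I := 𝓡 L.dim) (I' := 𝓡 L'.dim) (I'' := 𝓡 Q'.dim) (g := Q'.proj)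
    (f := L.map L' h0) z (Q'.mdiff_proj _)
    ((L.contMDiff_map h0 hs).contMDiffAt.mdifferentiableAt (by simp)) u
  have h3 : Q.map h0 Q' ∘ Q.proj = Q'.proj ∘ L.map L' h0 := funext (Q.map_proj h0 Q' hι)
  rw [h3] at h1
  exact h1.symm.trans h2

variable (hinv : ∀ (g : G) (x : M), (∀ a, φ x a = 0) → ∀ a, φ (g • x) a = 0)
  (hinv' : ∀ (g : G) (x : X), (∀ a, ψ x a = 0) → ∀ a, ψ (g • x) a = 0)

include hinv hinv'

lemma isEmbedding_map (hc : ∀ g : G, Continuous fun x : X ↦ g • x) (he : IsEmbedding ι) (hs : ContMDiff (𝓡 m) (𝓡 n) ∞ ι) :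
    IsEmbedding (Q.map h0 Q') := by
  have hinj : Function.Injective (Q.map h0 Q') := by
    intro q q' h
    obtain ⟨z, rfl⟩ := Q.proj_surjective q
    obtain ⟨z', rfl⟩ := Q.proj_surjective q'
    rw [Q.map_proj h0 Q' hι, Q.map_proj h0 Q' hι] at h
    obtain ⟨g, hg⟩ := Q'.proj_eq_iff.1 h
    rw [L.incl_map, L.incl_map, ← hι] at hg
    exact Q.proj_eq_iff.2 ⟨g, he.injective hg⟩
  let _ := L'.action hinv'
  have : ContinuousConstSMul G L'.Space :=
    ⟨fun g ↦ ((hc g).comp continuous_subtype_val).subtype_mk _⟩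
  have hopen : IsOpenMap Q'.proj := isOpenMap_mk_orbit (L'.orbitSetoid_iff hinv')
  refine ⟨⟨le_antisymm (Q.contMDiff_map h0 Q' hι hs).continuous.le_induced fun U hU ↦ ?_⟩, hinj⟩
  obtain ⟨W, hW, hWU⟩ := (L.isEmbedding_map (L' := L') h0 he).isInducing.isOpen_iff.1
    (hU.preimage Q.contMDiff_proj.continuous)
  have hmem : ∀ z, L.map L' h0 z ∈ W ↔ Q.proj z ∈ U := fun z ↦ by
    rw [← mem_preimage, hWU, mem_preimage]
  refine isOpen_induced_iff.2 ⟨Q'.proj '' W, hopen W hW, ?_⟩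
  ext q
  obtain ⟨z, rfl⟩ := Q.proj_surjective q
  rw [mem_preimage, Q.map_proj h0 Q' hι]
  constructor
  · rintro ⟨y, hy, hyz⟩
    obtain ⟨g, hg⟩ := Q'.proj_eq_iff.1 hyz.symm
    let z' : L.Space := ⟨g • L.incl z, hinv g _ (L.incl_mem z)⟩
    have h1 : L.map L' h0 z' = y := L'.incl_injective ((hι g (L.incl z)).trans hg)
    have h2 : Q.proj z = Q.proj z' := Q.proj_eq_iff.2 ⟨g, rfl⟩
    rw [h2, ← hmem, h1]
    exact hy
  · intro h
    exact ⟨_, (hmem z).2 h, rfl⟩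

/-- An equivariant embedding of manifolds induces an embedding of quotients of levels. -/
theorem isSmoothEmbedding_map (k : ℕ) [ChartedSpace (EuclideanSpace ℝ (Fin k)) G]
    [LieGroup (𝓡 k) ∞ G] [ContMDiffSMul (𝓡 k) (𝓡 m) ∞ G M] [ContMDiffSMul (𝓡 k) (𝓡 n) ∞ G X]
    [CompactSpace G] [T2Space X]
    (hfree : ∀ x : X, (∀ a, ψ x a = 0) → ∀ g : G, g • x = x → g = 1)
    (he : IsSmoothEmbedding (𝓡 m) (𝓡 n) ∞ ι) :
    IsSmoothEmbedding (𝓡 Q.dim) (𝓡 Q'.dim) ∞ (Q.map h0 Q') := by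
  have hs : ContMDiff (𝓡 m) (𝓡 n) ∞ ι := he.isImmersion.contMDiff
  refine ⟨isImmersion_of_injective (Q.contMDiff_map h0 Q' hι hs) fun q ↦ ?_,
    Q.isEmbedding_map h0 Q' hι hinv hinv'
      (fun g ↦ (contMDiff_const_smul (m := n) k g).continuous)
      he.isEmbedding hs⟩
  obtain ⟨z, rfl⟩ := Q.proj_surjective q
  refine (injective_iff_map_eq_zero _).2 fun u hu ↦ ?_
  obtain ⟨u, rfl⟩ := Q.surjective_mfderiv_proj z u
  obtain ⟨a, ha⟩ := Q'.exists_infAct_of_mfderiv_proj_eq_zero (k := k) hinv' hfree (L.map L' h0 z)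
    (mfderiv (𝓡 L.dim) (𝓡 L'.dim) (L.map L' h0) z u)
    ((Q.mfderiv_map_proj h0 Q' hι hs z u).symm.trans hu)
  obtain ⟨w, hw, hw'⟩ := Q.mfderiv_proj_infAct (k := k) hinv z a
  have h1 : mfderiv (𝓡 m) (𝓡 n) ι (L.incl z) (infAct G (L.incl z) a) = infAct G (ι (L.incl z)) a :=
    mfderiv_infAct hι _ (hs.contMDiffAt.mdifferentiableAt (by simp)) a
  have h2 := injective_mfderiv_of_isImmersion he.isImmersion (L.incl z)
    (h1.trans (ha.trans (L.mfderiv_incl_map h0 hs z u)))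
  have h3 := L.injective_mfderiv_incl z (hw.trans h2)
  rwa [h3] at hw'

end LevelQuotient

end InducedMap

variable {m k n : ℕ} {F : Type u} [NormedAddCommGroup F] [NormedSpace ℂ F]
  {M : Type v} [TopologicalSpace M] [ChartedSpace (EuclideanSpace ℝ (Fin m)) M]
  [IsManifold (𝓡 m) ∞ M] {E : HermitianBundle.{u, v, w} m F M}
  [FiniteDimensional ℂ F] [Nontrivial F]
  {G : Type*} [Group G] [TopologicalSpace G]
  [ChartedSpace (EuclideanSpace ℝ (Fin k)) G] [LieGroup (𝓡 k) ∞ G]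
  [MulAction G M] [ContMDiffSMul (𝓡 k) (𝓡 m) ∞ G M] {A : EquivariantStructure k G E}
  {X : Type*} [TopologicalSpace X] [ChartedSpace (EuclideanSpace ℝ (Fin n)) X]
  [IsManifold (𝓡 n) ∞ X] [MulAction G X] [ContMDiffSMul (𝓡 k) (𝓡 n) ∞ G X]
  {ωX : TwoForm n X ℝ} {μ : X → Module.Dual ℝ (GroupLieAlgebra (𝓡 k) G)} {ι : M → X}

omit [Nontrivial F] [MulAction G M] [ContMDiffSMul (𝓡 k) (𝓡 m) ∞ G M] [IsManifold (𝓡 n) ∞ X] in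
lemma HermitianBundle.braneForm_im (x : M) (u v : TangentSpace (𝓡 m) x) :
    (E.braneForm ωX ι x u v).im =
      ωX (ι x) (mfderiv (𝓡 m) (𝓡 n) ι x u) (mfderiv (𝓡 m) (𝓡 n) ι x v) := by
  have h : E.braneForm ωX ι x u v = E.traceCurvature x u v + Complex.I *
      (ωX (ι x) (mfderiv (𝓡 m) (𝓡 n) ι x u) (mfderiv (𝓡 m) (𝓡 n) ι x v) : ℂ) := rfl
  rw [h, Complex.add_im, HermitianBundle.traceCurvature_im]
  simp

omit [Nontrivial F] in
/-- A vector orthogonal to the orthogonal of a subspace of `TC` is tangent to `C`, and it belongs to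
the complex span of this subspace, if `C` is coisotropic. -/
lemma IsCoisotropicABrane.exists_mfderiv_eq (hB : IsCoisotropicABrane ωX ι E)
    {𝔤 : Type*}
    [AddCommGroup 𝔤] [Module ℝ 𝔤] [FiniteDimensional ℝ 𝔤] {x : M}
    (χ : 𝔤 →ₗ[ℝ] TangentSpace (𝓡 m) x) (hχ : ∀ a b, E.braneForm ωX ι x (χ a) (χ b) = 0)
    (y : TangentSpace (𝓡 n) (ι x))
    (hy : ∀ s, (∀ a, E.braneForm ωX ι x (χ a) s = 0) → ωX (ι x) y (mfderiv (𝓡 m) (𝓡 n) ι x s) = 0) :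
    ∃ s, (∀ a, E.braneForm ωX ι x (χ a) s = 0) ∧ mfderiv (𝓡 m) (𝓡 n) ι x s = y := by
  have halt := hB.holomorphicSymplectic.alternating x
  have hΩ := exists_isTransverseComplexStructure_iff.1 (hB.holomorphicSymplectic.complexStructure x)
  obtain ⟨a, b, w, hw, hK⟩ := exists_eq_im_apply hΩ (χ := χ)
    ((ωX (ι x) y).comp (mfderiv (𝓡 m) (𝓡 n) ι x).toLinearMap) hy
  have hK' : ∀ v, ωX (ι x) y (mfderiv (𝓡 m) (𝓡 n) ι x v) =
    ωX (ι x) (mfderiv (𝓡 m) (𝓡 n) ι x (χ a + w)) (mfderiv (𝓡 m) (𝓡 n) ι x v) := fun v ↦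
      (hK v).trans (HermitianBundle.braneForm_im x _ v)
  obtain ⟨t, ht⟩ := hB.coisotropic x (y - mfderiv (𝓡 m) (𝓡 n) ι x (χ a + w)) fun v ↦ by
    rw [map_sub, LinearMap.sub_apply, hK', sub_self]
  have ht0 : ∀ v, E.braneForm ωX ι x t v = 0 := fun v ↦
    apply_eq_zero_of_im halt hΩ (S := ⊤) (fun _ _ _ _ ↦ trivial) (fun v _ ↦ by
      rw [HermitianBundle.braneForm_im, ht, map_sub, LinearMap.sub_apply, hK', sub_self]) v trivial
  refine ⟨t + (χ a + w), fun c ↦ ?_, by rw [map_add, ht, sub_add_cancel]⟩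
  rw [map_add, map_add, hχ, apply_swap_of_alternating halt _ t, ht0,
    apply_swap_of_alternating halt _ w, hw, hχ]
  simp

namespace BraneReduction

variable (hneat : IsNeat A (fun x ↦ μ (ι x))) (R : SymplecticReduction G ωX μ)
  (B : BraneReduction A (fun x ↦ μ (ι x)))

/-- The map from the reduced brane to the symplectic reduction. -/
def toReduction : B.quot.Space → R.quot.Space :=
  B.quot.map (L' := R.level) (ι := ι) (fun _ ↦ hneat.momentMap_eq_zero (μ := μ) (ι := ι)) R.quot

variable (hμ : IsHamiltonian G ωX μ) (hι : ∀ (g : G) (x : M), ι (g • x) = g • ι x)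
  (hB : IsCoisotropicABrane ωX ι E)

include hι hB in
lemma form_toReduction (z : B.level.Space) (u v : TangentSpace (𝓡 B.level.dim) z) :
    R.form (B.toReduction hneat R (B.quot.proj z))
      (mfderiv (𝓡 B.quot.dim) (𝓡 R.quot.dim) (B.toReduction hneat R) (B.quot.proj z)
        (mfderiv (𝓡 B.level.dim) (𝓡 B.quot.dim) B.quot.proj z u))
      (mfderiv (𝓡 B.quot.dim) (𝓡 R.quot.dim) (B.toReduction hneat R) (B.quot.proj z)
        (mfderiv (𝓡 B.level.dim) (𝓡 B.quot.dim) B.quot.proj z v)) =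
      ωX (ι (B.level.incl z))
        (mfderiv (𝓡 m) (𝓡 n) ι (B.level.incl z) (mfderiv (𝓡 B.level.dim) (𝓡 m) B.level.incl z u))
        (mfderiv (𝓡 m) (𝓡 n) ι (B.level.incl z)
          (mfderiv (𝓡 B.level.dim) (𝓡 m) B.level.incl z v)) := by
  have hs : ContMDiff (𝓡 m) (𝓡 n) ∞ ι := hB.embedding.isImmersion.contMDiff
  have h0 := fun x ↦ hneat.momentMap_eq_zero (μ := μ) (ι := ι) (x := x)
  have hp := B.quot.map_proj (L' := R.level) (ι := ι) h0 R.quot hι z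
  have key : ∀ (p : R.quot.Space) (a b a' b' : Eu R.quot.dim),
      p = R.quot.proj (B.level.map R.level h0 z) → a = a' → b = b' →
      R.form p a b = R.form (R.quot.proj (B.level.map R.level h0 z)) a' b' := by
    rintro p a b a' b' rfl rfl rfl; rfl
  refine (key _ _ _ _ _ hp (B.quot.mfderiv_map_proj (L' := R.level) (ι := ι) h0 R.quot hι hs z u)
    (B.quot.mfderiv_map_proj (L' := R.level) (ι := ι) h0 R.quot hι hs z v)).trans ((R.pullback _ _ _).trans ?_)
  exact congrArg₂ (fun a b : Eu n ↦ ωX (ι (B.level.incl z)) a b)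
    (B.level.mfderiv_incl_map (L' := R.level) (ι := ι) h0 hs z u) (B.level.mfderiv_incl_map (L' := R.level) (ι := ι) h0 hs z v)

include hι hB in
lemma braneForm_toReduction (z : B.level.Space) (u v : TangentSpace (𝓡 B.level.dim) z) :
    B.bundle.braneForm R.form (B.toReduction hneat R) (B.quot.proj z)
      (mfderiv (𝓡 B.level.dim) (𝓡 B.quot.dim) B.quot.proj z u)
      (mfderiv (𝓡 B.level.dim) (𝓡 B.quot.dim) B.quot.proj z v) =
    E.braneForm ωX ι (B.level.incl z) (mfderiv (𝓡 B.level.dim) (𝓡 m) B.level.incl z u)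
      (mfderiv (𝓡 B.level.dim) (𝓡 m) B.level.incl z v) := by
  simp only [HermitianBundle.braneForm, LinearMap.mk₂_apply]
  rw [B.form_toReduction hneat R hι hB, B.traceCurvature_incl]

variable [CompactSpace G] [T2Space M]

include hμ hι hB in
lemma coisotropic_toReduction (z : B.level.Space) (y : Eu R.quot.dim)
    (hy : ∀ u, R.form (R.quot.proj (B.level.map R.level (ι := ι) (fun _ ↦ hneat.momentMap_eq_zero (μ := μ) (ι := ι)) z)) y
      (mfderiv (𝓡 R.level.dim) (𝓡 R.quot.dim) R.quot.proj _
        (mfderiv (𝓡 B.level.dim) (𝓡 R.level.dim)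
          (B.level.map R.level (ι := ι) fun _ ↦ hneat.momentMap_eq_zero (μ := μ) (ι := ι)) z u)) = 0) :
    ∃ u, mfderiv (𝓡 R.level.dim) (𝓡 R.quot.dim) R.quot.proj _
        (mfderiv (𝓡 B.level.dim) (𝓡 R.level.dim)
          (B.level.map R.level (ι := ι) fun _ ↦ hneat.momentMap_eq_zero (μ := μ) (ι := ι)) z u) = y := by
  have hs : ContMDiff (𝓡 m) (𝓡 n) ∞ ι := hB.embedding.isImmersion.contMDiff
  have h0 := fun x ↦ hneat.momentMap_eq_zero (μ := μ) (ι := ι) (x := x)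
  have hν := fun x (a : GroupLieAlgebra (𝓡 k) G) (w : TangentSpace (𝓡 m) x) ↦
    hμ.mvfderiv_momentTrace (A := A) hι (hs.contMDiffAt.mdifferentiableAt (x := x) (by simp)) a w
  have hS := B.exists_mfderiv_incl_eq_iff hν z
  have hinv := hμ.momentTrace_smul_eq_zero (A := A) hι
  have : FiniteDimensional ℝ (GroupLieAlgebra (𝓡 k) G) :=
    inferInstanceAs (FiniteDimensional ℝ (Eu k))
  obtain ⟨y, rfl⟩ := R.quot.surjective_mfderiv_proj (B.level.map R.level h0 z) y
  obtain ⟨s, hs1, hs2⟩ := hB.exists_mfderiv_eq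
    (infAct (k := k) (m := m) G (B.level.incl z)).toLinearMap (fun a b ↦ by
      obtain ⟨w, hw, -⟩ := B.quot.mfderiv_proj_infAct (k := k) hinv z b
      exact (hS _).1 ⟨w, hw⟩ a)
    (mfderiv (𝓡 R.level.dim) (𝓡 n) R.level.incl (B.level.map R.level h0 z) y) (fun s hs' ↦ by
      obtain ⟨u, rfl⟩ := (hS s).2 hs'
      refine Eq.trans ?_ ((R.pullback _ _ _).symm.trans (hy u))
      exact congrArg (fun a : Eu n ↦ ωX (ι (B.level.incl z)) (mfderiv (𝓡 R.level.dim) (𝓡 n)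
        R.level.incl (B.level.map R.level h0 z) y) a) (B.level.mfderiv_incl_map (L' := R.level) (ι := ι) h0 hs z u).symm)
  obtain ⟨u, rfl⟩ := (hS s).2 hs1
  refine ⟨u, ?_⟩
  have h := R.level.injective_mfderiv_incl _ ((B.level.mfderiv_incl_map (L' := R.level) (ι := ι) h0 hs z u).trans hs2)
  exact congrArg _ h

include hμ hι hB in
/-- The reduction of a neat brane is a coisotropic A-brane on the symplectic reduction. -/
theorem isCoisotropicABrane [T2Space X]
    (hfree : ∀ x : X, (∀ a, μ x a = 0) → ∀ g : G, g • x = x → g = 1) :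
    IsCoisotropicABrane R.form (B.toReduction hneat R) B.bundle := by
  have hs : ContMDiff (𝓡 m) (𝓡 n) ∞ ι := hB.embedding.isImmersion.contMDiff
  have h0 := fun x ↦ hneat.momentMap_eq_zero (μ := μ) (ι := ι) (x := x)
  have hν := fun x (a : GroupLieAlgebra (𝓡 k) G) (w : TangentSpace (𝓡 m) x) ↦
    hμ.mvfderiv_momentTrace (A := A) hι (hs.contMDiffAt.mdifferentiableAt (x := x) (by simp)) a w
  have hinv := hμ.momentTrace_smul_eq_zero (A := A) hι
  have hfree' : ∀ x : M, (∀ a, A.momentTrace (fun x ↦ μ (ι x)) x a = 0) →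
      ∀ g : G, g • x = x → g = 1 := fun x hx g hg ↦
    hfree (ι x) (hneat.momentMap_eq_zero hx) g (by rw [← hι, hg])
  have hform := B.braneForm_toReduction hneat R hι hB
  refine ⟨B.quot.isSmoothEmbedding_map (L' := R.level) (ι := ι) h0 R.quot hι hinv
    (k := k) (fun g _ hx ↦ hμ.map_smul_eq_zero g hx) hfree hB.embedding, fun q y hy ↦ ?_,
    B.isTransverseHolomorphicSymplectic hB.holomorphicSymplectic hν hinv hform hfree',
    B.isTransverseOneOne hB.holomorphicSymplectic hν hinv hform hB.oneOne⟩
  obtain ⟨z, rfl⟩ := B.quot.proj_surjective q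
  have hp := B.quot.map_proj (L' := R.level) (ι := ι) h0 R.quot hι z
  have key : ∀ (p : R.quot.Space) (a b b' : Eu R.quot.dim),
      p = R.quot.proj (B.level.map R.level h0 z) → b = b' →
      R.form (R.quot.proj (B.level.map R.level h0 z)) a b' = R.form p a b := by
    rintro p a b b' rfl rfl; rfl
  obtain ⟨u, hu⟩ := B.coisotropic_toReduction hneat R hμ hι hB z y fun u ↦
    (key _ y _ _ hp (B.quot.mfderiv_map_proj (L' := R.level) (ι := ι) h0 R.quot hι hs z u)).trans (hy _)
  exact ⟨_, (B.quot.mfderiv_map_proj (L' := R.level) (ι := ι) h0 R.quot hι hs z u).trans hu⟩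

end BraneReduction

end

end ABrane

end

theorem theorem4p11 {n m k : ℕ}
    {G : Type*} [Group G] [TopologicalSpace G] [ChartedSpace (EuclideanSpace ℝ (Fin k)) G]
    [LieGroup (𝓡 k) ∞ G] [T2Space G] [CompactSpace G] [ConnectedSpace G]
    {X : Type*} [TopologicalSpace X] [ChartedSpace (EuclideanSpace ℝ (Fin n)) X]
    [IsManifold (𝓡 n) ∞ X] [T2Space X] [SecondCountableTopology X]
    [MulAction G X] [ContMDiffSMul (𝓡 k) (𝓡 n) ∞ G X]
    (ωX : ABrane.TwoForm n X ℝ) (hωX : ABrane.IsSymplectic ωX)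
    (μ : X → Module.Dual ℝ (GroupLieAlgebra (𝓡 k) G)) (hμ : ABrane.IsHamiltonian G ωX μ)
    (hfree : ∀ x : X, μ x = 0 → ∀ g : G, g • x = x → g = 1)
    {C : Type*} [TopologicalSpace C] [ChartedSpace (EuclideanSpace ℝ (Fin m)) C]
    [IsManifold (𝓡 m) ∞ C] [MulAction G C] [ContMDiffSMul (𝓡 k) (𝓡 m) ∞ G C]
    (ι : C → X) (hι : ∀ (g : G) (x : C), ι (g • x) = g • ι x)
    {F : Type*} [NormedAddCommGroup F] [NormedSpace ℂ F] [FiniteDimensional ℂ F] [Nontrivial F]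
    (E : ABrane.HermitianBundle m F C) (A : ABrane.EquivariantStructure k G E)
    (hB : ABrane.IsCoisotropicABrane ωX ι E)
    (hneat : ABrane.IsNeat A (fun x ↦ μ (ι x))) :
    Nonempty (ABrane.SymplecticReduction G ωX μ) ∧
    Nonempty (ABrane.BraneReduction A (fun x ↦ μ (ι x))) ∧
    ∀ (R : ABrane.SymplecticReduction G ωX μ) (B : ABrane.BraneReduction A (fun x ↦ μ (ι x))),
      ∃ κ : B.quot.Space → R.quot.Space,
        (∀ x : B.level.Space, ∃ y : R.level.Space,
          R.level.incl y = ι (B.level.incl x) ∧ κ (B.quot.proj x) = R.quot.proj y) ∧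
        ABrane.IsCoisotropicABrane R.form κ B.bundle := by
  have hfree' : ∀ x : X, (∀ a, μ x a = 0) → ∀ g : G, g • x = x → g = 1 := fun x hx ↦
    hfree x (LinearMap.ext hx)
  have := hB.embedding.isEmbedding.t2Space
  have := hB.embedding.isEmbedding.secondCountableTopology
  refine ⟨hμ.nonempty_symplecticReduction hωX hfree',
    hneat.nonempty_braneReduction hμ hι hfree', fun R B ↦ ⟨B.toReduction hneat R,
      fun z ↦ ⟨B.level.map R.level (ι := ι) (fun _ ↦ hneat.momentMap_eq_zero (μ := μ) (ι := ι)) z,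
        rfl, ABrane.LevelQuotient.map_proj (L' := R.level) (ι := ι) _ B.quot R.quot hι z⟩,
      B.isCoisotropicABrane hneat R hμ hι hB hfree'⟩⟩
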